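/- **Setting.** Let $d\ge 1$, $\Omega=[0,1]^d$, $\Omega^*=[-\tfrac12,\tfrac12]^d$. Let $V\in L^\infty(\mathbb R^d)$ be real and $\mathbb Z^d$-periodic. For $k\in\Omega^*$ let $E_0(k)\le E_1(k)\le\cdots$ be the eigenvalues (with multiplicity) of $-(\nabla+2\pi i k)^2+V$ on $L^2_{\rm per}(\Omega)$, with a complete orthonormal set of eigenfunctions $p_b(\cdot;k)\in H^2_{\rm per}(\Omega)$. Fix a band $b_*$ with $E_{b_*}\in C^3(\Omega^*)$ and $p_{b_*}\in L^2_{\rm per}(\Omega;C^3(\Omega^*))$. Assume that $E_*=E_{b_*}(0)$ is an endpoint of this band and a simple eigenvalue of $-\Delta+V$ on $L^2_{\rm per}(\Omega)$ with real normalized eigenfunction $w=p_{b_*}(\cdot;0)$, that $\nabla E_{b_*}(0)=0$, and that $A=\frac1{8\pi^2}D^2E_{b_*}(0)$ is positive or negative definite. Let $N\ge1$ and let $Q\in H^\sigma(\mathbb R^d)$ be real with $\sigma>d$ and $\sigma\ge N$. Assume that $-\nabla\cdot A\nabla+Q$ has a simple eigenvalue $e_{A,Q}$ with $\operatorname{sgn}(A)\,e_{A,Q}<0$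 and a real eigenfunction $F_{A,Q}\in H^2(\mathbb R^d)$, $\|F_{A,Q}\|_{L^2}=1$. Put $L_*=-\Delta_x+V(x)-E_*$ and $L_{A,Q}=-\nabla_y\cdot A\nabla_y+Q(y)-e_{A,Q}$. For $f$ (possibly depending on $y$ as well) with $\langle w,f\rangle_{L^2(\Omega)}=0$, let $L_*^{-1}f$ be the solution of $L_*u=f$, periodic in $x$, with $\langle w,u\rangle_{L^2(\Omega)}=0$. Put $g_j=L_*^{-1}\{\partial_{x_j}w\}$. Repeated indices are summed. The hierarchy up to order $N$, for $U_n(x,y)$ periodic in $x$ and real numbers $\mu_n$, is $$L_*U_0=0,\qquad L_*U_1=2\nabla_x\cdot\nabla_yU_0+\mu_1U_0,$$ $$L_*U_n=2\nabla_x\cdot\nabla_yU_{n-1}-[-\Delta_y+Q(y)]U_{n-2}+\sum_{j=1}^{n}\mu_jU_{n-j},\qquad 2\le n\le N.$$ Write $F_n(y)=\langle w,U_n(\cdot,y)\rangle_{L^2(\Omega)}$ for the slow envelopes. A solution is called normalized if $F_0=F_{A,Q}$ (when $N\ge2$) and $F_n\perp F_{A,Q}$ in $L^2(\mathbb R^d)$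 for $1\le n\le N-2$. **Proposition.** There are real numbers $\mu_n$ with $\mu_1=0$, $\mu_2=e_{A,Q}$ such that the following holds. 1. (Solvability.) Let $G,G'\in H^2(\mathbb R^d)$ be such that $\partial_{y_j}G(y)\,g_j(x)\in H^2_{\rm per}(\Omega;H^2(\mathbb R^d))$; this holds in particular if $G\in H^3(\mathbb R^d)$. Then the hierarchy with these $\mu_n$ has a normalized solution $U_0,\dots,U_N\in H^2_{\rm per}(\Omega;H^2(\mathbb R^d))$ with $F_{N-1}=G$ and $F_N=G'$, and it has the form given in 2. 2. (Form of the solutions.) Let $U_0,\dots,U_N\in H^2_{\rm per}(\Omega;H^2(\mathbb R^d))$ be any normalized solution of the hierarchy, with some real numbers $\mu_1',\dots,\mu_N'$. If $U_0\ne0$ (which is automatic for $N\ge2$), then $\mu_n'=\mu_n$ for $1\le n\le N$. All $F_n$ are in $H^2(\mathbb R^d)$, and $$U_0=wF_0,\qquad U_n=wF_n+2\,\partial_{y_j}F_{n-1}\,g_j-Z_n\quad(1\le n\le N),$$ where $Z_0=Z_1=0$, $Z_2=L_*^{-1}\{\mathcal L[F_0]\}$ and, for $3\le n\le N$, $$Z_n=L_*^{-1}\{\mathcal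 L[F_{n-2}]+H_n-\mu_nwF_{A,Q}\},$$ $$H_n=2\nabla_x\cdot\nabla_yZ_{n-1}+[-\Delta_y+Q-e_{A,Q}]\big(2\,\partial_{y_j}F_{n-3}\,g_j-Z_{n-2}\big)-\sum_{j=3}^{n-1}\mu_jU_{n-j},$$ $$\mathcal L[G](x,y)=-4\,\partial_{x_j}g_l(x)\,\partial_{y_j}\partial_{y_l}G(y)+w(x)[-\Delta_y+Q(y)-e_{A,Q}]G(y);$$ moreover, for $3\le n\le N$, $$\mu_n=\big\langle F_{A,Q},\langle w,H_n\rangle_{L^2(\Omega)}\big\rangle_{L^2(\mathbb R^d)},\qquad L_{A,Q}F_{n-2}=-\langle w,H_n\rangle_{L^2(\Omega)}+\mu_nF_{A,Q}.$$ 3. (Uniqueness up to $F_{N-1}$ and $F_N$.) Two normalized solutions in $H^2_{\rm per}(\Omega;H^2(\mathbb R^d))$ with the same envelopes $F_{N-1}$ and $F_N$ coincide. 4. (Approximate eigenpair.) For every solution of the hierarchy in $H^2_{\rm per}(\Omega;H^2(\mathbb R^d))$ with these $\mu_n$, in particular for the normalized one with $F_{N-1}=F_N=0$, put $U^{(N)}_\varepsilon=\sum_{n=0}^N\varepsilon^nU_n$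 and $\mu^{(N)}_\varepsilon=E_*+\varepsilon^2e_{A,Q}+\sum_{n=3}^N\varepsilon^n\mu_n$. Then the error is formally of order $\varepsilon^{N+1}$: there are finitely many $R_m\in L^2_{\rm per}(\Omega;L^2(\mathbb R^d))$, independent of $\varepsilon$, such that for all real $\varepsilon$ $$\big[-(\nabla_x+\varepsilon\nabla_y)^2+V(x)+\varepsilon^2Q(y)-\mu^{(N)}_\varepsilon\big]U^{(N)}_\varepsilon(x,y)=\varepsilon^{N+1}\sum_m\varepsilon^mR_m(x,y).$$ -/

import Mathlib

open MeasureTheory Set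
open scoped ENNReal ContDiff ComplexConjugate

noncomputable section

namespace MultiScale

/-- The space `ℝ^d` with its Euclidean norm. -/
abbrev Pt (d : ℕ) := EuclideanSpace ℝ (Fin d)

/-! ### Weak derivatives and Sobolev spaces -/

section Weak

variable {X : Type*} [NormedAddCommGroup X] [NormedSpace ℝ X] [MeasureSpace X]

/-- `g` is the weak (distributional) derivative of `f` in the direction `v`. -/
def HasWeakDeriv (v : X) (f g : X → ℂ) : Prop :=
  LocallyIntegrable f volume ∧ LocallyIntegrable g volume ∧
    ∀ φ : X → ℝ, ContDiff ℝ ∞ φ → HasCompactSupport φ →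
      ∫ z, ((fderiv ℝ φ z v : ℝ) : ℂ) * f z = - ∫ z, ((φ z : ℝ) : ℂ) * g z

/-- `f` possesses a weak derivative in the direction `v`. -/
def WeakDiff (v : X) (f : X → ℂ) : Prop := ∃ g, HasWeakDeriv v f g

open Classical in
/-- The weak derivative in the direction `v` (determined almost everywhere; `0` if there is none).
It is only ever applied to functions of Sobolev spaces in which it exists. -/
def wd (v : X) (f : X → ℂ) : X → ℂ :=
  if h : WeakDiff v f then h.choose else 0

/-- Functions which satisfy `P` together with all iterated weak derivatives of order at most `k`
in the directions `D 1, …, D d`.  With `P` a space of square integrable functions this is the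
Sobolev space of order `k`; iterating it gives Sobolev spaces of vector valued functions. -/
def MemSob {d : ℕ} (P : (X → ℂ) → Prop) (D : Fin d → X) : ℕ → (X → ℂ) → Prop
  | 0, u => P u
  | k + 1, u => P u ∧ ∀ j, WeakDiff (D j) u ∧ MemSob P D k (wd (D j) u)

/-- The Laplacian `∑ j, ∂_{D j}²`. -/
def lap {d : ℕ} (D : Fin d → X) (u : X → ℂ) (z : X) : ℂ := ∑ j, wd (D j) (wd (D j) u) z

/-- `(-Δ + W - E) u`, where `Δ = ∑ j, ∂_{D j}²`. -/
def schr {d : ℕ} (D : Fin d → X) (W : X → ℝ) (E : ℝ) (u : X → ℂ) (z : X) : ℂ :=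
  - lap D u z + (W z : ℂ) * u z - (E : ℂ) * u z

end Weak

/-! ### The period cell, the Brillouin zone, and the function spaces -/

/-- The standard basis vectors of `ℝ^d`. -/
def ev {d : ℕ} (j : Fin d) : Pt d := EuclideanSpace.single j (1 : ℝ)

/-- The basis vectors in the fast variable `x` of `(x, y)`. -/
def ex {d : ℕ} (j : Fin d) : Pt d × Pt d := (ev j, 0)

/-- The basis vectors in the slow variable `y` of `(x, y)`. -/
def ey {d : ℕ} (j : Fin d) : Pt d × Pt d := (0, ev j)

/-- The period cell `Ω = [0,1]^d`. -/
def cell (d : ℕ) : Set (Pt d) := {x | ∀ j, x j ∈ Icc (0 : ℝ) 1}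

/-- The Brillouin zone `Ω* = [-1/2,1/2]^d`. -/
def BZ (d : ℕ) : Set (Pt d) := {k | ∀ j, k j ∈ Icc (-(1 / 2) : ℝ) (1 / 2)}

/-- `L²_per(Ω)`. -/
def MemL2per {d : ℕ} (u : Pt d → ℂ) : Prop :=
  (∀ j, ∀ᵐ x, u (x + ev j) = u x) ∧ MemLp u 2 (volume.restrict (cell d))

/-- `L²(ℝ^d)`. -/
def MemL2 {d : ℕ} (F : Pt d → ℂ) : Prop := MemLp F 2 volume

/-- `L²_per(Ω; L²(ℝ^d))`: functions of `(x, y)`, periodic in `x`, square integrable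
on `Ω × ℝ^d`. -/
def MemL2two {d : ℕ} (U : Pt d × Pt d → ℂ) : Prop :=
  (∀ j, ∀ᵐ z, U (z + ex j) = U z) ∧ MemLp U 2 (volume.restrict (cell d ×ˢ univ))

/-- `H²_per(Ω)`. -/
def MemH2per {d : ℕ} (u : Pt d → ℂ) : Prop := MemSob MemL2per ev 2 u

/-- `H^k(ℝ^d)`, for an integer `k ≥ 0`. -/
def MemH {d : ℕ} (k : ℕ) (F : Pt d → ℂ) : Prop := MemSob MemL2 ev k F

/-- `H²_per(Ω; H²(ℝ^d))`: the function and its weak `x`-derivatives of order at most two lie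
in `L²_per(Ω; H²(ℝ^d))`. -/
def MemH2H2 {d : ℕ} (U : Pt d × Pt d → ℂ) : Prop := MemSob (MemSob MemL2two ey 2) ex 2 U

/-- `H^σ(ℝ^d)` for real `σ ≥ 0`, for real valued functions. -/
def MemHReal {d : ℕ} (σ : ℝ) (Q : Pt d → ℝ) : Prop :=
  ∃ hQ : MemLp (fun y => (Q y : ℂ)) 2 (volume : Measure (Pt d)),
    TemperedDistribution.MemSobolev σ 2 (hQ.toLp : TemperedDistribution (Pt d) ℂ)

/-! ### Floquet-Bloch eigenpairs -/

/-- The shifted derivative `∂_{x_j} + 2πi k_j`. -/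
def blochD {d : ℕ} (k : Pt d) (j : Fin d) (u : Pt d → ℂ) (x : Pt d) : ℂ :=
  wd (ev j) u x + 2 * Real.pi * Complex.I * (k j : ℂ) * u x

/-- For every `k ∈ Ω*`, the functions `p b k` are periodic eigenfunctions of
`-(∇ + 2πik)² + V` with eigenvalues `E b k`, listed in increasing order (with multiplicity), which
form a complete orthonormal set of `L²_per(Ω)`. -/
structure IsFloquetBloch {d : ℕ} (V : Pt d → ℝ) (p : ℕ → Pt d → Pt d → ℂ)
    (E : ℕ → Pt d → ℝ) : Prop where
  memH2 : ∀ b, ∀ k ∈ BZ d, MemH2per (p b k)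
  eigen : ∀ b, ∀ k ∈ BZ d, ∀ᵐ x,
    - (∑ j, blochD k j (blochD k j (p b k)) x) + (V x : ℂ) * p b k x = (E b k : ℂ) * p b k x
  orthonormal : ∀ k ∈ BZ d, ∀ b b',
    ∫ x in cell d, conj (p b k x) * p b' k x = if b = b' then 1 else 0
  complete : ∀ k ∈ BZ d, ∀ f, MemL2per f →
    (∀ b, ∫ x in cell d, conj (p b k x) * f x = 0) → ∀ᵐ x, f x = 0
  ordered : ∀ k ∈ BZ d, Monotone fun b => E b k

/-! ### The problem and its hypotheses -/

/-- The data of the problem: the periodic potential `V`, the defect potential `Q`, the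
Floquet-Bloch eigenpairs of `-Δ + V`, the index of the band under consideration, the band edge
eigenfunction `w`, and the eigenpair of the homogenized operator. -/
structure Setting (d : ℕ) where
  V : Pt d → ℝ
  Q : Pt d → ℝ
  p : ℕ → Pt d → Pt d → ℂ
  E : ℕ → Pt d → ℝ
  bs : ℕ
  w : Pt d → ℝ
  eAQ : ℝ
  FAQ : Pt d → ℝ

namespace Setting

variable {d : ℕ} (S : Setting d)

/-- The band edge `E_* = E_{b_*}(0)`. -/
def Es : ℝ := S.E S.bs 0

/-- The inverse effective mass matrix `A = (1/8π²) D²E_{b_*}(0)`. -/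
def A : Matrix (Fin d) (Fin d) ℝ := Matrix.of fun j l =>
  (8 * Real.pi ^ 2)⁻¹ * fderiv ℝ (fun k => fderiv ℝ (S.E S.bs) k (ev l)) 0 (ev j)

/-- `w` as a complex valued function. -/
def wC (x : Pt d) : ℂ := (S.w x : ℂ)

/-- `F_{A,Q}` as a complex valued function. -/
def FC (y : Pt d) : ℂ := (S.FAQ y : ℂ)

/-- `L_* = -Δ + V - E_*` on periodic functions. -/
def Lstar (u : Pt d → ℂ) : Pt d → ℂ := schr ev S.V S.Es u

/-- `L_* = -Δ_x + V(x) - E_*` on functions of `(x, y)`. -/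
def Lstar2 (U : Pt d × Pt d → ℂ) : Pt d × Pt d → ℂ := schr ex (fun z => S.V z.1) S.Es U

/-- `-∇·A∇ F + Q F - e_{A,Q} F`. -/
def LAQ (F : Pt d → ℂ) (y : Pt d) : ℂ :=
  - (∑ j, ∑ l, wd (ev j) (fun y' => (S.A j l : ℂ) * wd (ev l) F y') y) + (S.Q y : ℂ) * F y
    - (S.eAQ : ℂ) * F y

/-- `V ∈ L^∞_per`, `Q ∈ H^σ(ℝ^d)`, `E_{b_*} ∈ C³(Ω*)`, `p_{b_*} ∈ L²_per(Ω; C³(Ω*))`. -/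
structure Regularity (σ : ℝ) : Prop where
  V_bounded : MemLp S.V ∞ volume
  V_periodic : ∀ j, ∀ᵐ x, S.V (x + ev j) = S.V x
  Q_sobolev : MemHReal σ S.Q
  E_C3 : ContDiffOn ℝ 3 (S.E S.bs) (BZ d)
  p_C3 : ∃ m : Pt d → ℝ, MemLp m 2 (volume.restrict (cell d)) ∧
    ∀ᵐ x ∂(volume.restrict (cell d)), ContDiffOn ℝ 3 (fun k => S.p S.bs k x) (BZ d) ∧
      ∀ i ≤ 3, ∀ k ∈ BZ d, ‖iteratedFDerivWithin ℝ i (fun k => S.p S.bs k x) (BZ d) k‖ ≤ m x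

/-- `E_* = E_{b_*}(0)` is an endpoint of the band number `b_*`, a simple eigenvalue with real
eigenfunction `w`, and a critical point of `E_{b_*}`. -/
structure BandEdge : Prop where
  bloch : IsFloquetBloch S.V S.p S.E
  endpoint : (∀ k ∈ BZ d, S.Es ≤ S.E S.bs k) ∨ (∀ k ∈ BZ d, S.E S.bs k ≤ S.Es)
  w_eq : ∀ᵐ x, S.p S.bs 0 x = S.wC x
  simple : ∀ u, MemH2per u → (∀ᵐ x, S.Lstar u x = 0) → ∃ c : ℂ, ∀ᵐ x, u x = c * S.wC x
  critical : fderiv ℝ (S.E S.bs) 0 = 0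

/-- `A` is definite and `e_{A,Q}`, with `sgn(A) e_{A,Q} < 0`, is a simple eigenvalue of the
homogenized operator `-∇·A∇ + Q` with normalized eigenfunction `F_{A,Q} ∈ H²(ℝ^d)`. -/
structure HomogenizedEigenpair : Prop where
  sign : (S.A.PosDef ∧ S.eAQ < 0) ∨ ((-S.A).PosDef ∧ 0 < S.eAQ)
  memH2 : MemH 2 S.FC
  eigen : ∀ᵐ y, S.LAQ S.FC y = 0
  normalized : ∫ y, S.FAQ y ^ 2 = 1
  simple : ∀ G, MemH 2 G → (∀ᵐ y, S.LAQ G y = 0) → ∃ c : ℂ, ∀ᵐ y, G y = c * S.FC y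

/-! ### The hierarchy of multiscale equations -/

/-- `∇_x · ∇_y U`. -/
def cross (U : Pt d × Pt d → ℂ) (z : Pt d × Pt d) : ℂ := ∑ j, wd (ey j) (wd (ex j) U) z

/-- The right hand side of the `O(ε^n)` equation `L_* U_n = …`. -/
def rhs (μ : ℕ → ℝ) (U : ℕ → Pt d × Pt d → ℂ) : ℕ → Pt d × Pt d → ℂ
  | 0, _ => 0
  | 1, z => 2 * cross (U 0) z + (μ 1 : ℂ) * U 0 z
  | n + 2, z => 2 * cross (U (n + 1)) z - (- lap ey (U n) z + (S.Q z.2 : ℂ) * U n z)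
      + ∑ j ∈ Finset.Icc 1 (n + 2), (μ j : ℂ) * U (n + 2 - j) z

/-- `U_0, …, U_N ∈ H²_per(Ω; H²(ℝ^d))` and `μ_1, …, μ_N` solve the equations of orders
`ε^0, …, ε^N`. -/
def SolvesHierarchy (N : ℕ) (μ : ℕ → ℝ) (U : ℕ → Pt d × Pt d → ℂ) : Prop :=
  ∀ n ≤ N, MemH2H2 (U n) ∧ ∀ᵐ z, S.Lstar2 (U n) z = S.rhs μ U n z

/-- The slow envelope `⟨w, U(·, y)⟩_{L²(Ω)}`. -/
def env (U : Pt d × Pt d → ℂ) (y : Pt d) : ℂ := ∫ x in cell d, S.wC x * U (x, y)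

/-- The normalization of the envelopes `F_n = ⟨w, U_n⟩` which is fixed by the equations up to
order `N`: the leading one is `F_{A,Q}`, the subsequent ones are orthogonal to `F_{A,Q}` (they
are given by the inverse of `-∇·A∇ + Q - e_{A,Q}` on the orthogonal complement of its kernel). -/
def Normalized (N : ℕ) (U : ℕ → Pt d × Pt d → ℂ) : Prop :=
  (2 ≤ N → ∀ᵐ y, S.env (U 0) y = S.FC y) ∧
    ∀ n, 1 ≤ n → n + 2 ≤ N → ∫ y, S.FC y * S.env (U n) y = 0

/-! ### The explicit expansion -/

/-- `g = L_*⁻¹ {f}`, for `f` orthogonal to `w`; the solution `g` is taken orthogonal to `w`. -/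
def IsLstarInv (f g : Pt d → ℂ) : Prop :=
  MemH2per g ∧ (∀ᵐ x, S.Lstar g x = f x) ∧ ∫ x in cell d, S.wC x * g x = 0

/-- `Z = L_*⁻¹ {G}` for functions of `(x, y)`, where `L_*⁻¹` acts in `x`. -/
def IsLstarInv2 (G Z : Pt d × Pt d → ℂ) : Prop :=
  MemH2H2 Z ∧ (∀ᵐ z, S.Lstar2 Z z = G z) ∧ ∀ᵐ y, S.env Z y = 0

/-- `-4 ∂_{x_j} g_l(x) ∂_{y_j} ∂_{y_l} G(y) + w(x) (-Δ_y + Q(y) - e_{A,Q}) G(y)`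
with `g_l = L_*⁻¹ {∂_{x_l} w}`. -/
def calL (g : Fin d → Pt d → ℂ) (G : Pt d → ℂ) (z : Pt d × Pt d) : ℂ :=
  -4 * (∑ j, ∑ l, wd (ev j) (g l) z.1 * wd (ev j) (wd (ev l) G) z.2)
    + S.wC z.1 * schr ev S.Q S.eAQ G z.2

/-- `2 ∂_{y_j} G(y) g_j(x)`. -/
def firstCorr (g : Fin d → Pt d → ℂ) (G : Pt d → ℂ) (z : Pt d × Pt d) : ℂ :=
  2 * ∑ j, wd (ev j) G z.2 * g j z.1

/-- The representation of the solutions up to order `N`, with envelopes `F_n`, where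
`g_j = L_*⁻¹ {∂_{x_j} w}`:
`U_n = w F_n + 2 ∂_{y_j} F_{n-1} g_j - Z_n`, `Z_n = L_*⁻¹ {ℒ[F_{n-2}] + H_n - μ_n w F_{A,Q}}`,
`L_{A,Q} F_{n-2} = - ⟨w, H_n⟩ + μ_n F_{A,Q}` and
`μ_n = ⟨F_{A,Q}, ⟨w, H_n⟩⟩`, where `H_n` depends on lower orders only. -/
structure IsExpansion (N : ℕ) (μ : ℕ → ℝ) (g : Fin d → Pt d → ℂ) (F : ℕ → Pt d → ℂ)
    (H Z U : ℕ → Pt d × Pt d → ℂ) : Prop where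
  memH2 : ∀ n ≤ N, MemH 2 (F n)
  leading : 2 ≤ N → ∀ᵐ y, F 0 y = S.FC y
  orthogonal : ∀ n, 1 ≤ n → n + 2 ≤ N → ∫ y, S.FC y * F n y = 0
  envelope : ∀ n ≤ N, ∀ᵐ y, S.env (U n) y = F n y
  Z_zero : Z 0 = 0
  Z_one : Z 1 = 0
  Z_two : 2 ≤ N → S.IsLstarInv2 (S.calL g (F 0)) (Z 2)
  H_formula : ∀ n, n + 3 ≤ N → ∀ᵐ z, H (n + 3) z =
    2 * cross (Z (n + 2)) z
      + schr ey (fun z => S.Q z.2) S.eAQ (fun z => firstCorr g (F n) z - Z (n + 1) z) z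
      - ∑ j ∈ Finset.Icc 3 (n + 2), (μ j : ℂ) * U (n + 3 - j) z
  mu_formula : ∀ n, n + 3 ≤ N → (μ (n + 3) : ℂ) = ∫ y, S.FC y * S.env (H (n + 3)) y
  F_equation : ∀ n, n + 3 ≤ N → ∀ᵐ y,
    S.LAQ (F (n + 1)) y = - S.env (H (n + 3)) y + (μ (n + 3) : ℂ) * S.FC y
  Z_formula : ∀ n, n + 3 ≤ N → S.IsLstarInv2
    (fun z => S.calL g (F (n + 1)) z + H (n + 3) z - (μ (n + 3) : ℂ) * (S.wC z.1 * S.FC z.2))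
    (Z (n + 3))
  U_zero : ∀ᵐ z, U 0 z = S.wC z.1 * F 0 z.2
  U_formula : ∀ n, n + 1 ≤ N → ∀ᵐ z,
    U (n + 1) z = S.wC z.1 * F (n + 1) z.2 + firstCorr g (F n) z - Z (n + 1) z

/-! ### The approximate eigenpair -/

/-- `[-(∇_x + ε∇_y)² + V(x) + ε² Q(y)] U`. -/
def multiscaleOp (ε : ℝ) (U : Pt d × Pt d → ℂ) (z : Pt d × Pt d) : ℂ :=
  - lap (fun j => ex j + ε • ey j) U z + (S.V z.1 : ℂ) * U z + (ε : ℂ) ^ 2 * (S.Q z.2 : ℂ) * U z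

/-- `U_ε^{(N)} = ∑_{n=0}^N ε^n U_n`. -/
def approxU (N : ℕ) (U : ℕ → Pt d × Pt d → ℂ) (ε : ℝ) (z : Pt d × Pt d) : ℂ :=
  ∑ n ∈ Finset.range (N + 1), (ε : ℂ) ^ n * U n z

/-- `μ_ε^{(N)} = E_* + ε² e_{A,Q} + ∑_{n=3}^N ε^n μ_n`. -/
def approxMu (N : ℕ) (μ : ℕ → ℝ) (ε : ℝ) : ℝ :=
  S.Es + ε ^ 2 * S.eAQ + ∑ n ∈ Finset.Icc 3 N, ε ^ n * μ n

/-- The residual of the pair `(U_ε^{(N)}, μ_ε^{(N)})` in the multiscale eigenvalue equation is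
formally of order `ε^{N+1}`: it is `ε^{N+1}` times a polynomial in `ε` with coefficients in
`L²_per(Ω; L²(ℝ^d))`. -/
def FormalError (N : ℕ) (μ : ℕ → ℝ) (U : ℕ → Pt d × Pt d → ℂ) : Prop :=
  ∃ (M : ℕ) (R : ℕ → Pt d × Pt d → ℂ), (∀ m, MemL2two (R m)) ∧
    ∀ ε : ℝ, ∀ᵐ z, S.multiscaleOp ε (approxU N U ε) z
        - (S.approxMu N μ ε : ℂ) * approxU N U ε z
      = (ε : ℂ) ^ (N + 1) * ∑ m ∈ Finset.range M, (ε : ℂ) ^ m * R m z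

end Setting

end MultiScale

end

set_option linter.unusedSectionVars false

noncomputable section

namespace MultiScale

/-! ### Weak derivatives and abstract Sobolev spaces -/

section General

variable {X : Type*} [NormedAddCommGroup X] [NormedSpace ℝ X] [MeasureSpace X] [BorelSpace X]
  [FiniteDimensional ℝ X]

/-! The hierarchy is solved by two nested Fredholm alternatives, one in the fast variable x and one
in the slow variable y.

In x, the operator L_* is symmetric, its kernel is spanned by w, and the other eigenvalues at k = 0
keep a positive distance from E_*. Hence L_* u = f is solvable exactly when ⟨w, f⟩ = 0, and u is
unique up to a multiple of w (`BandEdge.exists_inv`, `BandEdge.eq_zero`). The equation of order n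
therefore determines U_n up to a term w F_n, while its solvability condition is an equation in y for
the envelopes of lower order.

That condition contains F_{n-2} through the envelope of ℒ[F_{n-2}], and `env_calL` identifies this
envelope with L_{A,Q} F_{n-2}. The identification is second order perturbation theory: the Bloch
eigenvalue equation at quasi momentum tv is tested with w and with L_*⁻¹ ∂_v w, and t → 0 expresses
D²E(0) through the integrals ⟨w, ∂_j g_l⟩ (`second_deriv_eq`, `A_formula`).

In y, the condition sgn(A) e_{A,Q} < 0 makes the symbol of -∇·A∇ - e_{A,Q} at least c(1 + |ξ|²) in
absolute value. The operator with this symbol has an inverse G with values in H², and QG is compact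
because Q is square integrable and bounded and the inverse symbol vanishes at infinity. The Fredholm
alternative and the simplicity of e_{A,Q} then solve L_{A,Q} u = f for every f orthogonal to F_{A,Q}
(`exists_LAQ_inv`). At order n ≥ 3 the pairing with F_{A,Q} forces μ_n, the equation in y then gives
F_{n-2}, and inverting L_* gives Z_n (`exists_nextOrder`).

Each order costs one y-derivative. Multiplication by Q preserves H^s for s ≤ σ (`memH_mul`) and
inverting L_{A,Q} gains two derivatives (`memH_of_LAQ`), so F_{A,Q} lies in H^{N+2}. The envelopes
F_n with n ≤ N-2 and the y-factors of Z_n are then in H^{N+2-n}, which is at least H² up to order N.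
All correctors are finite sums of products a(x) b(y) (`TS`): L_*⁻¹ acts on the factors a, the
y-derivatives act on the factors b.

For an arbitrary normalized solution the same conditions are read as constraints. By induction on
the order they return the canonical μ_n and F_{n-2} and then the form of U_n (`solution_spec`),
which gives uniqueness. Finally, the coefficient of ε^n in the residual is L_* U_n minus the right
hand side of order n, also for n > N once U_n is set to zero there (`sum_rhsCoeff`). The
coefficients up to order N vanish and the remaining ones are the R_m. -/

theorem integrable_test_mul {φ : X → ℝ} (hφ : Continuous φ) (hc : HasCompactSupport φ)
    {f : X → ℂ} (hf : LocallyIntegrable f volume) :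
    Integrable (fun z => ((φ z : ℝ) : ℂ) * f z) volume := by
  have := hf.integrable_smul_left_of_hasCompactSupport hφ hc
  simpa [Complex.real_smul] using this

theorem integrable_ctest_mul {φ : X → ℂ} (hφ : Continuous φ) (hc : HasCompactSupport φ)
    {f : X → ℂ} (hf : LocallyIntegrable f volume) :
    Integrable (fun z => φ z * f z) volume := by
  have := hf.integrable_smul_left_of_hasCompactSupport (𝕜 := ℂ) hφ hc
  simpa using this

theorem ae_eq_of_integral_test_eq {f g : X → ℂ} (hf : LocallyIntegrable f volume)
    (hg : LocallyIntegrable g volume)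
    (h : ∀ φ : X → ℝ, ContDiff ℝ ∞ φ → HasCompactSupport φ →
      ∫ z, ((φ z : ℝ) : ℂ) * f z = ∫ z, ((φ z : ℝ) : ℂ) * g z) : ∀ᵐ z, f z = g z := by
  refine ae_eq_of_integral_contDiff_smul_eq hf hg fun φ h1 h2 => ?_
  simpa [Complex.real_smul] using h φ h1 h2

theorem continuous_fderiv_apply_test {φ : X → ℝ} (hφ : ContDiff ℝ ∞ φ) (v : X) :
    ContDiff ℝ ∞ (fun z => fderiv ℝ φ z v) :=
  (hφ.fderiv_right (m := ∞) (by simp)).clm_apply contDiff_const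

theorem hasCompactSupport_fderiv_apply_test {φ : X → ℝ} (hc : HasCompactSupport φ) (v : X) :
    HasCompactSupport (fun z => fderiv ℝ φ z v) := hc.fderiv_apply (𝕜 := ℝ) v

namespace HasWeakDeriv

variable {v : X} {f g f' g' : X → ℂ}

theorem unique (h : HasWeakDeriv v f g) (h' : HasWeakDeriv v f g') : ∀ᵐ z, g z = g' z := by
  refine ae_eq_of_integral_test_eq h.2.1 h'.2.1 fun φ h1 h2 => ?_
  have := (h.2.2 φ h1 h2).symm.trans (h'.2.2 φ h1 h2)
  exact neg_injective this

theorem congr (h : HasWeakDeriv v f g) (hf : ∀ᵐ z, f z = f' z) (hg : ∀ᵐ z, g z = g' z) :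
    HasWeakDeriv v f' g' := by
  refine ⟨h.1.congr hf, h.2.1.congr hg, fun φ h1 h2 => ?_⟩
  have := h.2.2 φ h1 h2
  rw [integral_congr_ae (g := fun z => ((fderiv ℝ φ z v : ℝ) : ℂ) * f' z)
    (by filter_upwards [hf] with z hz; simp [hz])] at this
  rw [this, integral_congr_ae (g := fun z => ((φ z : ℝ) : ℂ) * g' z)
    (by filter_upwards [hg] with z hz; simp [hz])]

theorem zero : HasWeakDeriv v (fun _ => 0) (fun _ => 0) := by
  refine ⟨locallyIntegrable_zero, locallyIntegrable_zero, by simp⟩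

theorem add (h : HasWeakDeriv v f g) (h' : HasWeakDeriv v f' g') :
    HasWeakDeriv v (fun z => f z + f' z) (fun z => g z + g' z) := by
  refine ⟨h.1.add h'.1, h.2.1.add h'.2.1, fun φ h1 h2 => ?_⟩
  have c := (continuous_fderiv_apply_test h1 v).continuous
  have s := hasCompactSupport_fderiv_apply_test h2 v
  simp only [mul_add]
  rw [integral_add (integrable_test_mul c s h.1) (integrable_test_mul c s h'.1),
    integral_add (integrable_test_mul h1.continuous h2 h.2.1)
      (integrable_test_mul h1.continuous h2 h'.2.1), h.2.2 φ h1 h2, h'.2.2 φ h1 h2]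
  ring

theorem smul (c : ℂ) (h : HasWeakDeriv v f g) :
    HasWeakDeriv v (fun z => c * f z) (fun z => c * g z) := by
  refine ⟨h.1.smul c, h.2.1.smul c, fun φ h1 h2 => ?_⟩
  simp only [mul_left_comm _ c]
  rw [integral_const_mul, integral_const_mul, h.2.2 φ h1 h2]
  ring

theorem sum {ι : Type*} (s : Finset ι) {f g : ι → X → ℂ} (h : ∀ i ∈ s, HasWeakDeriv v (f i) (g i)) :
    HasWeakDeriv v (fun z => ∑ i ∈ s, f i z) (fun z => ∑ i ∈ s, g i z) := by
  classical
  induction s using Finset.induction_on with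
  | empty => simpa using zero
  | insert a s ha ih =>
    simp only [Finset.sum_insert ha]
    exact (h a (Finset.mem_insert_self _ _)).add
      (ih fun i hi => h i (Finset.mem_insert_of_mem hi))

theorem conjugate (h : HasWeakDeriv v f g) :
    HasWeakDeriv v (fun z => conj (f z)) (fun z => conj (g z)) := by
  refine ⟨?_, ?_, fun φ h1 h2 => ?_⟩
  · have := h.1
    intro x
    obtain ⟨s, hs, hi⟩ := this x
    exact ⟨s, hs, by simpa [IntegrableOn, Function.comp_def] using
      (Complex.conjCLE.toContinuousLinearMap.integrable_comp hi)⟩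
  · have := h.2.1
    intro x
    obtain ⟨s, hs, hi⟩ := this x
    exact ⟨s, hs, by simpa [IntegrableOn, Function.comp_def] using
      (Complex.conjCLE.toContinuousLinearMap.integrable_comp hi)⟩
  · have := congrArg (starRingEnd ℂ) (h.2.2 φ h1 h2)
    rw [map_neg, ← integral_conj, ← integral_conj] at this
    simpa using this

/-- Test functions are differentiated linearly in the direction. This provides the derivatives along
`ex j + ε • ey j` in `multiscaleOp`. -/
theorem add_dir {w : X} (h : HasWeakDeriv v f g) (h' : HasWeakDeriv w f g') (c : ℝ) :
    HasWeakDeriv (v + c • w) f (fun z => g z + c * g' z) := by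
  refine ⟨h.1, h.2.1.add (h'.2.1.smul (c : ℂ)), fun φ h1 h2 => ?_⟩
  have cv := (continuous_fderiv_apply_test h1 v).continuous
  have sv := hasCompactSupport_fderiv_apply_test h2 v
  have cw := (continuous_fderiv_apply_test h1 w).continuous
  have sw := hasCompactSupport_fderiv_apply_test h2 w
  simp only [map_add, map_smul, smul_eq_mul, Complex.ofReal_add, Complex.ofReal_mul, add_mul,
    mul_add, mul_assoc, mul_left_comm _ (c : ℂ)]
  rw [integral_add (integrable_test_mul cv sv h.1) ((integrable_test_mul cw sw h.1).const_mul _),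
    integral_add (integrable_test_mul h1.continuous h2 h.2.1)
      ((integrable_test_mul h1.continuous h2 h'.2.1).const_mul _), integral_const_mul,
      integral_const_mul, h.2.2 φ h1 h2, h'.2.2 φ h1 h2]
  ring

/-- Mixed weak derivatives commute. -/
theorem swap {w : X} {fv fw fvw : X → ℂ} (h1 : HasWeakDeriv v f fv) (h2 : HasWeakDeriv w fv fvw)
    (h3 : HasWeakDeriv w f fw) : HasWeakDeriv v fw fvw := by
  refine ⟨h3.2.1, h2.2.1, fun φ hφ hc => ?_⟩
  have cv := continuous_fderiv_apply_test hφ v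
  have sv := hasCompactSupport_fderiv_apply_test hc v
  have cw := continuous_fderiv_apply_test hφ w
  have sw := hasCompactSupport_fderiv_apply_test hc w
  have e1 := h3.2.2 _ cv sv
  have e2 := h1.2.2 _ cw sw
  have e3 := h2.2.2 _ hφ hc
  -- The order of differentiation is exchanged on the smooth test function only. Existence of the
  -- derivative of `fw` along `v` is thus a conclusion.
  have key : ∀ z, fderiv ℝ (fun z => fderiv ℝ φ z v) z w = fderiv ℝ (fun z => fderiv ℝ φ z w) z v := by
    intro z
    have hs : IsSymmSndFDerivAt ℝ φ z :=
      (hφ.contDiffAt (x := z)).isSymmSndFDerivAt (by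
        simpa using (WithTop.coe_le_coe.2 (le_top : (2 : ℕ∞) ≤ ⊤)))
    have hd : DifferentiableAt ℝ (fderiv ℝ φ) z :=
      ((hφ.fderiv_right (m := ∞) (by simp)).differentiable (by simp)) z
    have a1 : ∀ u : X, fderiv ℝ (fun z => fderiv ℝ φ z u) z = (fderiv ℝ (fderiv ℝ φ) z).flip u := by
      intro u
      rw [fderiv_clm_apply hd (differentiableAt_const u)]
      simp
    rw [a1, a1]
    simpa using hs w v
  simp only [key] at e1
  rw [e3] at e2
  have : ∫ z, ((fderiv ℝ φ z v : ℝ) : ℂ) * fw z = - ∫ z, ((fderiv ℝ (fun z => fderiv ℝ φ z w) z v : ℝ) : ℂ) * f z := by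
    rw [e1, neg_neg]
  rw [this, e2]
  simp

/-- Integration by parts against complex valued test functions. -/
theorem integral_complex (h : HasWeakDeriv v f g) {φ : X → ℂ} (hφ : ContDiff ℝ ∞ φ)
    (hc : HasCompactSupport φ) :
    ∫ z, fderiv ℝ φ z v * f z = - ∫ z, φ z * g z := by
  have hre : ContDiff ℝ ∞ (fun z => (φ z).re) := Complex.reCLM.contDiff.comp hφ
  have him : ContDiff ℝ ∞ (fun z => (φ z).im) := Complex.imCLM.contDiff.comp hφ
  have cre : HasCompactSupport (fun z => (φ z).re) := hc.comp_left (g := Complex.re) rfl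
  have cim : HasCompactSupport (fun z => (φ z).im) := hc.comp_left (g := Complex.im) rfl
  have hd : ∀ z, DifferentiableAt ℝ φ z := fun z => hφ.differentiable (by simp) z
  have dre : ∀ z, fderiv ℝ (fun z => (φ z).re) z v = (fderiv ℝ φ z v).re := fun z => by
    have := (Complex.reCLM.hasFDerivAt.comp z (hd z).hasFDerivAt).fderiv
    change fderiv ℝ (Complex.reCLM ∘ φ) z v = _
    rw [this]; rfl
  have dim : ∀ z, fderiv ℝ (fun z => (φ z).im) z v = (fderiv ℝ φ z v).im := fun z => by
    have := (Complex.imCLM.hasFDerivAt.comp z (hd z).hasFDerivAt).fderiv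
    change fderiv ℝ (Complex.imCLM ∘ φ) z v = _
    rw [this]; rfl
  have e1 := h.2.2 _ hre cre
  have e2 := h.2.2 _ him cim
  have i1 := integrable_test_mul (continuous_fderiv_apply_test hre v).continuous
    (hasCompactSupport_fderiv_apply_test cre v) h.1
  have i2 := integrable_test_mul (continuous_fderiv_apply_test him v).continuous
    (hasCompactSupport_fderiv_apply_test cim v) h.1
  have i3 := integrable_test_mul hre.continuous cre h.2.1
  have i4 := integrable_test_mul him.continuous cim h.2.1
  have a1 : ∀ z, fderiv ℝ φ z v * f z = ((fderiv ℝ (fun z => (φ z).re) z v : ℝ) : ℂ) * f z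
      + Complex.I * (((fderiv ℝ (fun z => (φ z).im) z v : ℝ) : ℂ) * f z) := fun z => by
    rw [dre, dim, ← mul_assoc, ← add_mul]
    congr 1
    rw [mul_comm Complex.I]; exact (Complex.re_add_im _).symm
  have a2 : ∀ z, φ z * g z = (((φ z).re : ℝ) : ℂ) * g z
      + Complex.I * ((((φ z).im : ℝ) : ℂ) * g z) := fun z => by
    rw [← mul_assoc, ← add_mul]
    congr 1
    rw [mul_comm Complex.I]; exact (Complex.re_add_im _).symm
  simp only [a1, a2]
  rw [integral_add i1 (i2.const_mul _), integral_add i3 (i4.const_mul _), integral_const_mul,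
    integral_const_mul, e1, e2]
  ring

theorem weakDiff (h : HasWeakDeriv v f g) : WeakDiff v f := ⟨g, h⟩

/-- `wd` is a choice, so it is computed by exhibiting some weak derivative and comparing. This is
why the differential identities below hold almost everywhere only. -/
theorem wd_ae_eq (h : HasWeakDeriv v f g) : ∀ᵐ z, wd v f z = g z := by
  have hh : WeakDiff v f := ⟨g, h⟩
  have : HasWeakDeriv v f (wd v f) := by
    unfold wd
    rw [dif_pos hh]
    exact hh.choose_spec
  exact this.unique h

end HasWeakDeriv

theorem WeakDiff.hasWeakDeriv {v : X} {f : X → ℂ} (h : WeakDiff v f) :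
    HasWeakDeriv v f (wd v f) := by
  unfold wd
  rw [dif_pos h]
  exact h.choose_spec

/-- A property of functions which is linear and depends on the almost everywhere class only. -/
structure IsFunSpace (P : (X → ℂ) → Prop) : Prop where
  congr : ∀ {u v : X → ℂ}, P u → (∀ᵐ z, u z = v z) → P v
  zero : P fun _ => 0
  add : ∀ {u v : X → ℂ}, P u → P v → P fun z => u z + v z
  smul : ∀ (c : ℂ) {u : X → ℂ}, P u → P fun z => c * u z
  conjugate : ∀ {u : X → ℂ}, P u → P fun z => conj (u z)

namespace IsFunSpace

variable {P : (X → ℂ) → Prop}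

theorem neg (hP : IsFunSpace P) {u : X → ℂ} (hu : P u) : P fun z => - u z := by
  simpa using hP.smul (-1) hu

theorem sub (hP : IsFunSpace P) {u v : X → ℂ} (hu : P u) (hv : P v) : P fun z => u z - v z := by
  simpa [sub_eq_add_neg] using hP.add hu (hP.neg hv)

theorem sum (hP : IsFunSpace P) {ι : Type*} (s : Finset ι) {f : ι → X → ℂ}
    (h : ∀ i ∈ s, P (f i)) : P fun z => ∑ i ∈ s, f i z := by
  classical
  induction s using Finset.induction_on with
  | empty => simpa using hP.zero
  | insert a s ha ih =>
    simp only [Finset.sum_insert ha]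
    exact hP.add (h a (Finset.mem_insert_self _ _))
      (ih fun i hi => h i (Finset.mem_insert_of_mem hi))

end IsFunSpace

variable {d : ℕ} {P : (X → ℂ) → Prop} {D : Fin d → X}

theorem MemSob.base {k : ℕ} {u : X → ℂ} (h : MemSob P D k u) : P u := by
  cases k with
  | zero => exact h
  | succ k => exact h.1

/-- Membership may be checked on any exhibited weak derivatives instead of the chosen ones that
occur in `MemSob`. -/
theorem memSob_succ_of {k : ℕ} (hP : IsFunSpace (MemSob P D k)) {u : X → ℂ} (hu : P u)
    {ud : Fin d → X → ℂ} (hd : ∀ j, HasWeakDeriv (D j) u (ud j)) (h : ∀ j, MemSob P D k (ud j)) :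
    MemSob P D (k + 1) u :=
  ⟨hu, fun j => ⟨(hd j).weakDiff, hP.congr (h j) <| by
    filter_upwards [(hd j).wd_ae_eq] with z hz using hz.symm⟩⟩

theorem isFunSpace_memSob (hP : IsFunSpace P) (D : Fin d → X) (k : ℕ) :
    IsFunSpace (MemSob P D k) := by
  induction k with
  | zero => exact hP
  | succ k ih =>
    refine ⟨fun hu h => ?_, ?_, fun hu hv => ?_, fun c u hu => ?_, fun hu => ?_⟩
    · exact memSob_succ_of ih (hP.congr hu.1 h)
        (fun j => (hu.2 j).1.hasWeakDeriv.congr h (Filter.Eventually.of_forall fun _ => rfl))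
        fun j => (hu.2 j).2
    · exact memSob_succ_of ih hP.zero (fun j => HasWeakDeriv.zero) fun j => ih.zero
    · exact memSob_succ_of ih (hP.add hu.1 hv.1)
        (fun j => (hu.2 j).1.hasWeakDeriv.add (hv.2 j).1.hasWeakDeriv)
        fun j => ih.add (hu.2 j).2 (hv.2 j).2
    · exact memSob_succ_of ih (hP.smul c hu.1) (fun j => (hu.2 j).1.hasWeakDeriv.smul c)
        fun j => ih.smul c (hu.2 j).2
    · exact memSob_succ_of ih (hP.conjugate hu.1) (fun j => (hu.2 j).1.hasWeakDeriv.conjugate)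
        fun j => ih.conjugate (hu.2 j).2

theorem MemSob.mono {k l : ℕ} (hkl : l ≤ k) {u : X → ℂ} (h : MemSob P D k u) : MemSob P D l u := by
  induction k generalizing l u with
  | zero => obtain rfl : l = 0 := by omega
            exact h
  | succ k ih =>
    cases l with
    | zero => exact h.1
    | succ l => exact ⟨h.1, fun j => ⟨(h.2 j).1, ih (by omega) (h.2 j).2⟩⟩

theorem MemSob.imp {P' : (X → ℂ) → Prop} (hPP : ∀ u, P u → P' u) {k : ℕ} {u : X → ℂ}
    (h : MemSob P D k u) : MemSob P' D k u := by
  induction k generalizing u with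
  | zero => exact hPP u h
  | succ k ih => exact ⟨hPP u h.1, fun j => ⟨(h.2 j).1, ih (h.2 j).2⟩⟩

theorem MemSob.hasWeakDeriv {k : ℕ} {u : X → ℂ} (h : MemSob P D (k + 1) u) (j : Fin d) :
    HasWeakDeriv (D j) u (wd (D j) u) := (h.2 j).1.hasWeakDeriv

theorem MemSob.wd {k : ℕ} {u : X → ℂ} (h : MemSob P D (k + 1) u) (j : Fin d) :
    MemSob P D k (wd (D j) u) := (h.2 j).2

/-- `L` is the Laplacian of `u`, with weak derivatives which exist. -/
def IsLap (D : Fin d → X) (u L : X → ℂ) : Prop :=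
  ∃ u1 u2 : Fin d → X → ℂ, (∀ j, HasWeakDeriv (D j) u (u1 j)) ∧
    (∀ j, HasWeakDeriv (D j) (u1 j) (u2 j)) ∧ ∀ᵐ z, L z = ∑ j, u2 j z

namespace IsLap

variable {u v L M : X → ℂ}

/-- As `wd` has the default value 0 where no derivative exists, `lap` is not linear on all
functions. Sums and multiples are formed in `IsLap`, which carries the derivatives along, and only
the result is transferred to `lap`. -/
theorem lap_ae_eq (h : IsLap D u L) : ∀ᵐ z, lap D u z = L z := by
  obtain ⟨u1, u2, h1, h2, h3⟩ := h
  have : ∀ᵐ z, ∀ j, MultiScale.wd (D j) (MultiScale.wd (D j) u) z = u2 j z := by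
    rw [ae_all_iff]
    intro j
    exact ((h2 j).congr (by filter_upwards [(h1 j).wd_ae_eq] with z hz using hz.symm)
      (Filter.Eventually.of_forall fun _ => rfl)).wd_ae_eq
  filter_upwards [this, h3] with z hz h
  simp [lap, hz, h]

theorem congr (h : IsLap D u L) (huv : ∀ᵐ z, u z = v z) (hLM : ∀ᵐ z, L z = M z) : IsLap D v M := by
  obtain ⟨u1, u2, h1, h2, h3⟩ := h
  refine ⟨u1, u2, fun j => (h1 j).congr huv (Filter.Eventually.of_forall fun _ => rfl), h2, ?_⟩
  filter_upwards [h3, hLM] with z h1 h2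
  rw [← h2, h1]

theorem add (h : IsLap D u L) (h' : IsLap D v M) :
    IsLap D (fun z => u z + v z) (fun z => L z + M z) := by
  obtain ⟨u1, u2, h1, h2, h3⟩ := h
  obtain ⟨u1', u2', h1', h2', h3'⟩ := h'
  refine ⟨_, _, fun j => (h1 j).add (h1' j), fun j => (h2 j).add (h2' j), ?_⟩
  filter_upwards [h3, h3'] with z a b
  rw [a, b, Finset.sum_add_distrib]

theorem smul (c : ℂ) (h : IsLap D u L) : IsLap D (fun z => c * u z) (fun z => c * L z) := by
  obtain ⟨u1, u2, h1, h2, h3⟩ := h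
  refine ⟨_, _, fun j => (h1 j).smul c, fun j => (h2 j).smul c, ?_⟩
  filter_upwards [h3] with z a
  rw [a, Finset.mul_sum]

theorem neg (h : IsLap D u L) : IsLap D (fun z => - u z) (fun z => - L z) := by
  simpa using h.smul (-1)

theorem sub (h : IsLap D u L) (h' : IsLap D v M) :
    IsLap D (fun z => u z - v z) (fun z => L z - M z) := by
  simpa [sub_eq_add_neg] using h.add h'.neg

theorem zero : IsLap D (fun _ => 0) (fun _ => 0) :=
  ⟨fun _ _ => 0, fun _ _ => 0, fun _ => .zero, fun _ => .zero, by simp⟩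

theorem sum {ι : Type*} (s : Finset ι) {f g : ι → X → ℂ} (h : ∀ i ∈ s, IsLap D (f i) (g i)) :
    IsLap D (fun z => ∑ i ∈ s, f i z) (fun z => ∑ i ∈ s, g i z) := by
  classical
  induction s using Finset.induction_on with
  | empty => simpa using zero
  | insert a s ha ih =>
    simp only [Finset.sum_insert ha]
    exact (h a (Finset.mem_insert_self _ _)).add
      (ih fun i hi => h i (Finset.mem_insert_of_mem hi))

theorem conjugate (h : IsLap D u L) : IsLap D (fun z => conj (u z)) (fun z => conj (L z)) := by
  obtain ⟨u1, u2, h1, h2, h3⟩ := h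
  refine ⟨_, _, fun j => (h1 j).conjugate, fun j => (h2 j).conjugate, ?_⟩
  filter_upwards [h3] with z a
  rw [a, map_sum]

end IsLap

theorem MemSob.isLap {k : ℕ} {u : X → ℂ} (h : MemSob P D (k + 2) u) : IsLap D u (lap D u) :=
  ⟨fun j => MultiScale.wd (D j) u, fun j => MultiScale.wd (D j) (MultiScale.wd (D j) u), fun j => h.hasWeakDeriv j,
    fun j => (h.wd j).hasWeakDeriv j, Filter.Eventually.of_forall fun _ => rfl⟩

end General

end MultiScale

namespace MultiScale

/-! ### The torus -/

-- The multivariate Fourier basis is orthonormal for normalized Haar measure, so this measure is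
-- taken as the volume of the circle and, through products, of the torus.
local instance haarMeasureSpace : MeasureSpace UnitAddCircle := ⟨AddCircle.haarAddCircle⟩

local instance haarIsAddHaar : Measure.IsAddHaarMeasure (volume : Measure UnitAddCircle) :=
  inferInstanceAs (Measure.IsAddHaarMeasure AddCircle.haarAddCircle)

local instance haarIsProbability : IsProbabilityMeasure (volume : Measure UnitAddCircle) :=
  inferInstanceAs (IsProbabilityMeasure AddCircle.haarAddCircle)

variable {d : ℕ}

/-- The projection of `ℝ^d` onto the torus. -/
def toTorus (x : Pt d) : UnitAddTorus (Fin d) := fun i => (x i : UnitAddCircle)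

/-- The representative in `(0,1]^d` of a point of the torus. -/
def ofTorus (t : UnitAddTorus (Fin d)) : Pt d :=
  WithLp.toLp 2 fun i => (AddCircle.equivIoc (1 : ℝ) 0 (t i) : ℝ)

/-- The lattice vector with given integer coordinates. -/
def lat (n : Fin d → ℤ) : Pt d := WithLp.toLp 2 fun i => (n i : ℝ)

/-- The exponential `exp (2πi n·x)`. -/
def em (n : Fin d → ℤ) (x : Pt d) : ℂ := Complex.exp (2 * Real.pi * Complex.I * ∑ i, (n i : ℂ) * x i)

theorem em_eq (n : Fin d → ℤ) (x : Pt d) : em n x = UnitAddTorus.mFourier n (toTorus x) := by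
  simp only [em, UnitAddTorus.mFourier, toTorus, ContinuousMap.coe_mk, fourier_coe_apply]
  rw [← Complex.exp_sum]
  congr 1
  rw [Finset.mul_sum]
  refine Finset.sum_congr rfl fun i _ => ?_
  push_cast
  ring

theorem norm_em (n : Fin d → ℤ) (x : Pt d) : ‖em n x‖ = 1 := by
  have : (2 * Real.pi * Complex.I * ∑ i, (n i : ℂ) * x i)
      = ((2 * Real.pi * ∑ i, (n i : ℝ) * x i : ℝ) : ℂ) * Complex.I := by
    push_cast; ring
  rw [em, this, Complex.norm_exp_ofReal_mul_I]

theorem conj_em (n : Fin d → ℤ) (x : Pt d) : conj (em n x) = em (-n) x := by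
  rw [em_eq, em_eq, UnitAddTorus.mFourier_neg]

theorem em_add_lat (n m : Fin d → ℤ) (x : Pt d) : em n (x + lat m) = em n x := by
  rw [em_eq, em_eq]
  congr 1
  funext i
  simp [toTorus, lat]

theorem contDiff_em (n : Fin d → ℤ) : ContDiff ℝ ∞ (em n) := by
  unfold em
  refine Complex.contDiff_exp.comp (contDiff_const.mul (ContDiff.sum fun i _ => contDiff_const.mul ?_))
  exact Complex.ofRealCLM.contDiff.comp (EuclideanSpace.proj (𝕜 := ℝ) i).contDiff

theorem fderiv_em (n : Fin d → ℤ) (x : Pt d) (j : Fin d) :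
    fderiv ℝ (em n) x (ev j) = 2 * Real.pi * Complex.I * n j * em n x := by
  have h : HasFDerivAt (fun x : Pt d => 2 * Real.pi * Complex.I * ∑ i, (n i : ℂ) * x i)
      ((2 * Real.pi * Complex.I) • ∑ i, (n i : ℂ) • (Complex.ofRealCLM.comp (EuclideanSpace.proj (𝕜 := ℝ) i))) x := by
    refine HasFDerivAt.const_mul ?_ _
    refine HasFDerivAt.fun_sum fun i _ => HasFDerivAt.const_mul ?_ _
    exact (Complex.ofRealCLM.comp (EuclideanSpace.proj (𝕜 := ℝ) i)).hasFDerivAt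
  have h2 := h.cexp
  have : fderiv ℝ (em n) x = _ := h2.fderiv
  rw [this]
  simp [ev, em, apply_ite, mul_comm]

theorem toTorus_ofTorus (t : UnitAddTorus (Fin d)) : toTorus (ofTorus t) = t := by
  funext i
  exact AddCircle.coe_equivIoc

theorem exists_lat (x : Pt d) : ∃ n, ofTorus (toTorus x) = x + lat n := by
  have : ∀ i, ∃ m : ℤ, (ofTorus (toTorus x)) i = x i + m := by
    intro i
    have h := congrFun (toTorus_ofTorus (toTorus x)) i
    have h' : ((ofTorus (toTorus x) i : ℝ) : UnitAddCircle) = (x i : UnitAddCircle) := h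
    have h2 : ((ofTorus (toTorus x) i - x i : ℝ) : UnitAddCircle) = 0 := by
      rw [AddCircle.coe_sub, h', sub_self]
    obtain ⟨m, hm⟩ := (AddCircle.coe_eq_zero_iff 1).1 h2
    refine ⟨m, ?_⟩
    have : (m : ℝ) = ofTorus (toTorus x) i - x i := by simpa using hm
    linarith
  choose m hm using this
  refine ⟨m, ?_⟩
  ext i
  simpa [lat] using hm i

theorem measurable_toTorus : Measurable (toTorus (d := d)) := by
  refine measurable_pi_lambda _ fun i => ?_
  exact AddCircle.measurable_mk'.comp (by fun_prop)

theorem measurable_ofTorus : Measurable (ofTorus (d := d)) := by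
  refine (WithLp.measurable_toLp 2 _).comp (measurable_pi_lambda _ fun i => ?_)
  exact measurable_subtype_coe.comp ((AddCircle.measurableEquivIoc 1 0).measurable.comp (measurable_pi_apply i))

theorem cell_eq : cell d = (WithLp.ofLp) ⁻¹' (Set.univ.pi fun _ => Icc (0 : ℝ) 1) := by
  ext x; simp only [cell, mem_ofPred_eq, mem_preimage, Set.mem_univ_pi]

theorem measurableSet_cell : MeasurableSet (cell d) := by
  rw [cell_eq]
  exact (WithLp.measurable_ofLp 2 _) (MeasurableSet.univ_pi fun _ => measurableSet_Icc)

theorem measurePreserving_toTorus :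
    MeasurePreserving (toTorus (d := d)) (volume.restrict (cell d)) volume := by
  have h1 : MeasurePreserving (WithLp.ofLp : Pt d → (Fin d → ℝ)) (volume.restrict (cell d))
      (Measure.pi fun _ => volume.restrict (Icc (0 : ℝ) 1)) := by
    rw [← Measure.restrict_pi_pi, cell_eq]
    exact (PiLp.volume_preserving_ofLp (Fin d)).restrict_preimage
      (MeasurableSet.univ_pi fun _ => measurableSet_Icc)
  have h2 : MeasurePreserving (fun (x : Fin d → ℝ) (i : Fin d) => (x i : UnitAddCircle))
      (Measure.pi fun _ => volume.restrict (Icc (0 : ℝ) 1)) (Measure.pi fun _ => volume) := by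
    refine measurePreserving_pi _ _ fun i => ?_
    have := AddCircle.measurePreserving_mk 1 0
    rw [zero_add, Measure.restrict_congr_set Ioc_ae_eq_Icc] at this
    rw [AddCircle.volume_eq_smul_haarAddCircle, ENNReal.ofReal_one, one_smul] at this
    exact this
  exact h2.comp h1

instance isProbabilityMeasure_cell : IsProbabilityMeasure (volume.restrict (cell d)) := by
  constructor
  have := (measurePreserving_toTorus (d := d)).measure_preimage (s := univ) MeasurableSet.univ.nullMeasurableSet
  simpa using this

theorem ae_add_lat {P : Pt d → Prop} (h : ∀ᵐ x, P x) (v : Pt d) : ∀ᵐ x, P (x + v) :=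
  (measurePreserving_add_right (volume : Measure (Pt d)) v).quasiMeasurePreserving.ae h

theorem lat_eq_sum (n : Fin d → ℤ) : lat n = ∑ j, n j • ev j := by
  ext i
  simp [lat, ev, Pi.single_apply]

section Periodic

variable {X : Type*} [AddCommGroup X] [MeasurableSpace X] [MeasurableAdd X] {μ : Measure X}
  [μ.IsAddRightInvariant]

theorem ae_periodic_zsmul {u : X → ℂ} {v : X} (h : ∀ᵐ x ∂μ, u (x + v) = u x) (k : ℤ) :
    ∀ᵐ x ∂μ, u (x + k • v) = u x := by
  have hs : ∀ w : X, ∀ {P : X → Prop}, (∀ᵐ x ∂μ, P x) → ∀ᵐ x ∂μ, P (x + w) := fun w P hP =>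
    (measurePreserving_add_right μ w).quasiMeasurePreserving.ae hP
  induction k using Int.induction_on with
  | zero => simp
  | succ k ih =>
    filter_upwards [ih, hs (k • v) h] with x h1 h2
    rw [add_smul, one_smul, ← add_assoc]
    simp only [natCast_zsmul] at *
    rw [h2, h1]
  | pred k ih =>
    filter_upwards [ih, hs ((-k - 1 : ℤ) • v) h] with x h1 h2
    rw [← h2, ← h1, add_assoc]
    congr 2
    rw [sub_smul, one_smul]; abel

theorem ae_periodic_sum {u : X → ℂ} {D : Fin d → X} (h : ∀ j, ∀ᵐ x ∂μ, u (x + D j) = u x)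
    (n : Fin d → ℤ) : ∀ᵐ x ∂μ, u (x + ∑ j, n j • D j) = u x := by
  have hs : ∀ w : X, ∀ {P : X → Prop}, (∀ᵐ x ∂μ, P x) → ∀ᵐ x ∂μ, P (x + w) := fun w P hP =>
    (measurePreserving_add_right μ w).quasiMeasurePreserving.ae hP
  have : ∀ s : Finset (Fin d), ∀ᵐ x ∂μ, u (x + ∑ j ∈ s, n j • D j) = u x := by
    intro s
    induction s using Finset.induction_on with
    | empty => simp
    | insert a s ha ih =>
      filter_upwards [ih, hs (∑ j ∈ s, n j • D j) (ae_periodic_zsmul (h a) (n a))] with x h1 h2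
      rw [Finset.sum_insert ha, add_comm (n a • D a), ← add_assoc, h2, h1]
  exact this _

end Periodic

/-- Periodicity almost everywhere. -/
def AEPer (u : Pt d → ℂ) : Prop := ∀ j, ∀ᵐ x, u (x + ev j) = u x

/-- The lattice is countable, so one null set serves all translations. This matters since the
lattice vector of `exists_lat` depends on the point. -/
theorem AEPer.lat {u : Pt d → ℂ} (h : AEPer u) : ∀ᵐ x, ∀ n, u (x + lat n) = u x := by
  rw [ae_all_iff]
  intro n
  rw [lat_eq_sum]
  exact ae_periodic_sum h n

/-- A periodic function comes from a function on the torus. -/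
theorem AEPer.torus {u : Pt d → ℂ} (h : AEPer u) : ∀ᵐ x, (u ∘ ofTorus) (toTorus x) = u x := by
  filter_upwards [h.lat] with x hx
  obtain ⟨n, hn⟩ := exists_lat x
  simp only [Function.comp, hn, hx]

theorem toTorus_add (x y : Pt d) : toTorus (x + y) = toTorus x + toTorus y := by
  funext i
  simp [toTorus]

theorem toTorus_lat (n : Fin d → ℤ) : toTorus (lat n) = 0 := by
  funext i
  simp only [toTorus, lat, Pi.zero_apply]
  exact (AddCircle.coe_eq_zero_iff 1).2 ⟨n i, by simp⟩

theorem lat_single (j : Fin d) : lat (Pi.single j 1) = ev j := by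
  ext i
  simp [lat, ev, Pi.single_apply]

theorem aePer_comp_toTorus (f : UnitAddTorus (Fin d) → ℂ) : AEPer (f ∘ toTorus) := by
  intro j
  refine Filter.Eventually.of_forall fun x => ?_
  rw [← lat_single]
  simp [Function.comp, toTorus_add, toTorus_lat]

theorem aePer_em (n : Fin d → ℤ) : AEPer (em n) := fun j =>
  Filter.Eventually.of_forall fun x => by rw [← lat_single, em_add_lat]


theorem measurePreserving_ofTorus :
    MeasurePreserving (ofTorus (d := d)) volume (volume.restrict (cell d)) := by
  refine ⟨measurable_ofTorus, ?_⟩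
  have h := (measurePreserving_toTorus (d := d)).map_eq
  rw [← h, Measure.map_map measurable_ofTorus measurable_toTorus]
  -- `ofTorus` has values in (0,1]^d, hence it inverts `toTorus` on the closed cell only off the
  -- faces x_i = 0, a null set.
  have hI : ∀ᵐ x ∂(volume.restrict (cell d)), ∀ i, x i ∈ Ioc (0 : ℝ) 1 := by
    have h0 : ∀ i : Fin d, ∀ᵐ x : Pt d, x i ≠ 0 := by
      intro i
      have h1 : ∀ᵐ x : Fin d → ℝ, x i ≠ 0 := by
        have := (Measure.quasiMeasurePreserving_eval (μ := fun _ : Fin d => (volume : Measure ℝ)) i).ae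
          (p := fun t => t ≠ 0) (by simp [ae_iff])
        exact this
      exact (PiLp.volume_preserving_ofLp (Fin d)).quasiMeasurePreserving.ae h1
    rw [ae_restrict_iff' measurableSet_cell]
    filter_upwards [ae_all_iff.2 h0] with x hx hc i
    exact ⟨lt_of_le_of_ne (hc i).1 (hx i).symm, (hc i).2⟩
  have : (ofTorus ∘ toTorus) =ᵐ[volume.restrict (cell d)] id := by
    filter_upwards [hI] with x hx
    ext i
    have : (x i) ∈ Ioc (0 : ℝ) (0 + 1) := by simpa using hx i
    simpa [ofTorus, toTorus] using congrArg Subtype.val (AddCircle.equivIoc_coe_eq (p := (1 : ℝ)) this)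
  rw [Measure.map_congr this, Measure.map_id]

theorem integral_cell_eq_torus {u : Pt d → ℂ} (hu : AEStronglyMeasurable u (volume.restrict (cell d))) :
    ∫ x in cell d, u x = ∫ t, u (ofTorus t) := by
  have h := (measurePreserving_ofTorus (d := d)).map_eq
  rw [← h]
  rw [← h] at hu
  exact integral_map measurable_ofTorus.aemeasurable hu

theorem AEPer.shift_torus {u : Pt d → ℂ} (h : AEPer u) (s : Pt d) :
    (fun x => u (x + s)) =ᵐ[volume.restrict (cell d)]
      (fun t => u (ofTorus (t + toTorus s))) ∘ toTorus := by
  refine ae_restrict_of_ae ?_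
  filter_upwards [ae_add_lat h.torus s] with x hx
  simp only [Function.comp, ← toTorus_add] at *
  exact hx.symm

theorem measurePreserving_shift (s : UnitAddTorus (Fin d)) :
    MeasurePreserving (fun t : UnitAddTorus (Fin d) => ofTorus (t + s)) volume (volume.restrict (cell d)) :=
  measurePreserving_ofTorus.comp (measurePreserving_add_right volume s)

theorem integrableOn_cell_shift {u : Pt d → ℂ} (h : AEPer u) (hu : IntegrableOn u (cell d)) (s : Pt d) :
    IntegrableOn (fun x => u (x + s)) (cell d) := by
  refine Integrable.congr ?_ (h.shift_torus s).symm
  refine measurePreserving_toTorus.integrable_comp_of_integrable ?_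
  exact (measurePreserving_shift (toTorus s)).integrable_comp_of_integrable hu

/-- On the torus a shift by `s` is a translation, which preserves Haar measure. -/
theorem setIntegral_cell_shift {u : Pt d → ℂ} (h : AEPer u)
    (hu : AEStronglyMeasurable u (volume.restrict (cell d))) (s : Pt d) :
    ∫ x in cell d, u (x + s) = ∫ x in cell d, u x := by
  rw [integral_congr_ae (h.shift_torus s)]
  have h1 : AEStronglyMeasurable (fun t => u (ofTorus (t + toTorus s))) volume :=
    hu.comp_measurePreserving (measurePreserving_shift (toTorus s))
  have h2 := (measurePreserving_toTorus (d := d)).map_eq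
  have h3 : ∫ x in cell d, ((fun t => u (ofTorus (t + toTorus s))) ∘ toTorus) x
      = ∫ t, u (ofTorus (t + toTorus s)) := by
    conv_rhs => rw [← h2]
    rw [integral_map measurable_toTorus.aemeasurable (by rwa [h2])]
    rfl
  rw [h3, integral_add_right_eq_self (μ := (volume : Measure (UnitAddTorus (Fin d)))) (fun t => u (ofTorus t)),
    integral_cell_eq_torus hu]

/-- The Fourier coefficients of a periodic function. -/
def fc (n : Fin d → ℤ) (u : Pt d → ℂ) : ℂ := ∫ x in cell d, em (-n) x * u x

theorem fc_eq {u : Pt d → ℂ} (hu : AEStronglyMeasurable u (volume.restrict (cell d))) (n : Fin d → ℤ) :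
    fc n u = UnitAddTorus.mFourierCoeff (fun t => u (ofTorus t)) n := by
  rw [fc, integral_cell_eq_torus]
  · simp only [UnitAddTorus.mFourierCoeff, em_eq, toTorus_ofTorus, smul_eq_mul]
  · exact ((contDiff_em (-n)).continuous.aestronglyMeasurable).mul hu

theorem hasSum_fc {u v : Pt d → ℂ} (hu : MemLp u 2 (volume.restrict (cell d)))
    (hv : MemLp v 2 (volume.restrict (cell d))) :
    HasSum (fun n => conj (fc n u) * fc n v) (∫ x in cell d, conj (u x) * v x) := by
  have hu' := hu.comp_measurePreserving measurePreserving_ofTorus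
  have hv' := hv.comp_measurePreserving measurePreserving_ofTorus
  have h := UnitAddTorus.hasSum_prod_mFourierCoeff hu'.toLp hv'.toLp
  have e1 : ∀ n, UnitAddTorus.mFourierCoeff hu'.toLp n = fc n u := fun n => by
    rw [fc_eq hu.1]
    refine integral_congr_ae ?_
    filter_upwards [hu'.coeFn_toLp] with t ht
    rw [ht]; rfl
  have e2 : ∀ n, UnitAddTorus.mFourierCoeff hv'.toLp n = fc n v := fun n => by
    rw [fc_eq hv.1]
    refine integral_congr_ae ?_
    filter_upwards [hv'.coeFn_toLp] with t ht
    rw [ht]; rfl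
  simp only [e1, e2] at h
  convert h using 1
  rw [integral_cell_eq_torus]
  · refine integral_congr_ae ?_
    filter_upwards [hu'.coeFn_toLp, hv'.coeFn_toLp] with t h1 h2
    rw [h1, h2]; rfl
  · exact (Complex.continuous_conj.comp_aestronglyMeasurable hu.1).mul hv.1

/-- The Riesz-Fischer theorem on the torus. Composing with `toTorus` yields a representative which
is periodic. -/
theorem exists_fc_eq {c : (Fin d → ℤ) → ℂ} (hc : Summable fun n => ‖c n‖ ^ 2) :
    ∃ u, MemL2per u ∧ ∀ n, fc n u = c n := by
  have hm : Memℓp c 2 := by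
    refine memℓp_gen ?_
    simpa using hc
  let g := (UnitAddTorus.mFourierBasis (d := Fin d)).repr.symm ⟨c, hm⟩
  have hg : ∀ n, UnitAddTorus.mFourierCoeff g n = c n := fun n => by
    rw [← UnitAddTorus.mFourierBasis_repr]
    simp [g]
  have hm := (Lp.memLp g).comp_measurePreserving measurePreserving_toTorus
  refine ⟨g ∘ toTorus, ⟨aePer_comp_toTorus _, hm⟩, fun n => ?_⟩
  rw [fc_eq hm.1, ← hg]
  simp [toTorus_ofTorus]

end MultiScale

/-! ### Lattice translates of the cell, local integrability, Fourier coefficients of derivatives -/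

namespace MultiScale

section Translate

variable {X : Type*} [AddCommGroup X] [MeasurableSpace X] [MeasurableAdd X] {μ : Measure X}
  [μ.IsAddRightInvariant]

theorem ae_periodic_sub {u : X → ℂ} {v : X} (h : ∀ᵐ x ∂μ, u (x + v) = u x) :
    ∀ᵐ x ∂μ, u (x - v) = u x := by
  filter_upwards [ae_periodic_zsmul h (-1)] with x hx
  simpa [sub_eq_add_neg] using hx

theorem measurePreserving_translate {C : Set X} (hC : MeasurableSet C) (v : X) :
    MeasurePreserving (fun x => x - v) (μ.restrict ((fun x => x - v) ⁻¹' C)) (μ.restrict C) := by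
  have := measurePreserving_add_right μ (-v)
  simp only [← sub_eq_add_neg] at this
  exact this.restrict_preimage hC

theorem memLp_translate {C : Set X} (hC : MeasurableSet C) {u : X → ℂ} {v : X}
    (h : ∀ᵐ x ∂μ, u (x + v) = u x) {p : ℝ≥0∞} (hu : MemLp u p (μ.restrict C)) :
    MemLp u p (μ.restrict ((fun x => x - v) ⁻¹' C)) := by
  refine MemLp.ae_eq ?_ (hu.comp_measurePreserving (measurePreserving_translate hC v))
  exact ae_restrict_of_ae (ae_periodic_sub h)

theorem integral_norm_translate {C : Set X} {u : X → ℂ} {v : X}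
    (h : ∀ᵐ x ∂μ, u (x + v) = u x) :
    ∫ x in (fun x => x - v) ⁻¹' C, ‖u x‖ ∂μ = ∫ x in C, ‖u x‖ ∂μ := by
  have e : MeasurableEmbedding (fun x : X => x - v) := by
    simpa [sub_eq_add_neg] using (MeasurableEquiv.addRight (-v)).measurableEmbedding
  have hm : MeasurePreserving (fun x : X => x - v) μ μ := by
    simpa [sub_eq_add_neg] using measurePreserving_add_right μ (-v)
  rw [← hm.setIntegral_preimage_emb e (fun x => ‖u x‖) C]
  refine integral_congr_ae (ae_restrict_of_ae ?_)
  filter_upwards [ae_periodic_sub h] with x hx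
  rw [hx]

end Translate

variable {d : ℕ}

/-- The translate of the period cell by a lattice vector. -/
def cellAt (n : Fin d → ℤ) : Set (Pt d) := (fun x => x - lat n) ⁻¹' cell d

theorem measurableSet_cellAt (n : Fin d → ℤ) : MeasurableSet (cellAt n) :=
  (measurable_id.sub_const _) measurableSet_cell

theorem mem_cellAt_floor (x : Pt d) : x ∈ cellAt (fun i => ⌊x i⌋) := by
  intro i
  simp only [lat, PiLp.sub_apply, mem_Icc]
  exact ⟨by linarith [Int.floor_le (x i)], by linarith [Int.lt_floor_add_one (x i)]⟩

theorem iUnion_cellAt : ⋃ n : Fin d → ℤ, cellAt n = univ :=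
  eq_univ_of_forall fun x => mem_iUnion.2 ⟨_, mem_cellAt_floor x⟩

/-- A bounded set is covered by finitely many cells. -/
theorem exists_cover {K : Set (Pt d)} (hK : Bornology.IsBounded K) :
    ∃ s : Finset (Fin d → ℤ), K ⊆ ⋃ n ∈ s, cellAt n := by
  obtain ⟨R, hR⟩ := hK.exists_norm_le
  refine ⟨Fintype.piFinset fun _ => Finset.Icc ⌊-R⌋ ⌊R⌋, fun x hx => ?_⟩
  simp only [mem_iUnion]
  refine ⟨_, ?_, mem_cellAt_floor x⟩
  rw [Fintype.mem_piFinset]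
  intro i
  have h1 := abs_le.1 ((PiLp.norm_apply_le x i).trans (hR x hx))
  exact Finset.mem_Icc.2 ⟨Int.floor_le_floor h1.1, Int.floor_le_floor h1.2⟩

theorem AEPer.lat' {u : Pt d → ℂ} (h : AEPer u) (n : Fin d → ℤ) : ∀ᵐ x, u (x + MultiScale.lat n) = u x := by
  filter_upwards [h.lat] with x hx using hx n

theorem MemL2per.memLp_cellAt {u : Pt d → ℂ} (hu : MemL2per u) (n : Fin d → ℤ) :
    MemLp u 2 (volume.restrict (cellAt n)) :=
  memLp_translate measurableSet_cell (AEPer.lat' hu.1 n) hu.2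

instance isFiniteMeasure_cellAt (n : Fin d → ℤ) : IsFiniteMeasure (volume.restrict (cellAt n)) :=
  ⟨by
    have := (measurePreserving_translate (μ := (volume : Measure (Pt d))) measurableSet_cell (lat n)).measure_preimage
      (s := univ) MeasurableSet.univ.nullMeasurableSet
    rw [preimage_univ] at this
    change (volume.restrict ((fun x => x - lat n) ⁻¹' cell d)) univ < _
    rw [this]
    exact measure_lt_top _ _⟩

theorem MemL2per.integrableOn_cellAt {u : Pt d → ℂ} (hu : MemL2per u) (n : Fin d → ℤ) :
    IntegrableOn u (cellAt n) := (hu.memLp_cellAt n).integrable (by norm_num)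

theorem MemL2per.integrableOn {u : Pt d → ℂ} (hu : MemL2per u) {K : Set (Pt d)}
    (hK : Bornology.IsBounded K) : IntegrableOn u K := by
  obtain ⟨s, hs⟩ := exists_cover hK
  refine IntegrableOn.mono_set ?_ hs
  rw [integrableOn_finset_iUnion]
  exact fun n _ => hu.integrableOn_cellAt n

theorem MemL2per.locallyIntegrable {u : Pt d → ℂ} (hu : MemL2per u) : LocallyIntegrable u volume :=
  fun x => ⟨Metric.ball x 1, Metric.ball_mem_nhds x one_pos, hu.integrableOn Metric.isBounded_ball⟩

theorem ae_of_ae_cell {u v : Pt d → ℂ} (hu : AEPer u) (hv : AEPer v)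
    (h : ∀ᵐ x ∂(volume.restrict (cell d)), u x = v x) : ∀ᵐ x, u x = v x := by
  have : ∀ n : Fin d → ℤ, ∀ᵐ x ∂(volume.restrict (cellAt n)), u x = v x := by
    intro n
    have h1 := (measurePreserving_translate (μ := (volume : Measure (Pt d))) measurableSet_cell (lat n)).quasiMeasurePreserving.ae h
    have h2 := ae_restrict_of_ae (s := cellAt n) (ae_periodic_sub (AEPer.lat' hu n))
    have h3 := ae_restrict_of_ae (s := cellAt n) (ae_periodic_sub (AEPer.lat' hv n))
    filter_upwards [h1, h2, h3] with x a b c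
    rw [← b, ← c, a]
  have h2 := (ae_restrict_iUnion_iff (fun n : Fin d → ℤ => cellAt n) (μ := (volume : Measure (Pt d))) (fun x => u x = v x)).2 this
  rwa [iUnion_cellAt, Measure.restrict_univ] at h2

/-! ### Averages over the cell -/

/-- By Fubini, with x replaced by x + s, the integral of the periodic `k` over every shifted cell is
the same. Averaging in `s` turns integrals over ℝ^d against compactly supported functions into
integrals over the cell. -/
theorem integral_average {k ρ : Pt d → ℂ} (hk : AEPer k) (hki : LocallyIntegrable k volume)
    (hρ : Continuous ρ) (hc : HasCompactSupport ρ) :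
    IntegrableOn (fun s => ∫ x, ρ (x - s) * k x) (cell d) ∧
    ∫ s in cell d, ∫ x, ρ (x - s) * k x = (∫ x, ρ x) * ∫ x in cell d, k x := by
  have h1 : ∀ s : Pt d, ∫ x, ρ (x - s) * k x = ∫ x, ρ x * k (x + s) := fun s => by
    rw [← integral_add_right_eq_self (fun x => ρ (x - s) * k x) s]
    simp
  have hcell : IsCompact (cell d) := by
    rw [cell_eq]
    exact (PiLp.homeomorph 2 _).isCompact_preimage.2 (isCompact_univ_pi fun _ => isCompact_Icc)
  have hkc : IntegrableOn k (cell d) := hki.integrableOn_isCompact hcell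
  have hsh : ∀ x, ∫ s in cell d, k (x + s) = ∫ s in cell d, k s := fun x => by
    have := setIntegral_cell_shift hk hkc.1 x
    simpa [add_comm] using this
  have hnper : AEPer fun x => (‖k x‖ : ℂ) := fun j => by
    filter_upwards [hk j] with x hx
    rw [hx]
  have hnsh : ∀ x, ∫ s in cell d, ‖k (x + s)‖ = ∫ s in cell d, ‖k s‖ := fun x => by
    have := setIntegral_cell_shift hnper (Complex.continuous_ofReal.comp_aestronglyMeasurable hkc.1.norm) x
    simp only [add_comm _ x] at this
    rw [integral_complex_ofReal, integral_complex_ofReal] at this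
    exact_mod_cast this
  simp only [h1]
  have hm : AEStronglyMeasurable (fun p : Pt d × Pt d => k (p.1 + p.2)) (volume.prod (volume.restrict (cell d))) := by
    have : AEStronglyMeasurable (fun p : Pt d × Pt d => k (p.1 + p.2)) (volume.prod volume) :=
      hki.aestronglyMeasurable.comp_quasiMeasurePreserving (quasiMeasurePreserving_add volume volume)
    exact this.mono_measure (Measure.prod_mono le_rfl Measure.restrict_le_self)
  have hi : Integrable (fun p : Pt d × Pt d => ρ p.1 * k (p.1 + p.2)) (volume.prod (volume.restrict (cell d))) := by
    have hm2 : AEStronglyMeasurable (fun p : Pt d × Pt d => ρ p.1 * k (p.1 + p.2)) (volume.prod (volume.restrict (cell d))) :=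
      (hρ.comp continuous_fst).aestronglyMeasurable.mul hm
    rw [integrable_prod_iff hm2]
    constructor
    · refine Filter.Eventually.of_forall fun x => ?_
      have := integrableOn_cell_shift hk hkc x
      simp only [add_comm _ x] at this
      exact Integrable.const_mul this (ρ x)
    · simp only [norm_mul, integral_const_mul, hnsh]
      exact (hρ.norm.integrable_of_hasCompactSupport hc.norm).mul_const _
  refine ⟨hi.integral_prod_right, ?_⟩
  rw [← integral_integral_swap hi]
  simp only [integral_const_mul, hsh, integral_mul_const]

theorem exists_test_integral_one : ∃ ρ : Pt d → ℝ, ContDiff ℝ ∞ ρ ∧ HasCompactSupport ρ ∧ ∫ x, ρ x = 1 := by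
  let f : ContDiffBump (0 : Pt d) := default
  exact ⟨f.normed volume, f.contDiff_normed, f.hasCompactSupport_normed, f.integral_normed⟩

/-- The exponential has no compact support, so the weak formulation is applied to `em (-n)` times `ρ
(· - s)` and averaged over `s` in the cell. Since ρ has integral one and its derivative has integral
zero, only the Fourier coefficients survive. -/
theorem fc_deriv {u v : Pt d → ℂ} {j : Fin d} (h : HasWeakDeriv (ev j) u v) (hu : AEPer u) (hv : AEPer v)
    (n : Fin d → ℤ) : fc n v = 2 * Real.pi * Complex.I * n j * fc n u := by
  obtain ⟨ρ, h1, h2, h3⟩ := exists_test_integral_one (d := d)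
  have hρ : ContDiff ℝ ∞ (fun x => (ρ x : ℂ)) := Complex.ofRealCLM.contDiff.comp h1
  have hρc : HasCompactSupport (fun x => (ρ x : ℂ)) := h2.comp_left (g := fun r : ℝ => (r : ℂ)) (by simp)
  have hdρ : ∀ x, fderiv ℝ (fun x => (ρ x : ℂ)) x (ev j) = ((fderiv ℝ ρ x (ev j) : ℝ) : ℂ) := fun x => by
    have := (Complex.ofRealCLM.hasFDerivAt.comp x ((h1.differentiable (by simp)) x).hasFDerivAt).fderiv
    change fderiv ℝ (Complex.ofRealCLM ∘ ρ) x (ev j) = _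
    rw [this]; rfl
  have hper : ∀ {f : Pt d → ℂ}, AEPer f → AEPer fun x => em (-n) x * f x := fun hf j => by
    filter_upwards [hf j, aePer_em (-n) j] with x a b
    rw [a, b]
  have hli : ∀ {f : Pt d → ℂ}, LocallyIntegrable f volume → LocallyIntegrable (fun x => em (-n) x * f x) volume :=
    fun hf => by
      simpa [mul_comm] using hf.smul_continuous (contDiff_em (-n)).continuous
  -- the weak formulation with the test functions `em (-n) * ρ (· - s)`
  have key : ∀ s : Pt d, -(2 * Real.pi * Complex.I * n j) * (∫ x, (ρ (x - s) : ℂ) * (em (-n) x * u x))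
      + ∫ x, ((fderiv ℝ ρ (x - s) (ev j) : ℝ) : ℂ) * (em (-n) x * u x)
      = - ∫ x, (ρ (x - s) : ℂ) * (em (-n) x * v x) := by
    intro s
    have hρs : ContDiff ℝ ∞ (fun x => (ρ (x - s) : ℂ)) := hρ.comp (contDiff_id.sub contDiff_const)
    have hρsc : HasCompactSupport (fun x => (ρ (x - s) : ℂ)) := hρc.comp_homeomorph (Homeomorph.subRight s)
    have hdρs : ContDiff ℝ ∞ (fun x => ((fderiv ℝ ρ (x - s) (ev j) : ℝ) : ℂ)) :=
      Complex.ofRealCLM.contDiff.comp ((continuous_fderiv_apply_test h1 (ev j)).comp (contDiff_id.sub contDiff_const))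
    have hdρsc : HasCompactSupport (fun x => ((fderiv ℝ ρ (x - s) (ev j) : ℝ) : ℂ)) :=
      ((hasCompactSupport_fderiv_apply_test h2 (ev j)).comp_left (g := fun r : ℝ => (r : ℂ)) (by simp)).comp_homeomorph
        (Homeomorph.subRight s)
    have := h.integral_complex (φ := fun x => em (-n) x * (ρ (x - s) : ℂ)) ((contDiff_em _).mul hρs)
      (hρsc.mul_left)
    have hd : ∀ x, fderiv ℝ (fun x => em (-n) x * (ρ (x - s) : ℂ)) x (ev j) =
        -(2 * Real.pi * Complex.I * n j) * (em (-n) x * (ρ (x - s) : ℂ))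
        + em (-n) x * ((fderiv ℝ ρ (x - s) (ev j) : ℝ) : ℂ) := fun x => by
      rw [fderiv_fun_mul ((contDiff_em (-n)).differentiable (by simp) x) (hρs.differentiable (by simp) x)]
      simp only [add_apply, smul_apply, smul_eq_mul, fderiv_em,
        Pi.neg_apply]
      have : fderiv ℝ (fun x => (ρ (x - s) : ℂ)) x (ev j) = ((fderiv ℝ ρ (x - s) (ev j) : ℝ) : ℂ) := by
        rw [← hdρ]
        rw [← fderiv_comp_sub]
      rw [this]
      push_cast
      ring
    simp only [hd] at this
    rw [← integral_const_mul, ← integral_add ((integrable_ctest_mul hρs.continuous hρsc (hli h.1)).const_mul _)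
      (integrable_ctest_mul hdρs.continuous hdρsc (hli h.1))]
    calc _ = ∫ x, (-(2 * Real.pi * Complex.I * n j) * (em (-n) x * (ρ (x - s) : ℂ))
        + em (-n) x * ((fderiv ℝ ρ (x - s) (ev j) : ℝ) : ℂ)) * u x := by
          congr 1; funext x; ring
      _ = _ := this
      _ = _ := by congr 2; funext x; ring
  obtain ⟨i1, a1⟩ := integral_average (hper hu) (hli h.1) hρ.continuous hρc
  obtain ⟨i2, a2⟩ := integral_average (hper hv) (hli h.2.1) hρ.continuous hρc
  have hdc : HasCompactSupport (fun x => ((fderiv ℝ ρ x (ev j) : ℝ) : ℂ)) :=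
    (hasCompactSupport_fderiv_apply_test h2 (ev j)).comp_left (g := fun r : ℝ => (r : ℂ)) (by simp)
  have hdcont : Continuous (fun x => ((fderiv ℝ ρ x (ev j) : ℝ) : ℂ)) :=
    Complex.continuous_ofReal.comp (continuous_fderiv_apply_test h1 (ev j)).continuous
  obtain ⟨i3, a3⟩ := integral_average (hper hu) (hli h.1) hdcont hdc
  have z : ∫ x, ((fderiv ℝ ρ x (ev j) : ℝ) : ℂ) = 0 := by
    have := (integral_mul_fderiv_eq_neg_fderiv_mul_of_integrable (μ := (volume : Measure (Pt d))) (f := fun _ => (1 : ℝ)) (g := ρ) (v := ev j)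
      (by simp) (by simpa using ((continuous_fderiv_apply_test h1 (ev j)).continuous.integrable_of_hasCompactSupport
        (hasCompactSupport_fderiv_apply_test h2 (ev j))))
      (by simpa using h1.continuous.integrable_of_hasCompactSupport h2) (by simp) (fun x _ => h1.differentiable (by simp) x))
    rw [integral_complex_ofReal]
    simpa using this
  have o : ∫ x, (ρ x : ℂ) = 1 := by rw [integral_complex_ofReal, h3]; simp
  rw [o, one_mul] at a1 a2
  rw [z, zero_mul] at a3
  have tot := integral_congr_ae (μ := volume.restrict (cell d)) (Filter.Eventually.of_forall key)
  rw [integral_add, integral_const_mul, integral_neg, a1, a2, a3] at tot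
  · unfold fc
    linear_combination tot
  · exact i1.const_mul _
  · exact i3

end MultiScale

/-! ### Weak derivatives of periodic functions in terms of Fourier series -/

namespace MultiScale

variable {d : ℕ}

theorem isFunSpace_memL2per : IsFunSpace (MemL2per (d := d)) where
  congr := fun {u v} hu h => by
    refine ⟨fun j => ?_, hu.2.ae_eq (ae_restrict_of_ae h)⟩
    filter_upwards [hu.1 j, h, ae_add_lat h (ev j)] with x a b c
    rw [← b, ← c, a]
  zero := ⟨fun j => by simp, MemLp.zero⟩
  add := fun hu hv => ⟨fun j => by filter_upwards [hu.1 j, hv.1 j] with x a b; rw [a, b], hu.2.add hv.2⟩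
  smul := fun c u hu => ⟨fun j => by filter_upwards [hu.1 j] with x a; rw [a], hu.2.const_mul c⟩
  conjugate := fun {u} hu => ⟨fun j => by filter_upwards [hu.1 j] with x a; rw [a], hu.2.star⟩

theorem integral_cell_norm_cellAt {u : Pt d → ℂ} (hu : AEPer u) (n : Fin d → ℤ) :
    ∫ x in cellAt n, ‖u x‖ = ∫ x in cell d, ‖u x‖ :=
  integral_norm_translate (AEPer.lat' hu n)

/-- Integration against a test function is a bounded functional of periodic functions. -/
theorem exists_bound_integral_mul {ρ : Pt d → ℂ} (hρ : Continuous ρ) (hc : HasCompactSupport ρ) :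
    ∃ M : ℝ, 0 ≤ M ∧ ∀ u, MemL2per u → ‖∫ x, ρ x * u x‖ ≤ M * ∫ x in cell d, ‖u x‖ := by
  obtain ⟨s, hs⟩ := exists_cover hc.isCompact.isBounded
  obtain ⟨B, hB⟩ := hρ.bounded_above_of_compact_support hc
  have hB0 : 0 ≤ B := (norm_nonneg _).trans (hB 0)
  refine ⟨B * s.card, by positivity, fun u hu => ?_⟩
  have hK : IntegrableOn (fun x => ‖u x‖) (⋃ n ∈ s, cellAt n) := by
    rw [integrableOn_finset_iUnion]
    exact fun n _ => (hu.integrableOn_cellAt n).norm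
  have hm : MeasurableSet (⋃ n ∈ s, cellAt (d := d) n) :=
    Finset.measurableSet_biUnion _ fun n _ => measurableSet_cellAt n
  calc ‖∫ x, ρ x * u x‖ ≤ ∫ x, ‖ρ x * u x‖ := norm_integral_le_integral_norm _
    _ = ∫ x in ⋃ n ∈ s, cellAt n, ‖ρ x * u x‖ := by
        rw [setIntegral_eq_integral_of_forall_compl_eq_zero]
        intro x hx
        have : x ∉ tsupport ρ := fun h => hx (hs h)
        rw [image_eq_zero_of_notMem_tsupport this]; simp
    _ ≤ ∫ x in ⋃ n ∈ s, cellAt n, B * ‖u x‖ := by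
        refine integral_mono_of_nonneg (Filter.Eventually.of_forall fun x => norm_nonneg _) (hK.const_mul _) ?_
        refine Filter.Eventually.of_forall fun x => ?_
        simp only [norm_mul]
        exact mul_le_mul_of_nonneg_right (hB x) (norm_nonneg _)
    _ = B * ∫ x in ⋃ n ∈ s, cellAt n, ‖u x‖ := integral_const_mul _ _
    -- The closed cells share faces; subadditivity of restricted measures gives an inequality, which
    -- suffices.
    _ ≤ B * ∑ n ∈ s, ∫ x in cellAt n, ‖u x‖ := by
        refine mul_le_mul_of_nonneg_left ?_ hB0
        clear hs hm
        induction s using Finset.induction_on with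
        | empty => simp
        | insert a s ha ih =>
          rw [Finset.sum_insert ha]
          have h1 : IntegrableOn (fun x => ‖u x‖) (cellAt a) := (hu.integrableOn_cellAt a).norm
          have h2 : IntegrableOn (fun x => ‖u x‖) (⋃ n ∈ s, cellAt n) := by
            rw [integrableOn_finset_iUnion]
            exact fun n _ => (hu.integrableOn_cellAt n).norm
          rw [Finset.set_biUnion_insert]
          calc _ ≤ ∫ x, ‖u x‖ ∂(volume.restrict (cellAt a) + volume.restrict (⋃ n ∈ s, cellAt n)) := by
                refine integral_mono_measure (Measure.restrict_union_le _ _) (Filter.Eventually.of_forall fun x => norm_nonneg _) ?_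
                exact Integrable.add_measure h1 h2
            _ = _ := integral_add_measure h1 h2
            _ ≤ _ := by gcongr; exact ih h2
    _ = B * s.card * ∫ x in cell d, ‖u x‖ := by
        simp only [integral_cell_norm_cellAt hu.1, Finset.sum_const, nsmul_eq_mul]
        ring

/-- The cell has measure one, and the variance of `‖u‖` is nonnegative. -/
theorem integral_norm_sq_le {u : Pt d → ℂ} (hu : MemLp u 2 (volume.restrict (cell d))) :
    (∫ x in cell d, ‖u x‖) ^ 2 ≤ ∫ x in cell d, ‖u x‖ ^ 2 := by
  have hi : Integrable (fun x => ‖u x‖) (volume.restrict (cell d)) := (hu.integrable (by norm_num)).norm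
  have h2 : Integrable (fun x => ‖u x‖ ^ 2) (volume.restrict (cell d)) :=
    (memLp_two_iff_integrable_sq_norm hu.1).1 hu
  set c := ∫ x in cell d, ‖u x‖
  have : 0 ≤ ∫ x in cell d, (‖u x‖ - c) ^ 2 := integral_nonneg fun x => sq_nonneg _
  have e : ∫ x in cell d, (‖u x‖ - c) ^ 2 = ∫ x in cell d, (‖u x‖ ^ 2 - (2 * c) * ‖u x‖ + c ^ 2) := by
    congr 1; funext x; ring
  have hs : Integrable (fun x => ‖u x‖ ^ 2 - (2 * c) * ‖u x‖) (volume.restrict (cell d)) := h2.sub (hi.const_mul _)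
  rw [e, integral_add hs (integrable_const _), integral_sub h2 (hi.const_mul _),
    integral_const_mul] at this
  simp only [integral_const, probReal_univ, one_smul] at this
  change 0 ≤ _ - 2 * c * c + c ^ 2 at this
  nlinarith

theorem memL2per_em (n : Fin d → ℤ) : MemL2per (em n) :=
  ⟨aePer_em n, MemLp.of_bound (contDiff_em n).continuous.aestronglyMeasurable 1
    (Filter.Eventually.of_forall fun x => (norm_em n x).le)⟩

theorem fc_em (n m : Fin d → ℤ) : fc n (em m) = if n = m then 1 else 0 := by
  have h := orthonormal_iff_ite.1 (UnitAddTorus.mFourierBasis (d := Fin d)).orthonormal n m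
  rw [← h, ← HilbertBasis.repr_apply_apply, UnitAddTorus.mFourierBasis_repr, UnitAddTorus.coe_mFourierBasis,
    fc_eq (memL2per_em m).2.1]
  refine integral_congr_ae ?_
  filter_upwards [UnitAddTorus.coeFn_mFourierLp 2 m] with t ht
  rw [ht, em_eq, toTorus_ofTorus]

theorem fc_add {u v : Pt d → ℂ} (hu : MemLp u 2 (volume.restrict (cell d)))
    (hv : MemLp v 2 (volume.restrict (cell d))) (n) : fc n (fun x => u x + v x) = fc n u + fc n v := by
  have h : ∀ {u : Pt d → ℂ}, MemLp u 2 (volume.restrict (cell d)) →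
      Integrable (fun x => em (-n) x * u x) (volume.restrict (cell d)) := fun hu => by
    refine (hu.integrable (by norm_num)).bdd_mul (c := 1) (contDiff_em _).continuous.aestronglyMeasurable ?_
    exact Filter.Eventually.of_forall fun x => (norm_em _ x).le
  simp only [fc, mul_add]
  exact integral_add (h hu) (h hv)

theorem fc_smul (c : ℂ) (u : Pt d → ℂ) (n) : fc n (fun x => c * u x) = c * fc n u := by
  simp only [fc, mul_left_comm _ c, integral_const_mul]

theorem fc_sub {u v : Pt d → ℂ} (hu : MemLp u 2 (volume.restrict (cell d)))
    (hv : MemLp v 2 (volume.restrict (cell d))) (n) : fc n (fun x => u x - v x) = fc n u - fc n v := by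
  have := fc_add hu (hv.const_mul (-1)) n
  simp only [fc_smul] at this
  simpa [sub_eq_add_neg] using this

theorem integral_norm_sq_eq_re {α : Type*} [MeasurableSpace α] {μ : Measure α} (u : α → ℂ) :
    ∫ x, conj (u x) * u x ∂μ = ((∫ x, ‖u x‖ ^ 2 ∂μ : ℝ) : ℂ) := by
  rw [← integral_complex_ofReal]
  congr 1; funext x
  rw [Complex.conj_mul']; simp

theorem hasSum_norm_fc_sq {u : Pt d → ℂ} (hu : MemLp u 2 (volume.restrict (cell d))) :
    HasSum (fun n => ‖fc n u‖ ^ 2) (∫ x in cell d, ‖u x‖ ^ 2) := by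
  have h := hasSum_fc hu hu
  rw [integral_norm_sq_eq_re] at h
  have e : (fun n => conj (fc n u) * fc n u) = fun n => ((‖fc n u‖ ^ 2 : ℝ) : ℂ) := by
    funext n
    rw [Complex.conj_mul']; simp
  rw [e] at h
  exact_mod_cast h

theorem ae_eq_zero_of_integral_norm_sq {α : Type*} [MeasurableSpace α] {μ : Measure α} {u : α → ℂ}
    (hu : MemLp u 2 μ) (h : ∫ x, ‖u x‖ ^ 2 ∂μ = 0) : ∀ᵐ x ∂μ, u x = 0 := by
  have := (integral_eq_zero_iff_of_nonneg (fun x => sq_nonneg ‖u x‖)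
    ((memLp_two_iff_integrable_sq_norm hu.1).1 hu)).1 h
  filter_upwards [this] with x hx
  simpa using hx

theorem ae_eq_of_fc_eq {u v : Pt d → ℂ} (hu : MemL2per u) (hv : MemL2per v) (h : ∀ n, fc n u = fc n v) :
    ∀ᵐ x, u x = v x := by
  refine ae_of_ae_cell hu.1 hv.1 ?_
  have hs := isFunSpace_memL2per.sub hu hv
  have := hasSum_norm_fc_sq hs.2
  have e : (fun n => ‖fc n fun z => u z - v z‖ ^ 2) = fun _ => 0 := by
    funext n
    rw [fc_sub hu.2 hv.2, h n]; simp
  rw [e] at this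
  filter_upwards [ae_eq_zero_of_integral_norm_sq hs.2 (this.unique hasSum_zero)] with x hx
  exact sub_eq_zero.1 hx

theorem hasWeakDeriv_em (n : Fin d → ℤ) (j : Fin d) :
    HasWeakDeriv (ev j) (em n) (fun x => 2 * Real.pi * Complex.I * n j * em n x) := by
  have h1 : LocallyIntegrable (em n) (volume : Measure (Pt d)) := (contDiff_em n).continuous.locallyIntegrable
  refine ⟨h1, h1.smul (2 * Real.pi * Complex.I * n j), fun φ hφ hc => ?_⟩
  have hi : ∀ {ψ : Pt d → ℝ}, Continuous ψ → HasCompactSupport ψ → ∀ {f : Pt d → ℂ}, Continuous f →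
      Integrable (fun x => ψ x • f x) volume := fun h1 h2 f hf =>
    (h1.smul hf).integrable_of_hasCompactSupport h2.smul_right
  have hem : Continuous fun x => fderiv ℝ (em n) x (ev j) := by
    simp only [fderiv_em]
    exact continuous_const.mul (contDiff_em n).continuous
  have := integral_smul_fderiv_eq_neg_fderiv_smul_of_integrable (μ := (volume : Measure (Pt d))) (f := φ) (g := em n) (v := ev j)
    (hi (continuous_fderiv_apply_test hφ _).continuous (hasCompactSupport_fderiv_apply_test hc _) (contDiff_em n).continuous)
    (hi hφ.continuous hc hem) (hi hφ.continuous hc (contDiff_em n).continuous)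
    (fun x _ => hφ.differentiable (by simp) x) (fun x _ => (contDiff_em n).differentiable (by simp) x)
  simp only [fderiv_em, Complex.real_smul] at this
  rw [this, neg_neg]

/-- Integration against a test function, as a series of Fourier coefficients. -/
theorem hasSum_integral_mul {ρ : Pt d → ℂ} (hρ : Continuous ρ) (hc : HasCompactSupport ρ) {u : Pt d → ℂ}
    (hu : MemL2per u) : HasSum (fun n => fc n u * ∫ x, ρ x * em n x) (∫ x, ρ x * u x) := by
  obtain ⟨M, hM, hb⟩ := exists_bound_integral_mul hρ hc
  have hs := hasSum_norm_fc_sq hu.2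
  have hpart : ∀ s : Finset (Fin d → ℤ), MemL2per (fun x => ∑ n ∈ s, fc n u * em n x) := fun s =>
    isFunSpace_memL2per.sum s fun n _ => isFunSpace_memL2per.smul _ (memL2per_em n)
  have hfs : ∀ s : Finset (Fin d → ℤ), ∀ n, fc n (fun x => ∑ m ∈ s, fc m u * em m x) = if n ∈ s then fc n u else 0 := by
    intro s n
    induction s using Finset.induction_on with
    | empty => simp [fc]
    | insert a s ha ih =>
      simp only [Finset.sum_insert ha]
      rw [fc_add ((memL2per_em a).2.const_mul _) (hpart s).2, ih, fc_smul, fc_em]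
      by_cases h1 : n = a
      · subst h1; simp [ha]
      · simp [h1]
  -- The pairing is bounded by the L¹ norm on the cell, hence by the L² norm, and by Parseval the L²
  -- error of a partial Fourier sum is the tail of the squared coefficients.
  have hdiff : ∀ s : Finset (Fin d → ℤ), ‖(∑ n ∈ s, fc n u * ∫ x, ρ x * em n x) - ∫ x, ρ x * u x‖ ≤
      M * Real.sqrt ((∫ x in cell d, ‖u x‖ ^ 2) - ∑ n ∈ s, ‖fc n u‖ ^ 2) := by
    intro s
    have hd := isFunSpace_memL2per.sub (hpart s) hu
    have e1 : (∑ n ∈ s, fc n u * ∫ x, ρ x * em n x) - ∫ x, ρ x * u x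
        = ∫ x, ρ x * ((∑ n ∈ s, fc n u * em n x) - u x) := by
      simp only [mul_sub]
      rw [integral_sub (integrable_ctest_mul hρ hc (hpart s).locallyIntegrable) (integrable_ctest_mul hρ hc hu.locallyIntegrable)]
      congr 1
      simp only [Finset.mul_sum]
      rw [integral_finsetSum]
      · refine Finset.sum_congr rfl fun n _ => ?_
        rw [← integral_const_mul]
        congr 1; funext x; ring
      · intro n _
        exact integrable_ctest_mul hρ hc (isFunSpace_memL2per.smul _ (memL2per_em n)).locallyIntegrable
    rw [e1]
    refine (hb _ hd).trans (mul_le_mul_of_nonneg_left ?_ hM)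
    refine Real.le_sqrt_of_sq_le ((integral_norm_sq_le hd.2).trans (le_of_eq ?_))
    have h2 := hasSum_norm_fc_sq hd.2
    have h3 : HasSum (fun n => ‖fc n u‖ ^ 2 - if n ∈ s then ‖fc n u‖ ^ 2 else 0)
        ((∫ x in cell d, ‖u x‖ ^ 2) - ∑ n ∈ s, ‖fc n u‖ ^ 2) := by
      refine hs.sub ?_
      have : HasSum (fun n => if n ∈ s then ‖fc n u‖ ^ 2 else 0)
          (∑ n ∈ s, if n ∈ s then ‖fc n u‖ ^ 2 else 0) :=
        hasSum_sum_of_ne_finset_zero (fun n hn => by simp [hn])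
      rwa [Finset.sum_congr rfl fun n hn => if_pos hn] at this
    have e2 : (fun n => ‖fc n fun x => (∑ m ∈ s, fc m u * em m x) - u x‖ ^ 2)
        = fun n => ‖fc n u‖ ^ 2 - if n ∈ s then ‖fc n u‖ ^ 2 else 0 := by
      funext n
      rw [fc_sub (hpart s).2 hu.2, hfs]
      by_cases hn : n ∈ s <;> simp [hn]
    rw [e2] at h2
    exact h2.unique h3
  rw [HasSum, tendsto_iff_norm_sub_tendsto_zero]
  refine squeeze_zero (fun _ => norm_nonneg _) hdiff ?_
  have hs' : Filter.Tendsto (fun s : Finset (Fin d → ℤ) => ∑ n ∈ s, ‖fc n u‖ ^ 2)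
      (SummationFilter.unconditional (Fin d → ℤ)).filter (nhds (∫ x in cell d, ‖u x‖ ^ 2)) := hs
  have : Filter.Tendsto (fun s : Finset (Fin d → ℤ) => M * Real.sqrt ((∫ x in cell d, ‖u x‖ ^ 2) - ∑ n ∈ s, ‖fc n u‖ ^ 2))
      (SummationFilter.unconditional (Fin d → ℤ)).filter (nhds (M * Real.sqrt ((∫ x in cell d, ‖u x‖ ^ 2) - ∫ x in cell d, ‖u x‖ ^ 2))) :=
    ((Real.continuous_sqrt.tendsto _).comp (tendsto_const_nhds.sub hs')).const_mul M
  simpa using this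

/-- Converse of `fc_deriv`. Both sides of the weak formulation are expanded in Fourier series, and
each term is integration by parts for an exponential. -/
theorem hasWeakDeriv_of_fc {u v : Pt d → ℂ} (hu : MemL2per u) (hv : MemL2per v) {j : Fin d}
    (h : ∀ n, fc n v = 2 * Real.pi * Complex.I * n j * fc n u) : HasWeakDeriv (ev j) u v := by
  refine ⟨hu.locallyIntegrable, hv.locallyIntegrable, fun φ hφ hc => ?_⟩
  have hdc : HasCompactSupport (fun x => ((fderiv ℝ φ x (ev j) : ℝ) : ℂ)) :=
    (hasCompactSupport_fderiv_apply_test hc (ev j)).comp_left (g := fun r : ℝ => (r : ℂ)) (by simp)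
  have hdcont : Continuous (fun x => ((fderiv ℝ φ x (ev j) : ℝ) : ℂ)) :=
    Complex.continuous_ofReal.comp (continuous_fderiv_apply_test hφ (ev j)).continuous
  have hcc : HasCompactSupport (fun x => (φ x : ℂ)) := hc.comp_left (g := fun r : ℝ => (r : ℂ)) (by simp)
  have h1 := hasSum_integral_mul hdcont hdc hu
  have h2 := (hasSum_integral_mul (ρ := fun x => (φ x : ℂ)) (Complex.continuous_ofReal.comp hφ.continuous) hcc hv).neg
  have e : (fun n => fc n u * ∫ x, ((fderiv ℝ φ x (ev j) : ℝ) : ℂ) * em n x)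
      = fun n => -(fc n v * ∫ x, (φ x : ℂ) * em n x) := by
    funext n
    have := (hasWeakDeriv_em n j).2.2 φ hφ hc
    have e : ∫ z, (φ z : ℂ) * (2 * Real.pi * Complex.I * n j * em n z)
        = 2 * Real.pi * Complex.I * n j * ∫ z, (φ z : ℂ) * em n z := by
      rw [← integral_const_mul]
      congr 1; funext z; ring
    rw [h n, this, e]
    ring
  rw [e] at h1
  exact h1.unique h2

/-- Integration by parts on the cell. -/
theorem integral_cell_by_parts {u u' v v' : Pt d → ℂ} {j : Fin d} (h : HasWeakDeriv (ev j) u u')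
    (h' : HasWeakDeriv (ev j) v v') (hu : MemL2per u) (hu' : MemL2per u') (hv : MemL2per v) (hv' : MemL2per v') :
    ∫ x in cell d, conj (u x) * v' x = - ∫ x in cell d, conj (u' x) * v x := by
  have h1 := hasSum_fc hu.2 hv'.2
  have h2 := (hasSum_fc hu'.2 hv.2).neg
  have e : (fun n => conj (fc n u) * fc n v') = fun n => -(conj (fc n u') * fc n v) := by
    funext n
    rw [fc_deriv h hu.1 hu'.1, fc_deriv h' hv.1 hv'.1]
    simp only [map_mul, Complex.conj_I, Complex.conj_ofReal, map_intCast, map_ofNat]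
    ring
  rw [e] at h1
  exact h1.unique h2

end MultiScale

/-! ### Functions of (x, y): slices, pairings in one variable, tensor products -/

namespace MultiScale

variable {d : ℕ}

instance isAddRightInvariant_volume_prod : (volume : Measure (Pt d × Pt d)).IsAddRightInvariant := by
  have : ((volume : Measure (Pt d)).prod (volume : Measure (Pt d))).IsAddLeftInvariant := inferInstance
  rw [Measure.volume_eq_prod]
  exact IsAddLeftInvariant.isAddRightInvariant

theorem volume_restrict_cell_prod :
    (volume : Measure (Pt d × Pt d)).restrict (cell d ×ˢ univ) = (volume.restrict (cell d)).prod volume := by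
  rw [Measure.volume_eq_prod, ← Measure.prod_restrict, Measure.restrict_univ]

theorem ae_ae_swap {α β : Type*} [MeasurableSpace α] [MeasurableSpace β] {μ : Measure α} {ν : Measure β}
    [SFinite μ] [SFinite ν] {P : α × β → Prop} (h : ∀ᵐ z ∂μ.prod ν, P z) : ∀ᵐ y ∂ν, ∀ᵐ x ∂μ, P (x, y) := by
  have := (Measure.measurePreserving_swap (μ := ν) (ν := μ)).quasiMeasurePreserving.ae h
  exact Measure.ae_ae_of_ae_prod this

theorem isFunSpace_memL2 : IsFunSpace (MemL2 (d := d)) where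
  congr := fun hu h => MemLp.ae_eq h hu
  zero := MemLp.zero
  add := fun hu hv => MemLp.add hu hv
  smul := fun c _ hu => MemLp.const_mul hu c
  conjugate := fun hu => MemLp.star hu

theorem isFunSpace_memL2two : IsFunSpace (MemL2two (d := d)) where
  congr := fun {u v} hu h => by
    refine ⟨fun j => ?_, hu.2.ae_eq (ae_restrict_of_ae h)⟩
    have h2 := (measurePreserving_add_right (volume : Measure (Pt d × Pt d)) (ex j)).quasiMeasurePreserving.ae h
    filter_upwards [hu.1 j, h, h2] with x a b c
    rw [← b, ← c, a]
  zero := ⟨fun j => by simp, MemLp.zero⟩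
  add := fun hu hv => ⟨fun j => by filter_upwards [hu.1 j, hv.1 j] with x a b; rw [a, b], hu.2.add hv.2⟩
  smul := fun c u hu => ⟨fun j => by filter_upwards [hu.1 j] with x a; rw [a], hu.2.const_mul c⟩
  conjugate := fun {u} hu => ⟨fun j => by filter_upwards [hu.1 j] with x a; rw [a], hu.2.star⟩

theorem MemL2.locallyIntegrable {F : Pt d → ℂ} (h : MemL2 F) : LocallyIntegrable F volume :=
  MemLp.locallyIntegrable h (by norm_num)

theorem MemL2two.locallyIntegrable {U : Pt d × Pt d → ℂ} (hU : MemL2two U) : LocallyIntegrable U volume := by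
  intro z
  obtain ⟨s, hs⟩ := exists_cover (Metric.isBounded_ball (x := z.1) (r := 1))
  refine ⟨Metric.ball z.1 1 ×ˢ Metric.ball z.2 1, ?_, ?_⟩
  · exact prod_mem_nhds (Metric.ball_mem_nhds _ one_pos) (Metric.ball_mem_nhds _ one_pos)
  have hsub : Metric.ball z.1 1 ×ˢ Metric.ball z.2 1 ⊆ ⋃ n ∈ s, (cellAt n ×ˢ Metric.ball z.2 1) := by
    rintro ⟨x, y⟩ ⟨hx, hy⟩
    obtain ⟨n, hn, hxn⟩ := mem_iUnion₂.1 (hs hx)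
    exact mem_iUnion₂.2 ⟨n, hn, hxn, hy⟩
  refine IntegrableOn.mono_set ?_ hsub
  rw [integrableOn_finset_iUnion]
  intro n _
  have h1 : ∀ᵐ z : Pt d × Pt d, U (z + (lat n, 0)) = U z := by
    have := ae_periodic_sum hU.1 n
    have e : (∑ j, n j • ex j : Pt d × Pt d) = (lat n, 0) := by
      rw [lat_eq_sum]
      ext1 <;> simp [ex, Prod.fst_sum, Prod.snd_sum]
    rwa [e] at this
  have h2 := memLp_translate (measurableSet_cell.prod MeasurableSet.univ) h1 hU.2
  have e2 : ((fun x : Pt d × Pt d => x - (lat n, 0)) ⁻¹' cell d ×ˢ univ) = cellAt n ×ˢ univ := by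
    ext z; simp [cellAt]
  rw [e2] at h2
  have h3 : MemLp U 2 (volume.restrict (cellAt n ×ˢ Metric.ball z.2 1)) :=
    h2.mono_measure (Measure.restrict_mono (prod_mono le_rfl (subset_univ _)) le_rfl)
  have : IsFiniteMeasure ((volume : Measure (Pt d × Pt d)).restrict (cellAt n ×ˢ Metric.ball z.2 1)) := by
    rw [Measure.volume_eq_prod, ← Measure.prod_restrict]
    have : IsFiniteMeasure ((volume : Measure (Pt d)).restrict (Metric.ball z.2 1)) := ⟨by
      simpa using measure_ball_lt_top⟩
    infer_instance
  exact h3.integrable (by norm_num)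

theorem MemL2two.memLp_prod {U : Pt d × Pt d → ℂ} (hU : MemL2two U) :
    MemLp U 2 ((volume.restrict (cell d)).prod volume) := by
  rw [← volume_restrict_cell_prod]; exact hU.2

/-- The slices of functions in `L²_per(Ω; L²(ℝ^d))`. -/
theorem MemL2two.slice {U : Pt d × Pt d → ℂ} (hU : MemL2two U) :
    ∀ᵐ y, MemL2per fun x => U (x, y) := by
  have h1 : ∀ᵐ y, ∀ j, ∀ᵐ x, U (x + ev j, y) = U (x, y) := by
    rw [ae_all_iff]
    intro j
    have := ae_ae_swap (μ := (volume : Measure (Pt d))) (ν := (volume : Measure (Pt d))) (hU.1 j)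
    filter_upwards [this] with y hy
    filter_upwards [hy] with x hx
    simpa [ex] using hx
  have h2 := hU.memLp_prod
  have h3 := ((memLp_two_iff_integrable_sq_norm h2.1).1 h2).prod_left_ae
  have h4 := h2.1.prodMk_right
  filter_upwards [h1, h3, h4] with y a b c
  exact ⟨a, (memLp_two_iff_integrable_sq_norm c).2 b⟩

theorem norm_integral_mul_sq_le {α : Type*} [MeasurableSpace α] {μ : Measure α} {a b : α → ℂ} (ha : MemLp a 2 μ)
    (hb : MemLp b 2 μ) : ‖∫ x, a x * b x ∂μ‖ ^ 2 ≤ (∫ x, ‖a x‖ ^ 2 ∂μ) * ∫ x, ‖b x‖ ^ 2 ∂μ := by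
  have h1 := norm_integral_le_integral_norm (μ := μ) (fun x => a x * b x)
  simp only [norm_mul] at h1
  have h2 := integral_mul_norm_le_Lp_mul_Lq (μ := μ) (f := a) (g := b) Real.HolderConjugate.two_two
    (by simpa using ha) (by simpa using hb)
  have ha0 : 0 ≤ ∫ x, ‖a x‖ ^ 2 ∂μ := integral_nonneg fun x => sq_nonneg _
  have hb0 : 0 ≤ ∫ x, ‖b x‖ ^ 2 ∂μ := integral_nonneg fun x => sq_nonneg _
  simp only [Real.rpow_ofNat, ← Real.sqrt_eq_rpow] at h2
  rw [← Real.sqrt_mul ha0] at h2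
  calc _ ≤ (Real.sqrt ((∫ x, ‖a x‖ ^ 2 ∂μ) * ∫ x, ‖b x‖ ^ 2 ∂μ)) ^ 2 := by
        gcongr
        exact h1.trans h2
    _ = _ := Real.sq_sqrt (mul_nonneg ha0 hb0)

theorem memLp_tensor {α β : Type*} [MeasurableSpace α] [MeasurableSpace β] {μ : Measure α} {ν : Measure β}
    [SFinite μ] [SFinite ν] {a : α → ℂ} {b : β → ℂ} (ha : MemLp a 2 μ) (hb : MemLp b 2 ν) :
    MemLp (fun z : α × β => a z.1 * b z.2) 2 (μ.prod ν) := by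
  have hm : AEStronglyMeasurable (fun z : α × β => a z.1 * b z.2) (μ.prod ν) := ha.1.comp_fst.mul hb.1.comp_snd
  rw [memLp_two_iff_integrable_sq_norm hm]
  have := ((memLp_two_iff_integrable_sq_norm ha.1).1 ha).mul_prod ((memLp_two_iff_integrable_sq_norm hb.1).1 hb)
  simpa [mul_pow] using this

/-- Cauchy-Schwarz on each slice, followed by integration in y. -/
theorem memL2_pair {U : Pt d × Pt d → ℂ} (hU : MemL2two U) {a : Pt d → ℂ}
    (ha : MemLp a 2 (volume.restrict (cell d))) : MemL2 fun y => ∫ x in cell d, a x * U (x, y) := by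
  have h2 := hU.memLp_prod
  have hm : AEStronglyMeasurable (fun z : Pt d × Pt d => a z.1 * U z) ((volume.restrict (cell d)).prod volume) :=
    ha.1.comp_fst.mul h2.1
  have hm' : AEStronglyMeasurable (fun y => ∫ x in cell d, a x * U (x, y)) volume :=
    hm.prod_swap.integral_prod_right'
  unfold MemL2
  rw [memLp_two_iff_integrable_sq_norm hm']
  have h3 := ((memLp_two_iff_integrable_sq_norm h2.1).1 h2).integral_prod_right.const_mul (∫ x in cell d, ‖a x‖ ^ 2)
  refine h3.mono' (hm'.norm.pow 2) ?_
  filter_upwards [hU.slice] with y hy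
  rw [Real.norm_of_nonneg (sq_nonneg _)]
  exact norm_integral_mul_sq_le ha hy.2

theorem memLp_test {φ : Pt d → ℝ} (hφ : Continuous φ) (hc : HasCompactSupport φ) :
    MemLp (fun x => (φ x : ℂ)) 2 (volume : Measure (Pt d)) :=
  (Complex.continuous_ofReal.comp hφ).memLp_of_hasCompactSupport (hc.comp_left (g := fun r : ℝ => (r : ℂ)) (by simp))

theorem integrable_tensor_mul {U : Pt d × Pt d → ℂ} (hU : MemL2two U) {a b : Pt d → ℂ}
    (ha : MemLp a 2 (volume.restrict (cell d))) (hb : MemLp b 2 volume) :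
    Integrable (fun z => a z.1 * b z.2 * U z) ((volume.restrict (cell d)).prod volume) :=
  (memLp_tensor ha hb).integrable_mul hU.memLp_prod

theorem integral_pair_swap {U : Pt d × Pt d → ℂ} (hU : MemL2two U) {a b : Pt d → ℂ}
    (ha : MemLp a 2 (volume.restrict (cell d))) (hb : MemLp b 2 volume) :
    ∫ y, b y * ∫ x in cell d, a x * U (x, y) = ∫ x in cell d, a x * ∫ y, b y * U (x, y) := by
  simp only [← integral_const_mul]
  rw [← integral_integral_swap]
  · congr 1; funext x; congr 1; funext y; ring
  · refine (integrable_tensor_mul hU ha hb).congr (Filter.Eventually.of_forall fun z => ?_)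
    simp only [Function.uncurry]; ring

section Tests

theorem test_tensor {φ ψ : Pt d → ℝ} (hφ : ContDiff ℝ ∞ φ) (hψ : ContDiff ℝ ∞ ψ) (cφ : HasCompactSupport φ)
    (cψ : HasCompactSupport ψ) :
    ContDiff ℝ ∞ (fun z : Pt d × Pt d => φ z.1 * ψ z.2) ∧ HasCompactSupport (fun z : Pt d × Pt d => φ z.1 * ψ z.2) := by
  refine ⟨(hφ.comp contDiff_fst).mul (hψ.comp contDiff_snd), ?_⟩
  refine HasCompactSupport.intro (cφ.isCompact.prod cψ.isCompact) fun z hz => ?_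
  by_contra h
  exact hz ⟨subset_tsupport _ fun h0 => h (by simp [h0]), subset_tsupport _ fun h0 => h (by simp [h0])⟩

theorem fderiv_tensor {φ ψ : Pt d → ℝ} (hφ : ContDiff ℝ ∞ φ) (hψ : ContDiff ℝ ∞ ψ) (z v : Pt d × Pt d) :
    fderiv ℝ (fun z : Pt d × Pt d => φ z.1 * ψ z.2) z v
      = fderiv ℝ φ z.1 v.1 * ψ z.2 + φ z.1 * fderiv ℝ ψ z.2 v.2 := by
  have h1 : HasFDerivAt (fun z : Pt d × Pt d => φ z.1) ((fderiv ℝ φ z.1).comp (ContinuousLinearMap.fst ℝ _ _)) z :=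
    ((hφ.differentiable (by simp)) z.1).hasFDerivAt.comp z hasFDerivAt_fst
  have h2 : HasFDerivAt (fun z : Pt d × Pt d => ψ z.2) ((fderiv ℝ ψ z.2).comp (ContinuousLinearMap.snd ℝ _ _)) z :=
    ((hψ.differentiable (by simp)) z.2).hasFDerivAt.comp z hasFDerivAt_snd
  rw [(h1.fun_mul h2).fderiv]
  simp
  ring

theorem test_slice_left {Φ : Pt d × Pt d → ℝ} (hΦ : ContDiff ℝ ∞ Φ) (hc : HasCompactSupport Φ) (y : Pt d) :
    ContDiff ℝ ∞ (fun x => Φ (x, y)) ∧ HasCompactSupport (fun x => Φ (x, y)) ∧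
      ∀ x v, fderiv ℝ (fun x => Φ (x, y)) x v = fderiv ℝ Φ (x, y) (v, 0) := by
  refine ⟨hΦ.comp (contDiff_id.prodMk contDiff_const), ?_, fun x v => ?_⟩
  · refine HasCompactSupport.intro (hc.isCompact.image continuous_fst) fun x hx => ?_
    by_contra h
    exact hx ⟨(x, y), subset_tsupport _ h, rfl⟩
  · have h1 : HasFDerivAt (fun x : Pt d => (x, y)) (ContinuousLinearMap.inl ℝ _ _) x := hasFDerivAt_prodMk_left x y
    have := (((hΦ.differentiable (by simp)) (x, y)).hasFDerivAt.comp x h1).fderiv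
    change fderiv ℝ (Φ ∘ fun x => (x, y)) x v = _
    rw [this]; simp

theorem test_slice_right {Φ : Pt d × Pt d → ℝ} (hΦ : ContDiff ℝ ∞ Φ) (hc : HasCompactSupport Φ) (x : Pt d) :
    ContDiff ℝ ∞ (fun y => Φ (x, y)) ∧ HasCompactSupport (fun y => Φ (x, y)) ∧
      ∀ y v, fderiv ℝ (fun y => Φ (x, y)) y v = fderiv ℝ Φ (x, y) (0, v) := by
  refine ⟨hΦ.comp (contDiff_const.prodMk contDiff_id), ?_, fun y v => ?_⟩
  · refine HasCompactSupport.intro (hc.isCompact.image continuous_snd) fun y hy => ?_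
    by_contra h
    exact hy ⟨(x, y), subset_tsupport _ h, rfl⟩
  · have h1 : HasFDerivAt (fun y : Pt d => (x, y)) (ContinuousLinearMap.inr ℝ _ _) y := hasFDerivAt_prodMk_right x y
    have := (((hΦ.differentiable (by simp)) (x, y)).hasFDerivAt.comp y h1).fderiv
    change fderiv ℝ (Φ ∘ fun y => (x, y)) y v = _
    rw [this]; simp

end Tests

theorem locallyIntegrable_tensor {a b : Pt d → ℂ} (ha : LocallyIntegrable a volume) (hb : LocallyIntegrable b volume) :
    LocallyIntegrable (fun z : Pt d × Pt d => a z.1 * b z.2) volume := by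
  intro z
  obtain ⟨s, hs, h1⟩ := ha z.1
  obtain ⟨t, ht, h2⟩ := hb z.2
  refine ⟨s ×ˢ t, prod_mem_nhds hs ht, ?_⟩
  rw [IntegrableOn, Measure.volume_eq_prod, ← Measure.prod_restrict]
  exact Integrable.mul_prod h1 h2

theorem HasWeakDeriv.tensor_left {a a' b : Pt d → ℂ} {j : Fin d} (h : HasWeakDeriv (ev j) a a')
    (hb : LocallyIntegrable b volume) :
    HasWeakDeriv (ex j) (fun z : Pt d × Pt d => a z.1 * b z.2) (fun z => a' z.1 * b z.2) := by
  refine ⟨locallyIntegrable_tensor h.1 hb, locallyIntegrable_tensor h.2.1 hb, fun Φ hΦ hc => ?_⟩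
  have i1 := integrable_test_mul (continuous_fderiv_apply_test hΦ (ex j)).continuous
    (hasCompactSupport_fderiv_apply_test hc (ex j)) (locallyIntegrable_tensor h.1 hb)
  have i2 := integrable_test_mul hΦ.continuous hc (locallyIntegrable_tensor h.2.1 hb)
  rw [Measure.volume_eq_prod] at i1 i2 ⊢
  rw [integral_prod_symm _ i1, integral_prod_symm _ i2, ← integral_neg]
  congr 1; funext y
  obtain ⟨t1, t2, t3⟩ := test_slice_left hΦ hc y
  have := h.2.2 _ t1 t2
  simp only [t3] at this
  simp only [← mul_assoc, integral_mul_const]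
  rw [← neg_mul, ← this]
  rfl

theorem HasWeakDeriv.tensor_right {a b b' : Pt d → ℂ} {j : Fin d} (ha : LocallyIntegrable a volume)
    (h : HasWeakDeriv (ev j) b b') :
    HasWeakDeriv (ey j) (fun z : Pt d × Pt d => a z.1 * b z.2) (fun z => a z.1 * b' z.2) := by
  refine ⟨locallyIntegrable_tensor ha h.1, locallyIntegrable_tensor ha h.2.1, fun Φ hΦ hc => ?_⟩
  have i1 := integrable_test_mul (continuous_fderiv_apply_test hΦ (ey j)).continuous
    (hasCompactSupport_fderiv_apply_test hc (ey j)) (locallyIntegrable_tensor ha h.1)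
  have i2 := integrable_test_mul hΦ.continuous hc (locallyIntegrable_tensor ha h.2.1)
  rw [Measure.volume_eq_prod] at i1 i2 ⊢
  rw [integral_prod _ i1, integral_prod _ i2, ← integral_neg]
  congr 1; funext x
  obtain ⟨t1, t2, t3⟩ := test_slice_right hΦ hc x
  have := h.2.2 _ t1 t2
  simp only [t3] at this
  simp only [mul_left_comm _ (a x), integral_const_mul]
  rw [← mul_neg, ← this]
  rfl

theorem memL2two_tensor {a b : Pt d → ℂ} (ha : MemL2per a) (hb : MemL2 b) :
    MemL2two (fun z : Pt d × Pt d => a z.1 * b z.2) := by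
  constructor
  · intro j
    have : ∀ᵐ z : Pt d × Pt d, a (z.1 + ev j) = a z.1 :=
      (Measure.quasiMeasurePreserving_fst (μ := (volume : Measure (Pt d))) (ν := (volume : Measure (Pt d)))).ae (ha.1 j)
    filter_upwards [this] with z hz
    simp [ex, hz]
  · rw [volume_restrict_cell_prod]
    exact memLp_tensor ha.2 hb

theorem integrableOn_test_snd {U : Pt d × Pt d → ℂ} (hU : LocallyIntegrable U volume) {ψ : Pt d → ℝ}
    (hψ : Continuous ψ) (hc : HasCompactSupport ψ) {K : Set (Pt d)} (hK : IsCompact K) :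
    Integrable (fun z : Pt d × Pt d => (ψ z.2 : ℂ) * U z) ((volume.restrict K).prod volume) := by
  have h1 : IntegrableOn U (K ×ˢ tsupport ψ) volume := hU.integrableOn_isCompact (hK.prod hc.isCompact)
  obtain ⟨B, hB⟩ := hψ.bounded_above_of_compact_support hc
  have h2 : IntegrableOn (fun z : Pt d × Pt d => (ψ z.2 : ℂ) * U z) (K ×ˢ tsupport ψ) volume := by
    refine Integrable.bdd_mul (c := B) h1 ?_ ?_
    · exact (Complex.continuous_ofReal.comp (hψ.comp continuous_snd)).aestronglyMeasurable
    · exact Filter.Eventually.of_forall fun z => by simpa using hB z.2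
  have h3 : IntegrableOn (fun z : Pt d × Pt d => (ψ z.2 : ℂ) * U z) (K ×ˢ univ) volume := by
    refine h2.of_forall_sdiff_eq_zero (hK.measurableSet.prod MeasurableSet.univ) ?_
    rintro ⟨x, y⟩ ⟨⟨hx, _⟩, hn⟩
    have : y ∉ tsupport ψ := fun h => hn ⟨hx, h⟩
    simp [image_eq_zero_of_notMem_tsupport this]
  rw [IntegrableOn, Measure.volume_eq_prod, ← Measure.prod_restrict, Measure.restrict_univ] at h3
  exact h3

theorem locallyIntegrable_integral_test {U : Pt d × Pt d → ℂ} (hU : LocallyIntegrable U volume) {ψ : Pt d → ℝ}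
    (hψ : Continuous ψ) (hc : HasCompactSupport ψ) :
    LocallyIntegrable (fun x => ∫ y, (ψ y : ℂ) * U (x, y)) volume := fun x =>
  ⟨Metric.closedBall x 1, Metric.closedBall_mem_nhds x one_pos,
    (integrableOn_test_snd hU hψ hc (isCompact_closedBall x 1)).integral_prod_left⟩

/-- Testing in y with a fixed ψ removes the slow variable, since products φ(x) ψ(y) are admissible
test functions on the product. -/
theorem HasWeakDeriv.integral_test {U U' : Pt d × Pt d → ℂ} {j : Fin d} (h : HasWeakDeriv (ex j) U U')
    {ψ : Pt d → ℝ} (hψ : ContDiff ℝ ∞ ψ) (cψ : HasCompactSupport ψ) :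
    HasWeakDeriv (ev j) (fun x => ∫ y, (ψ y : ℂ) * U (x, y)) (fun x => ∫ y, (ψ y : ℂ) * U' (x, y)) := by
  refine ⟨locallyIntegrable_integral_test h.1 hψ.continuous cψ, locallyIntegrable_integral_test h.2.1 hψ.continuous cψ,
    fun φ hφ cφ => ?_⟩
  obtain ⟨t1, t2⟩ := test_tensor hφ hψ cφ cψ
  have e := h.2.2 _ t1 t2
  have i1 := integrable_test_mul (continuous_fderiv_apply_test t1 (ex j)).continuous
    (hasCompactSupport_fderiv_apply_test t2 (ex j)) h.1
  have i2 := integrable_test_mul t1.continuous t2 h.2.1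
  rw [Measure.volume_eq_prod] at e i1 i2
  rw [integral_prod _ i1, integral_prod _ i2] at e
  simp only [fderiv_tensor hφ hψ, ex, map_zero, mul_zero, add_zero, Complex.ofReal_mul, mul_assoc,
    integral_const_mul] at e
  exact e

/-- The same products, now with the derivative falling on ψ. The identity in x holds after testing
with every φ, hence almost everywhere; the exceptional set may depend on ψ. -/
theorem HasWeakDeriv.ae_integral_test {U U' : Pt d × Pt d → ℂ} {j : Fin d} (h : HasWeakDeriv (ey j) U U')
    {ψ : Pt d → ℝ} (hψ : ContDiff ℝ ∞ ψ) (cψ : HasCompactSupport ψ) :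
    ∀ᵐ x, ∫ y, ((fderiv ℝ ψ y (ev j) : ℝ) : ℂ) * U (x, y) = - ∫ y, (ψ y : ℂ) * U' (x, y) := by
  refine ae_eq_of_integral_test_eq (locallyIntegrable_integral_test h.1 (continuous_fderiv_apply_test hψ (ev j)).continuous
    (hasCompactSupport_fderiv_apply_test cψ (ev j))) (locallyIntegrable_integral_test h.2.1 hψ.continuous cψ).neg
    fun φ hφ cφ => ?_
  obtain ⟨t1, t2⟩ := test_tensor hφ hψ cφ cψ
  have e := h.2.2 _ t1 t2
  have i1 := integrable_test_mul (continuous_fderiv_apply_test t1 (ey j)).continuous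
    (hasCompactSupport_fderiv_apply_test t2 (ey j)) h.1
  have i2 := integrable_test_mul t1.continuous t2 h.2.1
  rw [Measure.volume_eq_prod] at e i1 i2
  rw [integral_prod _ i1, integral_prod _ i2] at e
  simp only [fderiv_tensor hφ hψ, ey, map_zero, zero_mul, zero_add, Complex.ofReal_mul, mul_assoc,
    integral_const_mul] at e
  rw [e, ← integral_neg]
  simp

/-- Weak derivatives in the slow variable of `y ↦ ∫_Ω a(x) U(x, y) dx`. -/
theorem HasWeakDeriv.pair {U U' : Pt d × Pt d → ℂ} {j : Fin d} (h : HasWeakDeriv (ey j) U U') (hU : MemL2two U)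
    (hU' : MemL2two U') {a : Pt d → ℂ} (ha : MemLp a 2 (volume.restrict (cell d))) :
    HasWeakDeriv (ev j) (fun y => ∫ x in cell d, a x * U (x, y)) (fun y => ∫ x in cell d, a x * U' (x, y)) := by
  refine ⟨(memL2_pair hU ha).locallyIntegrable, (memL2_pair hU' ha).locallyIntegrable, fun ψ hψ cψ => ?_⟩
  rw [integral_pair_swap hU ha (memLp_test (continuous_fderiv_apply_test hψ (ev j)).continuous
    (hasCompactSupport_fderiv_apply_test cψ (ev j))), integral_pair_swap hU' ha (memLp_test hψ.continuous cψ), ← integral_neg]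
  refine integral_congr_ae (ae_restrict_of_ae ?_)
  filter_upwards [h.ae_integral_test hψ cψ] with x hx
  rw [hx, mul_neg]

/-- Weak derivatives in the fast variable pass to the slices. -/
theorem HasWeakDeriv.slice {U U' : Pt d × Pt d → ℂ} {j : Fin d} (h : HasWeakDeriv (ex j) U U') (hU : MemL2two U)
    (hU' : MemL2two U') : ∀ᵐ y, HasWeakDeriv (ev j) (fun x => U (x, y)) (fun x => U' (x, y)) := by
  have per : ∀ {W : Pt d × Pt d → ℂ}, MemL2two W → ∀ ψ : Pt d → ℝ, AEPer fun x => ∫ y, (ψ y : ℂ) * W (x, y) := by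
    intro W hW ψ i
    have := Measure.ae_ae_of_ae_prod (μ := (volume : Measure (Pt d))) (ν := (volume : Measure (Pt d))) (hW.1 i)
    filter_upwards [this] with x hx
    refine integral_congr_ae ?_
    filter_upwards [hx] with y hy
    simp only [ex, Prod.mk_add_mk, add_zero] at hy
    rw [hy]
  -- The null set of values y must not depend on test functions in x. On the level of Fourier
  -- coefficients in x only countably many identities remain, and each of them is verified by
  -- testing in y.
  have key : ∀ᵐ y, ∀ n, fc n (fun x => U' (x, y)) = 2 * Real.pi * Complex.I * n j * fc n (fun x => U (x, y)) := by
    rw [ae_all_iff]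
    intro n
    have ha := (memL2per_em (-n)).2
    refine ae_eq_of_integral_test_eq (memL2_pair hU' ha).locallyIntegrable
      ((memL2_pair hU ha).locallyIntegrable.smul (2 * Real.pi * Complex.I * n j)) fun ψ hψ cψ => ?_
    have e := fc_deriv (h.integral_test hψ cψ) (per hU ψ) (per hU' ψ) n
    unfold fc at e ⊢
    rw [← integral_pair_swap hU ha (memLp_test hψ.continuous cψ),
      ← integral_pair_swap hU' ha (memLp_test hψ.continuous cψ)] at e
    rw [e, ← integral_const_mul]
    congr 1; funext y

    ring
  filter_upwards [key, hU.slice, hU'.slice] with y h1 h2 h3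
  exact hasWeakDeriv_of_fc h2 h3 h1

end MultiScale

/-! ### Elliptic regularity on the torus and the inverse of L_* -/

namespace MultiScale

variable {d : ℕ}

theorem MemSob.isLap_of {X : Type*} [NormedAddCommGroup X] [NormedSpace ℝ X] [MeasureSpace X] [BorelSpace X]
    [FiniteDimensional ℝ X] {P : (X → ℂ) → Prop} {D : Fin d → X} {u : X → ℂ} (h : MemSob P D 2 u) :
    IsLap D u (lap D u) := MemSob.isLap (k := 0) h

theorem MemH2per.memL2per {u : Pt d → ℂ} (h : MemH2per u) : MemL2per u := h.1
theorem MemH2per.wd {u : Pt d → ℂ} (h : MemH2per u) (j : Fin d) : MemL2per (wd (ev j) u) := (h.2 j).2.1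
theorem MemH2per.hasWeakDeriv {u : Pt d → ℂ} (h : MemH2per u) (j : Fin d) :
    HasWeakDeriv (ev j) u (MultiScale.wd (ev j) u) := (h.2 j).1.hasWeakDeriv
theorem MemH2per.wd_wd {u : Pt d → ℂ} (h : MemH2per u) (j l : Fin d) :
    MemL2per (MultiScale.wd (ev l) (MultiScale.wd (ev j) u)) := ((h.2 j).2.2 l).2
theorem MemH2per.hasWeakDeriv_wd {u : Pt d → ℂ} (h : MemH2per u) (j l : Fin d) :
    HasWeakDeriv (ev l) (MultiScale.wd (ev j) u) (MultiScale.wd (ev l) (MultiScale.wd (ev j) u)) := ((h.2 j).2.2 l).1.hasWeakDeriv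
theorem MemH2per.lap {u : Pt d → ℂ} (h : MemH2per u) : MemL2per (lap ev u) :=
  isFunSpace_memL2per.sum _ fun j _ => h.wd_wd j j

theorem isFunSpace_memH2per : IsFunSpace (MemH2per (d := d)) := isFunSpace_memSob isFunSpace_memL2per _ _

theorem fc_sum {ι : Type*} (s : Finset ι) {f : ι → Pt d → ℂ} (hf : ∀ i ∈ s, MemL2per (f i)) (n) :
    fc n (fun x => ∑ i ∈ s, f i x) = ∑ i ∈ s, fc n (f i) := by
  classical
  induction s using Finset.induction_on with
  | empty => simp [fc]
  | insert a s ha ih =>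
    simp only [Finset.sum_insert ha]
    rw [fc_add (hf a (Finset.mem_insert_self _ _)).2
      (isFunSpace_memL2per.sum s fun i hi => hf i (Finset.mem_insert_of_mem hi)).2,
      ih fun i hi => hf i (Finset.mem_insert_of_mem hi)]

/-- `|2πn|²` -/
def nsq (n : Fin d → ℤ) : ℝ := 4 * Real.pi ^ 2 * ∑ j, (n j : ℝ) ^ 2

theorem nsq_nonneg (n : Fin d → ℤ) : 0 ≤ nsq n := by unfold nsq; positivity

theorem mul_le_nsq (n : Fin d → ℤ) (j l : Fin d) : |2 * Real.pi * (n j : ℝ)| * |2 * Real.pi * (n l : ℝ)| ≤ nsq n := by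
  have h : ∀ j, (n j : ℝ) ^ 2 ≤ ∑ i, (n i : ℝ) ^ 2 := fun j =>
    Finset.single_le_sum (f := fun i => (n i : ℝ) ^ 2) (fun i _ => sq_nonneg _) (Finset.mem_univ j)
  have h1 : |(n j : ℝ)| * |(n l : ℝ)| ≤ ∑ i, (n i : ℝ) ^ 2 := by
    have a := h j; have b := h l
    rw [← sq_abs] at a b
    nlinarith [sq_nonneg (|(n j : ℝ)| - |(n l : ℝ)|)]
  rw [abs_mul, abs_mul _ (n l : ℝ), abs_of_pos (by positivity : 0 < 2 * Real.pi)]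
  unfold nsq
  nlinarith [Real.pi_pos, sq_nonneg Real.pi, mul_le_mul_of_nonneg_left h1 (by positivity : 0 ≤ 4 * Real.pi ^ 2)]

theorem fc_lap {u : Pt d → ℂ} (h : MemH2per u) (n) : fc n (lap ev u) = - (nsq n : ℂ) * fc n u := by
  have : fc n (lap ev u) = ∑ j, fc n (MultiScale.wd (ev j) (MultiScale.wd (ev j) u)) := fc_sum _ (fun j _ => h.wd_wd j j) n
  rw [this]
  have e : ∀ j, fc n (MultiScale.wd (ev j) (MultiScale.wd (ev j) u))
      = -(4 * Real.pi ^ 2 * (n j : ℂ) ^ 2) * fc n u := fun j => by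
    rw [fc_deriv (h.hasWeakDeriv_wd j j) (h.wd j).1 (h.wd_wd j j).1, fc_deriv (h.hasWeakDeriv j) h.1.1 (h.wd j).1]
    linear_combination (4 * Real.pi ^ 2 * (n j : ℂ) ^ 2) * fc n u * Complex.I_sq
  simp only [e, nsq]
  push_cast
  rw [← Finset.sum_mul, Finset.mul_sum, Finset.sum_neg_distrib]

/-- Elliptic regularity on the torus. -/
theorem memH2per_of_fc {u h : Pt d → ℂ} (hu : MemL2per u) (hh : MemL2per h)
    (e : ∀ n, (nsq n : ℂ) * fc n u = fc n h) : MemH2per u ∧ ∀ᵐ x, lap ev u x = - h x := by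
  have su := (hasSum_norm_fc_sq hu.2).summable
  have sh := (hasSum_norm_fc_sq hh.2).summable
  have ne : ∀ n, nsq n * ‖fc n u‖ = ‖fc n h‖ := fun n => by
    rw [← e n, norm_mul, Complex.norm_real, Real.norm_of_nonneg (nsq_nonneg n)]
  have nj : ∀ (n : Fin d → ℤ) (j : Fin d), ‖2 * Real.pi * Complex.I * (n j : ℂ)‖ = |2 * Real.pi * (n j : ℝ)| := fun n j => by
    have : (2 * Real.pi * Complex.I * (n j : ℂ)) = ((2 * Real.pi * (n j : ℝ) : ℝ) : ℂ) * Complex.I := by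
      push_cast; ring
    rw [this, norm_mul, Complex.norm_I, mul_one, Complex.norm_real, Real.norm_eq_abs]
  -- First derivatives are controlled by interpolation: |2πn_j|² |û|² ≤ |ĥ| |û|. For second
  -- derivatives the factors |2πn_l| |2πn_j| are bounded by |2πn|², so the coefficients are
  -- dominated by those of `h`.
  have s1 : ∀ j : Fin d, Summable fun n => ‖2 * Real.pi * Complex.I * (n j : ℂ) * fc n u‖ ^ 2 := fun j => by
    refine Summable.of_nonneg_of_le (fun n => sq_nonneg _) (fun n => ?_) (su.add sh)
    rw [norm_mul, nj, mul_pow, sq (|_|)]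
    have a := mul_le_nsq n j j
    have b := ne n
    have c := norm_nonneg (fc n u)
    calc _ ≤ nsq n * ‖fc n u‖ ^ 2 := by gcongr
      _ = ‖fc n h‖ * ‖fc n u‖ := by rw [← b]; ring
      _ ≤ _ := by nlinarith [sq_nonneg (‖fc n h‖ - ‖fc n u‖), sq_nonneg (‖fc n h‖), sq_nonneg (‖fc n u‖)]
  have s2 : ∀ j l : Fin d, Summable fun n => ‖2 * Real.pi * Complex.I * (n l : ℂ) * (2 * Real.pi * Complex.I * (n j : ℂ) * fc n u)‖ ^ 2 := fun j l => by
    refine Summable.of_nonneg_of_le (fun n => sq_nonneg _) (fun n => ?_) sh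
    rw [norm_mul, norm_mul (_ * _) (fc n u), nj, nj, ← ne n, ← mul_assoc]
    have a := mul_le_nsq n l j
    gcongr
  choose u1 m1 e1 using fun j => exists_fc_eq (s1 j)
  choose u2 m2 e2 using fun j l => exists_fc_eq (s2 j l)
  have w1 : ∀ j, HasWeakDeriv (ev j) u (u1 j) := fun j => hasWeakDeriv_of_fc hu (m1 j) (e1 j)
  have w2 : ∀ j l, HasWeakDeriv (ev l) (u1 j) (u2 j l) := fun j l =>
    hasWeakDeriv_of_fc (m1 j) (m2 j l) fun n => by rw [e2, e1]
  have hm : MemH2per u := memSob_succ_of (isFunSpace_memSob isFunSpace_memL2per _ 1) hu w1 fun j =>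
    memSob_succ_of (isFunSpace_memSob isFunSpace_memL2per _ 0) (m1 j) (w2 j) fun l => m2 j l
  refine ⟨hm, ?_⟩
  refine ae_eq_of_fc_eq hm.lap (isFunSpace_memL2per.neg hh) fun n => ?_
  have := fc_smul (-1) h n
  simp only [neg_mul, one_mul] at this
  rw [fc_lap hm, this, ← e n, neg_mul]

theorem integrable_conj_mul {α : Type*} [MeasurableSpace α] {μ : Measure α} {u v : α → ℂ} (hu : MemLp u 2 μ)
    (hv : MemLp v 2 μ) : Integrable (fun x => conj (u x) * v x) μ := (MemLp.star hu).integrable_mul hv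

theorem integral_lap_symm {u v : Pt d → ℂ} (hu : MemH2per u) (hv : MemH2per v) :
    ∫ x in cell d, conj (u x) * lap ev v x = ∫ x in cell d, conj (lap ev u x) * v x := by
  have h1 := hasSum_fc hu.1.2 hv.lap.2
  have h2 := hasSum_fc hu.lap.2 hv.1.2
  have e : (fun n => conj (fc n u) * fc n (lap ev v)) = fun n => conj (fc n (lap ev u)) * fc n v := by
    funext n
    rw [fc_lap hu, fc_lap hv]
    simp only [map_mul, map_neg, Complex.conj_ofReal]
    ring
  rw [e] at h1
  exact h1.unique h2

theorem memLp_bounded_mul {α : Type*} [MeasurableSpace α] {μ : Measure α} {V : α → ℝ} (hV : MemLp V ∞ μ) {u : α → ℂ}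
    (hu : MemLp u 2 μ) : MemLp (fun x => (V x : ℂ) * u x) 2 μ := by
  have h : MemLp (fun x => (V x : ℂ)) ∞ μ := hV.ofReal
  exact MemLp.mul (p := ∞) (q := 2) (r := 2) hu h

theorem _root_.HasSum.congr_fun' {ι : Type*} {f g : ι → ℂ} {a : ℂ} (h : HasSum g a) (e : ∀ i, f i = g i) :
    HasSum f a := (funext e : f = g) ▸ h

/-- An element of L²(Ω) determines nothing outside the cell; its periodic extension is rebuilt from
its Fourier coefficients. It links the completeness of the Bloch functions, which is stated for
periodic functions, to Hilbert bases of `Lp`. -/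
theorem memL2per_of_memLp {u : Pt d → ℂ} (hu : MemLp u 2 (volume.restrict (cell d))) :
    ∃ v, MemL2per v ∧ ∀ᵐ x ∂(volume.restrict (cell d)), v x = u x := by
  obtain ⟨v, hv, e⟩ := exists_fc_eq (hasSum_norm_fc_sq hu).summable
  refine ⟨v, hv, ?_⟩
  have h := hasSum_norm_fc_sq (hv.2.sub hu)
  have e2 : (fun n => ‖fc n (v - u)‖ ^ 2) = fun _ => 0 := by
    funext n
    have := fc_sub hv.2 hu n
    change fc n (v - u) = _ at this
    rw [this, e]; simp
  rw [e2] at h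
  filter_upwards [ae_eq_zero_of_integral_norm_sq (hv.2.sub hu) (h.unique hasSum_zero)] with x hx
  exact sub_eq_zero.1 hx

theorem zero_mem_BZ : (0 : Pt d) ∈ BZ d := fun j => by simp

namespace Setting

variable {S : Setting d} {σ : ℝ}

theorem Regularity.memL2per_mul (hreg : S.Regularity σ) {u : Pt d → ℂ} (hu : MemL2per u) :
    MemL2per fun x => (S.V x : ℂ) * u x := by
  refine ⟨fun j => ?_, memLp_bounded_mul (hreg.V_bounded.restrict _) hu.2⟩
  filter_upwards [hreg.V_periodic j, hu.1 j] with x a b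
  rw [a, b]

theorem memL2per_Lstar (hreg : S.Regularity σ) {u : Pt d → ℂ} (hu : MemH2per u) : MemL2per (S.Lstar u) :=
  isFunSpace_memL2per.sub (isFunSpace_memL2per.add (isFunSpace_memL2per.neg hu.lap) (hreg.memL2per_mul hu.1))
    (isFunSpace_memL2per.smul _ hu.1)

theorem integral_Lstar_symm (hreg : S.Regularity σ) {u v : Pt d → ℂ} (hu : MemH2per u) (hv : MemH2per v) :
    ∫ x in cell d, conj (u x) * S.Lstar v x = ∫ x in cell d, conj (S.Lstar u x) * v x := by
  have i1 := (integrable_conj_mul hu.1.2 hv.lap.2).neg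
  have i2 := integrable_conj_mul hu.1.2 (hreg.memL2per_mul hv.1).2
  have i3 := integrable_conj_mul hu.1.2 (hv.1.2.const_mul (S.Es : ℂ))
  have j1 := (integrable_conj_mul hu.lap.2 hv.1.2).neg
  have e1 : ∀ x, conj (u x) * S.Lstar v x = -(conj (u x) * lap ev v x)
      + (conj (u x) * ((S.V x : ℂ) * v x) - conj (u x) * ((S.Es : ℂ) * v x)) := fun x => by
    simp only [Lstar, schr]; ring
  have e2 : ∀ x, conj (S.Lstar u x) * v x = -(conj (lap ev u x) * v x)
      + (conj (u x) * ((S.V x : ℂ) * v x) - conj (u x) * ((S.Es : ℂ) * v x)) := fun x => by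
    simp only [Lstar, schr, map_sub, map_add, map_neg, map_mul, Complex.conj_ofReal]; ring
  simp only [e1, e2]
  have i23 := i2.sub i3
  have f1 := integral_add i1 i23
  have f2 := integral_add j1 i23
  simp only [Pi.neg_apply, Pi.sub_apply] at f1 f2
  rw [f1, f2, integral_neg, integral_neg, integral_lap_symm hu hv]

section Edge

variable (hedge : S.BandEdge)
include hedge

theorem BandEdge.memH2per_p (b : ℕ) : MemH2per (S.p b 0) := hedge.bloch.memH2 b 0 zero_mem_BZ

theorem BandEdge.memH2per_w : MemH2per S.wC :=
  isFunSpace_memH2per.congr (hedge.memH2per_p S.bs) hedge.w_eq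

theorem BandEdge.Lstar_p (b : ℕ) : ∀ᵐ x, S.Lstar (S.p b 0) x = ((S.E b 0 - S.Es : ℝ) : ℂ) * S.p b 0 x := by
  filter_upwards [hedge.bloch.eigen b 0 zero_mem_BZ] with x hx
  have e : ∀ (j : Fin d) (u : Pt d → ℂ), blochD 0 j u = MultiScale.wd (ev j) u := fun j u => by
    funext x; simp [blochD]
  simp only [e] at hx
  simp only [Lstar, schr, MultiScale.lap]
  rw [hx]; push_cast; ring

theorem BandEdge.integral_p_Lstar (hreg : S.Regularity σ) (b : ℕ) {u : Pt d → ℂ} (hu : MemH2per u) :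
    ∫ x in cell d, conj (S.p b 0 x) * S.Lstar u x = ((S.E b 0 - S.Es : ℝ) : ℂ) * ∫ x in cell d, conj (S.p b 0 x) * u x := by
  rw [integral_Lstar_symm hreg (hedge.memH2per_p b) hu, ← integral_const_mul]
  refine integral_congr_ae (ae_restrict_of_ae ?_)
  filter_upwards [hedge.Lstar_p b] with x hx
  rw [hx, map_mul, Complex.conj_ofReal, mul_assoc]

theorem BandEdge.integral_p_eq (u : Pt d → ℂ) :
    ∫ x in cell d, conj (S.p S.bs 0 x) * u x = ∫ x in cell d, S.wC x * u x := by
  refine integral_congr_ae (ae_restrict_of_ae ?_)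
  filter_upwards [hedge.w_eq] with x hx
  rw [hx]; simp [wC]

theorem BandEdge.integral_w_w : ∫ x in cell d, S.wC x * S.wC x = 1 := by
  have h := hedge.bloch.orthonormal 0 zero_mem_BZ S.bs S.bs
  rw [hedge.integral_p_eq] at h
  rw [if_pos rfl] at h
  rw [← h]
  refine integral_congr_ae (ae_restrict_of_ae ?_)
  filter_upwards [hedge.w_eq] with x hx
  rw [hx]

theorem BandEdge.Lstar_w : ∀ᵐ x, S.Lstar S.wC x = 0 := by
  have h := hedge.Lstar_p S.bs
  have h2 := IsLap.lap_ae_eq ((hedge.memH2per_p S.bs).isLap_of.congr hedge.w_eq (Filter.Eventually.of_forall fun _ => rfl))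
  filter_upwards [h, h2, hedge.w_eq] with x a b c
  simp only [Lstar, schr] at a ⊢
  rw [b, ← c, a]
  simp [Es]

theorem BandEdge.integral_w_Lstar (hreg : S.Regularity σ) {u : Pt d → ℂ} (hu : MemH2per u) :
    ∫ x in cell d, S.wC x * S.Lstar u x = 0 := by
  rw [← hedge.integral_p_eq, hedge.integral_p_Lstar hreg S.bs hu]
  simp [Es]

/-- Solutions of `L_* u = 0` which are orthogonal to `w` vanish. -/
theorem BandEdge.eq_zero {u : Pt d → ℂ} (hu : MemH2per u) (h : ∀ᵐ x, S.Lstar u x = 0)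
    (h0 : ∫ x in cell d, S.wC x * u x = 0) : ∀ᵐ x, u x = 0 := by
  obtain ⟨c, hc⟩ := hedge.simple u hu h
  have : ∫ x in cell d, S.wC x * u x = c := by
    rw [← mul_one c, ← hedge.integral_w_w, ← integral_const_mul]
    refine integral_congr_ae (ae_restrict_of_ae ?_)
    filter_upwards [hc] with x hx
    rw [hx]; ring
  rw [h0] at this
  filter_upwards [hc] with x hx
  rw [hx, ← this, zero_mul]

/-- By simplicity of E_*, another eigenfunction with this eigenvalue would be a multiple of w. Being
orthogonal to w it would vanish, against its normalization. -/
theorem BandEdge.E_ne {b : ℕ} (hb : b ≠ S.bs) : S.E b 0 ≠ S.Es := by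
  intro h
  have h1 : ∫ x in cell d, S.wC x * S.p b 0 x = 0 := by
    rw [← hedge.integral_p_eq, hedge.bloch.orthonormal 0 zero_mem_BZ, if_neg hb.symm]
  have h2 := hedge.eq_zero (hedge.memH2per_p b) (by
    filter_upwards [hedge.Lstar_p b] with x hx
    rw [hx, h]; simp) h1
  have h3 := hedge.bloch.orthonormal 0 zero_mem_BZ b b
  rw [if_pos rfl, integral_congr_ae (g := fun _ => 0) (ae_restrict_of_ae (by
    filter_upwards [h2] with x hx; rw [hx]; simp))] at h3
  simp at h3

/-- The eigenvalues are ordered, so from index `S.bs + 1` on the distance to E_* is at least the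
distance of E_{b_*+1}. Only finitely many indices remain, and for these the distance is positive by
`E_ne`. -/
theorem BandEdge.exists_gap : ∃ δ > 0, ∀ b ≠ S.bs, δ ≤ |S.E b 0 - S.Es| := by
  have hmono := hedge.bloch.ordered 0 zero_mem_BZ
  have hfin : ∃ δ > 0, ∀ b < S.bs + 2, b ≠ S.bs → δ ≤ |S.E b 0 - S.Es| := by
    generalize S.bs + 2 = n
    induction n with
    | zero => exact ⟨1, one_pos, by simp⟩
    | succ n ih =>
      obtain ⟨δ, h1, h2⟩ := ih
      by_cases hn : n = S.bs
      · refine ⟨δ, h1, fun b hb hne => h2 b (by omega) hne⟩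
      · refine ⟨min δ |S.E n 0 - S.Es|, lt_min h1 (abs_pos.2 (sub_ne_zero.2 (hedge.E_ne hn))), fun b hb hne => ?_⟩
        rcases Nat.lt_succ_iff_lt_or_eq.1 hb with h | rfl
        · exact (min_le_left _ _).trans (h2 b h hne)
        · exact min_le_right _ _
  obtain ⟨δ, h1, h2⟩ := hfin
  refine ⟨δ, h1, fun b hb => ?_⟩
  by_cases hlt : b < S.bs + 2
  · exact h2 b hlt hb
  · have a := h2 (S.bs + 1) (by omega) (by omega)
    have m1 : S.E S.bs 0 ≤ S.E (S.bs + 1) 0 := hmono (by omega)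
    have m2 : S.E (S.bs + 1) 0 ≤ S.E b 0 := hmono (by omega)
    have : S.Es = S.E S.bs 0 := rfl
    rw [abs_of_nonneg (by linarith)] at a
    rw [abs_of_nonneg (by linarith)]
    linarith

/-- The eigenfunctions at `k = 0` as elements of `L²(Ω)`. -/
def BandEdge.pLp (b : ℕ) : Lp ℂ 2 (volume.restrict (cell d)) := (hedge.memH2per_p b).1.2.toLp

omit hedge in
theorem inner_toLp {α : Type*} [MeasurableSpace α] {μ : Measure α} {u v : α → ℂ} (hu : MemLp u 2 μ)
    (hv : MemLp v 2 μ) : inner ℂ hu.toLp hv.toLp = ∫ x, conj (u x) * v x ∂μ := by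
  rw [L2.inner_def]
  refine integral_congr_ae ?_
  filter_upwards [hu.coeFn_toLp, hv.coeFn_toLp] with x a b
  rw [a, b, RCLike.inner_apply, mul_comm]

theorem BandEdge.exists_basis : ∃ B : HilbertBasis ℕ ℂ (Lp ℂ 2 (volume.restrict (cell d))), ⇑B = hedge.pLp := by
  have ho : Orthonormal ℂ hedge.pLp := by
    rw [orthonormal_iff_ite]
    intro b b'
    rw [BandEdge.pLp, BandEdge.pLp, inner_toLp, hedge.bloch.orthonormal 0 zero_mem_BZ]
  refine ⟨HilbertBasis.mkOfOrthogonalEqBot ho ?_, HilbertBasis.coe_mkOfOrthogonalEqBot _ _⟩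
  rw [Submodule.eq_bot_iff]
  intro f hf
  obtain ⟨u, hu, hue⟩ := memL2per_of_memLp (Lp.memLp f)
  have hz := hedge.bloch.complete 0 zero_mem_BZ u hu fun b => by
    have h1 := (Submodule.mem_orthogonal _ _).1 hf (hedge.pLp b) (Submodule.subset_span ⟨b, rfl⟩)
    rw [L2.inner_def] at h1
    rw [← h1]
    refine integral_congr_ae ?_
    filter_upwards [(hedge.memH2per_p b).1.2.coeFn_toLp, hue] with x a c
    rw [BandEdge.pLp, a, c, RCLike.inner_apply, mul_comm]
  refine (Lp.eq_zero_iff_ae_eq_zero).2 ?_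
  filter_upwards [hue, ae_restrict_of_ae hz] with x a b
  rw [← a, b]; rfl

theorem BandEdge.hasSum_p {u v : Pt d → ℂ} (hu : MemLp u 2 (volume.restrict (cell d)))
    (hv : MemLp v 2 (volume.restrict (cell d))) :
    HasSum (fun b => conj (∫ x in cell d, conj (S.p b 0 x) * u x) * ∫ x in cell d, conj (S.p b 0 x) * v x)
      (∫ x in cell d, conj (u x) * v x) := by
  obtain ⟨B, hB⟩ := hedge.exists_basis
  have := B.hasSum_inner_mul_inner hu.toLp hv.toLp
  rw [inner_toLp] at this
  refine this.congr_fun' fun b => ?_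
  rw [hB, BandEdge.pLp, inner_toLp _ hv, ← inner_conj_symm hu.toLp, inner_toLp _ hu]

theorem BandEdge.exists_coeff {c : ℕ → ℂ} (hc : Summable fun b => ‖c b‖ ^ 2) :
    ∃ u, MemL2per u ∧ ∀ b, ∫ x in cell d, conj (S.p b 0 x) * u x = c b := by
  obtain ⟨B, hB⟩ := hedge.exists_basis
  have hm : Memℓp c 2 := memℓp_gen (by simpa using hc)
  let f := B.repr.symm ⟨c, hm⟩
  obtain ⟨u, hu, hue⟩ := memL2per_of_memLp (Lp.memLp f)
  refine ⟨u, hu, fun b => ?_⟩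
  have h1 : B.repr f b = c b := by simp [f]
  rw [← h1, HilbertBasis.repr_apply_apply, hB, L2.inner_def]
  refine integral_congr_ae ?_
  filter_upwards [(hedge.memH2per_p b).1.2.coeFn_toLp, hue] with x a e
  rw [BandEdge.pLp, a, e, RCLike.inner_apply, mul_comm]

omit hedge in
theorem memH2per_em (n : Fin d → ℤ) : MemH2per (em n) ∧ ∀ᵐ x, lap ev (em n) x = - (nsq n : ℂ) * em n x := by
  have := memH2per_of_fc (memL2per_em n) (isFunSpace_memL2per.smul (nsq n : ℂ) (memL2per_em n)) fun m => by
    rw [fc_smul, fc_em]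
    by_cases h : m = n
    · rw [h]
    · simp [h]
  refine ⟨this.1, ?_⟩
  filter_upwards [this.2] with x hx
  rw [hx, neg_mul]

/-- Solvability of `L_* u = f` for `f` orthogonal to `w`. -/
theorem BandEdge.exists_inv (hreg : S.Regularity σ) {f : Pt d → ℂ} (hf : MemL2per f)
    (h0 : ∫ x in cell d, S.wC x * f x = 0) : ∃ u, S.IsLstarInv f u := by
  obtain ⟨δ, hδ, hgap⟩ := hedge.exists_gap
  set fb : ℕ → ℂ := fun b => ∫ x in cell d, conj (S.p b 0 x) * f x with hfb
  have hsum : Summable fun b => ‖fb b‖ ^ 2 := by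
    have := (hedge.hasSum_p hf.2 hf.2).summable.norm
    refine this.congr fun b => ?_
    rw [norm_mul, RCLike.norm_conj, sq]
  have hfbs : fb S.bs = 0 := by rw [hfb]; simp only; rw [hedge.integral_p_eq, h0]
  -- The expansion coefficients of f are divided by E_b - E_*; the gap keeps them square summable.
  -- The coefficient at b_* is zero, which will make u orthogonal to w.
  obtain ⟨u, hu, huc⟩ := hedge.exists_coeff (c := fun b => (((S.E b 0 - S.Es)⁻¹ : ℝ) : ℂ) * fb b) (by
    refine Summable.of_nonneg_of_le (fun _ => sq_nonneg _) (fun b => ?_) (hsum.mul_left (δ⁻¹ ^ 2))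
    by_cases hb : b = S.bs
    · rw [hb, hfbs]; simp
    · rw [norm_mul, mul_pow, Complex.norm_real, norm_inv, Real.norm_eq_abs]
      gcongr
      exact hgap b hb)
  -- the equation holds weakly, tested with exponentials
  have hweak : ∀ n, ∫ x in cell d, conj (S.Lstar (em n) x) * u x = ∫ x in cell d, conj (em n x) * f x := by
    intro n
    have a := hedge.hasSum_p (memL2per_Lstar hreg (memH2per_em n).1).2 hu.2
    have b := hedge.hasSum_p (memL2per_em n).2 hf.2
    refine a.unique (b.congr_fun' fun b => ?_)
    rw [hedge.integral_p_Lstar hreg b (memH2per_em n).1, huc, map_mul, Complex.conj_ofReal]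
    by_cases hb : b = S.bs
    · rw [hb, hfbs]
      have : (∫ x in cell d, conj (S.p S.bs 0 x) * f x) = 0 := hfbs
      rw [this]; simp
    · have : ((S.E b 0 - S.Es : ℝ) : ℂ) ≠ 0 := by
        exact_mod_cast sub_ne_zero.2 (hedge.E_ne hb)
      rw [Complex.ofReal_inv]
      field_simp
      rfl
  have hVu := hreg.memL2per_mul hu
  have hEu := isFunSpace_memL2per.smul (S.Es : ℂ) hu
  set h : Pt d → ℂ := fun x => f x - ((S.V x : ℂ) * u x - (S.Es : ℂ) * u x) with hh
  have hhm : MemL2per h := isFunSpace_memL2per.sub hf (isFunSpace_memL2per.sub hVu hEu)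
  -- So far u is only in L². Tested with exponentials, the weak equation says that -Δu = h with h in
  -- L², and elliptic regularity places u in H².
  have hcoef : ∀ n, (nsq n : ℂ) * fc n u = fc n h := by
    intro n
    rw [hh, fc_sub hf.2 (isFunSpace_memL2per.sub hVu hEu).2]
    have e1 : fc n f = ∫ x in cell d, conj (S.Lstar (em n) x) * u x := by
      rw [hweak, fc]; simp only [conj_em]
    have e2 : ∫ x in cell d, conj (S.Lstar (em n) x) * u x
        = fc n (fun x => (nsq n : ℂ) * u x + ((S.V x : ℂ) * u x - (S.Es : ℂ) * u x)) := by
      refine integral_congr_ae (ae_restrict_of_ae ?_)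
      filter_upwards [(memH2per_em n).2] with x hx
      simp only [Lstar, schr]
      rw [hx]
      simp only [map_sub, map_add, map_neg, map_mul, Complex.conj_ofReal, conj_em]
      ring
    rw [e1, e2, fc_add (hu.2.const_mul _) (isFunSpace_memL2per.sub hVu hEu).2, fc_smul]
    ring
  obtain ⟨hm, hl⟩ := memH2per_of_fc hu hhm hcoef
  refine ⟨u, hm, ?_, ?_⟩
  · filter_upwards [hl] with x hx
    simp only [Lstar, schr]
    rw [hx, hh]; ring
  · rw [← hedge.integral_p_eq, huc, hfbs, mul_zero]

omit hedge in
theorem Lstar_sub_smul {u v : Pt d → ℂ} (hu : MemH2per u) (hv : MemH2per v) (c : ℂ) :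
    ∀ᵐ x, S.Lstar (fun x => u x - c * v x) x = S.Lstar u x - c * S.Lstar v x := by
  filter_upwards [(hu.isLap_of.sub (hv.isLap_of.smul c)).lap_ae_eq] with x hx
  simp only [Lstar, schr]
  rw [hx]; ring

omit hedge in
theorem Lstar_conj {u : Pt d → ℂ} (hu : MemH2per u) :
    ∀ᵐ x, S.Lstar (fun x => conj (u x)) x = conj (S.Lstar u x) := by
  filter_upwards [hu.isLap_of.conjugate.lap_ae_eq] with x hx
  simp only [Lstar, schr]
  rw [hx]; simp

omit hedge in
theorem integral_wC_conj (u : Pt d → ℂ) :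
    ∫ x in cell d, S.wC x * conj (u x) = conj (∫ x in cell d, S.wC x * u x) := by
  rw [← integral_conj]
  congr 1; funext x; simp [wC]

/-- The inverse of `L_*` preserves real functions. -/
theorem BandEdge.inv_real {f u : Pt d → ℂ} (h : S.IsLstarInv f u) (hf : ∀ᵐ x, conj (f x) = f x) :
    ∀ᵐ x, conj (u x) = u x := by
  obtain ⟨h1, h2, h3⟩ := h
  have hc := isFunSpace_memH2per.conjugate h1
  have := hedge.eq_zero (isFunSpace_memH2per.sub hc (isFunSpace_memH2per.smul 1 h1)) (by
    filter_upwards [Lstar_sub_smul hc h1 1 (S := S), Lstar_conj h1 (S := S), h2, hf] with x a b c e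
    rw [a, b, c, e]; ring) (by
    have i1 := (hedge.memH2per_w.1.2).integrable_mul hc.1.2
    have i2 := (hedge.memH2per_w.1.2).integrable_mul h1.1.2
    have := integral_sub i1 i2
    simp only [Pi.mul_apply] at this
    simp only [one_mul, mul_sub]
    rw [this, integral_wC_conj, h3]; simp)
  filter_upwards [this] with x hx
  rw [one_mul] at hx
  exact sub_eq_zero.1 hx

end Edge

end Setting

end MultiScale

/-! ### L_* acting on functions of (x, y), and slow envelopes -/

namespace MultiScale

variable {d : ℕ}

/-- The slicewise criterion needs a measurable set, hence the passage to a strongly measurable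
representative of `U`. -/
theorem ae_eq_zero_of_ae_ae {α β : Type*} [MeasurableSpace α] [MeasurableSpace β] {μ : Measure α} {ν : Measure β}
    [SFinite μ] [SFinite ν] {U : α × β → ℂ} (hU : AEStronglyMeasurable U (μ.prod ν))
    (h : ∀ᵐ y ∂ν, ∀ᵐ x ∂μ, U (x, y) = 0) : ∀ᵐ z ∂μ.prod ν, U z = 0 := by
  obtain ⟨U', hU', e⟩ := hU
  have h2 : ∀ᵐ y ∂ν, ∀ᵐ x ∂μ, U' (x, y) = 0 := by
    filter_upwards [h, ae_ae_swap e] with y a b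
    filter_upwards [a, b] with x a b
    rw [← b, a]
  have hs : MeasurableSet {z : β × α | U' z.swap = 0} :=
    (hU'.measurable.comp measurable_swap) (measurableSet_singleton 0)
  have h3 : ∀ᵐ z ∂ν.prod μ, U' z.swap = 0 := (Measure.ae_prod_iff_ae_ae hs).2 h2
  have h4 := (Measure.measurePreserving_swap (μ := μ) (ν := ν)).quasiMeasurePreserving.ae h3
  filter_upwards [h4, e] with z a b
  rw [b]; simpa using a

theorem MemH2H2.memSob_ex {U : Pt d × Pt d → ℂ} (h : MemH2H2 U) : MemSob MemL2two ex 2 U :=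
  MemSob.imp (fun _ h => h.base) h

theorem isFunSpace_memH2H2 : IsFunSpace (MemH2H2 (d := d)) :=
  isFunSpace_memSob (isFunSpace_memSob isFunSpace_memL2two _ _) _ _

theorem memSob_ex_slice {U : Pt d × Pt d → ℂ} (h : MemSob MemL2two ex 2 U) :
    ∀ᵐ y, MemH2per (fun x => U (x, y)) ∧ ∀ᵐ x, lap ev (fun x => U (x, y)) x = lap ex U (x, y) := by
  have h1 : ∀ᵐ y, ∀ j, HasWeakDeriv (ev j) (fun x => U (x, y)) (fun x => wd (ex j) U (x, y)) := by
    rw [ae_all_iff]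
    exact fun j => (h.hasWeakDeriv j).slice h.base (h.wd j).base
  have h2 : ∀ᵐ y, ∀ j l, HasWeakDeriv (ev l) (fun x => wd (ex j) U (x, y)) (fun x => wd (ex l) (wd (ex j) U) (x, y)) := by
    rw [ae_all_iff]; intro j
    rw [ae_all_iff]; intro l
    exact ((h.wd j).hasWeakDeriv l).slice (h.wd j).base ((h.wd j).wd l)
  have m1 : ∀ᵐ y, ∀ j, MemL2per fun x => wd (ex j) U (x, y) := by
    rw [ae_all_iff]; exact fun j => (h.wd j).base.slice
  have m2 : ∀ᵐ y, ∀ j l, MemL2per fun x => wd (ex l) (wd (ex j) U) (x, y) := by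
    rw [ae_all_iff]; intro j
    rw [ae_all_iff]; intro l
    exact MemL2two.slice ((h.wd j).wd l)
  filter_upwards [h1, h2, m1, m2, h.base.slice] with y a1 a2 b1 b2 b0
  refine ⟨memSob_succ_of (isFunSpace_memSob isFunSpace_memL2per _ 1) b0 a1 fun j =>
    memSob_succ_of (isFunSpace_memSob isFunSpace_memL2per _ 0) (b1 j) (a2 j) fun l => b2 j l, ?_⟩
  exact IsLap.lap_ae_eq ⟨_, _, a1, fun j => a2 j j, Filter.Eventually.of_forall fun _ => rfl⟩

namespace Setting

variable {S : Setting d} {σ : ℝ}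

theorem Lstar2_slice {U : Pt d × Pt d → ℂ} (h : MemSob MemL2two ex 2 U) :
    ∀ᵐ y, MemH2per (fun x => U (x, y)) ∧ ∀ᵐ x, S.Lstar (fun x => U (x, y)) x = S.Lstar2 U (x, y) := by
  filter_upwards [memSob_ex_slice h] with y hy
  refine ⟨hy.1, ?_⟩
  filter_upwards [hy.2] with x hx
  simp only [Lstar, Lstar2, schr, hx]

/-- On almost every slice the range of L_* is orthogonal to its kernel. Applied to the equations of
the hierarchy, this is the source of all solvability conditions. -/
theorem BandEdge.env_Lstar2 (hedge : S.BandEdge) (hreg : S.Regularity σ) {U : Pt d × Pt d → ℂ}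
    (h : MemSob MemL2two ex 2 U) : ∀ᵐ y, S.env (S.Lstar2 U) y = 0 := by
  filter_upwards [Lstar2_slice (S := S) h] with y hy
  rw [env, ← hedge.integral_w_Lstar hreg hy.1]
  refine integral_congr_ae (ae_restrict_of_ae ?_)
  filter_upwards [hy.2] with x hx
  rw [hx]

theorem BandEdge.eq_zero2 (hedge : S.BandEdge) {U : Pt d × Pt d → ℂ} (h : MemSob MemL2two ex 2 U)
    (h1 : ∀ᵐ z, S.Lstar2 U z = 0) (h0 : ∀ᵐ y, S.env U y = 0) : ∀ᵐ z, U z = 0 := by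
  rw [Measure.volume_eq_prod] at h1 ⊢
  refine ae_eq_zero_of_ae_ae ?_ ?_
  · exact (MemL2two.locallyIntegrable h.base).aestronglyMeasurable
  · filter_upwards [Lstar2_slice (S := S) h, ae_ae_swap h1, h0] with y a b c
    refine hedge.eq_zero a.1 ?_ c
    filter_upwards [a.2, b] with x a b
    rw [a, b]

theorem env_congr {U U' : Pt d × Pt d → ℂ} (h : ∀ᵐ z, U z = U' z) : ∀ᵐ y, S.env U y = S.env U' y := by
  rw [Measure.volume_eq_prod] at h
  filter_upwards [ae_ae_swap h] with y hy
  refine integral_congr_ae (ae_restrict_of_ae ?_)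
  filter_upwards [hy] with x hx
  rw [hx]

section Edge

variable (hedge : S.BandEdge)
include hedge

theorem BandEdge.memLp_w : MemLp S.wC 2 (volume.restrict (cell d)) := hedge.memH2per_w.1.2

theorem BandEdge.env_add {U U' : Pt d × Pt d → ℂ} (h : MemL2two U) (h' : MemL2two U') :
    ∀ᵐ y, S.env (fun z => U z + U' z) y = S.env U y + S.env U' y := by
  filter_upwards [h.slice, h'.slice] with y a b
  simp only [env, mul_add]
  exact integral_add (hedge.memLp_w.integrable_mul a.2) (hedge.memLp_w.integrable_mul b.2)

omit hedge in
theorem env_smul (c : ℂ) (U : Pt d × Pt d → ℂ) (y : Pt d) : S.env (fun z => c * U z) y = c * S.env U y := by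
  simp only [env, mul_left_comm _ c, integral_const_mul]

theorem BandEdge.env_sub {U U' : Pt d × Pt d → ℂ} (h : MemL2two U) (h' : MemL2two U') :
    ∀ᵐ y, S.env (fun z => U z - U' z) y = S.env U y - S.env U' y := by
  filter_upwards [h.slice, h'.slice] with y a b
  simp only [env, mul_sub]
  exact integral_sub (hedge.memLp_w.integrable_mul a.2) (hedge.memLp_w.integrable_mul b.2)

theorem BandEdge.env_sum {ι : Type*} (s : Finset ι) {U : ι → Pt d × Pt d → ℂ} (h : ∀ i ∈ s, MemL2two (U i)) :
    ∀ᵐ y, S.env (fun z => ∑ i ∈ s, U i z) y = ∑ i ∈ s, S.env (U i) y := by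
  classical
  induction s using Finset.induction_on with
  | empty => simp [env]
  | insert a s ha ih =>
    simp only [Finset.sum_insert ha]
    filter_upwards [hedge.env_add (h a (Finset.mem_insert_self _ _))
      (isFunSpace_memL2two.sum s fun i hi => h i (Finset.mem_insert_of_mem hi)),
      ih fun i hi => h i (Finset.mem_insert_of_mem hi)] with y a b
    rw [a, b]

omit hedge in
theorem env_tensor (a b : Pt d → ℂ) (y : Pt d) :
    S.env (fun z => a z.1 * b z.2) y = (∫ x in cell d, S.wC x * a x) * b y := by
  simp only [env, ← mul_assoc, integral_mul_const]

theorem BandEdge.env_w_tensor (b : Pt d → ℂ) (y : Pt d) : S.env (fun z => S.wC z.1 * b z.2) y = b y := by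
  rw [env_tensor, hedge.integral_w_w, one_mul]

theorem BandEdge.memL2_env {U : Pt d × Pt d → ℂ} (h : MemL2two U) : MemL2 (S.env U) := memL2_pair h hedge.memLp_w

theorem BandEdge.memSob_env {U : Pt d × Pt d → ℂ} {k : ℕ} (h : MemSob MemL2two ey k U) : MemH k (S.env U) := by
  induction k generalizing U with
  | zero => exact hedge.memL2_env h
  | succ k ih =>
    refine memSob_succ_of (isFunSpace_memSob isFunSpace_memL2 _ k) (hedge.memL2_env h.base)
      (fun j => (h.hasWeakDeriv j).pair h.base (h.wd j).base hedge.memLp_w) fun j => ?_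
    exact ih (h.wd j)

end Edge

end Setting

end MultiScale

/-! ### The effective mass matrix by second order perturbation theory -/

namespace MultiScale

variable {d : ℕ}

/-- Second order Taylor expansion at a critical point, along a line. -/
theorem tendsto_second_order {X : Type*} [NormedAddCommGroup X] [NormedSpace ℝ X] {f : X → ℝ}
    (hf : ContDiffAt ℝ 3 f 0) (h0 : fderiv ℝ f 0 = 0) (v : X) :
    Filter.Tendsto (fun t : ℝ => (f (t • v) - f 0) / t ^ 2) (nhdsWithin 0 {0}ᶜ)
      (nhds (fderiv ℝ (fderiv ℝ f) 0 v v / 2)) := by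
  have hl : HasDerivAt (fun t : ℝ => t • v) v 0 := by simpa using (hasDerivAt_id (0 : ℝ)).smul_const v
  have hl' : ∀ t : ℝ, HasDerivAt (fun t : ℝ => t • v) v t := fun t => by simpa using (hasDerivAt_id t).smul_const v
  have hc : Filter.Tendsto (fun t : ℝ => t • v) (nhds 0) (nhds 0) := by
    simpa using hl.continuousAt.tendsto
  have ev1 : ∀ᶠ t : ℝ in nhds 0, DifferentiableAt ℝ f (t • v) :=
    hc.eventually ((hf.eventually (by simp)).mono fun x hx => hx.differentiableAt (by simp))
  have d2 : DifferentiableAt ℝ (fderiv ℝ f) 0 :=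
    (hf.fderiv_right (m := 2) (by norm_num)).differentiableAt (by simp)
  have hd : HasDerivAt (fun t : ℝ => fderiv ℝ f (t • v) v) (fderiv ℝ (fderiv ℝ f) 0 v v) 0 := by
    have h1 : HasFDerivAt (fderiv ℝ f) (fderiv ℝ (fderiv ℝ f) 0) ((0 : ℝ) • v) := by
      rw [zero_smul]; exact d2.hasFDerivAt
    have h2 := h1.comp_hasDerivAt (0 : ℝ) hl
    exact (ContinuousLinearMap.apply ℝ ℝ v).hasFDerivAt.comp_hasDerivAt 0 h2
  refine HasDerivAt.lhopital_zero_nhdsNE (f' := fun t => fderiv ℝ f (t • v) v) (g' := fun t => 2 * t) ?_ ?_ ?_ ?_ ?_ ?_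
  · filter_upwards [ev1.filter_mono nhdsWithin_le_nhds] with t ht
    have := ht.hasFDerivAt.comp_hasDerivAt t (hl' t)
    exact this.sub_const _
  · exact Filter.Eventually.of_forall fun t => by simpa using hasDerivAt_pow 2 t
  · filter_upwards [self_mem_nhdsWithin] with t ht
    exact mul_ne_zero two_ne_zero ht
  · have h1 : Filter.Tendsto (fun t : ℝ => f (t • v)) (nhds 0) (nhds (f 0)) := hf.continuousAt.tendsto.comp hc
    have := (h1.sub_const (f 0)).mono_left (nhdsWithin_le_nhds (s := {0}ᶜ))
    simpa using this
  · have : Filter.Tendsto (fun t : ℝ => t ^ 2) (nhds 0) (nhds (0 ^ 2)) := (continuous_pow 2).tendsto 0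
    simpa using this.mono_left (nhdsWithin_le_nhds (s := {0}ᶜ))
  · have := (hasDerivAt_iff_tendsto_slope_zero.1 hd).div_const 2
    refine this.congr fun t => ?_
    simp only [zero_add, zero_smul, h0, zero_apply, sub_zero, smul_eq_mul]
    ring

theorem BZ_mem_nhds : BZ d ∈ nhds (0 : Pt d) := by
  have : ∀ j : Fin d, ∀ᶠ k : Pt d in nhds 0, k j ∈ Icc (-(1 / 2) : ℝ) (1 / 2) := fun j => by
    have hc : Continuous fun k : Pt d => k j := by fun_prop
    have := hc.tendsto 0
    exact this.eventually (Icc_mem_nhds (by simp) (by simp))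
  exact Filter.eventually_all.2 this

theorem sum_blochD {u : Pt d → ℂ} (hu : MemH2per u) (k : Pt d) :
    ∀ᵐ x, ∑ j, blochD k j (blochD k j u) x = lap ev u x + 4 * Real.pi * Complex.I * (∑ j, (k j : ℂ) * wd (ev j) u x)
      - 4 * Real.pi ^ 2 * (∑ j, (k j : ℂ) ^ 2) * u x := by
  have h : ∀ᵐ x, ∀ j, wd (ev j) (blochD k j u) x
      = wd (ev j) (wd (ev j) u) x + 2 * Real.pi * Complex.I * (k j : ℂ) * wd (ev j) u x := by
    rw [ae_all_iff]
    exact fun j => ((hu.hasWeakDeriv_wd j j).add ((hu.hasWeakDeriv j).smul _)).wd_ae_eq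
  filter_upwards [h] with x hx
  have e : ∀ j, blochD k j (blochD k j u) x = wd (ev j) (wd (ev j) u) x
      + 4 * Real.pi * Complex.I * ((k j : ℂ) * wd (ev j) u x) - 4 * Real.pi ^ 2 * ((k j : ℂ) ^ 2 * u x) := fun j => by
    rw [blochD, hx]
    simp only [blochD]
    linear_combination 4 * (Real.pi : ℂ) ^ 2 * (k j : ℂ) ^ 2 * u x * Complex.I_sq
  simp only [e, Finset.sum_sub_distrib, Finset.sum_add_distrib, lap, ← Finset.mul_sum, ← Finset.sum_mul, mul_assoc]

/-- The inner product of `L²(Ω)`. -/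
def cellInner (u v : Pt d → ℂ) : ℂ := ∫ x in cell d, conj (u x) * v x

theorem cellInner_add {u v v' : Pt d → ℂ} (hu : MemL2per u) (hv : MemL2per v) (hv' : MemL2per v') :
    cellInner u (fun x => v x + v' x) = cellInner u v + cellInner u v' := by
  simp only [cellInner, mul_add]
  exact integral_add (integrable_conj_mul hu.2 hv.2) (integrable_conj_mul hu.2 hv'.2)

theorem cellInner_smul (c : ℂ) (u v : Pt d → ℂ) : cellInner u (fun x => c * v x) = c * cellInner u v := by
  simp only [cellInner, mul_left_comm _ c, integral_const_mul]

theorem cellInner_sum {ι : Type*} (s : Finset ι) {u : Pt d → ℂ} (hu : MemL2per u) {f : ι → Pt d → ℂ}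
    (hf : ∀ i ∈ s, MemL2per (f i)) : cellInner u (fun x => ∑ i ∈ s, f i x) = ∑ i ∈ s, cellInner u (f i) := by
  simp only [cellInner, Finset.mul_sum]
  exact integral_finsetSum _ fun i hi => integrable_conj_mul hu.2 (hf i hi).2

theorem cellInner_congr {u u' v v' : Pt d → ℂ} (h : ∀ᵐ x, u x = u' x) (h' : ∀ᵐ x, v x = v' x) :
    cellInner u v = cellInner u' v' := by
  refine integral_congr_ae (ae_restrict_of_ae ?_)
  filter_upwards [h, h'] with x a b
  rw [a, b]

namespace Setting

variable {S : Setting d} {σ : ℝ}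

/-- The eigenfunctions of the band are weakly continuous in the quasi momentum. -/
theorem Regularity.tendsto_p (hreg : S.Regularity σ) (hedge : S.BandEdge) (v : Pt d) {u : Pt d → ℂ} (hu : MemL2per u) :
    Filter.Tendsto (fun t : ℝ => cellInner u (S.p S.bs (t • v))) (nhdsWithin 0 {0}ᶜ)
      (nhds (cellInner u S.wC)) := by
  obtain ⟨m, hm, hp⟩ := hreg.p_C3
  rw [cellInner_congr (Filter.Eventually.of_forall fun _ => rfl) (hedge.w_eq.mono fun x h => h.symm)]
  have hc : Filter.Tendsto (fun t : ℝ => t • v) (nhds 0) (nhds 0) := by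
    have : Continuous fun t : ℝ => t • v := by fun_prop
    simpa using this.tendsto 0
  have hb : ∀ᶠ t : ℝ in nhdsWithin 0 {0}ᶜ, t • v ∈ BZ d := (hc.eventually BZ_mem_nhds).filter_mono nhdsWithin_le_nhds
  have hmu : Integrable (fun x => ‖u x‖ * m x) (volume.restrict (cell d)) := hu.2.norm.integrable_mul hm
  -- The majorant `m` of the C³ hypothesis is used with derivative order zero. Weak continuity of
  -- the eigenfunctions at k = 0 is all that the perturbation argument needs of them.
  refine MeasureTheory.tendsto_integral_filter_of_dominated_convergence (fun x => ‖u x‖ * m x) ?_ ?_ hmu ?_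
  · filter_upwards [hb] with t ht
    exact (integrable_conj_mul hu.2 (hedge.bloch.memH2 S.bs _ ht).1.2).1
  · filter_upwards [hb] with t ht
    filter_upwards [hp] with x hx
    have := hx.2 0 (by norm_num) _ ht
    rw [norm_iteratedFDerivWithin_zero] at this
    rw [norm_mul, RCLike.norm_conj]
    gcongr
  · filter_upwards [hp] with x hx
    refine Filter.Tendsto.const_mul _ ?_
    have h1 : ContinuousAt (fun k => S.p S.bs k x) 0 := (hx.1.contDiffAt BZ_mem_nhds).continuousAt
    exact (h1.tendsto.comp hc).mono_left nhdsWithin_le_nhds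

section Edge

variable (hreg : S.Regularity σ) (hedge : S.BandEdge)
include hreg hedge

/-- The quadratic form of the effective mass matrix in terms of `g = L_*⁻¹ ∇w`. -/
theorem second_deriv_eq {g : Fin d → Pt d → ℂ} (hg : ∀ j, S.IsLstarInv (wd (ev j) S.wC) (g j)) (v : Pt d) :
    ((fderiv ℝ (fderiv ℝ (S.E S.bs)) 0 v v / 2 : ℝ) : ℂ) = 4 * Real.pi ^ 2 * (∑ j, (v j : ℂ) ^ 2)
      + 16 * Real.pi ^ 2 * cellInner (fun x => ∑ l, ∑ j, (v l : ℂ) * (v j : ℂ) * wd (ev j) (g l) x) S.wC := by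
  have hw := hedge.memH2per_w
  set dw : Pt d → ℂ := fun x => ∑ j, (v j : ℂ) * wd (ev j) S.wC x with hdw
  set gv : Pt d → ℂ := fun x => ∑ j, (v j : ℂ) * g j x with hgv
  set dg : Pt d → ℂ := fun x => ∑ l, ∑ j, (v l : ℂ) * (v j : ℂ) * wd (ev j) (g l) x with hdg
  have hdwm : MemL2per dw := isFunSpace_memL2per.sum _ fun j _ => isFunSpace_memL2per.smul _ (hw.wd j)
  have hgvm : MemH2per gv := isFunSpace_memH2per.sum _ fun j _ => isFunSpace_memH2per.smul _ (hg j).1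
  have hdgm : MemL2per dg := isFunSpace_memL2per.sum _ fun l _ => isFunSpace_memL2per.sum _ fun j _ =>
    isFunSpace_memL2per.smul _ ((hg l).1.wd j)
  have hLg : ∀ᵐ x, S.Lstar gv x = dw x := by
    have hl : IsLap ev gv (fun x => ∑ j, (v j : ℂ) * lap ev (g j) x) :=
      IsLap.sum _ fun j _ => (hg j).1.isLap_of.smul _
    have h2 : ∀ᵐ x, ∀ j, S.Lstar (g j) x = wd (ev j) S.wC x := by
      rw [ae_all_iff]; exact fun j => (hg j).2.1
    filter_upwards [hl.lap_ae_eq, h2] with x a b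
    simp only [Lstar, schr] at b ⊢
    rw [a, hdw]
    simp only [← b, hgv, Finset.mul_sum, ← Finset.sum_neg_distrib, ← Finset.sum_add_distrib, ← Finset.sum_sub_distrib]
    exact Finset.sum_congr rfl fun j _ => by ring
  -- integration by parts
  have ibp : ∀ {u q : Pt d → ℂ}, MemH2per u → MemH2per q →
      cellInner u (fun x => ∑ j, (v j : ℂ) * wd (ev j) q x) = - cellInner (fun x => ∑ j, (v j : ℂ) * wd (ev j) u x) q := by
    intro u q hu hq
    rw [cellInner_sum _ hu.1 fun j _ => isFunSpace_memL2per.smul _ (hq.wd j)]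
    have : cellInner (fun x => ∑ j, (v j : ℂ) * wd (ev j) u x) q = ∑ j, (v j : ℂ) * cellInner (wd (ev j) u) q := by
      simp only [cellInner, map_sum, map_mul, Complex.conj_ofReal, Finset.sum_mul, mul_assoc]
      rw [integral_finsetSum _ fun j _ => (integrable_conj_mul (hu.wd j).2 hq.1.2).const_mul _]
      simp only [integral_const_mul]
    rw [this, ← Finset.sum_neg_distrib]
    refine Finset.sum_congr rfl fun j _ => ?_
    rw [cellInner_smul, ← mul_neg]
    congr 1
    exact integral_cell_by_parts (hu.hasWeakDeriv j) (hq.hasWeakDeriv j) hu.1 (hu.wd j) hq.1 (hq.wd j)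
  set s : ℂ := ∑ j, (v j : ℂ) ^ 2 with hs
  have hc : Filter.Tendsto (fun t : ℝ => t • v) (nhds 0) (nhds 0) := by
    have : Continuous fun t : ℝ => t • v := by fun_prop
    simpa using this.tendsto 0
  have hb : ∀ᶠ t : ℝ in nhdsWithin 0 {0}ᶜ, t • v ∈ BZ d := (hc.eventually BZ_mem_nhds).filter_mono nhdsWithin_le_nhds
  -- The scalar part of the eigenvalue equation at `t • v`: the energy difference less the term
  -- 4π²t²|v|² produced by expanding (∇ + 2πi t v)².
  set c : ℝ → ℂ := fun t => ((S.E S.bs (t • v) - S.E S.bs 0 : ℝ) : ℂ) - 4 * Real.pi ^ 2 * (t : ℂ) ^ 2 * s with hcdef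
  -- the eigenvalue equation tested with a function in `H²_per`
  have test : ∀ t : ℝ, t • v ∈ BZ d → ∀ {u : Pt d → ℂ}, MemH2per u →
      cellInner (S.Lstar u) (S.p S.bs (t • v)) = c t * cellInner u (S.p S.bs (t • v))
        - 4 * Real.pi * Complex.I * t * cellInner (fun x => ∑ j, (v j : ℂ) * wd (ev j) u x) (S.p S.bs (t • v)) := by
    intro t ht u hu
    have hp := hedge.bloch.memH2 S.bs _ ht
    have h1 : ∀ᵐ x, S.Lstar (S.p S.bs (t • v)) x = c t * S.p S.bs (t • v) x
        + 4 * Real.pi * Complex.I * t * ∑ j, (v j : ℂ) * wd (ev j) (S.p S.bs (t • v)) x := by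
      filter_upwards [hedge.bloch.eigen S.bs _ ht, sum_blochD hp (t • v)] with x a b
      rw [b] at a
      simp only [PiLp.smul_apply, smul_eq_mul, Complex.ofReal_mul, mul_assoc, mul_pow, ← Finset.mul_sum] at a
      simp only [Lstar, schr, hcdef, hs, Es]
      push_cast
      linear_combination a
    have h2 := integral_Lstar_symm hreg hu hp
    change cellInner u _ = cellInner _ _ at h2
    have hdp : MemL2per (fun x => ∑ j, (v j : ℂ) * wd (ev j) (S.p S.bs (t • v)) x) :=
      isFunSpace_memL2per.sum _ fun j _ => isFunSpace_memL2per.smul _ (hp.wd j)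
    rw [← h2, cellInner_congr (Filter.Eventually.of_forall fun _ => rfl) h1,
      cellInner_add hu.1 (isFunSpace_memL2per.smul _ hp.1) (isFunSpace_memL2per.smul _ hdp),
      cellInner_smul, cellInner_smul, ibp hu hp]
    ring
  -- Testing with w gives c⟨w, p⟩ = 4πi t ⟨∂_v w, p⟩. Since ∂_v w = L_* g_v, testing again with g_v
  -- replaces ⟨∂_v w, p⟩ by c⟨g_v, p⟩ - 4πi t ⟨∂_v g_v, p⟩. Every term can now be divided by t²
  -- before the limit, and no k-derivative of the eigenfunction appears.
  have key : ∀ᶠ t : ℝ in nhdsWithin 0 {0}ᶜ, c t / (t : ℂ) ^ 2 * cellInner S.wC (S.p S.bs (t • v))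
      = 4 * Real.pi * Complex.I * t * (c t / (t : ℂ) ^ 2) * cellInner gv (S.p S.bs (t • v))
        + 16 * Real.pi ^ 2 * cellInner dg (S.p S.bs (t • v)) := by
    filter_upwards [hb, self_mem_nhdsWithin] with t ht h0
    have h0' : (t : ℂ) ≠ 0 := by exact_mod_cast h0
    have e1 := test t ht hw
    have e2 := test t ht hgvm
    have z1 : cellInner (S.Lstar S.wC) (S.p S.bs (t • v)) = 0 := by
      rw [cellInner_congr (u' := fun _ => 0) hedge.Lstar_w (Filter.Eventually.of_forall fun _ => rfl)]
      simp [cellInner]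
    rw [z1] at e1
    rw [cellInner_congr hLg (Filter.Eventually.of_forall fun _ => rfl)] at e2
    have z2 : cellInner (fun x => ∑ j, (v j : ℂ) * wd (ev j) gv x) (S.p S.bs (t • v)) = cellInner dg (S.p S.bs (t • v)) := by
      refine cellInner_congr ?_ (Filter.Eventually.of_forall fun _ => rfl)
      have : ∀ᵐ x, ∀ j, wd (ev j) gv x = ∑ l, (v l : ℂ) * wd (ev j) (g l) x := by
        rw [ae_all_iff]
        exact fun j => (HasWeakDeriv.sum _ fun l _ => ((hg l).1.hasWeakDeriv j).smul (v l : ℂ)).wd_ae_eq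
      filter_upwards [this] with x hx
      simp only [hx, hdg, Finset.mul_sum]
      rw [Finset.sum_comm]
      exact Finset.sum_congr rfl fun l _ => Finset.sum_congr rfl fun j _ => by ring
    rw [z2] at e2
    rw [show (fun x => ∑ j, (v j : ℂ) * wd (ev j) S.wC x) = dw from rfl] at e1
    rw [e2] at e1
    field_simp
    linear_combination (-1) * e1 - 16 * Real.pi ^ 2 * (t : ℂ) ^ 2 * cellInner dg (S.p S.bs (t • v)) * Complex.I_sq
  -- passing to the limit
  have hE := tendsto_second_order (hreg.E_C3.contDiffAt BZ_mem_nhds) hedge.critical v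
  have hct : Filter.Tendsto (fun t : ℝ => c t / (t : ℂ) ^ 2) (nhdsWithin 0 {0}ᶜ)
      (nhds (((fderiv ℝ (fderiv ℝ (S.E S.bs)) 0 v v / 2 : ℝ) : ℂ) - 4 * Real.pi ^ 2 * s)) := by
    have h1 := ((Complex.continuous_ofReal.tendsto _).comp hE).sub_const (4 * Real.pi ^ 2 * s)
    refine h1.congr' ?_
    filter_upwards [self_mem_nhdsWithin] with t h0
    have h0' : (t : ℂ) ≠ 0 := by exact_mod_cast h0
    simp only [Function.comp, hcdef]
    push_cast
    field_simp
  have ht0 : Filter.Tendsto (fun t : ℝ => (t : ℂ)) (nhdsWithin 0 {0}ᶜ) (nhds 0) := by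
    have := (Complex.continuous_ofReal.tendsto 0).mono_left (nhdsWithin_le_nhds (s := {0}ᶜ))
    simpa using this
  have L1 := hct.mul (hreg.tendsto_p hedge v hw.1)
  have L2 := ((((ht0.const_mul (4 * Real.pi * Complex.I)).mul hct).mul (hreg.tendsto_p hedge v hgvm.1)).add
    ((hreg.tendsto_p hedge v hdgm).const_mul (16 * Real.pi ^ 2 : ℂ)))
  have hne : (nhdsWithin (0 : ℝ) {0}ᶜ).NeBot := inferInstance
  have := tendsto_nhds_unique (L1.congr' key) L2
  have ww : cellInner S.wC S.wC = 1 := by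
    rw [← hedge.integral_w_w]
    simp only [cellInner, wC, Complex.conj_ofReal]
  rw [ww] at this
  linear_combination this

/-- The symmetric part of the effective mass matrix in terms of `g = L_*⁻¹ ∇w`. -/
theorem A_formula {g : Fin d → Pt d → ℂ} (hg : ∀ j, S.IsLstarInv (wd (ev j) S.wC) (g j)) (j l : Fin d) :
    (S.A j l : ℂ) + S.A l j = 2 * (if j = l then 1 else 0)
      + 4 * ((∫ x in cell d, S.wC x * wd (ev j) (g l) x) + ∫ x in cell d, S.wC x * wd (ev l) (g j) x) := by
  set B := fderiv ℝ (fderiv ℝ (S.E S.bs)) 0 with hB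
  set N : Fin d → Fin d → ℂ := fun j l => ∫ x in cell d, S.wC x * wd (ev j) (g l) x with hN
  let T : Pt d → Pt d → ℂ := fun u v => 4 * Real.pi ^ 2 * (∑ i, (u i : ℂ) * (v i : ℂ))
    + 16 * Real.pi ^ 2 * ∑ l, ∑ j, (u l : ℂ) * (v j : ℂ) * N j l
  have hT : ∀ v, ((B v v / 2 : ℝ) : ℂ) = T v v := by
    intro v
    -- `cellInner` conjugates its first argument, where the derivatives of g stand. The left side is
    -- real, so conjugating the identity removes this conjugate.
    have h := congrArg (starRingEnd ℂ) (second_deriv_eq hreg hedge hg v)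
    have e : conj (cellInner (fun x => ∑ l, ∑ j, (v l : ℂ) * (v j : ℂ) * wd (ev j) (g l) x) S.wC)
        = ∑ l, ∑ j, (v l : ℂ) * (v j : ℂ) * N j l := by
      rw [cellInner, ← integral_conj]
      have e1 : ∀ x, conj (conj (∑ l, ∑ j, (v l : ℂ) * (v j : ℂ) * wd (ev j) (g l) x) * S.wC x)
          = ∑ l, ∑ j, (v l : ℂ) * (v j : ℂ) * (S.wC x * wd (ev j) (g l) x) := fun x => by
        rw [map_mul, Complex.conj_conj, wC, Complex.conj_ofReal, Finset.sum_mul]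
        refine Finset.sum_congr rfl fun l _ => ?_
        rw [Finset.sum_mul]
        exact Finset.sum_congr rfl fun j _ => by ring
      have hi : ∀ l j, Integrable (fun x => (v l : ℂ) * (v j : ℂ) * (S.wC x * wd (ev j) (g l) x)) (volume.restrict (cell d)) :=
        fun l j => (hedge.memLp_w.integrable_mul ((hg l).1.wd j).2).const_mul _
      simp only [e1]
      rw [integral_finsetSum _ fun l _ => integrable_finsetSum _ fun j _ => hi l j]
      refine Finset.sum_congr rfl fun l _ => ?_
      rw [integral_finsetSum _ fun j _ => hi l j]
      exact Finset.sum_congr rfl fun j _ => integral_const_mul _ _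
    rw [map_add, map_mul, map_mul _ (16 * _) _, e, Complex.conj_ofReal] at h
    rw [h]
    have c4 : conj (4 : ℂ) = 4 := Complex.conj_ofNat 4
    have c16 : conj (16 : ℂ) = 16 := Complex.conj_ofNat 16
    simp [T, map_sum, sq, c4, c16]
  -- Polarization. The perturbation argument yields quadratic forms, hence only the symmetric parts
  -- of the matrices.
  have hadd : T (ev j + ev l) (ev j + ev l) - T (ev j) (ev j) - T (ev l) (ev l) = T (ev j) (ev l) + T (ev l) (ev j) := by
    simp only [T, PiLp.add_apply, Complex.ofReal_add, add_mul, mul_add, Finset.sum_add_distrib]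
    ring
  have hTe : ∀ j l, T (ev j) (ev l) = 4 * Real.pi ^ 2 * (if j = l then 1 else 0) + 16 * Real.pi ^ 2 * N l j := by
    intro j l
    have hs : ∀ i m : Fin d, ((ev i m : ℝ) : ℂ) = if m = i then 1 else 0 := fun i m => by
      rw [ev, PiLp.single_apply]; split_ifs <;> simp
    simp only [T, hs]
    simp
    exact if_congr eq_comm rfl rfl
  rw [← hT, ← hT, ← hT, hTe, hTe] at hadd
  have hA : ∀ j l, S.A j l = (8 * Real.pi ^ 2)⁻¹ * B (ev j) (ev l) := by
    intro j l
    have d2 : DifferentiableAt ℝ (fderiv ℝ (S.E S.bs)) 0 :=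
      ((hreg.E_C3.contDiffAt BZ_mem_nhds).fderiv_right (m := 2) (by norm_num)).differentiableAt (by simp)
    rw [A, Matrix.of_apply, fderiv_clm_apply d2 (differentiableAt_const _)]
    simp [hB]
  rw [hA, hA]
  have hpi : (Real.pi : ℂ) ≠ 0 := by exact_mod_cast Real.pi_ne_zero
  simp only [map_add, add_apply] at hadd
  push_cast at hadd ⊢
  field_simp
  simp only [eq_comm (a := l)] at hadd
  linear_combination 2 * hadd

omit hreg hedge in
theorem LAQ_ae_eq {F : Pt d → ℂ} (hF : MemH 2 F) : ∀ᵐ y, S.LAQ F y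
    = - (∑ j, ∑ l, (S.A j l : ℂ) * wd (ev j) (wd (ev l) F) y) + (S.Q y : ℂ) * F y - (S.eAQ : ℂ) * F y := by
  have h : ∀ᵐ y, ∀ j l, wd (ev j) (fun y' => (S.A j l : ℂ) * wd (ev l) F y') y = (S.A j l : ℂ) * wd (ev j) (wd (ev l) F) y := by
    rw [ae_all_iff]; intro j
    rw [ae_all_iff]; intro l
    exact (((MemSob.wd hF l).hasWeakDeriv j).smul _).wd_ae_eq
  filter_upwards [h] with y hy
  simp only [LAQ, hy]

omit hreg hedge in
theorem wd_comm {F : Pt d → ℂ} (hF : MemH 2 F) : ∀ᵐ y, ∀ j l, wd (ev j) (wd (ev l) F) y = wd (ev l) (wd (ev j) F) y := by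
  rw [ae_all_iff]; intro j
  rw [ae_all_iff]; intro l
  exact (HasWeakDeriv.swap (MemSob.hasWeakDeriv hF j) ((MemSob.wd hF j).hasWeakDeriv l) (MemSob.hasWeakDeriv hF l)).wd_ae_eq

/-- The homogenized operator is the envelope of `ℒ`. -/
theorem env_calL {g : Fin d → Pt d → ℂ} (hg : ∀ j, S.IsLstarInv (wd (ev j) S.wC) (g j)) {F : Pt d → ℂ} (hF : MemH 2 F) :
    ∀ᵐ y, S.env (S.calL g F) y = S.LAQ F y := by
  filter_upwards [LAQ_ae_eq (S := S) hF, wd_comm hF] with y h1 h2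
  set N : Fin d → Fin d → ℂ := fun j l => ∫ x in cell d, S.wC x * wd (ev j) (g l) x with hN
  have hi : ∀ j l, Integrable (fun x => wd (ev j) (wd (ev l) F) y * (S.wC x * wd (ev j) (g l) x)) (volume.restrict (cell d)) :=
    fun j l => (hedge.memLp_w.integrable_mul ((hg l).1.wd j).2).const_mul _
  have e0 : ∀ x, S.wC x * S.calL g F (x, y)
      = -4 * (∑ j, ∑ l, wd (ev j) (wd (ev l) F) y * (S.wC x * wd (ev j) (g l) x))
        + S.wC x * S.wC x * schr ev S.Q S.eAQ F y := fun x => by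
    rw [calL, mul_add, mul_left_comm, Finset.mul_sum]
    refine congrArg₂ _ (congrArg _ ?_) ?_
    · refine Finset.sum_congr rfl fun j _ => ?_
      rw [Finset.mul_sum]
      exact Finset.sum_congr rfl fun l _ => by ring
    · ring
  have hsum : Integrable (fun x => ∑ j, ∑ l, wd (ev j) (wd (ev l) F) y * (S.wC x * wd (ev j) (g l) x)) (volume.restrict (cell d)) :=
    integrable_finsetSum _ fun j _ => integrable_finsetSum _ fun l _ => hi j l
  have hww : Integrable (fun x => S.wC x * S.wC x) (volume.restrict (cell d)) := hedge.memLp_w.integrable_mul hedge.memLp_w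
  have e1 : S.env (S.calL g F) y = -4 * (∑ j, ∑ l, wd (ev j) (wd (ev l) F) y * N j l) + schr ev S.Q S.eAQ F y := by
    simp only [env, e0]
    rw [integral_add (hsum.const_mul _) (hww.mul_const _), integral_const_mul, integral_mul_const, hedge.integral_w_w, one_mul,
      integral_finsetSum _ fun j _ => integrable_finsetSum _ fun l _ => hi j l]
    congr 2
    refine Finset.sum_congr rfl fun j _ => ?_
    rw [integral_finsetSum _ fun l _ => hi j l]
    exact Finset.sum_congr rfl fun l _ => integral_const_mul _ _
  have hA := A_formula hreg hedge hg
  -- Second weak derivatives commute, so a coefficient matrix may be transposed under the double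
  -- sum. The symmetrized formula for `S.A` is therefore sufficient.
  have sym : ∀ c : Fin d → Fin d → ℂ, ∑ j, ∑ l, c j l * wd (ev j) (wd (ev l) F) y
      = ∑ j, ∑ l, c l j * wd (ev j) (wd (ev l) F) y := fun c => by
    rw [Finset.sum_comm]
    exact Finset.sum_congr rfl fun j _ => Finset.sum_congr rfl fun l _ => by rw [h2]
  have s1 : ∑ j, ∑ l, ((S.A j l : ℂ) + S.A l j) * wd (ev j) (wd (ev l) F) y
      = 2 * ∑ j, ∑ l, (S.A j l : ℂ) * wd (ev j) (wd (ev l) F) y := by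
    simp only [add_mul, Finset.sum_add_distrib]
    rw [← sym fun j l => (S.A j l : ℂ)]
    ring
  have s2 : ∑ j, ∑ l, (N j l + N l j) * wd (ev j) (wd (ev l) F) y
      = 2 * ∑ j, ∑ l, N j l * wd (ev j) (wd (ev l) F) y := by
    simp only [add_mul, Finset.sum_add_distrib]
    rw [← sym fun j l => N j l]
    ring
  have s3 : ∑ j, ∑ l, ((S.A j l : ℂ) + S.A l j) * wd (ev j) (wd (ev l) F) y
      = 2 * lap ev F y + 4 * ∑ j, ∑ l, (N j l + N l j) * wd (ev j) (wd (ev l) F) y := by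
    have : ∀ j l, ((S.A j l : ℂ) + S.A l j) * wd (ev j) (wd (ev l) F) y
        = 2 * (if j = l then wd (ev j) (wd (ev l) F) y else 0) + 4 * ((N j l + N l j) * wd (ev j) (wd (ev l) F) y) := fun j l => by
      rw [hA]; split_ifs <;> ring
    simp only [this, Finset.sum_add_distrib, ← Finset.mul_sum, Finset.sum_ite_eq, Finset.mem_univ, if_true, lap]
  have s4 : ∑ j, ∑ l, wd (ev j) (wd (ev l) F) y * N j l = ∑ j, ∑ l, N j l * wd (ev j) (wd (ev l) F) y := by
    simp only [mul_comm]
  rw [s1, s2] at s3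
  rw [e1, h1, schr, s4]
  linear_combination (1 / 2) * s3

end Edge

end Setting

end MultiScale

/-! ### The Fourier transform on L²(ℝ^d) and weak derivatives -/

namespace MultiScale

section FourierSide

open FourierTransform SchwartzMap LineDeriv

variable {d : ℕ}

/-- The Fourier transform of square integrable functions. -/
def ft (F : Pt d → ℂ) : Pt d → ℂ := open Classical in
  if h : MemLp F 2 (volume : Measure (Pt d)) then ⇑(𝓕 h.toLp : Lp ℂ 2 (volume : Measure (Pt d))) else 0

/-- The inverse Fourier transform of square integrable functions. -/
def ift (F : Pt d → ℂ) : Pt d → ℂ := open Classical in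
  if h : MemLp F 2 (volume : Measure (Pt d)) then ⇑(𝓕⁻ h.toLp : Lp ℂ 2 (volume : Measure (Pt d))) else 0

theorem ft_eq {F : Pt d → ℂ} (h : MemLp F 2 volume) : ft F = ⇑(𝓕 h.toLp : Lp ℂ 2 (volume : Measure (Pt d))) := by
  unfold ft; rw [dif_pos h]

theorem ift_eq {F : Pt d → ℂ} (h : MemLp F 2 volume) : ift F = ⇑(𝓕⁻ h.toLp : Lp ℂ 2 (volume : Measure (Pt d))) := by
  unfold ift; rw [dif_pos h]

theorem memL2_ft (F : Pt d → ℂ) : MemL2 (ft F) := by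
  unfold ft
  split_ifs with h
  · exact Lp.memLp _
  · exact MemLp.zero

theorem memL2_ift (F : Pt d → ℂ) : MemL2 (ift F) := by
  unfold ift
  split_ifs with h
  · exact Lp.memLp _
  · exact MemLp.zero

theorem toLp_ft {F : Pt d → ℂ} (h : MemLp F 2 volume) : (memL2_ft F).toLp = 𝓕 h.toLp := by
  refine Lp.ext ((memL2_ft F).coeFn_toLp.trans ?_)
  rw [ft_eq h]

theorem toLp_ift {F : Pt d → ℂ} (h : MemLp F 2 volume) : (memL2_ift F).toLp = 𝓕⁻ h.toLp := by
  refine Lp.ext ((memL2_ift F).coeFn_toLp.trans ?_)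
  rw [ift_eq h]

theorem ft_ift {F : Pt d → ℂ} (h : MemL2 F) : ∀ᵐ y, ft (ift F) y = F y := by
  rw [ft_eq (memL2_ift F), toLp_ift h, fourier_fourierInv_eq]
  exact MemLp.coeFn_toLp _

theorem ift_ft {F : Pt d → ℂ} (h : MemL2 F) : ∀ᵐ y, ift (ft F) y = F y := by
  rw [ift_eq (memL2_ft F), toLp_ft h, fourierInv_fourier_eq]
  exact MemLp.coeFn_toLp _

theorem ft_congr {F G : Pt d → ℂ} (h : ∀ᵐ y, F y = G y) : ft F = ft G := by
  by_cases hF : MemLp F 2 (volume : Measure (Pt d))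
  · have hG := hF.ae_eq h
    rw [ft_eq hF, ft_eq hG, MemLp.toLp_congr hF hG h]
  · have hG : ¬ MemLp G 2 (volume : Measure (Pt d)) := fun hG => hF (hG.ae_eq (h.mono fun _ => Eq.symm))
    simp [ft, hF, hG]

theorem ft_add {F G : Pt d → ℂ} (hF : MemL2 F) (hG : MemL2 G) : ∀ᵐ y, ft (fun y => F y + G y) y = ft F y + ft G y := by
  unfold MemL2 at hF hG
  have h : MemLp (fun y => F y + G y) 2 volume := MemLp.add hF hG
  rw [ft_eq h, ft_eq hF, ft_eq hG, show h.toLp = MemLp.toLp F hF + MemLp.toLp G hG from MemLp.toLp_add hF hG,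
    FourierTransform.fourier_add]
  exact Lp.coeFn_add _ _

theorem ft_smul (c : ℂ) {F : Pt d → ℂ} (hF : MemL2 F) : ∀ᵐ y, ft (fun y => c * F y) y = c * ft F y := by
  unfold MemL2 at hF
  have h : MemLp (fun y => c * F y) 2 volume := MemLp.const_mul hF c
  rw [ft_eq h, ft_eq hF, show h.toLp = c • MemLp.toLp F hF from MemLp.toLp_const_smul c hF, FourierTransform.fourier_smul]
  exact Lp.coeFn_smul _ _

theorem schwartz_ae {f g : Pt d → ℂ} (hf : LocallyIntegrable f volume) (hg : LocallyIntegrable g volume)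
    (h : ∀ φ : 𝓢(Pt d, ℂ), ∫ z, φ z * f z = ∫ z, φ z * g z) : ∀ᵐ z, f z = g z := by
  refine ae_eq_of_integral_test_eq hf hg fun φ h1 h2 => ?_
  have c : HasCompactSupport (Complex.ofRealCLM ∘ φ) := h2.comp_left rfl
  have s : ContDiff ℝ ∞ (Complex.ofRealCLM ∘ φ) := by fun_prop
  exact h (c.toSchwartzMap s)

theorem integral_ft (φ : 𝓢(Pt d, ℂ)) {F : Pt d → ℂ} (hF : MemL2 F) : ∫ z, φ z * ft F z = ∫ z, (𝓕 φ) z * F z := by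
  have := congrArg (fun T => T φ) (Lp.fourier_toTemperedDistribution_eq (MemLp.toLp F hF))
  simp only [TemperedDistribution.fourier_apply, Lp.toTemperedDistribution_apply, smul_eq_mul] at this
  rw [ft_eq hF, ← this]
  refine integral_congr_ae ?_
  filter_upwards [MemLp.coeFn_toLp hF] with z hz
  rw [hz]

theorem integral_ift (φ : 𝓢(Pt d, ℂ)) {F : Pt d → ℂ} (hF : MemL2 F) : ∫ z, φ z * ift F z = ∫ z, (𝓕⁻ φ) z * F z := by
  have := congrArg (fun T => T φ) (Lp.fourierInv_toTemperedDistribution_eq (MemLp.toLp F hF))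
  simp only [TemperedDistribution.fourierInv_apply, Lp.toTemperedDistribution_apply, smul_eq_mul] at this
  rw [ift_eq hF, ← this]
  refine integral_congr_ae ?_
  filter_upwards [MemLp.coeFn_toLp hF] with z hz
  rw [hz]

theorem memLp_schwartz (φ : 𝓢(Pt d, ℂ)) : MemLp (fun z => φ z) 2 (volume : Measure (Pt d)) := φ.memLp 2 volume

/-- Integration by parts against Schwartz functions. -/
theorem HasWeakDeriv.integral_schwartz {v : Pt d} {F G : Pt d → ℂ} (h : HasWeakDeriv v F G) (hF : MemL2 F) (hG : MemL2 G)
    (φ : 𝓢(Pt d, ℂ)) : ∫ z, (∂_{v} φ) z * F z = - ∫ z, φ z * G z := by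
  -- The Schwartz function is cut off by χ(r z) with r = 1/(n+1) tending to zero. The derivative of
  -- the cutoff carries a factor r, so its contribution vanishes in the limit by dominated
  -- convergence.
  let χ : ContDiffBump (0 : Pt d) := ⟨1, 2, one_pos, one_lt_two⟩
  have hχ : ContDiff ℝ ∞ χ := χ.contDiff
  have hχd : ∀ z, DifferentiableAt ℝ χ z := fun z => hχ.differentiable (by simp) z
  have hφd : ∀ z, DifferentiableAt ℝ φ z := fun z => φ.differentiableAt
  let r : ℕ → ℝ := fun n => ((n : ℝ) + 1)⁻¹
  have hr : Filter.Tendsto r Filter.atTop (nhds 0) := tendsto_inv_atTop_zero.comp (Filter.tendsto_atTop_add_const_right _ 1 tendsto_natCast_atTop_atTop)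
  have hr0 : ∀ n, 0 < r n := fun n => by positivity
  have hr1 : ∀ n, r n ≤ 1 := fun n => inv_le_one_of_one_le₀ (by linarith [(Nat.cast_nonneg n : (0 : ℝ) ≤ n)])
  let ψ : ℕ → Pt d → ℂ := fun n z => (χ (r n • z) : ℂ) * φ z
  have hψ : ∀ n, ContDiff ℝ ∞ (ψ n) := fun n =>
    (Complex.ofRealCLM.contDiff.comp (hχ.comp (contDiff_const_smul (r n)))).mul φ.smooth'
  have hψc : ∀ n, HasCompactSupport (ψ n) := fun n => by
    have h1 : HasCompactSupport (fun z : Pt d => χ (r n • z)) := χ.hasCompactSupport.comp_smul (hr0 n).ne'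
    exact (h1.comp_left (g := fun t : ℝ => (t : ℂ)) (by simp)).mul_right
  have hψd : ∀ n z, fderiv ℝ (ψ n) z v = (χ (r n • z) : ℂ) * (∂_{v} φ) z
      + ((r n * fderiv ℝ χ (r n • z) v : ℝ) : ℂ) * φ z := fun n z => by
    have h0 : HasFDerivAt (fun z : Pt d => r n • z) (r n • ContinuousLinearMap.id ℝ (Pt d)) z :=
      (hasFDerivAt_id z).const_smul (r n)
    have h1 := Complex.ofRealCLM.hasFDerivAt.comp z ((hχd (r n • z)).hasFDerivAt.comp z h0)
    have h2 : HasFDerivAt (ψ n) _ z := h1.mul (hφd z).hasFDerivAt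
    rw [h2.fderiv, lineDerivOp_apply_eq_fderiv]
    simp
    ring
  have e := fun n => h.integral_complex (hψ n) (hψc n)
  obtain ⟨B, hB⟩ := (continuous_fderiv_apply_test hχ v).continuous.bounded_above_of_compact_support
    (hasCompactSupport_fderiv_apply_test χ.hasCompactSupport v)
  have hB0 : 0 ≤ B := (norm_nonneg _).trans (hB 0)
  have hχ1 : ∀ z, ‖(χ z : ℂ)‖ ≤ 1 := fun z => by
    rw [Complex.norm_real, Real.norm_of_nonneg χ.nonneg]; exact χ.le_one
  have lim1 : ∀ z : Pt d, Filter.Tendsto (fun n => (χ (r n • z) : ℂ)) Filter.atTop (nhds 1) := fun z => by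
    have : Filter.Tendsto (fun n => r n • z) Filter.atTop (nhds 0) := by simpa using hr.smul_const z
    have h2 := (hχ.continuous.tendsto 0).comp this
    have h3 : χ 0 = 1 := χ.one_of_mem_closedBall (by simp [χ])
    rw [h3] at h2
    have := (Complex.continuous_ofReal.tendsto 1).comp h2
    rw [Complex.ofReal_one] at this
    exact this
  have lim2 : ∀ z : Pt d, Filter.Tendsto (fun n => ((r n * fderiv ℝ χ (r n • z) v : ℝ) : ℂ)) Filter.atTop (nhds 0) := fun z => by
    refine squeeze_zero_norm (a := fun n => r n * B) (fun n => ?_) (by simpa using hr.mul_const B)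
    rw [Complex.norm_real, norm_mul, Real.norm_of_nonneg (hr0 n).le]
    gcongr
    exact hB _
  have i1 : Integrable (fun z => ‖(∂_{v} φ) z‖ * ‖F z‖) volume := (memLp_schwartz (∂_{v} φ)).norm.integrable_mul (MemLp.norm hF)
  have i2 : Integrable (fun z => B * (‖φ z‖ * ‖F z‖)) volume := ((memLp_schwartz φ).norm.integrable_mul (MemLp.norm hF)).const_mul B
  have i3 : Integrable (fun z => ‖φ z‖ * ‖G z‖) volume := (memLp_schwartz φ).norm.integrable_mul (MemLp.norm hG)
  have t1 : Filter.Tendsto (fun n => ∫ z, fderiv ℝ (ψ n) z v * F z) Filter.atTop (nhds (∫ z, (∂_{v} φ) z * F z)) := by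
    refine tendsto_integral_of_dominated_convergence _ (fun n => ?_) (i1.add i2) (fun n => ?_) ?_
    · exact ((((hψ n).continuous_fderiv (by simp)).clm_apply continuous_const).aestronglyMeasurable).mul hF.1
    · refine Filter.Eventually.of_forall fun z => ?_
      rw [hψd, norm_mul, Pi.add_apply]
      have a1 : ‖(χ (r n • z) : ℂ) * (∂_{v} φ) z‖ ≤ ‖(∂_{v} φ) z‖ := by
        rw [norm_mul]; exact mul_le_of_le_one_left (norm_nonneg _) (hχ1 _)
      have a2 : ‖((r n * fderiv ℝ χ (r n • z) v : ℝ) : ℂ) * φ z‖ ≤ B * ‖φ z‖ := by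
        rw [norm_mul, Complex.norm_real, norm_mul, Real.norm_of_nonneg (hr0 n).le]
        gcongr
        calc _ ≤ 1 * B := mul_le_mul (hr1 n) (hB _) (norm_nonneg _) zero_le_one
          _ = B := one_mul B
      calc _ ≤ (‖(∂_{v} φ) z‖ + B * ‖φ z‖) * ‖F z‖ := by
            gcongr
            exact (norm_add_le _ _).trans (add_le_add a1 a2)
        _ = _ := by ring
    · refine Filter.Eventually.of_forall fun z => ?_
      simp only [hψd]
      have := (((lim1 z).mul_const ((∂_{v} φ) z)).add ((lim2 z).mul_const (φ z))).mul_const (F z)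
      simpa using this
  have t2 : Filter.Tendsto (fun n => ∫ z, ψ n z * G z) Filter.atTop (nhds (∫ z, φ z * G z)) := by
    refine tendsto_integral_of_dominated_convergence _ (fun n => ?_) i3 (fun n => ?_) ?_
    · exact (hψ n).continuous.aestronglyMeasurable.mul hG.1
    · refine Filter.Eventually.of_forall fun z => ?_
      simp only [ψ, norm_mul, mul_assoc]
      exact mul_le_of_le_one_left (by positivity) (hχ1 _)
    · refine Filter.Eventually.of_forall fun z => ?_
      have := ((lim1 z).mul_const (φ z)).mul_const (G z)
      simpa [ψ] using this
  simp only [e] at t1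
  exact tendsto_nhds_unique t1 t2.neg

theorem inner_ev (z : Pt d) (j : Fin d) : inner ℝ z (ev j) = z j := by
  rw [ev, EuclideanSpace.inner_single_right]; simp

theorem locallyIntegrable_mul_coord {F : Pt d → ℂ} (hF : MemL2 F) (j : Fin d) :
    LocallyIntegrable (fun z => 2 * Real.pi * Complex.I * (z j : ℂ) * F z) volume := by
  have hc : Continuous fun z : Pt d => 2 * Real.pi * Complex.I * (z j : ℂ) := by fun_prop
  have := hF.locallyIntegrable.locallyIntegrableOn univ |>.continuousOn_mul hc.continuousOn isOpen_univ.isLocallyClosed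
  exact locallyIntegrableOn_univ.1 this

/-- The Fourier transform turns weak derivatives into multiplications. -/
theorem HasWeakDeriv.ft_eq {F G : Pt d → ℂ} {j : Fin d} (h : HasWeakDeriv (ev j) F G) (hF : MemL2 F) (hG : MemL2 G) :
    ∀ᵐ z, ft G z = 2 * Real.pi * Complex.I * (z j : ℂ) * ft F z := by
  refine schwartz_ae (memL2_ft G).locallyIntegrable (locallyIntegrable_mul_coord (memL2_ft F) j) fun φ => ?_
  have hg : (fun z : Pt d => inner ℝ z (ev j)).HasTemperateGrowth := by fun_prop
  rw [integral_ft φ hG, ← neg_eq_iff_eq_neg.2 (h.integral_schwartz hF hG (𝓕 φ)), lineDerivOp_fourier_eq,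
    ← integral_ft _ hF, ← integral_neg]
  congr 1; funext z
  simp only [smul_apply, smul_eq_mul, smulLeftCLM_apply_apply hg, Complex.real_smul]
  rw [inner_ev]
  ring

/-- Both pairings of the weak formulation are moved to the Fourier side, where differentiation of
the test function is a multiplication. -/
theorem hasWeakDeriv_of_ft {F G : Pt d → ℂ} {j : Fin d} (hF : MemL2 F) (hG : MemL2 G)
    (h : ∀ᵐ z, ft G z = 2 * Real.pi * Complex.I * (z j : ℂ) * ft F z) : HasWeakDeriv (ev j) F G := by
  refine ⟨hF.locallyIntegrable, hG.locallyIntegrable, fun φ h1 h2 => ?_⟩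
  have c : HasCompactSupport (Complex.ofRealCLM ∘ φ) := h2.comp_left rfl
  have s : ContDiff ℝ ∞ (Complex.ofRealCLM ∘ φ) := by fun_prop
  let φ' : 𝓢(Pt d, ℂ) := c.toSchwartzMap s
  have hg : (fun z : Pt d => inner ℝ z (ev j)).HasTemperateGrowth := by fun_prop
  have e1 : ∀ z, ((fderiv ℝ φ z (ev j) : ℝ) : ℂ) = (∂_{ev j} φ') z := fun z => by
    rw [lineDerivOp_apply_eq_fderiv]
    have := (Complex.ofRealCLM.hasFDerivAt.comp z ((h1.differentiable (by simp)) z).hasFDerivAt).fderiv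
    change _ = fderiv ℝ (Complex.ofRealCLM ∘ φ) z (ev j)
    rw [this]; rfl
  have e2 : ∀ z, ((φ z : ℝ) : ℂ) = φ' z := fun z => rfl
  have e3 : ∀ (ψ : 𝓢(Pt d, ℂ)) {H : Pt d → ℂ}, MemL2 H → ∫ z, ψ z * H z = ∫ z, (𝓕⁻ ψ) z * ft H z := fun ψ H hH => by
    rw [← integral_ift ψ (memL2_ft H)]
    refine integral_congr_ae ?_
    filter_upwards [ift_ft hH] with z hz
    rw [hz]
  simp only [e1, e2]
  rw [e3 _ hF, e3 _ hG, fourierInv_lineDerivOp_eq, ← integral_neg]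
  refine integral_congr_ae ?_
  filter_upwards [h] with z hz
  simp only [smul_apply, smul_eq_mul, smulLeftCLM_apply_apply hg, Complex.real_smul, hz]
  rw [inner_ev]
  ring

end FourierSide

end MultiScale

/-! ### Sobolev spaces through Fourier weights, and boundedness of Q -/

namespace MultiScale

section FourierWeights

open FourierTransform SchwartzMap LineDeriv

variable {d : ℕ}

/-- The weight `(1 + |ξ|²)^{1/2}`. -/
def jb (z : Pt d) : ℝ := Real.sqrt (1 + ‖z‖ ^ 2)

theorem jb_sq (z : Pt d) : jb z ^ 2 = 1 + ‖z‖ ^ 2 := Real.sq_sqrt (by positivity)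

theorem one_le_jb (z : Pt d) : 1 ≤ jb z := Real.one_le_sqrt.2 (by nlinarith [sq_nonneg ‖z‖])

theorem jb_pos (z : Pt d) : 0 < jb z := one_pos.trans_le (one_le_jb z)

theorem norm_le_jb (z : Pt d) : ‖z‖ ≤ jb z := Real.le_sqrt_of_sq_le (by linarith)

theorem abs_coord_le_jb (z : Pt d) (j : Fin d) : |z j| ≤ jb z :=
  (by simpa using PiLp.norm_apply_le z j : |z j| ≤ ‖z‖).trans (norm_le_jb z)

theorem continuous_jb : Continuous (jb (d := d)) := by unfold jb; fun_prop

theorem jb_le (z : Pt d) : jb z ≤ 1 + ∑ j, |z j| := by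
  have h : ‖z‖ ^ 2 ≤ (∑ j, |z j|) ^ 2 := by
    rw [EuclideanSpace.norm_sq_eq]
    simpa using Finset.sum_sq_le_sq_sum_of_nonneg (s := Finset.univ) (f := fun j => |z j|) fun j _ => abs_nonneg _
  have h0 : 0 ≤ ∑ j, |z j| := Finset.sum_nonneg fun j _ => abs_nonneg _
  exact Real.sqrt_le_iff.2 ⟨by positivity, by nlinarith⟩

theorem jb_add_le (y z : Pt d) : jb (y + z) ≤ jb y + jb z := by
  refine Real.sqrt_le_iff.2 ⟨by linarith [jb_pos y, jb_pos z], ?_⟩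
  have h1 := norm_add_le y z
  have h2 : ‖y‖ * ‖z‖ ≤ jb y * jb z := mul_le_mul (norm_le_jb y) (norm_le_jb z) (norm_nonneg _) (jb_pos y).le
  have h3 : ‖y + z‖ ^ 2 ≤ (‖y‖ + ‖z‖) ^ 2 := by gcongr
  nlinarith [jb_sq y, jb_sq z]

theorem stronglyMeasurable_ft (F : Pt d → ℂ) : StronglyMeasurable (ft F) := by
  unfold ft
  split_ifs with h
  · exact Lp.stronglyMeasurable _
  · exact stronglyMeasurable_zero

theorem memL2_of_le {F G : Pt d → ℂ} (hG : MemL2 G) (hF : AEStronglyMeasurable F volume) (c : ℝ)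
    (h : ∀ᵐ z, ‖F z‖ ≤ c * ‖G z‖) : MemL2 F := MemLp.of_le_mul hG hF h

theorem aestronglyMeasurable_jb_mul (k : ℕ) (F : Pt d → ℂ) :
    AEStronglyMeasurable (fun z => ((jb z ^ k : ℝ) : ℂ) * ft F z) volume :=
  (Complex.continuous_ofReal.comp (continuous_jb.pow k)).aestronglyMeasurable.mul (stronglyMeasurable_ft F).aestronglyMeasurable

/-- Sobolev spaces of integer order in terms of the Fourier transform. -/
theorem memH_iff {k : ℕ} {F : Pt d → ℂ} : MemH k F ↔ MemL2 F ∧ MemL2 fun z => ((jb z ^ k : ℝ) : ℂ) * ft F z := by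
  induction k generalizing F with
  | zero =>
    simp only [pow_zero, Complex.ofReal_one, one_mul]
    exact ⟨fun h => ⟨h, memL2_ft F⟩, fun h => h.1⟩
  | succ k ih =>
    constructor
    · intro h
      refine ⟨h.base, ?_⟩
      have h0 := (ih.1 (MemSob.mono (Nat.le_succ k) h)).2
      have h1 : ∀ j, MemL2 fun z => ((jb z ^ k : ℝ) : ℂ) * ft (wd (ev j) F) z := fun j => (ih.1 (MemSob.wd h j)).2
      have h2 : ∀ᵐ z, ∀ j, ft (wd (ev j) F) z = 2 * Real.pi * Complex.I * (z j : ℂ) * ft F z := by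
        rw [ae_all_iff]
        exact fun j => (MemSob.hasWeakDeriv h j).ft_eq h.base (MemSob.wd h j).base
      -- The weight of order k + 1 is at most the weight of order k times 1 + Σ|ξ_j|, and the
      -- factors ξ_j are accounted for by the derivatives of F.
      have hm : MemLp (fun z => ‖((jb z ^ k : ℝ) : ℂ) * ft F z‖
          + ∑ j, ‖((jb z ^ k : ℝ) : ℂ) * ft (wd (ev j) F) z‖) 2 volume :=
        (MemLp.norm h0).add (memLp_finsetSum _ fun j _ => MemLp.norm (h1 j))
      refine hm.mono' (aestronglyMeasurable_jb_mul _ F) ?_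
      filter_upwards [h2] with z hz
      simp only [norm_mul, Complex.norm_real, Real.norm_of_nonneg (pow_nonneg (jb_pos z).le _), hz]
      have e : ∀ j : Fin d, |z j| ≤ ‖(2 : ℂ)‖ * ‖Real.pi‖ * ‖Complex.I‖ * |z j| := fun j => by
        refine le_mul_of_one_le_left (abs_nonneg _) ?_
        rw [Complex.norm_I, Real.norm_of_nonneg Real.pi_pos.le]
        norm_num
        linarith [Real.pi_gt_three]
      calc jb z ^ (k + 1) * ‖ft F z‖ = jb z ^ k * ‖ft F z‖ * jb z := by ring
        _ ≤ jb z ^ k * ‖ft F z‖ * (1 + ∑ j, ‖(2 : ℂ)‖ * ‖Real.pi‖ * ‖Complex.I‖ * |z j|) := by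
          refine mul_le_mul_of_nonneg_left ((jb_le z).trans ?_) (mul_nonneg (pow_nonneg (jb_pos z).le _) (norm_nonneg _))
          gcongr with j
          exact e j
        _ = _ := by
          rw [mul_add, mul_one, Finset.mul_sum]
          congr 1
          refine Finset.sum_congr rfl fun j _ => ?_
          rw [Real.norm_eq_abs (z j)]; ring
    · rintro ⟨h0, h⟩
      have hc : ∀ j : Fin d, Continuous fun z : Pt d => 2 * Real.pi * Complex.I * (z j : ℂ) := fun j => by fun_prop
      have hb : ∀ (j : Fin d) (z : Pt d), ‖2 * Real.pi * Complex.I * (z j : ℂ)‖ ≤ 2 * Real.pi * jb z := fun j z => by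
        rw [norm_mul, norm_mul, norm_mul, Complex.norm_I, Complex.norm_real, Complex.norm_real,
          Real.norm_of_nonneg Real.pi_pos.le, Real.norm_eq_abs, mul_one]
        have := abs_coord_le_jb z j
        have : ‖(2 : ℂ)‖ = 2 := by norm_num
        rw [this]
        gcongr
      have m1 : ∀ j : Fin d, MemL2 fun z => 2 * Real.pi * Complex.I * (z j : ℂ) * ft F z := fun j => by
        refine memL2_of_le h ((hc j).aestronglyMeasurable.mul (stronglyMeasurable_ft F).aestronglyMeasurable) (2 * Real.pi)
          (Filter.Eventually.of_forall fun z => ?_)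
        simp only [norm_mul _ (ft F z), Complex.norm_real, Real.norm_of_nonneg (pow_nonneg (jb_pos z).le _)]
        rw [← mul_assoc]
        gcongr
        refine (hb j z).trans ?_
        gcongr
        exact le_self_pow₀ (one_le_jb z) (by omega)
      -- The weak derivatives are constructed: the j-th one is the inverse transform of 2πi ξ_j
      -- F̂(ξ), a square integrable function because k + 1 ≥ 1.
      have e1 := fun j => ft_ift (m1 j)
      refine memSob_succ_of (isFunSpace_memSob isFunSpace_memL2 _ k) h0
        (ud := fun j => ift fun z => 2 * Real.pi * Complex.I * (z j : ℂ) * ft F z)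
        (fun j => hasWeakDeriv_of_ft h0 (memL2_ift _) (e1 j)) fun j => ih.2 ⟨memL2_ift _, ?_⟩
      refine memL2_of_le h (aestronglyMeasurable_jb_mul _ _) (2 * Real.pi) ?_
      filter_upwards [e1 j] with z hz
      rw [hz, norm_mul, norm_mul _ (ft F z), norm_mul _ (ft F z), Complex.norm_real, Complex.norm_real,
        Real.norm_of_nonneg (pow_nonneg (jb_pos z).le _), Real.norm_of_nonneg (pow_nonneg (jb_pos z).le _)]
      calc _ ≤ jb z ^ k * (2 * Real.pi * jb z * ‖ft F z‖) := by
            refine mul_le_mul_of_nonneg_left ?_ (pow_nonneg (jb_pos z).le _)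
            exact mul_le_mul_of_nonneg_right (hb j z) (norm_nonneg _)
        _ = _ := by ring

theorem jb_rpow (z : Pt d) (s : ℝ) : jb z ^ s = (1 + ‖z‖ ^ 2) ^ (s / 2) := by
  rw [jb, Real.sqrt_eq_rpow, ← Real.rpow_mul (by positivity)]
  congr 1; ring

theorem continuous_jb_rpow (s : ℝ) : Continuous fun z : Pt d => jb z ^ s :=
  continuous_jb.rpow_const fun z => Or.inl (jb_pos z).ne'

/-- Sobolev spaces of real order in terms of the Fourier transform. -/
theorem MemHReal.memL2_ft {s : ℝ} {Q : Pt d → ℝ} (h : MemHReal s Q) :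
    MemL2 (fun y => (Q y : ℂ)) ∧ MemL2 fun z => ((jb z ^ s : ℝ) : ℂ) * ft (fun y => (Q y : ℂ)) z := by
  obtain ⟨hQ, h⟩ := h
  refine ⟨hQ, ?_⟩
  obtain ⟨f', hf'⟩ := TemperedDistribution.memSobolev_iff_exists_smulLeftCLM_fourier.1 h
  have hg : (fun x : Pt d => (((1 + ‖x‖ ^ 2) ^ (s / 2) : ℝ) : ℂ)).HasTemperateGrowth := by fun_prop
  have hm : MemL2 (⇑f') := Lp.memLp f'
  have hloc : LocallyIntegrable (fun z => ((jb z ^ s : ℝ) : ℂ) * ft (fun y => (Q y : ℂ)) z) volume := by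
    have hc : Continuous fun z : Pt d => ((jb z ^ s : ℝ) : ℂ) := Complex.continuous_ofReal.comp (continuous_jb_rpow s)
    exact locallyIntegrableOn_univ.1 ((MultiScale.memL2_ft (fun y => (Q y : ℂ))).locallyIntegrable.locallyIntegrableOn univ
      |>.continuousOn_mul hc.continuousOn isOpen_univ.isLocallyClosed)
  have := schwartz_ae hloc hm.locallyIntegrable fun φ => by
    have := congrArg (fun T => T φ) hf'
    rw [Lp.fourier_toTemperedDistribution_eq] at this
    simp only [TemperedDistribution.smulLeftCLM_apply_apply, Lp.toTemperedDistribution_apply, smul_eq_mul,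
      SchwartzMap.smulLeftCLM_apply_apply hg] at this
    rw [← this, ft_eq hQ]
    congr 1; funext z
    rw [jb_rpow]; ring
  exact MemLp.ae_eq (this.mono fun z hz => hz.symm) hm

/-- The inverse Fourier transform of integrable functions. -/
theorem ift_eq_integral {K : Pt d → ℂ} (h2 : MemL2 K) (h1 : Integrable K volume) :
    ∀ᵐ y, ift K y = 𝓕⁻ K y := by
  have hcont : Continuous (𝓕⁻ K) := by
    have := VectorFourier.fourierIntegral_continuous (L := -innerₗ (Pt d)) Real.continuous_fourierChar
      (by simp only [LinearMap.neg_apply]; exact continuous_inner.neg) h1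
    exact this
  -- The L² transform is characterized by duality with Schwartz functions, and the integral formula
  -- obeys the same duality by Fubini.
  refine schwartz_ae (memL2_ift K).locallyIntegrable hcont.locallyIntegrable fun φ => ?_
  rw [integral_ift φ h2]
  have := VectorFourier.integral_fourierIntegral_smul_eq_flip (L := -innerₗ (Pt d)) (μ := volume) (ν := volume)
    Real.continuous_fourierChar (by simp only [LinearMap.neg_apply]; exact continuous_inner.neg) φ.integrable h1
  have e : (-innerₗ (Pt d)).flip = -innerₗ (Pt d) := by
    ext x y; simp [real_inner_comm]
  rw [e] at this
  simp only [smul_eq_mul] at this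
  rw [fourierInv_coe]
  exact this

theorem norm_fourierInv_le (K : Pt d → ℂ) (y : Pt d) : ‖𝓕⁻ K y‖ ≤ ∫ z, ‖K z‖ :=
  VectorFourier.norm_fourierIntegral_le_integral_norm _ _ _ _ _

theorem memLp_jb_rpow_neg {s : ℝ} (hs : (d : ℝ) < 2 * s) : MemLp (fun z : Pt d => ((jb z ^ (-s) : ℝ) : ℂ)) 2 volume := by
  have hm : AEStronglyMeasurable (fun z : Pt d => ((jb z ^ (-s) : ℝ) : ℂ)) volume :=
    (Complex.continuous_ofReal.comp (continuous_jb_rpow _)).aestronglyMeasurable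
  rw [memLp_two_iff_integrable_sq_norm hm]
  have := integrable_rpow_neg_one_add_norm_sq (E := Pt d) (μ := volume) (r := 2 * s) (by simpa using hs)
  refine this.congr (Filter.Eventually.of_forall fun z => ?_)
  simp only
  rw [Complex.norm_real, Real.norm_of_nonneg (Real.rpow_nonneg (jb_pos z).le _), ← Real.rpow_natCast (jb z ^ (-s)),
    ← Real.rpow_mul (jb_pos z).le, jb_rpow]
  congr 1; push_cast; ring

/-- Cauchy-Schwarz against the weight of order -s, which is square integrable as 2s > d. -/
theorem memL1_ft_of_memHReal {s : ℝ} (hs : (d : ℝ) < 2 * s) {Q : Pt d → ℝ} (h : MemHReal s Q) :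
    Integrable (ft fun y => (Q y : ℂ)) volume := by
  have h1 : Integrable (fun z => ((jb z ^ (-s) : ℝ) : ℂ) * (((jb z ^ s : ℝ) : ℂ) * ft (fun y => (Q y : ℂ)) z)) volume :=
    (memLp_jb_rpow_neg hs).integrable_mul h.memL2_ft.2
  refine h1.congr (Filter.Eventually.of_forall fun z => ?_)
  simp only
  rw [← mul_assoc, ← Complex.ofReal_mul, ← Real.rpow_add (jb_pos z)]
  simp

/-- Sobolev embedding: the Fourier inversion integral converges absolutely and is bounded by the L¹
norm of the transform. -/
theorem MemHReal.bounded {s : ℝ} (hs : (d : ℝ) < 2 * s) {Q : Pt d → ℝ} (h : MemHReal s Q) : MemLp Q ∞ volume := by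
  have h2 := h.memL2_ft.1
  have e1 := ift_ft h2
  have e2 := ift_eq_integral (MultiScale.memL2_ft _) (memL1_ft_of_memHReal hs h)
  have hm : AEStronglyMeasurable Q volume := by
    have := Complex.continuous_re.comp_aestronglyMeasurable h2.1
    simpa [Function.comp_def] using this
  refine memLp_top_of_bound hm (∫ z, ‖ft (fun y => (Q y : ℂ)) z‖) ?_
  filter_upwards [e1, e2] with y a b
  have := norm_fourierInv_le (ft fun y => (Q y : ℂ)) y
  rw [← b, a, Complex.norm_real] at this
  exact this

end FourierWeights

end MultiScale

/-! ### Convolutions and multiplication by Q on Sobolev spaces -/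

namespace MultiScale

section FourierProducts

open FourierTransform SchwartzMap LineDeriv

variable {d : ℕ}

/-- Cauchy-Schwarz for the factorization ab = a^{1/2} (ab²)^{1/2}. -/
theorem sq_lintegral_mul_le {α : Type*} [MeasurableSpace α] {μ : Measure α} {a b : α → ℝ≥0∞} (ha : Measurable a)
    (hb : Measurable b) : (∫⁻ x, a x * b x ∂μ) ^ 2 ≤ (∫⁻ x, a x ∂μ) * ∫⁻ x, a x * b x ^ 2 ∂μ := by
  have h := ENNReal.lintegral_mul_norm_pow_le (μ := μ) (f := a) (g := fun x => a x * b x ^ 2) ha.aemeasurable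
    (ha.mul (hb.pow_const 2)).aemeasurable (p := 1 / 2) (q := 1 / 2) (by norm_num) (by norm_num) (by norm_num)
  have e : ∀ x, a x ^ (1 / 2 : ℝ) * (a x * b x ^ 2) ^ (1 / 2 : ℝ) = a x * b x := fun x => by
    rw [ENNReal.mul_rpow_of_nonneg _ _ (by norm_num : (0 : ℝ) ≤ 1 / 2), ← mul_assoc, ← ENNReal.rpow_add_of_nonneg _ _ (by norm_num) (by norm_num),
      ← ENNReal.rpow_natCast, ← ENNReal.rpow_mul]
    norm_num
  simp only [e] at h
  calc _ ≤ ((∫⁻ x, a x ∂μ) ^ (1 / 2 : ℝ) * (∫⁻ x, a x * b x ^ 2 ∂μ) ^ (1 / 2 : ℝ)) ^ 2 := by gcongr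
    _ = _ := by
      rw [mul_pow, ← ENNReal.rpow_natCast, ← ENNReal.rpow_natCast, ← ENNReal.rpow_mul, ← ENNReal.rpow_mul]
      norm_num

/-- Young's inequality for the convolution of an integrable and a square integrable function. -/
theorem lintegral_conv_sq_le {a b : Pt d → ℝ≥0∞} (ha : Measurable a) (hb : Measurable b) :
    ∫⁻ ξ, (∫⁻ η, a η * b (ξ - η)) ^ 2 ≤ (∫⁻ η, a η) ^ 2 * ∫⁻ η, b η ^ 2 := by
  have hm : Measurable fun z : Pt d × Pt d => a z.2 * b (z.1 - z.2) ^ 2 :=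
    (ha.comp measurable_snd).mul ((hb.comp (measurable_fst.sub measurable_snd)).pow_const 2)
  calc _ ≤ ∫⁻ ξ, (∫⁻ η, a η) * ∫⁻ η, a η * b (ξ - η) ^ 2 :=
        lintegral_mono fun ξ => sq_lintegral_mul_le ha (hb.comp (measurable_const.sub measurable_id))
    _ = (∫⁻ η, a η) * ∫⁻ ξ, ∫⁻ η, a η * b (ξ - η) ^ 2 := lintegral_const_mul _ hm.lintegral_prod_right'
    _ = (∫⁻ η, a η) * ∫⁻ η, ∫⁻ ξ, a η * b (ξ - η) ^ 2 := by rw [lintegral_lintegral_swap hm.aemeasurable]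
    _ = (∫⁻ η, a η) * ∫⁻ η, a η * ∫⁻ ξ, b ξ ^ 2 := by
      congr 1
      refine lintegral_congr fun η => ?_
      have hb' : Measurable fun ξ => b (ξ - η) ^ 2 := (hb.comp (measurable_id.sub_const η)).pow_const 2
      rw [lintegral_const_mul _ hb']
      congr 1
      exact lintegral_sub_right_eq_self (fun ξ => b ξ ^ 2) η
    _ = _ := by rw [lintegral_mul_const _ ha]; ring

theorem memL2_iff_lintegral {F : Pt d → ℂ} (hF : AEStronglyMeasurable F volume) :
    MemL2 F ↔ ∫⁻ z, ‖F z‖ₑ ^ 2 < ⊤ := by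
  have := eLpNorm_lt_top_iff_lintegral_rpow_enorm_lt_top (f := F) (μ := (volume : Measure (Pt d))) (p := 2) (by norm_num) (by norm_num)
  simp only [ENNReal.toReal_ofNat, ENNReal.rpow_ofNat] at this
  exact ⟨fun h => this.1 h.2, fun h => ⟨hF, this.2 h⟩⟩

/-- The convolution of `K` and `f`. -/
def conv (K f : Pt d → ℂ) (ξ : Pt d) : ℂ := ∫ η, K η * f (ξ - η)

theorem stronglyMeasurable_conv {K f : Pt d → ℂ} (hK : StronglyMeasurable K) (hf : StronglyMeasurable f) :
    StronglyMeasurable (conv K f) := by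
  have hm : StronglyMeasurable fun z : Pt d × Pt d => K z.2 * f (z.1 - z.2) :=
    (hK.comp_measurable measurable_snd).mul (hf.comp_measurable (measurable_fst.sub measurable_snd))
  exact hm.integral_prod_right'

theorem enorm_conv_le (K f : Pt d → ℂ) (ξ : Pt d) : ‖conv K f ξ‖ₑ ≤ ∫⁻ η, ‖K η‖ₑ * ‖f (ξ - η)‖ₑ := by
  refine (enorm_integral_le_lintegral_enorm _).trans (le_of_eq ?_)
  simp only [enorm_mul]

theorem memL2_conv {K f : Pt d → ℂ} (hK : StronglyMeasurable K) (hf : StronglyMeasurable f) (hKi : Integrable K volume)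
    (hf2 : MemL2 f) : MemL2 (conv K f) := by
  rw [memL2_iff_lintegral (stronglyMeasurable_conv hK hf).aestronglyMeasurable]
  refine lt_of_le_of_lt ((lintegral_mono fun ξ => pow_le_pow_left' (enorm_conv_le K f ξ) 2).trans
    (lintegral_conv_sq_le hK.enorm hf.enorm)) ?_
  exact ENNReal.mul_lt_top (ENNReal.pow_lt_top hKi.2) ((memL2_iff_lintegral hf.aestronglyMeasurable).1 hf2)

/-- Provides Fubini for the transform of a product. For fixed η the inner integral is bounded by
|K(η)| times a constant, by st ≤ s² + t² and translation invariance. -/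
theorem integrable_schwartz_conv {K f : Pt d → ℂ} (sK : StronglyMeasurable K) (hK : Integrable K volume)
    (sf : StronglyMeasurable f) (hf : MemL2 f) (φ : 𝓢(Pt d, ℂ)) :
    Integrable (fun z : Pt d × Pt d => φ z.1 * (K z.2 * f (z.1 - z.2))) (volume.prod volume) := by
  have hm : AEStronglyMeasurable (fun z : Pt d × Pt d => φ z.1 * (K z.2 * f (z.1 - z.2))) (volume.prod volume) :=
    (((φ.continuous.comp continuous_fst).stronglyMeasurable).mul ((sK.comp_measurable measurable_snd).mul
      (sf.comp_measurable (measurable_fst.sub measurable_snd)))).aestronglyMeasurable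
  refine ⟨hm, ?_⟩
  rw [HasFiniteIntegral, lintegral_prod_symm _ hm.enorm]
  have hb : ∀ η, ∫⁻ x, ‖φ x * (K η * f (x - η))‖ₑ ≤ ‖K η‖ₑ * ((∫⁻ x, ‖φ x‖ₑ ^ 2) + ∫⁻ x, ‖f x‖ₑ ^ 2) := by
    intro η
    calc _ ≤ ∫⁻ x, ‖K η‖ₑ * (‖φ x‖ₑ ^ 2 + ‖f (x - η)‖ₑ ^ 2) := by
          refine lintegral_mono fun x => ?_
          rw [enorm_mul, enorm_mul, mul_left_comm]
          gcongr
          have : ∀ s t : ℝ≥0∞, s * t ≤ s ^ 2 + t ^ 2 := fun s t => by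
            rcases le_total s t with h | h
            · calc s * t ≤ t * t := by gcongr
                _ ≤ _ := by rw [← sq]; exact le_add_self
            · calc s * t ≤ s * s := by gcongr
                _ ≤ _ := by rw [← sq]; exact le_self_add
          exact this _ _
      _ = _ := by
          have m1 : Measurable fun x => ‖φ x‖ₑ ^ 2 := φ.continuous.enorm.measurable.pow_const 2
          have m2 : Measurable fun x => ‖f (x - η)‖ₑ ^ 2 := (sf.enorm.comp (measurable_id.sub_const η)).pow_const 2
          have m12 : Measurable fun x => ‖φ x‖ₑ ^ 2 + ‖f (x - η)‖ₑ ^ 2 := m1.add m2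
          rw [lintegral_const_mul _ m12, lintegral_add_left m1]
          congr 2
          exact lintegral_sub_right_eq_self (fun x => ‖f x‖ₑ ^ 2) η
  refine lt_of_le_of_lt (lintegral_mono hb) ?_
  rw [lintegral_mul_const _ sK.enorm]
  refine ENNReal.mul_lt_top hK.2 (ENNReal.add_lt_top.2 ⟨?_, ?_⟩)
  · exact (memL2_iff_lintegral φ.continuous.aestronglyMeasurable).1 (memLp_schwartz φ)
  · exact (memL2_iff_lintegral sf.aestronglyMeasurable).1 hf

/-- A modulation of the transform is the transform of a translate. This is how the shift in the
convolution of `ft_mul` arises. -/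
theorem fourierChar_mul_fourier (φ : 𝓢(Pt d, ℂ)) (η y : Pt d) :
    (Real.fourierChar (inner ℝ η y) : ℂ) * (𝓕 φ) y = (𝓕 (φ.compSubConstCLM ℂ (-η))) y := by
  simp only [fourier_coe]
  rw [Real.fourier_eq, Real.fourier_eq, ← integral_const_mul]
  rw [← integral_sub_right_eq_self _ (-η)]
  congr 1; funext x
  simp only [Circle.smul_def, smul_eq_mul, SchwartzMap.compSubConstCLM_apply, ← mul_assoc]
  rw [← Circle.coe_mul, ← AddChar.map_add_eq_mul]
  congr 3
  rw [sub_neg_eq_add, inner_add_left]; ring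

/-- The Fourier transform of a product. -/
theorem ft_mul {Q F : Pt d → ℂ} (hQ : MemL2 Q) (hK : Integrable (ft Q) volume) (hF : MemL2 F)
    (hQF : MemL2 fun y => Q y * F y) : ∀ᵐ ξ, ft (fun y => Q y * F y) ξ = conv (ft Q) (ft F) ξ := by
  have sK := stronglyMeasurable_ft Q
  have sf := stronglyMeasurable_ft F
  refine schwartz_ae (memL2_ft _).locallyIntegrable (memL2_conv sK sf hK (memL2_ft F)).locallyIntegrable fun φ => ?_
  -- Q is an absolutely convergent superposition of characters. It is inserted into the pairing of
  -- QF with the transformed test function, and the order of integration is exchanged.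
  have hQe : ∀ᵐ y, Q y = ∫ η, (Real.fourierChar (inner ℝ η y) : ℂ) * ft Q η := by
    filter_upwards [ift_ft hQ, ift_eq_integral (memL2_ft Q) hK] with y a b
    rw [← a, b, Real.fourierInv_eq]
    rfl
  have hψ : Integrable (fun y => (𝓕 φ) y * F y) volume := (memLp_schwartz (𝓕 φ)).integrable_mul hF
  have hce : Continuous fun z : Pt d × Pt d => (Real.fourierChar (inner ℝ z.2 z.1) : ℂ) := by fun_prop
  have i1 : Integrable (fun z : Pt d × Pt d => (Real.fourierChar (inner ℝ z.2 z.1) : ℂ) * (((𝓕 φ) z.1 * F z.1) * ft Q z.2))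
      (volume.prod volume) := by
    refine (hψ.mul_prod hK).bdd_mul (c := 1) hce.aestronglyMeasurable (Filter.Eventually.of_forall fun z => (Circle.norm_coe _).le)
  have i2 := integrable_schwartz_conv sK hK sf (memL2_ft F) φ
  have s1 : ∫ z, φ z * ft (fun y => Q y * F y) z = ∫ y, (𝓕 φ) y * (Q y * F y) := integral_ft φ hQF
  generalize hΦ : 𝓕 φ = Φ at *
  have s2 : ∫ y, Φ y * (Q y * F y) = ∫ y, ∫ η, (Real.fourierChar (inner ℝ η y) : ℂ) * ((Φ y * F y) * ft Q η) := by
    refine integral_congr_ae ?_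
    filter_upwards [hQe] with y hy
    simp only [mul_left_comm _ (Φ y * F y)]
    rw [integral_const_mul, ← hy]; ring
  have s3 : ∫ y, ∫ η, (Real.fourierChar (inner ℝ η y) : ℂ) * ((Φ y * F y) * ft Q η)
      = ∫ η, ∫ y, (Real.fourierChar (inner ℝ η y) : ℂ) * ((Φ y * F y) * ft Q η) := integral_integral_swap i1
  have s4 : ∀ η, ∫ y, (Real.fourierChar (inner ℝ η y) : ℂ) * ((Φ y * F y) * ft Q η)
      = ∫ x, φ x * (ft Q η * ft F (x - η)) := fun η => by
    have e1 := fourierChar_mul_fourier φ η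
    rw [hΦ] at e1
    have t1 : ∫ y, (Real.fourierChar (inner ℝ η y) : ℂ) * ((Φ y * F y) * ft Q η)
        = ft Q η * ∫ y, (𝓕 (φ.compSubConstCLM ℂ (-η))) y * F y := by
      rw [← integral_const_mul]
      congr 1; funext y
      rw [← e1]; ring
    have t2 : ∫ x, φ (x + η) * ft F x = ∫ x, φ x * ft F (x - η) := by
      rw [← integral_sub_right_eq_self (fun x => φ (x + η) * ft F x) η]
      simp
    rw [t1, ← integral_ft _ hF]
    simp only [SchwartzMap.compSubConstCLM_apply, sub_neg_eq_add]
    rw [t2, ← integral_const_mul]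
    congr 1; funext x; ring
  have s5 : ∫ η, ∫ x, φ x * (ft Q η * ft F (x - η)) = ∫ x, ∫ η, φ x * (ft Q η * ft F (x - η)) :=
    (integral_integral_swap i2).symm
  rw [s1, s2, s3]
  simp only [s4]
  rw [s5]
  simp only [integral_const_mul, conv]

/-- Multiplication by a function in `H^σ(ℝ^d)` preserves `H^s(ℝ^d)` for `s ≤ σ`. -/
theorem memH_mul {σ : ℝ} (hσ : (d : ℝ) < 2 * σ) {Q : Pt d → ℝ} (hQ : MemHReal σ Q) {s : ℕ} (hs : (s : ℝ) ≤ σ)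
    {F : Pt d → ℂ} (hF : MemH s F) : MemH s fun y => (Q y : ℂ) * F y := by
  set K := ft fun y => (Q y : ℂ) with hK
  have hKi : Integrable K volume := memL1_ft_of_memHReal hσ hQ
  have hQF : MemL2 fun y => (Q y : ℂ) * F y := memLp_bounded_mul (hQ.bounded hσ) hF.base
  have sK : StronglyMeasurable K := stronglyMeasurable_ft _
  have sf : StronglyMeasurable (ft F) := stronglyMeasurable_ft _
  have mj : ∀ r : ℝ, Measurable fun z : Pt d => ENNReal.ofReal (jb z ^ r) := fun r =>
    ENNReal.measurable_ofReal.comp (continuous_jb_rpow r).measurable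
  obtain ⟨_, hF2⟩ := memH_iff.1 hF
  refine memH_iff.2 ⟨hQF, ?_⟩
  rw [memL2_iff_lintegral (aestronglyMeasurable_jb_mul _ _)]
  rw [memL2_iff_lintegral (aestronglyMeasurable_jb_mul _ _)] at hF2
  have hK2 := hQ.memL2_ft.2
  have hKm : AEStronglyMeasurable (fun z => ((jb z ^ σ : ℝ) : ℂ) * K z) volume := hK2.1
  rw [memL2_iff_lintegral hKm] at hK2
  have en : ∀ (r : ℝ) (z : Pt d) (c : ℂ), ‖((jb z ^ r : ℝ) : ℂ) * c‖ₑ = ENNReal.ofReal (jb z ^ r) * ‖c‖ₑ := fun r z c => by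
    rw [enorm_mul, ← ofReal_norm, Complex.norm_real, Real.norm_of_nonneg (Real.rpow_nonneg (jb_pos z).le _)]
  have en' : ∀ (z : Pt d) (c : ℂ), ‖((jb z ^ s : ℝ) : ℂ) * c‖ₑ = ENNReal.ofReal (jb z ^ (s : ℝ)) * ‖c‖ₑ := fun z c => by
    rw [← en, Real.rpow_natCast]
  simp only [en, en'] at hK2 hF2 ⊢
  set a : Pt d → ℝ≥0∞ := fun η => ‖K η‖ₑ with ha
  set b : Pt d → ℝ≥0∞ := fun η => ENNReal.ofReal (jb η ^ (s : ℝ)) * ‖ft F η‖ₑ with hb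
  set a' : Pt d → ℝ≥0∞ := fun η => ENNReal.ofReal (jb η ^ σ) * ‖K η‖ₑ with ha'
  set b' : Pt d → ℝ≥0∞ := fun η => ENNReal.ofReal (jb η ^ (-σ)) * (ENNReal.ofReal (jb η ^ (s : ℝ)) * ‖ft F η‖ₑ) with hb'
  have ma : Measurable a := sK.enorm
  have mb : Measurable b := (mj _).mul sf.enorm
  have ma' : Measurable a' := (mj _).mul sK.enorm
  have mb' : Measurable b' := (mj _).mul mb
  -- The weight at ξ is at most twice the larger of the weights at η and ξ - η. If ξ - η dominates,
  -- the whole weight goes to F, leaving an L¹ function convolved with an L² function. If η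
  -- dominates, Q receives the weight of order σ and F the weight of order s - σ ≤ 0; the comparison
  -- of these weights uses s ≤ σ.
  have key : ∀ ξ η : Pt d, ENNReal.ofReal (jb ξ ^ (s : ℝ)) * (‖K η‖ₑ * ‖ft F (ξ - η)‖ₑ)
      ≤ 2 ^ s * (a η * b (ξ - η) + a' η * b' (ξ - η)) := by
    intro ξ η
    have h1 : jb ξ ≤ jb η + jb (ξ - η) := by simpa using jb_add_le η (ξ - η)
    have p1 := jb_pos η
    have p2 := jb_pos (ξ - η)
    rcases le_total (jb η) (jb (ξ - η)) with h | h
    · have h2 : jb ξ ^ (s : ℝ) ≤ 2 ^ s * jb (ξ - η) ^ (s : ℝ) := by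
        rw [Real.rpow_natCast, Real.rpow_natCast, ← mul_pow]
        exact pow_le_pow_left₀ (jb_pos ξ).le (by linarith) _
      calc _ ≤ ENNReal.ofReal (2 ^ s * jb (ξ - η) ^ (s : ℝ)) * (‖K η‖ₑ * ‖ft F (ξ - η)‖ₑ) := by gcongr
        _ = 2 ^ s * (a η * b (ξ - η)) := by
          rw [ENNReal.ofReal_mul (by positivity), ENNReal.ofReal_pow (by norm_num), ENNReal.ofReal_ofNat, ha, hb]
          simp only; ring
        _ ≤ _ := by gcongr; exact le_self_add
    · have h2 : jb ξ ^ (s : ℝ) ≤ 2 ^ s * (jb η ^ σ * (jb (ξ - η) ^ (-σ) * jb (ξ - η) ^ (s : ℝ))) := by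
        have h3 : jb ξ ^ (s : ℝ) ≤ 2 ^ s * jb η ^ (s : ℝ) := by
          rw [Real.rpow_natCast, Real.rpow_natCast, ← mul_pow]
          exact pow_le_pow_left₀ (jb_pos ξ).le (by linarith) _
        refine h3.trans ?_
        gcongr
        rw [← Real.rpow_add p2]
        have h4 : jb η ^ (-σ + s) ≤ jb (ξ - η) ^ (-σ + s) := Real.rpow_le_rpow_of_nonpos p2 h (by linarith)
        calc jb η ^ (s : ℝ) = jb η ^ σ * jb η ^ (-σ + s) := by rw [← Real.rpow_add p1]; congr 1; ring
          _ ≤ _ := by gcongr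
      calc _ ≤ ENNReal.ofReal (2 ^ s * (jb η ^ σ * (jb (ξ - η) ^ (-σ) * jb (ξ - η) ^ (s : ℝ)))) * (‖K η‖ₑ * ‖ft F (ξ - η)‖ₑ) := by gcongr
        _ = 2 ^ s * (a' η * b' (ξ - η)) := by
          rw [ENNReal.ofReal_mul (by positivity), ENNReal.ofReal_pow (by norm_num), ENNReal.ofReal_ofNat,
            ENNReal.ofReal_mul (by positivity), ENNReal.ofReal_mul (by positivity), ha', hb']
          simp only; ring
        _ ≤ _ := by gcongr; exact le_add_self
  have hconv := ft_mul hQ.memL2_ft.1 hKi hF.base hQF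
  have bound : ∀ᵐ ξ, (ENNReal.ofReal (jb ξ ^ (s : ℝ)) * ‖ft (fun y => (Q y : ℂ) * F y) ξ‖ₑ) ^ 2
      ≤ (2 ^ s) ^ 2 * (4 * ((∫⁻ η, a η * b (ξ - η)) ^ 2 + (∫⁻ η, b' η * a' (ξ - η)) ^ 2)) := by
    filter_upwards [hconv] with ξ hξ
    rw [hξ]
    have e1 : ENNReal.ofReal (jb ξ ^ (s : ℝ)) * ‖conv K (ft F) ξ‖ₑ
        ≤ 2 ^ s * ((∫⁻ η, a η * b (ξ - η)) + ∫⁻ η, b' η * a' (ξ - η)) := by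
      calc _ ≤ ENNReal.ofReal (jb ξ ^ (s : ℝ)) * ∫⁻ η, ‖K η‖ₑ * ‖ft F (ξ - η)‖ₑ := by gcongr; exact enorm_conv_le _ _ _
        _ = ∫⁻ η, ENNReal.ofReal (jb ξ ^ (s : ℝ)) * (‖K η‖ₑ * ‖ft F (ξ - η)‖ₑ) :=
          (lintegral_const_mul _ (sK.enorm.mul (sf.enorm.comp (measurable_const.sub measurable_id)))).symm
        _ ≤ ∫⁻ η, 2 ^ s * (a η * b (ξ - η) + a' η * b' (ξ - η)) := lintegral_mono fun η => key ξ η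
        _ = 2 ^ s * ((∫⁻ η, a η * b (ξ - η)) + ∫⁻ η, a' η * b' (ξ - η)) := by
          have m1 : Measurable fun η => a η * b (ξ - η) := ma.mul (mb.comp (measurable_const.sub measurable_id))
          have m2 : Measurable fun η => a' η * b' (ξ - η) := ma'.mul (mb'.comp (measurable_const.sub measurable_id))
          have m12 : Measurable fun η => a η * b (ξ - η) + a' η * b' (ξ - η) := m1.add m2
          rw [lintegral_const_mul _ m12, lintegral_add_left m1]
        _ = _ := by
          congr 2
          rw [← lintegral_sub_left_eq_self _ ξ]
          refine lintegral_congr fun η => ?_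
          rw [sub_sub_cancel, mul_comm]
    calc _ ≤ (2 ^ s * ((∫⁻ η, a η * b (ξ - η)) + ∫⁻ η, b' η * a' (ξ - η))) ^ 2 := by gcongr
      _ ≤ _ := by
        rw [mul_pow]
        gcongr
        generalize (∫⁻ η, a η * b (ξ - η)) = s
        generalize (∫⁻ η, b' η * a' (ξ - η)) = t
        rcases le_total s t with h | h
        · calc (s + t) ^ 2 ≤ (t + t) ^ 2 := by gcongr
            _ = 4 * t ^ 2 := by ring
            _ ≤ _ := by gcongr; exact le_add_self
        · calc (s + t) ^ 2 ≤ (s + s) ^ 2 := by gcongr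
            _ = 4 * s ^ 2 := by ring
            _ ≤ _ := by gcongr; exact le_self_add
  refine lt_of_le_of_lt (lintegral_mono_ae bound) ?_
  have m1 : Measurable fun ξ => (∫⁻ η, a η * b (ξ - η)) ^ 2 := by
    have : Measurable fun z : Pt d × Pt d => a z.2 * b (z.1 - z.2) :=
      (ma.comp measurable_snd).mul (mb.comp (measurable_fst.sub measurable_snd))
    exact this.lintegral_prod_right'.pow_const 2
  have m2 : Measurable fun ξ => (∫⁻ η, b' η * a' (ξ - η)) ^ 2 := by
    have : Measurable fun z : Pt d × Pt d => b' z.2 * a' (z.1 - z.2) :=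
      (mb'.comp measurable_snd).mul (ma'.comp (measurable_fst.sub measurable_snd))
    exact this.lintegral_prod_right'.pow_const 2
  have m12 : Measurable fun ξ => (∫⁻ η, a η * b (ξ - η)) ^ 2 + (∫⁻ η, b' η * a' (ξ - η)) ^ 2 := m1.add m2
  rw [lintegral_const_mul _ (m12.const_mul 4), lintegral_const_mul _ m12, lintegral_add_left m1]
  -- In the second region the roles are exchanged: the factor from Q is in L² and the factor from F
  -- is integrable by Cauchy-Schwarz, because 2σ > d.
  have hb1 : ∫⁻ η, b' η < ⊤ := by
    have h1 : Integrable (fun z => ((jb z ^ (-σ) : ℝ) : ℂ) * (((jb z ^ s : ℝ) : ℂ) * ft F z)) volume :=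
      (memLp_jb_rpow_neg hσ).integrable_mul (memH_iff.1 hF).2
    have := h1.2
    simp only [HasFiniteIntegral, en, en'] at this
    exact this
  refine ENNReal.mul_lt_top (by finiteness) (ENNReal.mul_lt_top (by finiteness) (ENNReal.add_lt_top.2 ⟨?_, ?_⟩))
  · exact (lintegral_conv_sq_le ma mb).trans_lt (ENNReal.mul_lt_top (ENNReal.pow_lt_top hKi.2) hF2)
  · exact (lintegral_conv_sq_le mb' ma').trans_lt (ENNReal.mul_lt_top (ENNReal.pow_lt_top hb1) hK2)

end FourierProducts

end MultiScale

/-! ### Compactness of products of a multiplication and a Fourier multiplier -/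

namespace MultiScale

section Compactness

open FourierTransform

/-- Hilbert-Schmidt operators are compact. -/
theorem isCompactOperator_of_sum_sq_le {H ι : Type*} [NormedAddCommGroup H] [InnerProductSpace ℂ H] [CompleteSpace H]
    (T : H →L[ℂ] H) (b : HilbertBasis ι ℂ H) (M : ℝ) (h : ∀ s : Finset ι, ∑ i ∈ s, ‖T (b i)‖ ^ 2 ≤ M) :
    IsCompactOperator T := by
  classical
  -- T restricted to finitely many basis directions. By Cauchy-Schwarz and Bessel's inequality, the
  -- operator norm of the difference to T is bounded by the square root of a tail of Σ ‖T b_i‖².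
  let P : Finset ι → H →L[ℂ] H := fun s => ∑ i ∈ s, (innerSL ℂ (b i)).smulRight (T (b i))
  have hP : ∀ s x, P s x = ∑ i ∈ s, inner ℂ (b i) x • T (b i) := fun s x => by
    simp [P]
  have hcomp : ∀ s, IsCompactOperator (P s) := fun s => by
    have h1 : ∀ i, IsCompactOperator ((innerSL ℂ (b i)).smulRight (T (b i))) := fun i => by
      have := (isCompactOperator_of_locallyCompactSpace_rng
        ((1 : ℂ →L[ℂ] ℂ).smulRight (T (b i)))).comp_clm (innerSL ℂ (b i))
      exact this
    exact Submodule.sum_mem (compactOperator (RingHom.id ℂ) H H) (t := s)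
      (f := fun i => ((innerSL ℂ (b i)).smulRight (T (b i)))) fun i _ => h1 i
  have hs : Summable fun i => ‖T (b i)‖ ^ 2 := summable_of_sum_le (fun i => by positivity) h
  refine isCompactOperator_of_tendsto (l := Filter.atTop) (F := P) (f := T) ?_ (Filter.Eventually.of_forall hcomp)
  rw [Metric.tendsto_atTop]
  intro ε hε
  obtain ⟨s, hs⟩ := summable_iff_vanishing_norm.1 hs ((ε / 2) ^ 2) (by positivity)
  refine ⟨s, fun t ht => ?_⟩
  rw [dist_eq_norm]
  refine lt_of_le_of_lt (ContinuousLinearMap.opNorm_le_bound _ (by positivity : 0 ≤ ε / 2) fun x => ?_) (half_lt_self hε)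
  have hx : HasSum (fun i => inner ℂ (b i) x • T (b i)) (T x) := by
    have := (b.hasSum_repr x).mapL T
    simpa [b.repr_apply_apply] using this
  have hlim : Filter.Tendsto (fun u => ‖P t x - P u x‖) Filter.atTop (nhds ‖P t x - T x‖) := by
    simp only [hP]
    exact (tendsto_const_nhds.sub hx).norm
  refine le_of_tendsto hlim ?_
  filter_upwards [Filter.eventually_ge_atTop t] with u hu
  rw [norm_sub_rev, hP, hP, ← Finset.sum_sdiff hu, add_sub_cancel_right]
  have h1 : ‖∑ i ∈ u \ t, inner ℂ (b i) x • T (b i)‖ ≤ ∑ i ∈ u \ t, ‖inner ℂ (b i) x‖ * ‖T (b i)‖ :=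
    (norm_sum_le _ _).trans (Finset.sum_le_sum fun i _ => (norm_smul_le _ _))
  have h2 := Finset.sum_mul_sq_le_sq_mul_sq (u \ t) (fun i => ‖inner ℂ (b i) x‖) fun i => ‖T (b i)‖
  have h3 := b.orthonormal.sum_inner_products_le x (s := u \ t)
  have h4 := hs (u \ t) (Finset.sdiff_disjoint.mono_right ht)
  rw [Real.norm_of_nonneg (Finset.sum_nonneg fun i _ => by positivity)] at h4
  refine h1.trans (abs_le_of_sq_le_sq' ?_ (by positivity)).2
  calc _ ≤ _ := h2
    _ ≤ ‖x‖ ^ 2 * (ε / 2) ^ 2 := by gcongr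
    _ = _ := by ring

variable {d : ℕ}

/-- Operators with a square integrable kernel are compact. -/
theorem isCompactOperator_of_kernel {X : Type*} [MeasureSpace X] (T : Lp ℂ 2 (volume : Measure X) →L[ℂ] Lp ℂ 2 (volume : Measure X))
    (κ : X → Lp ℂ 2 (volume : Measure X)) (φ : X → ℝ) (hφ : MemLp φ 2 volume)
    (h1 : ∀ f, ∀ᵐ y, T f y = inner ℂ (κ y) f) (h2 : ∀ᵐ y, ‖κ y‖ ≤ φ y) : IsCompactOperator T := by
  obtain ⟨w, b, -⟩ := exists_hilbertBasis ℂ (Lp ℂ 2 (volume : Measure X))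
  refine isCompactOperator_of_sum_sq_le T b (∫ y, φ y ^ 2) fun s => ?_
  have hn : ∀ f : Lp ℂ 2 (volume : Measure X), ‖f‖ ^ 2 = ∫ y, ‖f y‖ ^ 2 := fun f => by
    have := L2.inner_def (𝕜 := ℂ) f f
    rw [inner_self_eq_norm_sq_to_K] at this
    have e : ∫ y, inner ℂ (f y) (f y) = ((∫ y, ‖f y‖ ^ 2 : ℝ) : ℂ) := by
      rw [← integral_complex_ofReal]
      refine integral_congr_ae (Filter.Eventually.of_forall fun y => ?_)
      simp only
      rw [inner_self_eq_norm_sq_to_K]; norm_cast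
    rw [e] at this
    exact Complex.ofReal_injective (by rw [Complex.ofReal_pow]; exact this)
  have hi : ∀ f : Lp ℂ 2 (volume : Measure X), Integrable (fun y => ‖f y‖ ^ 2) := fun f =>
    (Lp.memLp f).integrable_norm_pow (by norm_num)
  simp only [hn]
  rw [← integral_finsetSum _ fun i _ => hi _]
  refine integral_mono_ae (integrable_finsetSum _ fun i _ => hi _) hφ.integrable_sq ?_
  have : ∀ᵐ y, ∀ i ∈ s, T (b i) y = inner ℂ (κ y) (b i) := (Finset.eventually_all s).2 fun i _ => h1 (b i)
  -- Bessel's inequality at each point y; integrating it gives a bound uniform in the finite set.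
  filter_upwards [this, h2] with y hy hk
  calc ∑ i ∈ s, ‖T (b i) y‖ ^ 2 = ∑ i ∈ s, ‖inner ℂ (b i) (κ y)‖ ^ 2 :=
        Finset.sum_congr rfl fun i hi => by rw [hy i hi, norm_inner_symm]
    _ ≤ ‖κ y‖ ^ 2 := b.orthonormal.sum_inner_products_le _
    _ ≤ φ y ^ 2 := by gcongr

/-- Multiplication with a bounded function on `L²`. -/
def mulL : Lp ℂ ∞ (volume : Measure (Pt d)) →L[ℂ] Lp ℂ 2 (volume : Measure (Pt d)) →L[ℂ] Lp ℂ 2 (volume : Measure (Pt d)) :=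
  (ContinuousLinearMap.mul ℂ ℂ).holderL volume ∞ 2 2

theorem mulL_ae (m : Lp ℂ ∞ (volume : Measure (Pt d))) (f : Lp ℂ 2 (volume : Measure (Pt d))) :
    ∀ᵐ y, mulL m f y = m y * f y := by
  have := (ContinuousLinearMap.mul ℂ ℂ).coeFn_holder (r := 2) m f
  exact this

/-- The inverse Fourier transform as a continuous operator. -/
def iftL : Lp ℂ 2 (volume : Measure (Pt d)) →L[ℂ] Lp ℂ 2 (volume : Measure (Pt d)) :=
  (fourierInvCLM ℂ (Lp ℂ 2 (volume : Measure (Pt d))) : _ →L[ℂ] Lp ℂ 2 (volume : Measure (Pt d)))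

theorem iftL_ae (f : Lp ℂ 2 (volume : Measure (Pt d))) : ⇑(iftL f) = ift f := by
  rw [ift_eq (Lp.memLp f), Lp.toLp_coeFn]; rfl

theorem memLp_mulL {m : Lp ℂ ∞ (volume : Measure (Pt d))} (h : MemLp m 2 volume) (f : Lp ℂ 2 (volume : Measure (Pt d))) :
    Integrable (mulL m f) volume :=
  (h.integrable_mul (Lp.memLp f)).congr ((mulL_ae m f).mono fun _ => Eq.symm)

/-- The kernel is q(y) exp(2πi z·y) m(z), whose modulus is a product of two square integrable
functions. -/
theorem isCompactOperator_of_memL2 {q m : Lp ℂ ∞ (volume : Measure (Pt d))} (hq : MemLp q 2 volume) (hm : MemLp m 2 volume) :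
    IsCompactOperator (mulL q ∘L iftL ∘L mulL m) := by
  have hk : ∀ y, MemLp (fun z => conj (q y * (Real.fourierChar (inner ℝ z y) : ℂ) * m z)) 2 volume := fun y => by
    refine (hm.const_mul (q y)).of_le (g := fun z => q y * m z) ?_ (Filter.Eventually.of_forall fun z => ?_)
    · refine Complex.continuous_conj.comp_aestronglyMeasurable (AEStronglyMeasurable.mul ?_ hm.1)
      refine Continuous.aestronglyMeasurable ?_
      exact continuous_const.mul (continuous_subtype_val.comp (Real.continuous_fourierChar.comp (by fun_prop)))
    · rw [RCLike.norm_conj, norm_mul, norm_mul, Circle.norm_coe, mul_one, norm_mul]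
  refine isCompactOperator_of_kernel _ (fun y => (hk y).toLp) (fun y => ‖q y‖ * ‖hm.toLp‖) (hq.norm.mul_const _) (fun f => ?_)
    (Filter.Eventually.of_forall fun y => ?_)
  · have a1 := mulL_ae q (iftL (mulL m f))
    have a2 := ift_eq_integral (Lp.memLp (mulL m f)) (memLp_mulL hm f)
    filter_upwards [a1, a2] with y b1 b2
    simp only [ContinuousLinearMap.comp_apply]
    rw [b1, iftL_ae, b2, L2.inner_def, Real.fourierInv_eq, ← integral_const_mul]
    refine integral_congr_ae ?_
    filter_upwards [mulL_ae m f, (hk y).coeFn_toLp] with z c1 c2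
    rw [c1, c2]
    simp only [RCLike.inner_apply, Circle.smul_def, smul_eq_mul]
    rw [Complex.conj_conj]; ring
  · have : ‖(hk y).toLp‖ = ‖q y‖ * ‖hm.toLp‖ := by
      rw [Lp.norm_toLp, Lp.norm_toLp, ← toReal_enorm (q y), ← ENNReal.toReal_mul]
      congr 1
      rw [← eLpNorm_const_smul]
      refine eLpNorm_congr_norm_ae (Filter.Eventually.of_forall fun z => ?_)
      rw [RCLike.norm_conj, norm_mul, norm_mul, Circle.norm_coe, mul_one, Pi.smul_apply, norm_smul]
    exact this.le

/-- Products `Q(x) m(∇/i)` with `Q ∈ L² ∩ L^∞` and `m` vanishing at infinity are compact. -/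
theorem isCompactOperator_mul_ift_mul {q m : Lp ℂ ∞ (volume : Measure (Pt d))} (hq : MemLp q 2 volume) (c : ℝ)
    (hm : ∀ᵐ z, ‖m z‖ ≤ c * (jb z ^ 2)⁻¹) : IsCompactOperator (mulL q ∘L iftL ∘L mulL m) := by
  have hB : ∀ R : ℕ, MeasurableSet (Metric.ball (0 : Pt d) R) := fun R => measurableSet_ball
  -- The multiplier is truncated to balls. The truncations are in L², so they give compact
  -- operators, and they converge to m uniformly by the decay of m; compactness is stable under norm
  -- limits.
  have hmR : ∀ R : ℕ, MemLp ((Metric.ball (0 : Pt d) R).indicator m) ∞ volume := fun R => (Lp.memLp m).indicator (hB R)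
  refine isCompactOperator_of_tendsto (l := Filter.atTop) (F := fun R : ℕ => mulL q ∘L iftL ∘L mulL (hmR R).toLp) ?_
    (Filter.Eventually.of_forall fun R => isCompactOperator_of_memL2 hq ?_)
  · have hc : Continuous fun n : Lp ℂ ∞ (volume : Measure (Pt d)) => mulL q ∘L iftL ∘L mulL n := by fun_prop
    refine (hc.tendsto m).comp (f := fun R : ℕ => (hmR R).toLp) ?_
    rw [tendsto_iff_norm_sub_tendsto_zero]
    have hc0 : Filter.Tendsto (fun R : ℕ => |c| * (1 + (R : ℝ) ^ 2)⁻¹) Filter.atTop (nhds 0) := by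
      have : Filter.Tendsto (fun R : ℕ => (1 + (R : ℝ) ^ 2)) Filter.atTop Filter.atTop :=
        Filter.tendsto_atTop_add_const_left _ _ ((Filter.tendsto_pow_atTop two_ne_zero).comp tendsto_natCast_atTop_atTop)
      simpa using (tendsto_inv_atTop_zero.comp this).const_mul |c|
    refine squeeze_zero (fun _ => norm_nonneg _) (fun R => ?_) hc0
    rw [Lp.norm_def, eLpNorm_exponent_top]
    refine ENNReal.toReal_le_of_le_ofReal (by positivity) (eLpNormEssSup_le_of_ae_bound ?_)
    filter_upwards [Lp.coeFn_sub (hmR R).toLp m, (hmR R).coeFn_toLp, hm] with z h1 h2 h3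
    rw [h1, Pi.sub_apply, h2]
    by_cases hz : z ∈ Metric.ball (0 : Pt d) R
    · simp only [indicator_of_mem hz, sub_self, norm_zero]; positivity
    · rw [indicator_of_notMem hz, zero_sub, norm_neg]
      have hz' : (R : ℝ) ≤ ‖z‖ := by simpa using hz
      refine h3.trans ?_
      rw [jb_sq]
      gcongr
      exact le_abs_self c
  · refine MemLp.ae_eq (hmR R).coeFn_toLp.symm ?_
    have : IsFiniteMeasure (volume.restrict (Metric.ball (0 : Pt d) R)) :=
      ⟨by rw [Measure.restrict_apply_univ]; exact measure_ball_lt_top⟩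
    have := ((Lp.memLp m).restrict (Metric.ball (0 : Pt d) R)).mono_exponent (p := 2) le_top (μ := volume.restrict (Metric.ball (0 : Pt d) R))
    exact (memLp_indicator_iff_restrict (hB R)).2 this

end Compactness

end MultiScale

/-! ### The symbol and the symmetry of the homogenized operator -/

namespace MultiScale

section Homogenized

open FourierTransform

variable {d : ℕ} {S : Setting d}

/-- The minimum over the compact unit sphere is positive, and the form is homogeneous of degree two.
-/
theorem exists_posDef_bound {M : Matrix (Fin d) (Fin d) ℝ} (hM : M.PosDef) :
    ∃ c > 0, ∀ z : Pt d, c * ‖z‖ ^ 2 ≤ ∑ j, ∑ l, M j l * z j * z l := by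
  set f : Pt d → ℝ := fun z => ∑ j, ∑ l, M j l * z j * z l with hf
  have hc : Continuous f := by fun_prop
  have hpos : ∀ z : Pt d, z ≠ 0 → 0 < f z := fun z hz => by
    have h := hM.dotProduct_mulVec_pos (x := fun j => z j) (fun h => hz (by ext j; exact congrFun h j))
    refine h.trans_eq ?_
    simp only [hf, dotProduct, Matrix.mulVec, Finset.mul_sum]
    refine Finset.sum_congr rfl fun j _ => Finset.sum_congr rfl fun l _ => ?_
    simp; ring
  have hs : ∀ (t : ℝ) (z : Pt d), f (t • z) = t ^ 2 * f z := fun t z => by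
    simp only [hf, Finset.mul_sum, PiLp.smul_apply, smul_eq_mul]
    refine Finset.sum_congr rfl fun j _ => Finset.sum_congr rfl fun l _ => ?_
    ring
  have key : ∃ c > 0, ∀ z ∈ Metric.sphere (0 : Pt d) 1, c ≤ f z := by
    rcases (Metric.sphere (0 : Pt d) 1).eq_empty_or_nonempty with h | h
    -- In dimension zero the sphere is empty and any constant will do.
    · exact ⟨1, one_pos, by simp [h]⟩
    · obtain ⟨z, hz, hm⟩ := (isCompact_sphere (0 : Pt d) 1).exists_isMinOn h hc.continuousOn
      exact ⟨f z, hpos z (by rintro rfl; simp at hz), fun y hy => hm hy⟩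
  obtain ⟨c, hc0, h⟩ := key
  refine ⟨c, hc0, fun z => ?_⟩
  rcases eq_or_ne z 0 with rfl | hz
  · simp
  have hn : 0 < ‖z‖ := norm_pos_iff.2 hz
  have := h (‖z‖⁻¹ • z) (by simp [norm_smul, hn.ne'])
  rw [hs, inv_pow] at this
  calc c * ‖z‖ ^ 2 ≤ ((‖z‖ ^ 2)⁻¹ * f z) * ‖z‖ ^ 2 := by gcongr
    _ = f z := by field_simp

/-- The symbol of `-∇·A∇ - e_{A,Q}`. -/
def Setting.sym (S : Setting d) (z : Pt d) : ℝ := 4 * Real.pi ^ 2 * (∑ j, ∑ l, S.A j l * z j * z l) - S.eAQ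

theorem continuous_sym : Continuous S.sym := by unfold Setting.sym; fun_prop

/-- As sgn(A) e_{A,Q} < 0, the quadratic part and -e_{A,Q} have the same sign and cannot cancel.
This makes the operator elliptic with e_{A,Q} outside the spectrum of -∇·A∇. -/
theorem Setting.HomogenizedEigenpair.sym_bound (hhom : S.HomogenizedEigenpair) :
    ∃ c > 0, ∀ z, c * jb z ^ 2 ≤ |S.sym z| := by
  have hπ := Real.pi_pos
  rcases hhom.sign with ⟨h1, h2⟩ | ⟨h1, h2⟩
  · obtain ⟨c, hc, h⟩ := exists_posDef_bound h1
    refine ⟨min (4 * Real.pi ^ 2 * c) (-S.eAQ), lt_min (by positivity) (by linarith), fun z => ?_⟩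
    refine le_trans ?_ (le_abs_self _)
    rw [jb_sq, Setting.sym]
    have a := min_le_left (4 * Real.pi ^ 2 * c) (-S.eAQ)
    have b := min_le_right (4 * Real.pi ^ 2 * c) (-S.eAQ)
    have e := mul_le_mul_of_nonneg_right a (sq_nonneg ‖z‖)
    have e' := mul_le_mul_of_nonneg_left (h z) (by positivity : 0 ≤ 4 * Real.pi ^ 2)
    nlinarith
  · obtain ⟨c, hc, h⟩ := exists_posDef_bound h1
    refine ⟨min (4 * Real.pi ^ 2 * c) S.eAQ, lt_min (by positivity) (by linarith), fun z => ?_⟩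
    refine le_trans ?_ (neg_le_abs _)
    rw [jb_sq, Setting.sym]
    have a := min_le_left (4 * Real.pi ^ 2 * c) S.eAQ
    have b := min_le_right (4 * Real.pi ^ 2 * c) S.eAQ
    have e := mul_le_mul_of_nonneg_right a (sq_nonneg ‖z‖)
    have e' := mul_le_mul_of_nonneg_left (h z) (by positivity : 0 ≤ 4 * Real.pi ^ 2)
    simp only [Matrix.neg_apply, neg_mul, Finset.sum_neg_distrib] at e'
    nlinarith

theorem ft_injective {F G : Pt d → ℂ} (hF : MemL2 F) (hG : MemL2 G) (h : ∀ᵐ z, ft F z = ft G z) : ∀ᵐ y, F y = G y := by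
  have e : ift (ft F) = ift (ft G) := by
    have h1 : MemLp (ft F) 2 volume := memL2_ft F
    have h2 : MemLp (ft G) 2 volume := memL2_ft G
    rw [ift_eq h1, ift_eq h2, MemLp.toLp_congr h1 h2 h]
  filter_upwards [ift_ft hF, ift_ft hG] with y a b
  rw [← a, ← b, e]

theorem ft_sum {ι : Type*} (s : Finset ι) {F : ι → Pt d → ℂ} (h : ∀ i ∈ s, MemL2 (F i)) :
    ∀ᵐ z, ft (fun y => ∑ i ∈ s, F i y) z = ∑ i ∈ s, ft (F i) z := by
  classical
  induction s using Finset.induction_on with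
  | empty =>
    simp only [Finset.sum_empty]
    filter_upwards [ft_smul 0 (F := fun _ : Pt d => 0) isFunSpace_memL2.zero] with z hz
    simpa using hz
  | insert i s hi ih =>
    have h1 := fun j hj => h j (Finset.mem_insert_of_mem hj)
    simp only [Finset.sum_insert hi]
    filter_upwards [ft_add (h i (Finset.mem_insert_self i s)) (isFunSpace_memL2.sum s h1), ih h1] with z a b
    rw [a, b]

/-- Plancherel's identity. -/
theorem integral_conj_ft_mul {F G : Pt d → ℂ} (hF : MemL2 F) (hG : MemL2 G) :
    ∫ z, conj (ft F z) * ft G z = ∫ y, conj (F y) * G y := by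
  unfold MemL2 at hF hG
  rw [← Setting.inner_toLp (memL2_ft F) (memL2_ft G), ← Setting.inner_toLp hF hG, toLp_ft hF, toLp_ft hG]
  exact Lp.inner_fourier_eq _ _

theorem LAQ_add_smul (c : ℂ) {u v : Pt d → ℂ} (hu : MemH 2 u) (hv : MemH 2 v) :
    ∀ᵐ y, S.LAQ (fun y => u y + c * v y) y = S.LAQ u y + c * S.LAQ v y := by
  have hP := isFunSpace_memSob isFunSpace_memL2 (ev (d := d)) 2
  have h : ∀ᵐ y, ∀ j l, wd (ev j) (wd (ev l) fun y => u y + c * v y) y = wd (ev j) (wd (ev l) u) y + c * wd (ev j) (wd (ev l) v) y := by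
    rw [ae_all_iff]; intro j
    rw [ae_all_iff]; intro l
    have h1 := (MemSob.hasWeakDeriv hu l).add ((MemSob.hasWeakDeriv hv l).smul c)
    have h2 := ((MemSob.wd hu l).hasWeakDeriv j).add (((MemSob.wd hv l).hasWeakDeriv j).smul c)
    exact (h2.congr (h1.wd_ae_eq.mono fun _ => Eq.symm) (Filter.Eventually.of_forall fun _ => rfl)).wd_ae_eq
  filter_upwards [h, Setting.LAQ_ae_eq (S := S) hu, Setting.LAQ_ae_eq (S := S) hv, Setting.LAQ_ae_eq (S := S) (hP.add hu (hP.smul c hv))] with y a b e f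
  rw [b, e, f]
  simp only [a, mul_add, Finset.sum_add_distrib, neg_add, sub_eq_add_neg]
  have : ∑ j, ∑ l, (S.A j l : ℂ) * (c * wd (ev j) (wd (ev l) v) y) = ∑ j, ∑ l, c * ((S.A j l : ℂ) * wd (ev j) (wd (ev l) v) y) :=
    Finset.sum_congr rfl fun j _ => Finset.sum_congr rfl fun l _ => by ring
  rw [this]
  simp only [mul_neg, ← Finset.mul_sum]
  ring

theorem LAQ_conj {u : Pt d → ℂ} (hu : MemH 2 u) : ∀ᵐ y, S.LAQ (fun y => conj (u y)) y = conj (S.LAQ u y) := by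
  have hP := isFunSpace_memSob isFunSpace_memL2 (ev (d := d)) 2
  have h : ∀ᵐ y, ∀ j l, wd (ev j) (wd (ev l) fun y => conj (u y)) y = conj (wd (ev j) (wd (ev l) u) y) := by
    rw [ae_all_iff]; intro j
    rw [ae_all_iff]; intro l
    have h1 := (MemSob.hasWeakDeriv hu l).conjugate
    have h2 := ((MemSob.wd hu l).hasWeakDeriv j).conjugate
    exact (h2.congr (h1.wd_ae_eq.mono fun _ => Eq.symm) (Filter.Eventually.of_forall fun _ => rfl)).wd_ae_eq
  filter_upwards [h, Setting.LAQ_ae_eq (S := S) hu, Setting.LAQ_ae_eq (S := S) (hP.conjugate hu)] with y a b f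
  rw [b, f]
  simp [a]

section

variable {σ : ℝ} (hσ : (d : ℝ) < 2 * σ) (hQ : MemHReal σ S.Q)

include hσ hQ

theorem memL2_Q_mul {F : Pt d → ℂ} (hF : MemL2 F) : MemL2 fun y => (S.Q y : ℂ) * F y := memLp_bounded_mul (hQ.bounded hσ) hF

theorem memL2_LAQ {F : Pt d → ℂ} (hF : MemH 2 F) : MemL2 (S.LAQ F) := by
  have h := fun j l => isFunSpace_memL2.smul (S.A j l : ℂ) (MemSob.base (MemSob.wd (MemSob.wd hF l) j))
  have h1 := isFunSpace_memL2.neg (isFunSpace_memL2.sum Finset.univ fun j _ => isFunSpace_memL2.sum Finset.univ fun l _ => h j l)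
  have h2 := isFunSpace_memL2.sub (isFunSpace_memL2.add h1 (memL2_Q_mul hσ hQ hF.base)) (isFunSpace_memL2.smul (S.eAQ : ℂ) hF.base)
  exact isFunSpace_memL2.congr h2 ((Setting.LAQ_ae_eq hF).mono fun _ => Eq.symm)

/-- The homogenized operator on the Fourier side. -/
theorem ft_LAQ {F : Pt d → ℂ} (hF : MemH 2 F) :
    ∀ᵐ z, ft (S.LAQ F) z = (S.sym z : ℂ) * ft F z + ft (fun y => (S.Q y : ℂ) * F y) z := by
  have h := fun j l => isFunSpace_memL2.smul (-(S.A j l) : ℂ) (MemSob.base (MemSob.wd (MemSob.wd hF l) j))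
  have h1 := fun j => isFunSpace_memL2.sum Finset.univ fun l _ => h j l
  have h2 := isFunSpace_memL2.sum Finset.univ fun j _ => h1 j
  have h3 := isFunSpace_memL2.smul (-S.eAQ : ℂ) hF.base
  have hQF := memL2_Q_mul hσ hQ hF.base
  have e0 : ft (S.LAQ F) = ft fun y => (∑ j, ∑ l, (-(S.A j l) : ℂ) * wd (ev j) (wd (ev l) F) y) + ((S.Q y : ℂ) * F y
      + (-S.eAQ : ℂ) * F y) := ft_congr ((Setting.LAQ_ae_eq hF).mono fun y hy => by
    rw [hy]; simp only [neg_mul, Finset.sum_neg_distrib]; ring)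
  have e1 : ∀ᵐ z, ∀ j, ft (fun y => ∑ l, (-(S.A j l) : ℂ) * wd (ev j) (wd (ev l) F) y) z
      = ∑ l, ft (fun y => (-(S.A j l) : ℂ) * wd (ev j) (wd (ev l) F) y) z :=
    ae_all_iff.2 fun j => ft_sum Finset.univ fun l _ => h j l
  have e2 : ∀ᵐ z, ∀ j l, ft (fun y => (-(S.A j l) : ℂ) * wd (ev j) (wd (ev l) F) y) z
      = (-(S.A j l) : ℂ) * (2 * Real.pi * Complex.I * (z j : ℂ) * (2 * Real.pi * Complex.I * (z l : ℂ) * ft F z)) := by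
    rw [ae_all_iff]; intro j
    rw [ae_all_iff]; intro l
    filter_upwards [ft_smul (-(S.A j l) : ℂ) (MemSob.base (MemSob.wd (MemSob.wd hF l) j)),
      HasWeakDeriv.ft_eq ((MemSob.wd hF l).hasWeakDeriv j) (MemSob.wd hF l).base (MemSob.wd (MemSob.wd hF l) j).base,
      HasWeakDeriv.ft_eq (MemSob.hasWeakDeriv hF l) hF.base (MemSob.wd hF l).base] with z a b c
    rw [a, b, c]
  rw [e0]
  filter_upwards [ft_add h2 (isFunSpace_memL2.add hQF h3), ft_add hQF h3, ft_smul (-S.eAQ : ℂ) hF.base,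
    ft_sum Finset.univ fun j _ => h1 j, e1, e2] with z a1 a2 a3 a4 a5 a6
  rw [a1, a2, a3, a4]
  simp only [a5, a6, Setting.sym]
  have : ∑ j, ∑ l, (-(S.A j l) : ℂ) * (2 * Real.pi * Complex.I * (z j : ℂ) * (2 * Real.pi * Complex.I * (z l : ℂ) * ft F z))
      = (4 * Real.pi ^ 2 * ft F z) * ∑ j, ∑ l, (S.A j l : ℂ) * z j * z l := by
    simp only [Finset.mul_sum]
    refine Finset.sum_congr rfl fun j _ => Finset.sum_congr rfl fun l _ => ?_
    linear_combination (-4 * Real.pi ^ 2 * (S.A j l : ℂ) * z j * z l * ft F z) * Complex.I_sq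
  rw [this]
  push_cast
  ring

/-- On the Fourier side the constant coefficient part is multiplication by a real function. The Q
terms are split off and compared in y, where Q is real. -/
theorem integral_conj_LAQ {u v : Pt d → ℂ} (hu : MemH 2 u) (hv : MemH 2 v) :
    ∫ y, conj (u y) * S.LAQ v y = ∫ y, conj (S.LAQ u y) * v y := by
  have hQu := memL2_Q_mul hσ hQ hu.base
  have hQv := memL2_Q_mul hσ hQ hv.base
  have hLu := memL2_LAQ hσ hQ hu
  have hLv := memL2_LAQ hσ hQ hv
  have i1 := integrable_conj_mul (memL2_ft u) (memL2_ft fun y => (S.Q y : ℂ) * v y)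
  have i2 := integrable_conj_mul (memL2_ft fun y => (S.Q y : ℂ) * u y) (memL2_ft v)
  have i3 := integrable_conj_mul (memL2_ft u) (memL2_ft (S.LAQ v))
  have i4 := integrable_conj_mul (memL2_ft (S.LAQ u)) (memL2_ft v)
  have e1 := integral_sub i3 i1
  have e2 := integral_sub i4 i2
  have e3 : ∫ z, (conj (ft u z) * ft (S.LAQ v) z - conj (ft u z) * ft (fun y => (S.Q y : ℂ) * v y) z)
      = ∫ z, (conj (ft (S.LAQ u) z) * ft v z - conj (ft (fun y => (S.Q y : ℂ) * u y) z) * ft v z) := by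
    refine integral_congr_ae ?_
    filter_upwards [ft_LAQ hσ hQ hu, ft_LAQ hσ hQ hv] with z a b
    rw [a, b]
    simp only [map_add, map_mul, Complex.conj_ofReal]
    ring
  rw [e1, e2, integral_conj_ft_mul hu.base hLv, integral_conj_ft_mul hu.base hQv, integral_conj_ft_mul hLu hv.base,
    integral_conj_ft_mul hQu hv.base] at e3
  have e4 : ∫ y, conj (u y) * ((S.Q y : ℂ) * v y) = ∫ y, conj ((S.Q y : ℂ) * u y) * v y := by
    congr 1; funext y; simp only [map_mul, Complex.conj_ofReal]; ring
  rw [e4] at e3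
  exact sub_left_injective e3

end

end Homogenized

end MultiScale

/-! ### Solvability and regularity for the homogenized operator -/

namespace MultiScale

theorem wd_congr {X : Type*} [NormedAddCommGroup X] [NormedSpace ℝ X] [MeasureSpace X] [BorelSpace X] [FiniteDimensional ℝ X] {v : X} {f f' : X → ℂ}
    (h : ∀ᵐ z, f z = f' z) : wd v f = wd v f' := by
  have : HasWeakDeriv v f = HasWeakDeriv v f' := by
    funext g
    exact propext ⟨fun k => k.congr h (Filter.Eventually.of_forall fun _ => rfl),
      fun k => k.congr (h.mono fun _ => Eq.symm) (Filter.Eventually.of_forall fun _ => rfl)⟩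
  unfold wd WeakDiff
  rw [this]

/-- The Fredholm alternative. -/
theorem exists_add_eq_of_isCompactOperator {X : Type*} [NormedAddCommGroup X] [NormedSpace ℂ X] [CompleteSpace X]
    (T : X →L[ℂ] X) (hT : IsCompactOperator T) (h : ∀ v, T v = -v → v = 0) (f : X) : ∃ v, v + T v = f := by
  rcases hT.hasEigenvalue_or_mem_resolventSet (μ := (-1 : ℂ)) (by norm_num) with h1 | h1
  · obtain ⟨v, hv⟩ := h1.exists_hasEigenvector
    exact absurd (h v (by simpa using hv.apply_eq_smul)) hv.2
  · have hb : Function.Bijective ⇑(algebraMap ℂ (X →L[ℂ] X) (-1) - T) :=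
      ContinuousLinearMap.isUnit_iff_bijective.1 h1
    obtain ⟨v, hv⟩ := hb.2 (-f)
    refine ⟨v, ?_⟩
    have e : (algebraMap ℂ (X →L[ℂ] X) (-1) - T) v = (-1 : ℂ) • v - T v := rfl
    rw [e, neg_one_smul] at hv
    rw [← neg_inj, ← hv]; abel

section Solvability

open FourierTransform

variable {d : ℕ} {S : Setting d}

theorem LAQ_congr {u v : Pt d → ℂ} (hu : MemH 2 u) (h : ∀ᵐ y, u y = v y) : ∀ᵐ y, S.LAQ u y = S.LAQ v y := by
  have hv := (isFunSpace_memSob isFunSpace_memL2 (ev (d := d)) 2).congr hu h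
  filter_upwards [h, Setting.LAQ_ae_eq (S := S) hu, Setting.LAQ_ae_eq (S := S) hv] with y a b c
  rw [b, c, a]
  simp only [fun l => wd_congr (v := ev l) h]

theorem memLp_Q {σ : ℝ} (hσ : (d : ℝ) < 2 * σ) (hQ : MemHReal σ S.Q) : MemLp (fun y => (S.Q y : ℂ)) ∞ volume :=
  (hQ.bounded hσ).ofReal

variable (hhom : S.HomogenizedEigenpair) {σ : ℝ} (hσ : (d : ℝ) < 2 * σ) (hQ : MemHReal σ S.Q)

include hhom

theorem sym_inv_bound : ∃ c > 0, ∀ z, S.sym z ≠ 0 ∧ ‖((S.sym z : ℂ))⁻¹‖ ≤ c * (jb z ^ 2)⁻¹ := by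
  obtain ⟨c, hc, h⟩ := hhom.sym_bound
  refine ⟨c⁻¹, inv_pos.2 hc, fun z => ?_⟩
  have hp : 0 < c * jb z ^ 2 := mul_pos hc (pow_pos (jb_pos z) 2)
  refine ⟨abs_pos.1 (hp.trans_le (h z)), ?_⟩
  rw [norm_inv, Complex.norm_real, ← mul_inv]
  exact inv_anti₀ hp (h z)

theorem memLp_sym_inv : MemLp (fun z => ((S.sym z : ℂ))⁻¹) ∞ (volume : Measure (Pt d)) := by
  obtain ⟨c, hc, h⟩ := sym_inv_bound hhom
  refine memLp_top_of_bound ?_ c (Filter.Eventually.of_forall fun z => (h z).2.trans ?_)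
  · exact (Complex.continuous_ofReal.comp continuous_sym).measurable.inv.aestronglyMeasurable
  · exact mul_le_of_le_one_right hc.le (inv_le_one_of_one_le₀ (one_le_pow₀ (one_le_jb z)))

include hσ hQ

/-- A parametrix of the homogenized operator. -/
theorem exists_parametrix : ∃ G : Lp ℂ 2 (volume : Measure (Pt d)) →L[ℂ] Lp ℂ 2 (volume : Measure (Pt d)),
    IsCompactOperator (mulL (memLp_Q hσ hQ).toLp ∘L G) ∧ ∀ h, MemH 2 (G h) ∧
      ∀ᵐ y, S.LAQ (G h) y = h y + (S.Q y : ℂ) * G h y := by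
  obtain ⟨c, hc, hb⟩ := sym_inv_bound hhom
  have hm := memLp_sym_inv hhom
  let ftL : Lp ℂ 2 (volume : Measure (Pt d)) →L[ℂ] Lp ℂ 2 (volume : Measure (Pt d)) :=
    (fourierCLM ℂ (Lp ℂ 2 (volume : Measure (Pt d))) : _ →L[ℂ] Lp ℂ 2 (volume : Measure (Pt d)))
  have ftL_ae : ∀ f, ⇑(ftL f) = ft f := fun f => by
    rw [ft_eq (Lp.memLp f), Lp.toLp_coeFn]; rfl
  -- G divides by the symbol of -∇·A∇ - e_{A,Q}. It gains two derivatives, and Q is the whole error.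
  refine ⟨iftL ∘L mulL hm.toLp ∘L ftL, ?_, fun h => ?_⟩
  · have h1 : MemLp (memLp_Q hσ hQ).toLp 2 (volume : Measure (Pt d)) :=
      MemLp.ae_eq (MemLp.coeFn_toLp (memLp_Q hσ hQ)).symm hQ.memL2_ft.1
    have := isCompactOperator_mul_ift_mul (m := hm.toLp) h1 c
      (by filter_upwards [hm.coeFn_toLp] with z hz; rw [hz]; exact (hb z).2)
    exact this.comp_clm ftL
  · set f := mulL hm.toLp (ftL h) with hf
    have e0 : ⇑((iftL ∘L mulL hm.toLp ∘L ftL) h) = ift f := iftL_ae f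
    have e1 : ∀ᵐ z, f z = ((S.sym z : ℂ))⁻¹ * ft h z := by
      filter_upwards [mulL_ae hm.toLp (ftL h), hm.coeFn_toLp] with z a b
      rw [hf, a, b, ftL_ae]
    have e2 : ∀ᵐ z, ft (ift f) z = f z := ft_ift (Lp.memLp f)
    rw [e0]
    have hH : MemH 2 (ift f) := by
      refine memH_iff.2 ⟨memL2_ift f, memL2_of_le (memL2_ft h) (aestronglyMeasurable_jb_mul 2 _) c ?_⟩
      filter_upwards [e1, e2] with z a b
      rw [b, a, norm_mul, norm_mul, Complex.norm_real, Real.norm_of_nonneg (by positivity)]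
      have hj := pow_pos (jb_pos z) 2
      calc jb z ^ 2 * (‖((S.sym z : ℂ))⁻¹‖ * ‖ft h z‖) ≤ jb z ^ 2 * ((c * (jb z ^ 2)⁻¹) * ‖ft h z‖) := by
            gcongr; exact (hb z).2
        _ = _ := by rw [← mul_assoc, mul_left_comm, mul_inv_cancel₀ hj.ne', mul_one]
    refine ⟨hH, ft_injective (memL2_LAQ hσ hQ hH) (isFunSpace_memL2.add (Lp.memLp h) (memL2_Q_mul hσ hQ hH.base)) ?_⟩
    filter_upwards [ft_LAQ hσ hQ hH, ft_add (Lp.memLp h) (memL2_Q_mul hσ hQ hH.base), e1, e2] with z a b a1 a2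
    rw [a, b, a2, a1, ← mul_assoc, mul_inv_cancel₀ (by exact_mod_cast (hb z).1), one_mul]

theorem integral_FC_FC : ∫ y, S.FC y * S.FC y = 1 := by
  have := congrArg (fun t : ℝ => (t : ℂ)) hhom.normalized
  rw [← integral_complex_ofReal] at this
  simpa [Setting.FC, sq] using this

theorem integral_FC_LAQ {u : Pt d → ℂ} (hu : MemH 2 u) : ∫ y, S.FC y * S.LAQ u y = 0 := by
  have := integral_conj_LAQ hσ hQ hhom.memH2 hu
  have e : ∀ y, conj (S.FC y) = S.FC y := fun y => by simp [Setting.FC]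
  simp only [e] at this
  rw [this]
  refine integral_eq_zero_of_ae ?_
  filter_upwards [hhom.eigen] with y hy
  simp [hy]

theorem LAQ_eq_zero {u : Pt d → ℂ} (hu : MemH 2 u) (h : ∀ᵐ y, S.LAQ u y = 0) (h0 : ∫ y, S.FC y * u y = 0) :
    ∀ᵐ y, u y = 0 := by
  obtain ⟨c, hc⟩ := hhom.simple u hu h
  have : ∫ y, S.FC y * u y = c := by
    rw [← mul_one c, ← integral_FC_FC hhom hσ hQ, ← integral_const_mul]
    refine integral_congr_ae ?_
    filter_upwards [hc] with y hy
    rw [hy]; ring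
  rw [h0] at this
  filter_upwards [hc] with y hy
  rw [hy, ← this, zero_mul]

/-- With u = Gh the equation becomes h + QGh = f, where QG is compact. This equation has a kernel
coming from F_{A,Q}, which is removed by adding the rank one operator R h = ⟨F_{A,Q}, Gh⟩ F_{A,Q}.
For f orthogonal to F_{A,Q} the extra term turns out to be zero, and its vanishing is the
orthogonality of the solution. -/
theorem exists_LAQ_inv {f : Pt d → ℂ} (hf : MemL2 f) (h0 : ∫ y, S.FC y * f y = 0) :
    ∃ u, MemH 2 u ∧ (∀ᵐ y, S.LAQ u y = f y) ∧ ∫ y, S.FC y * u y = 0 := by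
  obtain ⟨G, hG, hL⟩ := exists_parametrix hhom hσ hQ
  have hF : MemLp S.FC 2 volume := hhom.memH2.base
  have iFC : ∀ {v : Pt d → ℂ}, MemL2 v → Integrable fun y => S.FC y * v y := fun hv => hF.integrable_mul hv
  let R : Lp ℂ 2 (volume : Measure (Pt d)) →L[ℂ] Lp ℂ 2 (volume : Measure (Pt d)) :=
    (innerSL ℂ hF.toLp ∘L G).smulRight hF.toLp
  have hR : IsCompactOperator R := (isCompactOperator_of_locallyCompactSpace_rng
        ((1 : ℂ →L[ℂ] ℂ).smulRight hF.toLp)).comp_clm (innerSL ℂ hF.toLp ∘L G)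
  set q := (memLp_Q hσ hQ).toLp with hq
  have hin : ∀ v : Lp ℂ 2 (volume : Measure (Pt d)), inner ℂ hF.toLp v = ∫ y, S.FC y * v y := fun v => by
    have := Setting.inner_toLp hF (Lp.memLp v)
    rw [Lp.toLp_coeFn] at this
    rw [this]
    congr 1; funext y; simp [Setting.FC]
  have hRa : ∀ h, ∀ᵐ y, ((mulL q ∘L G + R) h) y = (S.Q y : ℂ) * G h y + (∫ y, S.FC y * G h y) * S.FC y := fun h => by
    have : (mulL q ∘L G + R) h = mulL q (G h) + inner ℂ hF.toLp (G h) • hF.toLp := rfl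
    rw [this]
    filter_upwards [Lp.coeFn_add (mulL q (G h)) (inner ℂ hF.toLp (G h) • hF.toLp), mulL_ae q (G h),
      MemLp.coeFn_toLp (memLp_Q hσ hQ), Lp.coeFn_smul (inner ℂ hF.toLp (G h)) hF.toLp, hF.coeFn_toLp] with y a1 a2 a3 a4 a5
    rw [a1, Pi.add_apply, a2, a3, a4, Pi.smul_apply, a5, hin, smul_eq_mul]
  -- Pairing the modified equation with F_{A,Q} eliminates L_{A,Q} Gh by symmetry and f by
  -- assumption, so ⟨F_{A,Q}, Gh⟩ = 0 and the equation reduces to the original one.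
  have key : ∀ h f : Lp ℂ 2 (volume : Measure (Pt d)), h + (mulL q ∘L G + R) h = f → ∫ y, S.FC y * f y = 0 →
      (∀ᵐ y, S.LAQ (G h) y = f y) ∧ ∫ y, S.FC y * G h y = 0 := fun h f hf h0 => by
    have e : ∀ᵐ y, S.LAQ (G h) y = f y - (∫ y, S.FC y * G h y) * S.FC y := by
      filter_upwards [(hL h).2, hRa h, Lp.coeFn_add h ((mulL q ∘L G + R) h)] with y a b c
      rw [← hf, c, Pi.add_apply, a, b]; ring
    have e2 : ∫ y, S.FC y * S.LAQ (G h) y = ∫ y, (S.FC y * f y - (∫ y, S.FC y * G h y) * (S.FC y * S.FC y)) :=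
      integral_congr_ae (by filter_upwards [e] with y hy; rw [hy]; ring)
    rw [integral_FC_LAQ hhom hσ hQ (hL h).1, integral_sub (iFC (Lp.memLp f)) ((iFC hF).const_mul _), h0,
      integral_const_mul, integral_FC_FC hhom hσ hQ, zero_sub, mul_one] at e2
    have e3 := neg_eq_zero.1 e2.symm
    refine ⟨?_, e3⟩
    filter_upwards [e] with y hy
    rw [hy, e3]; ring
  -- Injectivity is the case f = 0 of `key`: then Gv is in the kernel of L_{A,Q} and orthogonal to
  -- F_{A,Q}, hence zero by simplicity, and v itself is recovered from the parametrix identity.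
  obtain ⟨h, hh⟩ := exists_add_eq_of_isCompactOperator (mulL q ∘L G + R) (hG.add hR) (fun v hv => by
    obtain ⟨k1, k2⟩ := key v 0 (by rw [hv, add_neg_cancel]) (by
      refine integral_eq_zero_of_ae ?_
      filter_upwards [Lp.coeFn_zero ℂ 2 (volume : Measure (Pt d))] with y hy
      rw [hy]; simp)
    have k3 := LAQ_eq_zero hhom hσ hQ (hL v).1 (by
      filter_upwards [k1, Lp.coeFn_zero ℂ 2 (volume : Measure (Pt d))] with y a b
      rw [a, b]; rfl) k2
    refine Lp.ext ?_
    filter_upwards [k1, k3, (hL v).2] with y a b c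
    rw [a, b, mul_zero, add_zero] at c
    exact c.symm) (MemLp.toLp f hf)
  obtain ⟨k1, k2⟩ := key h _ hh (by
    rw [← h0]
    refine integral_congr_ae ?_
    filter_upwards [MemLp.coeFn_toLp hf] with y hy
    rw [hy])
  refine ⟨G h, (hL h).1, ?_, k2⟩
  filter_upwards [k1, MemLp.coeFn_toLp hf] with y a b
  rw [a, b]

/-- The conjugate solves the same problem, so it agrees with u by uniqueness. Reality of the
envelopes is what makes the numbers μ_n real. -/
theorem LAQ_inv_real {f u : Pt d → ℂ} (hu : MemH 2 u) (h1 : ∀ᵐ y, S.LAQ u y = f y) (h0 : ∫ y, S.FC y * u y = 0)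
    (hf : ∀ᵐ y, conj (f y) = f y) : ∀ᵐ y, conj (u y) = u y := by
  have hP := isFunSpace_memSob isFunSpace_memL2 (ev (d := d)) 2
  have hc := hP.conjugate hu
  have hF : MemLp S.FC 2 volume := hhom.memH2.base
  have := LAQ_eq_zero hhom hσ hQ (hP.add hc (hP.smul (-1) hu)) (by
    filter_upwards [LAQ_add_smul (S := S) (-1) hc hu, LAQ_conj (S := S) hu, h1, hf] with y a b c e
    rw [a, b, c, e]; ring) (by
    have i1 : Integrable fun y => S.FC y * u y := hF.integrable_mul hu.base
    have i2 : Integrable fun y => S.FC y * conj (u y) := hF.integrable_mul hc.base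
    have e : ∀ y, S.FC y * (conj (u y) + -1 * u y) = S.FC y * conj (u y) - S.FC y * u y := fun y => by ring
    simp only [e]
    rw [integral_sub i2 i1, h0, sub_zero, ← map_zero (starRingEnd ℂ), ← h0, ← integral_conj]
    congr 1; funext y; simp [Setting.FC])
  filter_upwards [this] with y hy
  linear_combination hy

/-- Elliptic regularity for the homogenized operator. -/
theorem memH_of_LAQ {s : ℕ} (hs : (s : ℝ) ≤ σ) {f u : Pt d → ℂ} (hu : MemH 2 u) (h1 : ∀ᵐ y, S.LAQ u y = f y)
    (hf : MemH s f) : MemH (s + 2) u := by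
  obtain ⟨c, hc, hb⟩ := hhom.sym_bound
  suffices ∀ k ≤ s, MemH (k + 2) u from this s le_rfl
  -- Bootstrap: the transform of u times the symbol is the transform of f - Qu. If u is in H^k then
  -- so is Qu, because k ≤ s ≤ σ, and the lower bound on the symbol yields two more derivatives.
  have step : ∀ k ≤ s, MemH k u → MemH (k + 2) u := fun k hk hku => by
    have hQu := memH_mul hσ hQ (s := k) (((Nat.cast_le (α := ℝ)).2 hk).trans hs) hku
    have a := (memH_iff.1 (MemSob.mono hk hf)).2
    have b := (memH_iff.1 hQu).2
    refine memH_iff.2 ⟨hu.base, ?_⟩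
    refine memL2_of_le (isFunSpace_memL2.sub a b) (aestronglyMeasurable_jb_mul _ _) c⁻¹ ?_
    filter_upwards [ft_LAQ hσ hQ hu] with z hz
    rw [ft_congr h1] at hz
    have hj := pow_pos (jb_pos z) k
    rw [← mul_sub, hz, add_sub_cancel_right, norm_mul, norm_mul, norm_mul, Complex.norm_real, Complex.norm_real, Complex.norm_real,
      Real.norm_of_nonneg (pow_pos (jb_pos z) _).le, Real.norm_of_nonneg hj.le, pow_add]
    have e : jb z ^ 2 ≤ c⁻¹ * |S.sym z| := by
      rw [← div_eq_inv_mul, le_div_iff₀ hc, mul_comm]; exact hb z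
    calc jb z ^ k * jb z ^ 2 * ‖ft u z‖ ≤ jb z ^ k * (c⁻¹ * |S.sym z|) * ‖ft u z‖ := by gcongr
      _ = _ := by rw [Real.norm_eq_abs]; ring
  intro k
  induction k with
  | zero => exact fun hk => hu
  | succ k ih => exact fun hk => step (k + 1) hk (MemSob.mono (by omega) (ih (by omega)))

end Solvability

end MultiScale

/-! ### Real valued functions and finite sums of tensor products -/

namespace MultiScale

section RealValued

variable {X : Type*} [MeasureSpace X] {u v : X → ℂ}

/-- Functions which are real valued almost everywhere. -/
def AEReal (u : X → ℂ) : Prop := ∀ᵐ z, conj (u z) = u z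

theorem AEReal.congr (hu : AEReal u) (h : ∀ᵐ z, u z = v z) : AEReal v := by
  filter_upwards [hu, h] with z a b
  rw [← b, a]

theorem AEReal.add (hu : AEReal u) (hv : AEReal v) : AEReal fun z => u z + v z := by
  filter_upwards [hu, hv] with z a b
  rw [map_add, a, b]

theorem AEReal.mul (hu : AEReal u) (hv : AEReal v) : AEReal fun z => u z * v z := by
  filter_upwards [hu, hv] with z a b
  rw [map_mul, a, b]

theorem aeReal_ofReal (f : X → ℝ) : AEReal fun z => (f z : ℂ) :=
  Filter.Eventually.of_forall fun _ => Complex.conj_ofReal _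

theorem AEReal.integral (hu : AEReal u) : conj (∫ z, u z) = ∫ z, u z := by
  rw [← integral_conj]
  exact integral_congr_ae hu

/-- The real valued elements of a function space. -/
def RealMem (P : (X → ℂ) → Prop) (u : X → ℂ) : Prop := P u ∧ AEReal u

end RealValued

section

variable {X : Type*} [NormedAddCommGroup X] [NormedSpace ℝ X] [MeasureSpace X] [BorelSpace X] [FiniteDimensional ℝ X]
  {u v : X → ℂ} {P R : (X → ℂ) → Prop}

theorem AEReal.wd {e : X} (hu : AEReal u) (h : WeakDiff e u) : AEReal (wd e u) := by
  have := (h.hasWeakDeriv.conjugate.congr hu (Filter.Eventually.of_forall fun _ => rfl)).wd_ae_eq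
  filter_upwards [this] with z hz using hz.symm

theorem RealMem.congr (hP : IsFunSpace P) (hu : RealMem P u) (h : ∀ᵐ z, u z = v z) : RealMem P v :=
  ⟨hP.congr hu.1 h, hu.2.congr h⟩

theorem RealMem.zero (hP : IsFunSpace P) : RealMem P fun _ => 0 := ⟨hP.zero, Filter.Eventually.of_forall fun _ => map_zero _⟩

theorem RealMem.add (hP : IsFunSpace P) (hu : RealMem P u) (hv : RealMem P v) : RealMem P fun z => u z + v z :=
  ⟨hP.add hu.1 hv.1, hu.2.add hv.2⟩

theorem RealMem.smul (hP : IsFunSpace P) (c : ℝ) (hu : RealMem P u) : RealMem P fun z => (c : ℂ) * u z :=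
  ⟨hP.smul c hu.1, (aeReal_ofReal fun _ => c).mul hu.2⟩

theorem RealMem.neg (hP : IsFunSpace P) (hu : RealMem P u) : RealMem P fun z => - u z := by
  simpa using hu.smul hP (-1)

theorem RealMem.sub (hP : IsFunSpace P) (hu : RealMem P u) (hv : RealMem P v) : RealMem P fun z => u z - v z := by
  simpa [sub_eq_add_neg] using hu.add hP (hv.neg hP)

theorem RealMem.sum (hP : IsFunSpace P) {ι : Type*} (s : Finset ι) {f : ι → X → ℂ} (h : ∀ i ∈ s, RealMem P (f i)) :
    RealMem P fun z => ∑ i ∈ s, f i z := by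
  classical
  induction s using Finset.induction_on with
  | empty => simpa using RealMem.zero hP
  | insert a s ha ih =>
    simp only [Finset.sum_insert ha]
    exact (h a (Finset.mem_insert_self _ _)).add hP (ih fun i hi => h i (Finset.mem_insert_of_mem hi))

theorem RealMem.imp (hPR : ∀ u, P u → R u) (hu : RealMem P u) : RealMem R u := ⟨hPR u hu.1, hu.2⟩

theorem RealMem.wd {d : ℕ} {D : Fin d → X} {k : ℕ} (hu : RealMem (MemSob P D (k + 1)) u) (j : Fin d) :
    RealMem (MemSob P D k) (wd (D j) u) := ⟨hu.1.wd j, hu.2.wd (hu.1.2 j).1⟩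

theorem lap_congr {d : ℕ} {D : Fin d → X} (h : ∀ᵐ z, u z = v z) : lap D u = lap D v := by
  unfold lap
  simp only [wd_congr h]

theorem schr_congr {d : ℕ} {D : Fin d → X} (W : X → ℝ) (E : ℝ) (h : ∀ᵐ z, u z = v z) :
    ∀ᵐ z, schr D W E u z = schr D W E v z := by
  filter_upwards [h] with z hz
  rw [schr, schr, lap_congr h, hz]

theorem schr_add_smul {d : ℕ} {D : Fin d → X} (W : X → ℝ) (E : ℝ) (c : ℂ) {L M : X → ℂ} (hu : IsLap D u L) (hv : IsLap D v M) :
    ∀ᵐ z, schr D W E (fun z => u z + c * v z) z = schr D W E u z + c * schr D W E v z := by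
  filter_upwards [(hu.add (hv.smul c)).lap_ae_eq, hu.lap_ae_eq, hv.lap_ae_eq] with z a b e
  rw [schr, schr, schr, a, b, e]
  ring

theorem schr_add {d : ℕ} {D : Fin d → X} (W : X → ℝ) (E : ℝ) {L M : X → ℂ} (hu : IsLap D u L) (hv : IsLap D v M) :
    ∀ᵐ z, schr D W E (fun z => u z + v z) z = schr D W E u z + schr D W E v z := by
  simpa using schr_add_smul W E 1 hu hv

theorem schr_sub {d : ℕ} {D : Fin d → X} (W : X → ℝ) (E : ℝ) {L M : X → ℂ} (hu : IsLap D u L) (hv : IsLap D v M) :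
    ∀ᵐ z, schr D W E (fun z => u z - v z) z = schr D W E u z - schr D W E v z := by
  have := schr_add_smul W E (-1) hu hv
  simpa [sub_eq_add_neg] using this

end

variable {d : ℕ}

/-- `C` is `∇_x · ∇_y U`, with weak derivatives which exist. -/
def IsCross (U C : Pt d × Pt d → ℂ) : Prop :=
  ∃ u1 u2 : Fin d → Pt d × Pt d → ℂ, (∀ j, HasWeakDeriv (ex j) U (u1 j)) ∧
    (∀ j, HasWeakDeriv (ey j) (u1 j) (u2 j)) ∧ ∀ᵐ z, C z = ∑ j, u2 j z

namespace IsCross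

variable {U C U' C' : Pt d × Pt d → ℂ}

theorem cross_ae_eq (h : IsCross U C) : ∀ᵐ z, Setting.cross U z = C z := by
  obtain ⟨u1, u2, h1, h2, h3⟩ := h
  have : ∀ᵐ z, ∀ j, wd (ey j) (wd (ex j) U) z = u2 j z := by
    rw [ae_all_iff]
    intro j
    rw [wd_congr (h1 j).wd_ae_eq]
    exact (h2 j).wd_ae_eq
  filter_upwards [this, h3] with z hz h
  simp [Setting.cross, hz, h]

theorem congr (h : IsCross U C) (hU : ∀ᵐ z, U z = U' z) : IsCross U' C := by
  obtain ⟨u1, u2, h1, h2, h3⟩ := h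
  exact ⟨u1, u2, fun j => (h1 j).congr hU (Filter.Eventually.of_forall fun _ => rfl), h2, h3⟩

theorem zero : IsCross (fun _ : Pt d × Pt d => 0) fun _ => 0 :=
  ⟨fun _ _ => 0, fun _ _ => 0, fun _ => HasWeakDeriv.zero, fun _ => HasWeakDeriv.zero, Filter.Eventually.of_forall fun _ => by simp⟩

theorem add (h : IsCross U C) (h' : IsCross U' C') : IsCross (fun z => U z + U' z) fun z => C z + C' z := by
  obtain ⟨u1, u2, h1, h2, h3⟩ := h
  obtain ⟨v1, v2, k1, k2, k3⟩ := h'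
  refine ⟨_, _, fun j => (h1 j).add (k1 j), fun j => (h2 j).add (k2 j), ?_⟩
  filter_upwards [h3, k3] with z a b
  rw [a, b, Finset.sum_add_distrib]

theorem smul (c : ℂ) (h : IsCross U C) : IsCross (fun z => c * U z) fun z => c * C z := by
  obtain ⟨u1, u2, h1, h2, h3⟩ := h
  refine ⟨_, _, fun j => (h1 j).smul c, fun j => (h2 j).smul c, ?_⟩
  filter_upwards [h3] with z a
  rw [a, Finset.mul_sum]

theorem sub (h : IsCross U C) (h' : IsCross U' C') : IsCross (fun z => U z - U' z) fun z => C z - C' z := by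
  simpa [sub_eq_add_neg] using h.add (h'.smul (-1))

theorem sum {ι : Type*} (s : Finset ι) {f g : ι → Pt d × Pt d → ℂ} (h : ∀ i ∈ s, IsCross (f i) (g i)) :
    IsCross (fun z => ∑ i ∈ s, f i z) (fun z => ∑ i ∈ s, g i z) := by
  classical
  induction s using Finset.induction_on with
  | empty => simpa using zero
  | insert a s ha ih =>
    simp only [Finset.sum_insert ha]
    exact (h a (Finset.mem_insert_self _ _)).add (ih fun i hi => h i (Finset.mem_insert_of_mem hi))

end IsCross

theorem cross_congr {U U' : Pt d × Pt d → ℂ} (h : ∀ᵐ z, U z = U' z) : Setting.cross U = Setting.cross U' := by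
  funext z
  unfold Setting.cross
  simp only [wd_congr h]

theorem MemH2H2.isCross {U : Pt d × Pt d → ℂ} (h : MemH2H2 U) : IsCross U (Setting.cross U) :=
  ⟨fun j => wd (ex j) U, fun j => wd (ey j) (wd (ex j) U), fun j => MemSob.hasWeakDeriv h j,
    fun j => MemSob.hasWeakDeriv (MemSob.base (MemSob.wd h j)) j, Filter.Eventually.of_forall fun _ => rfl⟩

theorem MemH2H2.isLap_ey {U : Pt d × Pt d → ℂ} (h : MemH2H2 U) : IsLap ey U (lap ey U) := MemSob.isLap_of h.base

section Tensor

variable {a b : Pt d → ℂ}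

theorem IsLap.tensor_left {L : Pt d → ℂ} (h : IsLap ev a L) (hb : LocallyIntegrable b volume) :
    IsLap ex (fun z : Pt d × Pt d => a z.1 * b z.2) fun z => L z.1 * b z.2 := by
  obtain ⟨u1, u2, h1, h2, h3⟩ := h
  refine ⟨_, _, fun j => (h1 j).tensor_left hb, fun j => (h2 j).tensor_left hb, ?_⟩
  filter_upwards [Measure.quasiMeasurePreserving_fst.ae h3] with z hz
  rw [hz, Finset.sum_mul]

theorem IsLap.tensor_right {L : Pt d → ℂ} (ha : LocallyIntegrable a volume) (h : IsLap ev b L) :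
    IsLap ey (fun z : Pt d × Pt d => a z.1 * b z.2) fun z => a z.1 * L z.2 := by
  obtain ⟨u1, u2, h1, h2, h3⟩ := h
  refine ⟨_, _, fun j => (h1 j).tensor_right ha, fun j => (h2 j).tensor_right ha, ?_⟩
  filter_upwards [Measure.quasiMeasurePreserving_snd.ae h3] with z hz
  rw [hz, Finset.mul_sum]

theorem isCross_tensor {a' b' : Fin d → Pt d → ℂ} (ha : ∀ j, HasWeakDeriv (ev j) a (a' j)) (hb : ∀ j, HasWeakDeriv (ev j) b (b' j)) :
    IsCross (fun z : Pt d × Pt d => a z.1 * b z.2) fun z => ∑ j, a' j z.1 * b' j z.2 :=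
  ⟨_, _, fun j => (ha j).tensor_left (hb j).1, fun j => (hb j).tensor_right (ha j).2.1, Filter.Eventually.of_forall fun _ => rfl⟩

theorem memSob_ey_tensor {k : ℕ} (ha : MemL2per a) (hb : MemH k b) :
    MemSob MemL2two ey k fun z : Pt d × Pt d => a z.1 * b z.2 := by
  induction k generalizing b with
  | zero => exact memL2two_tensor ha hb
  | succ k ih =>
    exact memSob_succ_of (isFunSpace_memSob isFunSpace_memL2two _ _) (memL2two_tensor ha hb.base)
      (fun j => (MemSob.hasWeakDeriv hb j).tensor_right ha.locallyIntegrable) fun j => ih (MemSob.wd hb j)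

theorem memSob_ex_tensor {k l : ℕ} (ha : MemSob MemL2per ev k a) (hb : MemH l b) :
    MemSob (MemSob MemL2two ey l) ex k fun z : Pt d × Pt d => a z.1 * b z.2 := by
  induction k generalizing a with
  | zero => exact memSob_ey_tensor ha hb
  | succ k ih =>
    exact memSob_succ_of (isFunSpace_memSob (isFunSpace_memSob isFunSpace_memL2two _ _) _ _) (memSob_ey_tensor ha.base hb)
      (fun j => (ha.hasWeakDeriv j).tensor_left (MemL2.locallyIntegrable hb.base)) fun j => ih (ha.wd j)

end Tensor

/-- Finite sums of tensor products of real valued functions. -/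
inductive TS (P R : (Pt d → ℂ) → Prop) : (Pt d × Pt d → ℂ) → Prop
  | tensor {a b : Pt d → ℂ} (ha : RealMem P a) (hb : RealMem R b) : TS P R fun z => a z.1 * b z.2
  | zero : TS P R fun _ => 0
  | add {U V : Pt d × Pt d → ℂ} (hU : TS P R U) (hV : TS P R V) : TS P R fun z => U z + V z
  | congr {U V : Pt d × Pt d → ℂ} (hU : TS P R U) (h : ∀ᵐ z, U z = V z) : TS P R V

namespace TS

variable {P R P' R' : (Pt d → ℂ) → Prop} {U V : Pt d × Pt d → ℂ}

theorem imp (hP : ∀ u, P u → P' u) (hR : ∀ u, R u → R' u) (h : TS P R U) : TS P' R' U := by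
  induction h with
  | tensor ha hb => exact tensor (ha.imp hP) (hb.imp hR)
  | zero => exact zero
  | add _ _ h1 h2 => exact add h1 h2
  | congr _ h h1 => exact congr h1 h

theorem smul (hP : IsFunSpace P) (c : ℝ) (h : TS P R U) : TS P R fun z => (c : ℂ) * U z := by
  induction h with
  | tensor ha hb =>
    refine congr (tensor (ha.smul hP c) hb) (Filter.Eventually.of_forall fun z => ?_)
    ring
  | zero => exact congr zero (Filter.Eventually.of_forall fun z => by simp)
  | add _ _ h1 h2 => exact congr (add h1 h2) (Filter.Eventually.of_forall fun z => by ring)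
  | congr _ h h1 => exact congr h1 (by filter_upwards [h] with z hz; rw [hz])

theorem sub (hP : IsFunSpace P) (h : TS P R U) (h' : TS P R V) : TS P R fun z => U z - V z :=
  congr (add h (smul hP (-1) h')) (Filter.Eventually.of_forall fun z => by push_cast; ring)

theorem sum {ι : Type*} (s : Finset ι) {f : ι → Pt d × Pt d → ℂ} (h : ∀ i ∈ s, TS P R (f i)) :
    TS P R fun z => ∑ i ∈ s, f i z := by
  classical
  induction s using Finset.induction_on with
  | empty => simpa using zero
  | insert a s ha ih =>
    simp only [Finset.sum_insert ha]
    exact add (h a (Finset.mem_insert_self _ _)) (ih fun i hi => h i (Finset.mem_insert_of_mem hi))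

theorem memL2two (h : TS MemL2per MemL2 U) : MemL2two U := by
  induction h with
  | tensor ha hb => exact memL2two_tensor ha.1 hb.1
  | zero => exact isFunSpace_memL2two.zero
  | add _ _ h1 h2 => exact isFunSpace_memL2two.add h1 h2
  | congr _ h h1 => exact isFunSpace_memL2two.congr h1 h

theorem memH2H2 (h : TS MemH2per (MemH 2) U) : MemH2H2 U := by
  induction h with
  | tensor ha hb => exact memSob_ex_tensor ha.1 hb.1
  | zero => exact isFunSpace_memH2H2.zero
  | add _ _ h1 h2 => exact isFunSpace_memH2H2.add h1 h2
  | congr _ h h1 => exact isFunSpace_memH2H2.congr h1 h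

theorem memSob_ex (h : TS MemH2per MemL2 U) : MemSob MemL2two ex 2 U := by
  have hP := isFunSpace_memSob (isFunSpace_memL2two (d := d)) ex 2
  induction h with
  | tensor ha hb => exact memSob_ex_tensor (l := 0) ha.1 hb.1
  | zero => exact hP.zero
  | add _ _ h1 h2 => exact hP.add h1 h2
  | congr _ h h1 => exact hP.congr h1 h

/-- The class `TS` separates the bookkeeping of regularity: differentiations in y cost orders of the
y-factor only, here one and for Δ_y two, while inverting L_* costs none of them. -/
theorem exists_isCross {s : ℕ} (h : TS MemH2per (MemH (s + 1)) U) : ∃ C, IsCross U C ∧ TS MemL2per (MemH s) C := by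
  induction h with
  | tensor ha hb =>
    refine ⟨_, isCross_tensor (fun j => MemSob.hasWeakDeriv ha.1 j) (fun j => MemSob.hasWeakDeriv hb.1 j), sum _ fun j _ => ?_⟩
    exact tensor ((RealMem.wd (k := 1) ha j).imp fun u hu => hu.base) (RealMem.wd hb j)
  | zero => exact ⟨_, IsCross.zero, zero⟩
  | add _ _ h1 h2 =>
    obtain ⟨C1, a1, b1⟩ := h1
    obtain ⟨C2, a2, b2⟩ := h2
    exact ⟨_, a1.add a2, add b1 b2⟩
  | congr _ h h1 =>
    obtain ⟨C, a, b⟩ := h1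
    exact ⟨C, a.congr h, b⟩

theorem cross {s : ℕ} (h : TS MemH2per (MemH (s + 1)) U) : TS MemL2per (MemH s) (Setting.cross U) := by
  obtain ⟨C, a, b⟩ := h.exists_isCross
  exact congr b (a.cross_ae_eq.mono fun _ => Eq.symm)

theorem exists_isLap {s : ℕ} (hP : ∀ u, P u → MemL2per u) (h : TS P (MemH (s + 2)) U) :
    ∃ L, IsLap ey U L ∧ TS P (MemH s) L := by
  induction h with
  | tensor ha hb =>
    refine ⟨_, (MemSob.isLap hb.1).tensor_right (hP _ ha.1).locallyIntegrable, tensor ha ?_⟩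
    exact RealMem.sum (isFunSpace_memSob isFunSpace_memL2 _ _) _ fun j _ => RealMem.wd (RealMem.wd hb j) j
  | zero => exact ⟨_, IsLap.zero, zero⟩
  | add _ _ h1 h2 =>
    obtain ⟨C1, a1, b1⟩ := h1
    obtain ⟨C2, a2, b2⟩ := h2
    exact ⟨_, a1.add a2, add b1 b2⟩
  | congr _ h h1 =>
    obtain ⟨C, a, b⟩ := h1
    exact ⟨C, a.congr h (Filter.Eventually.of_forall fun _ => rfl), b⟩

section

variable {σ : ℝ} {S : Setting d} (hσ : (d : ℝ) < 2 * σ) (hQ : MemHReal σ S.Q)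

include hσ hQ

theorem Q_mul {s : ℕ} (hs : (s : ℝ) ≤ σ) (h : TS P (MemH s) U) : TS P (MemH s) fun z => (S.Q z.2 : ℂ) * U z := by
  induction h with
  | tensor ha hb =>
    refine congr (tensor ha ⟨memH_mul hσ hQ hs hb.1, (aeReal_ofReal S.Q).mul hb.2⟩) (Filter.Eventually.of_forall fun z => ?_)
    ring
  | zero => exact congr zero (Filter.Eventually.of_forall fun z => by simp)
  | add _ _ h1 h2 => exact congr (add h1 h2) (Filter.Eventually.of_forall fun z => by ring)
  | congr _ h h1 => exact congr h1 (by filter_upwards [h] with z hz; rw [hz])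

theorem schr_ey {s : ℕ} (hs : (s : ℝ) ≤ σ) (E : ℝ) (hP : IsFunSpace P) (hP' : ∀ u, P u → MemL2per u) (h : TS P (MemH (s + 2)) U) :
    TS P (MemH s) (schr ey (fun z => S.Q z.2) E U) := by
  obtain ⟨L, a, b⟩ := h.exists_isLap hP'
  have h' : TS P (MemH s) U := h.imp (fun _ h => h) fun _ h => MemSob.mono (by omega) h
  refine congr (sub hP (add (smul hP (-1) b) (Q_mul hσ hQ hs h')) (smul hP E h')) ?_
  filter_upwards [a.lap_ae_eq] with z hz
  rw [schr, hz]; push_cast; ring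

end

end TS

end MultiScale

/-! ### Inverting L_* on sums of tensor products -/

namespace MultiScale

variable {d : ℕ} {S : Setting d} {σ : ℝ}

theorem isFunSpace_memH (k : ℕ) : IsFunSpace (MemH (d := d) k) := isFunSpace_memSob isFunSpace_memL2 _ _

theorem TS.memL2two_of {s : ℕ} {U : Pt d × Pt d → ℂ} (h : TS MemL2per (MemH s) U) : MemL2two U :=
  (h.imp (fun _ h => h) fun _ h => MemSob.base h).memL2two

theorem TS.memSob_ex_of {s : ℕ} {U : Pt d × Pt d → ℂ} (h : TS MemH2per (MemH s) U) : MemSob MemL2two ex 2 U :=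
  (h.imp (fun _ h => h) fun _ h => MemSob.base h).memSob_ex

section Edge

variable (hreg : S.Regularity σ) (hedge : S.BandEdge)

include hedge

theorem realMem_w : RealMem MemH2per S.wC := ⟨hedge.memH2per_w, aeReal_ofReal S.w⟩

theorem locallyIntegrable_w : LocallyIntegrable S.wC volume := (hedge.memH2per_w).memL2per.locallyIntegrable

/-- For real w, integration by parts shows that the integral equals its own negative. It is the
solvability condition for g_j and, in `env_cross_w_tensor`, removes the leading cross term from all
envelopes. -/
theorem integral_w_wd_w (j : Fin d) : ∫ x in cell d, S.wC x * wd (ev j) S.wC x = 0 := by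
  have h := hedge.memH2per_w
  have e := integral_cell_by_parts (h.hasWeakDeriv j) (h.hasWeakDeriv j) h.memL2per (h.wd j) h.memL2per (h.wd j)
  have hr : AEReal (wd (ev j) S.wC) := (realMem_w hedge).2.wd (h.hasWeakDeriv j).weakDiff
  have e1 : ∫ x in cell d, conj (wd (ev j) S.wC x) * S.wC x = ∫ x in cell d, S.wC x * wd (ev j) S.wC x := by
    refine integral_congr_ae (ae_restrict_of_ae ?_)
    filter_upwards [hr] with x hx
    rw [hx, mul_comm]
  have e2 : ∀ x, conj (S.wC x) = S.wC x := fun x => by simp [Setting.wC]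
  simp only [e2] at e
  rw [e1] at e
  exact CharZero.eq_neg_self_iff.1 e

theorem TS.env {s : ℕ} {U : Pt d × Pt d → ℂ} (h : TS MemL2per (MemH s) U) : RealMem (MemH s) (S.env U) := by
  induction h with
  | @tensor a b ha hb =>
    have e : S.env (fun z => a z.1 * b z.2) = fun y => (∫ x in cell d, S.wC x * a x) * b y := by
      funext y; exact Setting.env_tensor a b y
    rw [e]
    refine ⟨(isFunSpace_memH s).smul _ hb.1, ?_⟩
    have hr : conj (∫ x in cell d, S.wC x * a x) = ∫ x in cell d, S.wC x * a x := by
      rw [← integral_conj]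
      refine integral_congr_ae (ae_restrict_of_ae ?_)
      filter_upwards [ha.2] with x hx
      rw [map_mul, hx]; simp [Setting.wC]
    filter_upwards [hb.2] with y hy
    rw [map_mul, hr, hy]
  | zero =>
    have e : S.env (fun _ => 0) = fun _ => 0 := by funext y; simp [Setting.env]
    rw [e]; exact RealMem.zero (isFunSpace_memH s)
  | add hU hV h1 h2 =>
    exact (h1.add (isFunSpace_memH s) h2).congr (isFunSpace_memH s) ((hedge.env_add hU.memL2two_of hV.memL2two_of).mono fun _ => Eq.symm)
  | congr _ h h1 => exact h1.congr (isFunSpace_memH s) (Setting.env_congr h)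

theorem Lstar2_tensor {a b : Pt d → ℂ} (ha : MemH2per a) (hb : LocallyIntegrable b volume) :
    ∀ᵐ z, S.Lstar2 (fun z => a z.1 * b z.2) z = S.Lstar a z.1 * b z.2 := by
  filter_upwards [((MemSob.isLap_of ha).tensor_left hb).lap_ae_eq] with z hz
  rw [Setting.Lstar2, schr, hz, Setting.Lstar, schr]
  ring

theorem Lstar2_w_tensor {b : Pt d → ℂ} (hb : LocallyIntegrable b volume) :
    ∀ᵐ z, S.Lstar2 (fun z => S.wC z.1 * b z.2) z = 0 := by
  filter_upwards [Lstar2_tensor hedge hedge.memH2per_w hb, Measure.quasiMeasurePreserving_fst.ae hedge.Lstar_w] with z a b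
  rw [a, b, zero_mul]

include hreg

/-- The single tensors of a sum need not be orthogonal to w even if the sum is. Therefore the
component along w is subtracted from each summand, and the inverse is constructed modulo w times the
envelope. -/
theorem TS.exists_Lstar2_inv {s : ℕ} {U : Pt d × Pt d → ℂ} (h : TS MemL2per (MemH s) U) :
    ∃ Z, TS MemH2per (MemH s) Z ∧ (∀ᵐ z, S.Lstar2 Z z = U z - S.wC z.1 * S.env U z.2) ∧ ∀ᵐ y, S.env Z y = 0 := by
  induction h with
  | @tensor a b ha hb =>
    set c := ∫ x in cell d, S.wC x * a x with hc
    have i1 : Integrable (fun x => S.wC x * a x) (volume.restrict (cell d)) := hedge.memLp_w.integrable_mul ha.1.2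
    have i2 : Integrable (fun x => S.wC x * S.wC x) (volume.restrict (cell d)) := hedge.memLp_w.integrable_mul hedge.memLp_w
    have hcr : conj c = c := by
      rw [hc, ← integral_conj]
      refine integral_congr_ae (ae_restrict_of_ae ?_)
      filter_upwards [ha.2] with x hx
      rw [map_mul, hx]; simp [Setting.wC]
    obtain ⟨u, hu⟩ := hedge.exists_inv hreg (f := fun x => a x - c * S.wC x)
      (isFunSpace_memL2per.sub ha.1 (isFunSpace_memL2per.smul c hedge.memH2per_w.memL2per)) (by
        have e : ∀ x, S.wC x * (a x - c * S.wC x) = S.wC x * a x - c * (S.wC x * S.wC x) := fun x => by ring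
        simp only [e]
        rw [integral_sub i1 (i2.const_mul c), integral_const_mul, hedge.integral_w_w, ← hc, mul_one, sub_self])
    have hur := hedge.inv_real hu (by
      filter_upwards [ha.2] with x hx
      rw [map_sub, map_mul, hx, hcr]; simp [Setting.wC])
    refine ⟨fun z => u z.1 * b z.2, TS.tensor ⟨hu.1, hur⟩ hb, ?_, Filter.Eventually.of_forall fun y => ?_⟩
    · filter_upwards [Lstar2_tensor hedge hu.1 (MemL2.locallyIntegrable (MemSob.base hb.1)),
        Measure.quasiMeasurePreserving_fst.ae hu.2.1] with z a1 a2
      rw [a1, a2, Setting.env_tensor, ← hc]; ring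
    · rw [Setting.env_tensor, hu.2.2, zero_mul]
  | zero =>
    refine ⟨fun _ => 0, TS.zero, ?_, Filter.Eventually.of_forall fun y => by simp [Setting.env]⟩
    filter_upwards [(IsLap.zero (D := ex (d := d))).lap_ae_eq] with z hz
    rw [Setting.Lstar2, schr, hz]; simp [Setting.env]
  | add hU hV h1 h2 =>
    obtain ⟨Z1, a1, a2, a3⟩ := h1
    obtain ⟨Z2, b1, b2, b3⟩ := h2
    refine ⟨_, TS.add a1 b1, ?_, ?_⟩
    · filter_upwards [schr_add (fun z => S.V z.1) S.Es (MemSob.isLap_of a1.memSob_ex_of) (MemSob.isLap_of b1.memSob_ex_of), a2, b2,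
        Measure.quasiMeasurePreserving_snd.ae (hedge.env_add hU.memL2two_of hV.memL2two_of)] with z c1 c2 c3 c4
      simp only [Setting.Lstar2] at c1 c2 c3 ⊢
      rw [c1, c2, c3, c4]; ring
    · filter_upwards [hedge.env_add a1.memSob_ex_of.base b1.memSob_ex_of.base, a3, b3] with y c1 c2 c3
      rw [c1, c2, c3, add_zero]
  | congr _ h h1 =>
    obtain ⟨Z1, a1, a2, a3⟩ := h1
    refine ⟨Z1, a1, ?_, a3⟩
    filter_upwards [a2, h, Measure.quasiMeasurePreserving_snd.ae (Setting.env_congr (S := S) h)] with z c1 c2 c3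
    rw [c1, c2, c3]

end Edge

section Correctors

variable {g : Fin d → Pt d → ℂ} (hgr : ∀ j, RealMem MemH2per (g j))

include hgr

theorem TS.firstCorr {s : ℕ} {F : Pt d → ℂ} (hF : RealMem (MemH (s + 1)) F) : TS MemH2per (MemH s) (Setting.firstCorr g F) := by
  refine TS.congr (TS.smul isFunSpace_memH2per 2 (TS.sum Finset.univ fun j _ => TS.tensor (hgr j) (RealMem.wd hF j)))
    (Filter.Eventually.of_forall fun z => ?_)
  simp only [Setting.firstCorr]
  push_cast
  congr 1
  exact Finset.sum_congr rfl fun j _ => mul_comm _ _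

theorem TS.calL {s : ℕ} (hσ : (d : ℝ) < 2 * σ) (hQ : MemHReal σ S.Q) (hs : (s : ℝ) ≤ σ) (hw : RealMem MemH2per S.wC) {F : Pt d → ℂ}
    (hF : RealMem (MemH (s + 2)) F) : TS MemL2per (MemH s) (S.calL g F) := by
  have hP := isFunSpace_memH (d := d) s
  have hF' : RealMem (MemH s) F := hF.imp fun _ h => MemSob.mono (by omega) h
  have hlap : RealMem (MemH s) (lap ev F) := RealMem.sum hP _ fun j _ => RealMem.wd (RealMem.wd hF j) j
  have hschr : RealMem (MemH s) (schr ev S.Q S.eAQ F) :=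
    ((hlap.neg hP).add hP ⟨memH_mul hσ hQ hs hF'.1, (aeReal_ofReal S.Q).mul hF'.2⟩).sub hP (hF'.smul hP S.eAQ)
  refine TS.congr (TS.add (TS.smul isFunSpace_memL2per (-4) (TS.sum Finset.univ fun j _ => TS.sum Finset.univ fun l _ =>
    TS.tensor ((RealMem.wd (k := 1) (hgr l) j).imp fun u hu => hu.base) (RealMem.wd (RealMem.wd hF l) j)))
    (TS.tensor (hw.imp fun _ h => h.base) hschr)) (Filter.Eventually.of_forall fun z => ?_)
  simp only [Setting.calL]
  push_cast
  rfl

end Correctors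

end MultiScale

/-! ### The right hand sides of the hierarchy for functions of the expected form -/

namespace MultiScale

variable {d : ℕ} {S : Setting d} {σ : ℝ}

theorem firstCorr_congr {g : Fin d → Pt d → ℂ} {F F' : Pt d → ℂ} (h : ∀ᵐ y, F y = F' y) :
    Setting.firstCorr g F = Setting.firstCorr g F' := by
  funext z
  unfold Setting.firstCorr
  simp only [wd_congr h]

theorem calL_congr {g : Fin d → Pt d → ℂ} {F F' : Pt d → ℂ} (h : ∀ᵐ y, F y = F' y) :
    ∀ᵐ z, S.calL g F z = S.calL g F' z := by
  filter_upwards [Measure.quasiMeasurePreserving_snd.ae (schr_congr (D := ev) S.Q S.eAQ h)] with z hz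
  unfold Setting.calL
  rw [hz]
  have : ∀ l, wd (ev l) F = wd (ev l) F' := fun l => wd_congr h
  simp only [this]

/-- The representation `w F_n + 2 ∂_{y_j} F_{n-1} g_j - Z_n`. -/
def Setting.uform (S : Setting d) (g : Fin d → Pt d → ℂ) (F : ℕ → Pt d → ℂ) (Z : ℕ → Pt d × Pt d → ℂ) :
    ℕ → Pt d × Pt d → ℂ
  | 0, z => S.wC z.1 * F 0 z.2
  | n + 1, z => S.wC z.1 * F (n + 1) z.2 + Setting.firstCorr g (F n) z - Z (n + 1) z

/-- The inhomogeneity `H_{n+3}`. -/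
def Setting.hform (S : Setting d) (μ : ℕ → ℝ) (g : Fin d → Pt d → ℂ) (F : ℕ → Pt d → ℂ) (Z U : ℕ → Pt d × Pt d → ℂ)
    (n : ℕ) (z : Pt d × Pt d) : ℂ :=
  2 * Setting.cross (Z (n + 2)) z
    + schr ey (fun z => S.Q z.2) S.eAQ (fun z => Setting.firstCorr g (F n) z - Z (n + 1) z) z
    - ∑ j ∈ Finset.Icc 3 (n + 2), (μ j : ℂ) * U (n + 3 - j) z

theorem hform_congr {μ μ' : ℕ → ℝ} {g : Fin d → Pt d → ℂ} {F F' : ℕ → Pt d → ℂ} {Z Z' U U' : ℕ → Pt d × Pt d → ℂ} {n : ℕ}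
    (hμ : ∀ j, 3 ≤ j → j ≤ n + 2 → μ j = μ' j) (hF : ∀ᵐ y, F n y = F' n y) (hZ1 : Z (n + 1) = Z' (n + 1)) (hZ2 : Z (n + 2) = Z' (n + 2))
    (hU : ∀ m ≤ n, ∀ᵐ z, U m z = U' m z) : ∀ᵐ z, S.hform μ g F Z U n z = S.hform μ' g F' Z' U' n z := by
  have h : ∀ᵐ z, ∀ m ≤ n, U m z = U' m z := by
    rw [ae_all_iff]; intro m
    by_cases hm : m ≤ n
    · exact (hU m hm).mono fun z hz _ => hz
    · exact Filter.Eventually.of_forall fun z h => absurd h hm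
  filter_upwards [h] with z hz
  unfold Setting.hform
  rw [firstCorr_congr hF, hZ1, hZ2]
  congr 1
  refine Finset.sum_congr rfl fun j hj => ?_
  rw [Finset.mem_Icc] at hj
  rw [hμ j hj.1 hj.2, hz _ (by omega)]

section Expansion

variable (hedge : S.BandEdge) {g : Fin d → Pt d → ℂ}
  (hg : ∀ j, S.IsLstarInv (wd (ev j) S.wC) (g j))

theorem memSob_firstCorr (hg : ∀ j, MemH2per (g j)) {l : ℕ} {F : Pt d → ℂ} (hF : MemH (l + 1) F) :
    MemSob (MemSob MemL2two ey l) ex 2 (Setting.firstCorr g F) := by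
  have hP := isFunSpace_memSob (isFunSpace_memSob (isFunSpace_memL2two (d := d)) ey l) ex 2
  refine hP.congr (hP.smul 2 (hP.sum Finset.univ fun j _ => memSob_ex_tensor (hg j) (MemSob.wd hF j)))
    (Filter.Eventually.of_forall fun z => ?_)
  simp only [Setting.firstCorr]
  congr 1
  exact Finset.sum_congr rfl fun j _ => mul_comm _ _

theorem isCross_firstCorr (hg : ∀ j, MemH2per (g j)) {F : Pt d → ℂ} (hF : MemH 2 F) :
    IsCross (Setting.firstCorr g F) fun z => 2 * ∑ l, ∑ j, wd (ev j) (g l) z.1 * wd (ev j) (wd (ev l) F) z.2 := by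
  refine ((IsCross.sum Finset.univ fun l _ => isCross_tensor (fun j => MemSob.hasWeakDeriv (hg l) j)
    (fun j => (MemSob.wd hF l).hasWeakDeriv j)).smul 2).congr (Filter.Eventually.of_forall fun z => ?_)
  simp only [Setting.firstCorr]
  congr 1
  exact Finset.sum_congr rfl fun j _ => mul_comm _ _

/-- The second order part of ℒ is minus the cross term 2 ∇_x·∇_y of the first corrector; it enters
the equation two orders above the envelope F. -/
theorem calL_eq (hg : ∀ j, MemH2per (g j)) {F : Pt d → ℂ} (hF : MemH 2 F) :
    ∀ᵐ z, S.calL g F z = -2 * Setting.cross (Setting.firstCorr g F) z + S.wC z.1 * schr ev S.Q S.eAQ F z.2 := by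
  filter_upwards [(isCross_firstCorr hg hF).cross_ae_eq] with z hz
  rw [hz, Setting.calL, Finset.sum_comm]
  ring

theorem env_firstCorr (hg : ∀ j, S.IsLstarInv (wd (ev j) S.wC) (g j)) (hedge : S.BandEdge) {F : Pt d → ℂ} (hF : MemH 1 F) :
    ∀ᵐ y, S.env (Setting.firstCorr g F) y = 0 := by
  have h : ∀ j, MemL2two fun z => g j z.1 * wd (ev j) F z.2 := fun j => memL2two_tensor (hg j).1.memL2per (MemSob.wd hF j)
  have e : Setting.firstCorr g F = fun z => 2 * ∑ j, g j z.1 * wd (ev j) F z.2 := by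
    funext z
    simp only [Setting.firstCorr, mul_comm]
  rw [e]
  filter_upwards [hedge.env_sum Finset.univ fun j _ => h j] with y hy
  rw [Setting.env_smul, hy]
  simp [Setting.env_tensor, (hg _).2.2]

include hedge

theorem isCross_w_tensor {F : Pt d → ℂ} (hF : MemH 1 F) :
    IsCross (fun z => S.wC z.1 * F z.2) fun z => ∑ j, wd (ev j) S.wC z.1 * wd (ev j) F z.2 :=
  isCross_tensor (fun j => MemSob.hasWeakDeriv hedge.memH2per_w j) fun j => MemSob.hasWeakDeriv hF j

theorem env_cross_w_tensor {F : Pt d → ℂ} (hF : MemH 1 F) : ∀ᵐ y, S.env (Setting.cross fun z => S.wC z.1 * F z.2) y = 0 := by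
  have h : ∀ j, MemL2two fun z => wd (ev j) S.wC z.1 * wd (ev j) F z.2 := fun j =>
    memL2two_tensor (hedge.memH2per_w.wd j) (MemSob.wd hF j)
  filter_upwards [Setting.env_congr (S := S) (isCross_w_tensor hedge hF).cross_ae_eq, hedge.env_sum Finset.univ fun j _ => h j] with y a b
  rw [a, b]
  simp [Setting.env_tensor, integral_w_wd_w hedge]

theorem schr_ey_w_tensor {F : Pt d → ℂ} (hF : MemH 2 F) :
    ∀ᵐ z, schr ey (fun z => S.Q z.2) S.eAQ (fun z => S.wC z.1 * F z.2) z = S.wC z.1 * schr ev S.Q S.eAQ F z.2 := by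
  filter_upwards [((MemSob.isLap_of hF).tensor_right (locallyIntegrable_w hedge)).lap_ae_eq] with z hz
  rw [schr, hz, schr]
  ring

include hg

/-- Since L_* g_j = ∂_j w, the first corrector absorbs the cross term of w F. -/
theorem Lstar2_firstCorr {F : Pt d → ℂ} (hF : MemH 1 F) :
    ∀ᵐ z, S.Lstar2 (Setting.firstCorr g F) z = 2 * Setting.cross (fun z => S.wC z.1 * F z.2) z := by
  have h := (IsLap.sum Finset.univ fun j _ => (MemSob.isLap_of (hg j).1).tensor_left
    (MemL2.locallyIntegrable (MemSob.wd hF j))).smul 2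
  have h' : IsLap ex (Setting.firstCorr g F) _ := h.congr (Filter.Eventually.of_forall fun z => by
    simp only [Setting.firstCorr]
    congr 1
    exact Finset.sum_congr rfl fun j _ => mul_comm _ _) (Filter.Eventually.of_forall fun _ => rfl)
  have hL : ∀ᵐ x, ∀ j, S.Lstar (g j) x = wd (ev j) S.wC x := ae_all_iff.2 fun j => (hg j).2.1
  filter_upwards [h'.lap_ae_eq, (isCross_w_tensor hedge hF).cross_ae_eq, Measure.quasiMeasurePreserving_fst.ae hL] with z a b c
  rw [Setting.Lstar2, schr, a, b]
  simp only [Setting.Lstar, schr] at c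
  simp only [Setting.firstCorr, ← c, Finset.mul_sum, ← Finset.sum_neg_distrib, ← Finset.sum_add_distrib, ← Finset.sum_sub_distrib]
  exact Finset.sum_congr rfl fun j _ => by ring

variable {F : ℕ → Pt d → ℂ} {Z U : ℕ → Pt d × Pt d → ℂ} {μ : ℕ → ℝ}

theorem cross_uform {n : ℕ} (hF1 : MemH 1 (F (n + 1))) (hF : MemH 2 (F n)) {C : Pt d × Pt d → ℂ} (hZ : IsCross (Z (n + 1)) C) :
    ∀ᵐ z, Setting.cross (S.uform g F Z (n + 1)) z = Setting.cross (fun z => S.wC z.1 * F (n + 1) z.2) z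
      + Setting.cross (Setting.firstCorr g (F n)) z - Setting.cross (Z (n + 1)) z := by
  have h1 := isCross_w_tensor hedge hF1
  have h2 := isCross_firstCorr (fun j => (hg j).1) hF
  filter_upwards [((h1.add h2).sub hZ).cross_ae_eq, h1.cross_ae_eq, h2.cross_ae_eq, hZ.cross_ae_eq] with z a b c e
  rw [b, c, e]
  exact a

theorem isLap_ey_firstCorr {F : Pt d → ℂ} (hF : MemH 3 F) :
    IsLap ey (Setting.firstCorr g F) (lap ey (Setting.firstCorr g F)) :=
  MemSob.isLap_of (MemSob.base (memSob_firstCorr (l := 2) (fun j => (hg j).1) hF))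

theorem schr_uform {n : ℕ} (hF1 : MemH 2 (F (n + 1))) (hF : MemH 3 (F n)) {L : Pt d × Pt d → ℂ} (hZ : IsLap ey (Z (n + 1)) L) :
    ∀ᵐ z, schr ey (fun z => S.Q z.2) S.eAQ (S.uform g F Z (n + 1)) z = S.wC z.1 * schr ev S.Q S.eAQ (F (n + 1)) z.2
      + schr ey (fun z => S.Q z.2) S.eAQ (fun z => Setting.firstCorr g (F n) z - Z (n + 1) z) z := by
  have h1 := (MemSob.isLap_of hF1).tensor_right (locallyIntegrable_w hedge)
  have h2 := (isLap_ey_firstCorr hedge hg hF).sub hZ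
  have e : S.uform g F Z (n + 1) = fun z => S.wC z.1 * F (n + 1) z.2 + (Setting.firstCorr g (F n) z - Z (n + 1) z) := by
    funext z; simp only [Setting.uform]; ring
  rw [e]
  filter_upwards [schr_add (fun z => S.Q z.2) S.eAQ h1 h2, schr_ey_w_tensor hedge hF1] with z a b
  rw [a, b]

/-- The number e_{A,Q} is already part of ℒ. Keeping μ_2 free leaves the multiple (μ_2 - e_{A,Q}) w
F_0, from which μ_2 is later identified. -/
theorem rhs_two (hμ : μ 1 = 0) (hZ : Z 1 = 0) (h0 : ∀ᵐ z, U 0 z = S.uform g F Z 0 z) (h1 : ∀ᵐ z, U 1 z = S.uform g F Z 1 z)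
    (hF0 : MemH 2 (F 0)) (hF1 : MemH 1 (F 1)) :
    ∀ᵐ z, S.rhs μ U 2 z = 2 * Setting.cross (fun z => S.wC z.1 * F 1 z.2) z - S.calL g (F 0) z
      + ((μ 2 : ℂ) - S.eAQ) * (S.wC z.1 * F 0 z.2) := by
  have hZ' : IsCross (Z 1) fun _ => 0 := by rw [hZ]; exact IsCross.zero
  filter_upwards [h0, h1, cross_uform hedge hg hF1 hF0 hZ', hZ'.cross_ae_eq, schr_congr (D := ey) (fun z => S.Q z.2) S.eAQ h0,
    schr_ey_w_tensor hedge hF0, calL_eq (S := S) (fun j => (hg j).1) hF0] with z a0 a1 b1 b2 c1 c2 e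
  have hs : (Finset.Icc 1 2 : Finset ℕ) = {1, 2} := rfl
  rw [Setting.rhs, zero_add, cross_congr h1, b1, b2, hs, Finset.sum_pair (by norm_num), hμ, e]
  have c3 : schr ey (fun z => S.Q z.2) S.eAQ (U 0) z = S.wC z.1 * schr ev S.Q S.eAQ (F 0) z.2 := c1.trans c2
  rw [schr, lap_congr h0] at c3
  rw [lap_congr h0, ← c3]
  simp only [a0, Setting.uform]
  push_cast
  ring

/-- Three kinds of terms are separated: the cross term of w F_{n+2}, which the corrector in U_{n+3}
absorbs; the contributions of F_{n+1}, which form ℒ[F_{n+1}]; and the remainder H_{n+3}, in which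
only F_0, ..., F_n and Z occur. -/
theorem rhs_add_three {n : ℕ} (hμ1 : μ 1 = 0) (hμ2 : μ 2 = S.eAQ) (h0 : ∀ᵐ z, U 0 z = S.uform g F Z 0 z)
    (h1 : ∀ᵐ z, U (n + 1) z = S.uform g F Z (n + 1) z) (h2 : ∀ᵐ z, U (n + 2) z = S.uform g F Z (n + 2) z)
    (hF0 : MemH 3 (F n)) (hF1 : MemH 2 (F (n + 1))) (hF2 : MemH 1 (F (n + 2))) {C L : Pt d × Pt d → ℂ}
    (hZ1 : IsLap ey (Z (n + 1)) L) (hZ2 : IsCross (Z (n + 2)) C) :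
    ∀ᵐ z, S.rhs μ U (n + 3) z = 2 * Setting.cross (fun z => S.wC z.1 * F (n + 2) z.2) z
      - (S.calL g (F (n + 1)) z + S.hform μ g F Z U n z - (μ (n + 3) : ℂ) * (S.wC z.1 * F 0 z.2)) := by
  filter_upwards [h0, cross_uform hedge hg hF2 hF1 hZ2, schr_congr (D := ey) (fun z => S.Q z.2) S.eAQ h1,
    schr_uform hedge hg hF1 hF0 hZ1, calL_eq (S := S) (fun j => (hg j).1) hF1] with z a0 b1 c1 c2 e
  -- The index 1 contributes nothing, the index 2 supplies -e_{A,Q} in the slow operator, and the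
  -- last index multiplies U_0, isolating μ_{n+3}.
  have hs : (Finset.Icc 1 (n + 3) : Finset ℕ) = insert 1 (insert 2 (insert (n + 3) (Finset.Icc 3 (n + 2)))) := by
    ext j; simp only [Finset.mem_Icc, Finset.mem_insert]; omega
  have c3 := c1.trans c2
  rw [schr] at c3
  rw [show S.rhs μ U (n + 3) z = 2 * Setting.cross (U (n + 2)) z - (- lap ey (U (n + 1)) z + (S.Q z.2 : ℂ) * U (n + 1) z)
      + ∑ j ∈ Finset.Icc 1 (n + 3), (μ j : ℂ) * U (n + 3 - j) z from rfl, cross_congr h2, b1, hs,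
    Finset.sum_insert (by simp), Finset.sum_insert (by simp), Finset.sum_insert (by simp), hμ1, hμ2, e, Setting.hform,
    Nat.sub_self, a0, show n + 3 - 2 = n + 1 from rfl]
  simp only [Setting.uform]
  push_cast
  linear_combination -c3

end Expansion

end MultiScale

/-! ### Recursive construction of μ_n, F_n and Z_n -/

namespace MultiScale

/-- Sequences defined by a solvable recursive condition on the preceding terms. -/
theorem exists_seq_of_recursion {α : Type*} [Inhabited α] (P : ℕ → (ℕ → α) → α → Prop)
    (hloc : ∀ n h h' a, (∀ k < n, h k = h' k) → P n h a → P n h' a)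
    (hstep : ∀ n h, (∀ k < n, P k h (h k)) → ∃ a, P n h a) : ∃ f : ℕ → α, ∀ n, P n f (f n) := by
  classical
  -- `H n` is the sequence after n choices, with default values beyond. Because the condition at n
  -- sees only earlier entries, it is unaffected when the partial sequence is replaced by the final
  -- one.
  let c : ℕ → (ℕ → α) → α := fun n h => if e : ∃ a, P n h a then e.choose else default
  let H : ℕ → ℕ → α := fun n => Nat.rec (fun _ => default) (fun n h => Function.update h n (c n h)) n
  have hs : ∀ n, H (n + 1) = Function.update (H n) n (c n (H n)) := fun n => rfl
  have hst : ∀ n k m, k < n → n ≤ m → H m k = H n k := fun n k m hk hm => by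
    induction m, hm using Nat.le_induction with
    | base => rfl
    | succ m hm ih => rw [hs, Function.update_of_ne (by omega), ih]
  refine ⟨fun n => H (n + 1) n, fun n => ?_⟩
  induction n using Nat.strong_induction_on with
  | _ n ih =>
    have hag : ∀ k < n, H (k + 1) k = H n k := fun k hk => (hst (k + 1) k n (by omega) (by omega)).symm
    have e : ∃ a, P n (H n) a := hstep n (H n) fun k hk => by
      rw [← hag k hk]
      exact hloc k _ _ _ (fun l hl => hag l (hl.trans hk)) (ih k hk)
    have : P n (H n) (H (n + 1) n) := by
      rw [hs, Function.update_self]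
      simp only [c, dif_pos e]
      exact e.choose_spec
    exact hloc n _ _ _ (fun k hk => (hag k hk).symm) this

variable {d : ℕ} {S : Setting d} {σ : ℝ}

theorem uform_eq {g : Fin d → Pt d → ℂ} {F F' : ℕ → Pt d → ℂ} {Z Z' : ℕ → Pt d × Pt d → ℂ} {n : ℕ}
    (hF : ∀ m ≤ n, F m = F' m) (hZ : ∀ m ≤ n, Z m = Z' m) : S.uform g F Z n = S.uform g F' Z' n := by
  cases n with
  | zero => funext z; simp only [Setting.uform, hF 0 le_rfl]
  | succ n => funext z; simp only [Setting.uform, hF (n + 1) le_rfl, hF n (Nat.le_succ n), hZ (n + 1) le_rfl]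

theorem hform_eq {μ μ' : ℕ → ℝ} {g : Fin d → Pt d → ℂ} {F F' : ℕ → Pt d → ℂ} {Z Z' : ℕ → Pt d × Pt d → ℂ} {n : ℕ}
    (hμ : ∀ j ≤ n + 2, μ j = μ' j) (hF : ∀ m ≤ n, F m = F' m) (hZ : ∀ m ≤ n + 2, Z m = Z' m) :
    S.hform μ g F Z (S.uform g F Z) n = S.hform μ' g F' Z' (S.uform g F' Z') n := by
  funext z
  unfold Setting.hform
  rw [hF n le_rfl, hZ (n + 1) (by omega), hZ (n + 2) le_rfl]
  congr 1
  refine Finset.sum_congr rfl fun j hj => ?_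
  rw [Finset.mem_Icc] at hj
  rw [hμ j hj.2, uform_eq (F := F) (F' := F') (Z := Z) (Z' := Z') (fun m hm => hF m (by omega)) fun m hm => hZ m (by omega)]

/-- The conditions which determine the coefficients of order `n + 3` from the preceding ones. -/
structure Setting.IsNextOrder (S : Setting d) (N : ℕ) (g : Fin d → Pt d → ℂ) (H : Pt d × Pt d → ℂ) (n : ℕ) (m : ℝ)
    (f : Pt d → ℂ) (z : Pt d × Pt d → ℂ) : Prop where
  memF : ∀ s, s + (n + 1) ≤ N + 2 → RealMem (MemH s) f
  memZ : ∀ s, s + (n + 3) ≤ N + 2 → TS MemH2per (MemH s) z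
  memH : MemL2two H
  orth : ∫ y, S.FC y * f y = 0
  mu : (m : ℂ) = ∫ y, S.FC y * S.env H y
  eqF : ∀ᵐ y, S.LAQ f y = - S.env H y + (m : ℂ) * S.FC y
  eqZ : S.IsLstarInv2 (fun x => S.calL g f x + H x - (m : ℂ) * (S.wC x.1 * S.FC x.2)) z

section Recursion

variable (hreg : S.Regularity σ) (hedge : S.BandEdge) (hhom : S.HomogenizedEigenpair) (hσ : (d : ℝ) < 2 * σ)
  {N : ℕ} (hN : (N : ℝ) ≤ σ) {g : Fin d → Pt d → ℂ} (hg : ∀ j, S.IsLstarInv (wd (ev j) S.wC) (g j))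

include hreg hedge

theorem exists_real_g : ∃ g : Fin d → Pt d → ℂ, ∀ j, S.IsLstarInv (wd (ev j) S.wC) (g j) := by
  choose g hg using fun j => hedge.exists_inv hreg (f := wd (ev j) S.wC) (hedge.memH2per_w.wd j) (integral_w_wd_w hedge j)
  exact ⟨g, hg⟩

omit hreg in
theorem realMem_g (hg : ∀ j, S.IsLstarInv (wd (ev j) S.wC) (g j)) (j : Fin d) : RealMem MemH2per (g j) :=
  ⟨(hg j).1, hedge.inv_real (hg j) ((realMem_w hedge).2.wd (hedge.memH2per_w.hasWeakDeriv j).weakDiff)⟩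

theorem exists_TS_inv {s : ℕ} (hs : 2 ≤ s) {U : Pt d × Pt d → ℂ} (h : TS MemL2per (MemH s) U) (h0 : ∀ᵐ y, S.env U y = 0) :
    ∃ Z, TS MemH2per (MemH s) Z ∧ S.IsLstarInv2 U Z := by
  obtain ⟨Z, h1, h2, h3⟩ := h.exists_Lstar2_inv hreg hedge
  refine ⟨Z, h1, (h1.imp (fun _ h => h) fun _ h => MemSob.mono hs h).memH2H2, ?_, h3⟩
  filter_upwards [h2, Measure.quasiMeasurePreserving_snd.ae h0] with z a b
  rw [a, b, mul_zero, sub_zero]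

include hhom hσ hN

-- Elliptic regularity for the eigenvalue equation, with right hand side zero: Q preserves H^N
-- because N ≤ σ, and two derivatives are gained. This is the regularity budget for the recursion.
omit hedge in
theorem realMem_FC {s : ℕ} (hs : s ≤ N + 2) : RealMem (MemH s) S.FC :=
  ⟨MemSob.mono hs (memH_of_LAQ hhom hσ hreg.Q_sobolev hN hhom.memH2 hhom.eigen (isFunSpace_memH N).zero), aeReal_ofReal S.FAQ⟩

include hg

/-- The three unknowns of an order are found one after the other. The number m makes -env H + m
F_{A,Q} orthogonal to F_{A,Q}; then f exists by the Fredholm alternative in y; and the equation for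
f says exactly that ℒ[f] + H - m w F_{A,Q} has zero envelope, so that L_* can be inverted. -/
theorem exists_nextOrder {n : ℕ} (hn : n + 3 ≤ N) {μ : ℕ → ℝ} {F : ℕ → Pt d → ℂ} {Z : ℕ → Pt d × Pt d → ℂ}
    (hF : ∀ m ≤ n, ∀ s, s + m ≤ N + 2 → RealMem (MemH s) (F m))
    (hZ : ∀ m ≤ n + 2, ∀ s, s + m ≤ N + 2 → TS MemH2per (MemH s) (Z m)) :
    ∃ m f z, S.IsNextOrder N g (S.hform μ g F Z (S.uform g F Z) n) n m f z := by
  have hgr := realMem_g hedge hg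
  have hQ := hreg.Q_sobolev
  -- The y-regularity left at order n + 3 is s = N - 1 - n. H is of class H^s, hence f = F_{n+1}
  -- gains two derivatives and is of class H^{s+2}, while Z_{n+3} is of class H^s with s ≥ 2 because
  -- n + 3 ≤ N.
  obtain ⟨s, hs⟩ : ∃ s, s + (n + 3) = N + 2 := ⟨N - (n + 1), by omega⟩
  have hsσ : (s : ℝ) ≤ σ := le_trans (by exact_mod_cast (show s ≤ N by omega)) hN
  set H := S.hform μ g F Z (S.uform g F Z) n with hH
  have hU : ∀ m ≤ n, TS MemH2per (MemH s) (S.uform g F Z m) := fun m hm => by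
    cases m with
    | zero => exact TS.tensor (realMem_w hedge) (hF 0 hm s (by omega))
    | succ m =>
      exact TS.sub isFunSpace_memH2per (TS.add (TS.tensor (realMem_w hedge) (hF (m + 1) hm s (by omega)))
        (TS.firstCorr hgr (hF m (by omega) (s + 1) (by omega)))) (hZ (m + 1) (by omega) s (by omega))
  have l2 : ∀ u : Pt d → ℂ, MemH2per u → MemL2per u := fun _ h => h.memL2per
  have hHT : TS MemL2per (MemH s) H := by
    refine TS.sub isFunSpace_memL2per (TS.add ?_ ?_) (TS.sum _ fun j hj => TS.smul isFunSpace_memL2per _ ?_)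
    · have := TS.smul isFunSpace_memL2per 2 (TS.cross (hZ (n + 2) le_rfl (s + 1) (by omega)))
      simpa using this
    · exact (TS.schr_ey hσ hQ hsσ S.eAQ isFunSpace_memH2per l2 (TS.sub isFunSpace_memH2per
        (TS.firstCorr hgr (hF n le_rfl (s + 2 + 1) (by omega))) (hZ (n + 1) (by omega) (s + 2) (by omega)))).imp l2 fun _ h => h
    · rw [Finset.mem_Icc] at hj
      exact (hU _ (by omega)).imp l2 fun _ h => h
  have hE := hHT.env hedge
  have hFC := realMem_FC hreg hhom hσ hN (s := s) (by omega)
  have i1 : Integrable fun y => S.FC y * S.env H y := MemLp.integrable_mul (MemSob.base hFC.1) (MemSob.base hE.1)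
  have i2 : Integrable fun y => S.FC y * S.FC y := MemLp.integrable_mul (MemSob.base hFC.1) (MemSob.base hFC.1)
  -- All factors are real valued, so the complex integral is a real number and nothing is lost by
  -- taking its real part.
  have hm : (((∫ y, S.FC y * S.env H y).re : ℝ) : ℂ) = ∫ y, S.FC y * S.env H y :=
    Complex.conj_eq_iff_re.1 (hFC.2.mul hE.2).integral
  set m := (∫ y, S.FC y * S.env H y).re with hmdef
  have hr : RealMem (MemH s) fun y => - S.env H y + (m : ℂ) * S.FC y :=
    (hE.neg (isFunSpace_memH s)).add (isFunSpace_memH s) (hFC.smul (isFunSpace_memH s) m)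
  obtain ⟨f, f1, f2, f3⟩ := exists_LAQ_inv hhom hσ hQ (MemSob.base hr.1) (by
    have e : ∀ y, S.FC y * (- S.env H y + (m : ℂ) * S.FC y) = (m : ℂ) * (S.FC y * S.FC y) - S.FC y * S.env H y := fun y => by ring
    simp only [e]
    rw [integral_sub (i2.const_mul _) i1, integral_const_mul, integral_FC_FC hhom hσ hQ, ← hm, mul_one, sub_self])
  have fr : RealMem (MemH (s + 2)) f := ⟨memH_of_LAQ hhom hσ hQ hsσ f1 f2 hr.1, LAQ_inv_real hhom hσ hQ f1 f2 f3 hr.2⟩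
  have hc := TS.calL hgr hσ hQ hsσ (realMem_w hedge) fr
  have hw : TS MemL2per (MemH s) fun x => (m : ℂ) * (S.wC x.1 * S.FC x.2) :=
    TS.smul isFunSpace_memL2per m (TS.tensor ((realMem_w hedge).imp l2) hFC)
  obtain ⟨z, z1, z2⟩ := exists_TS_inv hreg hedge (by omega) (TS.sub isFunSpace_memL2per (TS.add hc hHT) hw) (by
    filter_upwards [hedge.env_sub (TS.add hc hHT).memL2two_of hw.memL2two_of, hedge.env_add hc.memL2two_of hHT.memL2two_of,
      Setting.env_calL hreg hedge hg f1, f2] with y a b c e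
    rw [a, b, c, e, Setting.env_smul, hedge.env_w_tensor]; ring)
  exact ⟨m, f, z, fun t ht => fr.imp fun _ h => MemSob.mono (by omega) h,
    fun t ht => z1.imp (fun _ h => h) fun _ h => MemSob.mono (by omega) h, hHT.memL2two_of, f3, hm, f2, z2⟩

/-- At order two the solvability condition is the eigenvalue equation L_{A,Q} F_{A,Q} = 0. -/
theorem exists_Z_two (h2 : 2 ≤ N) : ∃ Z, TS MemH2per (MemH N) Z ∧ S.IsLstarInv2 (S.calL g S.FC) Z := by
  refine exists_TS_inv hreg hedge h2 (TS.calL (realMem_g hedge hg) hσ hreg.Q_sobolev hN (realMem_w hedge)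
    (realMem_FC hreg hhom hσ hN le_rfl)) ?_
  filter_upwards [Setting.env_calL hreg hedge hg hhom.memH2, hhom.eigen] with y a b
  rw [a, b]

end Recursion

/-- The coefficients of the expansion up to order `N`. -/
structure Setting.IsCanonical (S : Setting d) (N : ℕ) (g : Fin d → Pt d → ℂ) (μ : ℕ → ℝ) (F : ℕ → Pt d → ℂ)
    (Z : ℕ → Pt d × Pt d → ℂ) : Prop where
  mu_one : μ 1 = 0
  mu_two : μ 2 = S.eAQ
  F_zero : F 0 = S.FC
  Z_zero : Z 0 = 0
  Z_one : Z 1 = 0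
  Z_two : 2 ≤ N → TS MemH2per (MemH N) (Z 2) ∧ S.IsLstarInv2 (S.calL g S.FC) (Z 2)
  next : ∀ n, n + 3 ≤ N → S.IsNextOrder N g (S.hform μ g F Z (S.uform g F Z) n) n (μ (n + 3)) (F (n + 1)) (Z (n + 3))

theorem exists_isCanonical (hreg : S.Regularity σ) (hedge : S.BandEdge) (hhom : S.HomogenizedEigenpair) (hσ : (d : ℝ) < 2 * σ)
    {N : ℕ} (hN : (N : ℝ) ≤ σ) {g : Fin d → Pt d → ℂ} (hg : ∀ j, S.IsLstarInv (wd (ev j) S.wC) (g j)) :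
    ∃ μ F Z, S.IsCanonical N g μ F Z := by
  let M : (ℕ → ℝ × (Pt d → ℂ) × (Pt d × Pt d → ℂ)) → ℕ → ℝ := fun h k => (h k).1
  -- The entry with index n holds μ_n, F_{n-2} and Z_n, the quantities determined at order n; hence
  -- the shift by two.
  let F : (ℕ → ℝ × (Pt d → ℂ) × (Pt d × Pt d → ℂ)) → ℕ → Pt d → ℂ := fun h k => (h (k + 2)).2.1
  let Z : (ℕ → ℝ × (Pt d → ℂ) × (Pt d × Pt d → ℂ)) → ℕ → Pt d × Pt d → ℂ := fun h k => (h k).2.2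
  -- Entries 0 and 1 are zero, which encodes μ_1 = 0 and Z_0 = Z_1 = 0; their F components are never
  -- read. Entry 2 starts the recursion, and beyond N there is no condition.
  let P : ℕ → (ℕ → ℝ × (Pt d → ℂ) × (Pt d × Pt d → ℂ)) → ℝ × (Pt d → ℂ) × (Pt d × Pt d → ℂ) → Prop := fun n h a =>
    match n with
    | 0 => a = (0, 0, 0)
    | 1 => a = (0, 0, 0)
    | 2 => a.1 = S.eAQ ∧ a.2.1 = S.FC ∧ (2 ≤ N → TS MemH2per (MemH N) a.2.2 ∧ S.IsLstarInv2 (S.calL g S.FC) a.2.2)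
    | n + 3 => n + 3 ≤ N → S.IsNextOrder N g (S.hform (M h) g (F h) (Z h) (S.uform g (F h) (Z h)) n) n a.1 a.2.1 a.2.2
  obtain ⟨f, hf⟩ := exists_seq_of_recursion P (fun n h h' a hh ha => by
    match n, hh, ha with
    | 0, _, ha => exact ha
    | 1, _, ha => exact ha
    | 2, _, ha => exact ha
    | n + 3, hh, ha =>
      intro hn
      have := ha hn
      rwa [hform_eq (F := F h) (F' := F h') (Z := Z h) (Z' := Z h') (μ := M h) (μ' := M h')
        (fun j hj => by simp only [M, hh j (by omega)]) (fun j hj => by simp only [F, hh (j + 2) (by omega)])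
        (fun j hj => by simp only [Z, hh j (by omega)])] at this) (fun n h hh => by
    match n, hh with
    | 0, _ => exact ⟨_, rfl⟩
    | 1, _ => exact ⟨_, rfl⟩
    | 2, _ =>
      by_cases h2 : 2 ≤ N
      · obtain ⟨z, hz⟩ := exists_Z_two hreg hedge hhom hσ hN hg h2
        exact ⟨(S.eAQ, S.FC, z), rfl, rfl, fun _ => hz⟩
      · exact ⟨(S.eAQ, S.FC, 0), rfl, rfl, fun h => absurd h h2⟩
    | n + 3, hh =>
      by_cases hn : n + 3 ≤ N
      · have h0 : h 0 = (0, 0, 0) := hh 0 (by omega)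
        have h1 : h 1 = (0, 0, 0) := hh 1 (by omega)
        have h2 := hh 2 (by omega)
        have h3 : ∀ k, k < n → S.IsNextOrder N g _ k (h (k + 3)).1 (h (k + 3)).2.1 (h (k + 3)).2.2 := fun k hk =>
          hh (k + 3) (by omega) (by omega)
        obtain ⟨m, f, z, hz⟩ := exists_nextOrder hreg hedge hhom hσ hN hg hn (μ := M h) (F := F h) (Z := Z h) (fun k hk s hs => by
          cases k with
          | zero => rw [show F h 0 = S.FC from h2.2.1]; exact realMem_FC hreg hhom hσ hN (by omega)
          | succ k => exact (h3 k (by omega)).memF s (by omega)) (fun k hk s hs => by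
          match k, hk, hs with
          | 0, _, _ => simp only [Z, h0]; exact TS.zero
          | 1, _, _ => simp only [Z, h1]; exact TS.zero
          | 2, _, hs => exact (h2.2.2 (by omega)).1.imp (fun _ h => h) fun _ h => MemSob.mono (by omega) h
          | k + 3, hk, hs => exact (h3 k (by omega)).memZ s (by omega))
        exact ⟨(m, f, z), fun _ => hz⟩
      · exact ⟨(0, 0, 0), fun h => absurd h hn⟩)
  have h1 : f 1 = (0, 0, 0) := hf 1
  have h0 : f 0 = (0, 0, 0) := hf 0
  have h2 := hf 2
  exact ⟨M f, F f, Z f, by simp only [M, h1], h2.1, h2.2.1, by simp only [Z, h0], by simp only [Z, h1], h2.2.2,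
    fun n hn => hf (n + 3) hn⟩

end MultiScale

/-! ### Solutions built from the canonical coefficients -/

namespace MultiScale

variable {d : ℕ} {S : Setting d} {σ : ℝ}

theorem isLstarInv2_congr {G G' Z : Pt d × Pt d → ℂ} (h : S.IsLstarInv2 G Z) (hG : ∀ᵐ z, G z = G' z) : S.IsLstarInv2 G' Z :=
  ⟨h.1, by filter_upwards [h.2.1, hG] with z a b; rw [a, b], h.2.2⟩

theorem uform_congr {g : Fin d → Pt d → ℂ} {F F' : ℕ → Pt d → ℂ} {Z : ℕ → Pt d × Pt d → ℂ} {n : ℕ}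
    (hF : ∀ m ≤ n, ∀ᵐ y, F m y = F' m y) : ∀ᵐ z, S.uform g F Z n z = S.uform g F' Z n z := by
  cases n with
  | zero =>
    filter_upwards [Measure.quasiMeasurePreserving_snd.ae (hF 0 le_rfl)] with z hz
    simp only [Setting.uform, hz]
  | succ n =>
    filter_upwards [Measure.quasiMeasurePreserving_snd.ae (hF (n + 1) le_rfl)] with z hz
    simp only [Setting.uform, hz, firstCorr_congr (hF n (Nat.le_succ n))]

theorem Lstar2_zero : ∀ᵐ z, S.Lstar2 0 z = 0 := by
  filter_upwards [(IsLap.zero (D := ex (d := d))).lap_ae_eq] with z hz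
  rw [Setting.Lstar2, schr, show (0 : Pt d × Pt d → ℂ) = fun _ => 0 from rfl, hz]
  simp

section Canonical

variable (hreg : S.Regularity σ) (hedge : S.BandEdge) (hhom : S.HomogenizedEigenpair) (hσ : (d : ℝ) < 2 * σ)
  {N : ℕ} (hN : (N : ℝ) ≤ σ) {g : Fin d → Pt d → ℂ} (hg : ∀ j, S.IsLstarInv (wd (ev j) S.wC) (g j))
  {μ : ℕ → ℝ} {F : ℕ → Pt d → ℂ} {Z : ℕ → Pt d × Pt d → ℂ} (hC : S.IsCanonical N g μ F Z)

include hC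

theorem Setting.IsCanonical.memZ {m s : ℕ} (hm : m ≤ N) (hs : s + m ≤ N + 2) : TS MemH2per (MemH s) (Z m) := by
  match m, hm, hs with
  | 0, _, _ => rw [hC.Z_zero]; exact TS.zero
  | 1, _, _ => rw [hC.Z_one]; exact TS.zero
  | 2, hm, hs => exact (hC.Z_two hm).1.imp (fun _ h => h) fun _ h => MemSob.mono (by omega) h
  | m + 3, hm, hs => exact (hC.next m hm).memZ s hs

theorem Setting.IsCanonical.memH2H2_Z {m : ℕ} (hm : m ≤ N) : MemH2H2 (Z m) := (hC.memZ hm (by omega)).memH2H2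

theorem Setting.IsCanonical.env_Z {m : ℕ} (hm : m ≤ N) : ∀ᵐ y, S.env (Z m) y = 0 := by
  match m, hm with
  | 0, _ => rw [hC.Z_zero]; exact Filter.Eventually.of_forall fun y => by simp [Setting.env]
  | 1, _ => rw [hC.Z_one]; exact Filter.Eventually.of_forall fun y => by simp [Setting.env]
  | 2, hm => exact (hC.Z_two hm).2.2.2
  | m + 3, hm => exact (hC.next m hm).eqZ.2.2

include hreg hhom hσ hN in
theorem Setting.IsCanonical.memF {m s : ℕ} (hm : m + 2 ≤ N) (hs : s + m ≤ N + 2) : MemH s (F m) := by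
  cases m with
  | zero => rw [hC.F_zero]; exact (realMem_FC hreg hhom hσ hN hs).1
  | succ m => exact ((hC.next m hm).memF s hs).1

-- L_* annihilates w F_{n+1}, and on the first corrector it returns the cross term of w F_n. In this
-- way L_* U_{n+1} becomes independent of the envelope F_{n+1}.
omit hC in
include hedge hg in
theorem Lstar2_uform {n : ℕ} (hF1 : MemL2 (F (n + 1))) (hF : MemH 1 (F n)) (hZ : MemSob MemL2two ex 2 (Z (n + 1))) :
    MemSob MemL2two ex 2 (S.uform g F Z (n + 1)) ∧
    ∀ᵐ z, S.Lstar2 (S.uform g F Z (n + 1)) z = 2 * Setting.cross (fun z => S.wC z.1 * F n z.2) z - S.Lstar2 (Z (n + 1)) z := by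
  have hP := isFunSpace_memSob (isFunSpace_memL2two (d := d)) ex 2
  have h1 : MemSob MemL2two ex 2 fun z => S.wC z.1 * F (n + 1) z.2 := memSob_ex_tensor (l := 0) hedge.memH2per_w hF1
  have h2 : MemSob MemL2two ex 2 (Setting.firstCorr g (F n)) := memSob_firstCorr (l := 0) (fun j => (hg j).1) hF
  refine ⟨hP.sub (hP.add h1 h2) hZ, ?_⟩
  filter_upwards [schr_sub (fun z => S.V z.1) S.Es (MemSob.isLap_of (hP.add h1 h2)) (MemSob.isLap_of hZ),
    schr_add (fun z => S.V z.1) S.Es (MemSob.isLap_of h1) (MemSob.isLap_of h2),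
    Lstar2_w_tensor hedge (MemL2.locallyIntegrable hF1), Lstar2_firstCorr hedge hg hF] with z a b c e
  simp only [Setting.Lstar2] at c e ⊢
  rw [← e, ← zero_add (schr ex _ _ (Setting.firstCorr g (F n)) z), ← c, ← b]
  exact a

omit hC in
include hedge hg in
theorem env_uform {n : ℕ} (hF1 : MemL2 (F n)) (hF : ∀ k, k + 1 = n → MemH 1 (F k)) (hZ : MemL2two (Z n)) (h0 : ∀ᵐ y, S.env (Z n) y = 0) :
    ∀ᵐ y, S.env (S.uform g F Z n) y = F n y := by
  cases n with
  | zero => exact Filter.Eventually.of_forall fun y => hedge.env_w_tensor (F 0) y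
  | succ n =>
    have h1 : MemL2two fun z => S.wC z.1 * F (n + 1) z.2 := memL2two_tensor hedge.memH2per_w.memL2per hF1
    have h2 : MemL2two (Setting.firstCorr g (F n)) := (memSob_firstCorr (l := 0) (fun j => (hg j).1) (hF n rfl)).base
    filter_upwards [hedge.env_sub (isFunSpace_memL2two.add h1 h2) hZ, hedge.env_add h1 h2, env_firstCorr hg hedge (hF n rfl), h0] with y a b c e
    rw [b, hedge.env_w_tensor, c, e, add_zero, sub_zero] at a
    exact a

include hreg hedge hhom hσ hN hg

theorem hform_canonical {μ' : ℕ → ℝ} {F' : ℕ → Pt d → ℂ} {U : ℕ → Pt d × Pt d → ℂ} {n : ℕ}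
    (hμ : ∀ k, 1 ≤ k → k ≤ n + 2 → μ' k = μ k) (hF : ∀ m ≤ n, ∀ᵐ y, F' m y = F m y)
    (hU : ∀ m ≤ n, ∀ᵐ z, U m z = S.uform g F' Z m z) :
    ∀ᵐ z, S.hform μ' g F' Z U n z = S.hform μ g F Z (S.uform g F Z) n z :=
  hform_congr (fun j h1 h2 => hμ j (by omega) h2) (hF n le_rfl) rfl rfl fun m hm => by
    filter_upwards [hU m hm, uform_congr (S := S) (g := g) (Z := Z) (fun k hk => hF k (hk.trans hm))] with z a b
    rw [a, b]

theorem rhs_add_three_canonical {μ' : ℕ → ℝ} {F' : ℕ → Pt d → ℂ} {U : ℕ → Pt d × Pt d → ℂ} {n : ℕ} (hn : n + 3 ≤ N)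
    (hμ : ∀ k, 1 ≤ k → k ≤ n + 2 → μ' k = μ k) (hF : ∀ m ≤ n, ∀ᵐ y, F' m y = F m y)
    (hF2 : ∀ m ≤ n + 2, MemH 2 (F' m)) (hU : ∀ k ≤ n + 2, ∀ᵐ z, U k z = S.uform g F' Z k z) :
    ∀ᵐ z, S.rhs μ' U (n + 3) z = 2 * Setting.cross (fun z => S.wC z.1 * F' (n + 2) z.2) z
      - (S.calL g (F' (n + 1)) z + S.hform μ g F Z (S.uform g F Z) n z - (μ' (n + 3) : ℂ) * (S.wC z.1 * S.FC z.2)) := by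
  have h3 : MemH 3 (F' n) := (isFunSpace_memH 3).congr (hC.memF hreg hhom hσ hN (by omega) (by omega))
    ((hF n le_rfl).mono fun _ => Eq.symm)
  filter_upwards [rhs_add_three (μ := μ') hedge hg (by rw [hμ 1 le_rfl (by omega), hC.mu_one]) (by rw [hμ 2 (by omega) (by omega), hC.mu_two])
    (hU 0 (by omega)) (hU (n + 1) (by omega)) (hU (n + 2) le_rfl) h3 (hF2 (n + 1) (by omega)) (MemSob.mono (by omega) (hF2 (n + 2) le_rfl))
    (hC.memH2H2_Z (by omega)).isLap_ey (hC.memH2H2_Z (by omega)).isCross,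
    hform_canonical hreg hedge hhom hσ hN hg hC hμ hF fun m hm => hU m (by omega),
    Measure.quasiMeasurePreserving_snd.ae (hF 0 (Nat.zero_le n))] with z a b c
  rw [a, b, c, hC.F_zero]

/-- The right hand sides of the hierarchy for the canonical coefficients. -/
theorem rhs_canonical {μ' : ℕ → ℝ} {F' : ℕ → Pt d → ℂ} {U : ℕ → Pt d × Pt d → ℂ} {n : ℕ} (hn : n + 1 ≤ N)
    (hμ : ∀ k, 1 ≤ k → k ≤ n + 1 → μ' k = μ k) (hF : ∀ m, m + 1 ≤ n → ∀ᵐ y, F' m y = F m y)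
    (hF2 : ∀ m ≤ n, MemH 2 (F' m)) (hU : ∀ k ≤ n, ∀ᵐ z, U k z = S.uform g F' Z k z) :
    ∀ᵐ z, S.rhs μ' U (n + 1) z = 2 * Setting.cross (fun z => S.wC z.1 * F' n z.2) z - S.Lstar2 (Z (n + 1)) z := by
  match n, hn, hμ, hF, hF2, hU with
  | 0, hn, hμ, hF, hF2, hU =>
    filter_upwards [hU 0 le_rfl, Lstar2_zero (S := S)] with z a b
    rw [hC.Z_one, b, zero_add, Setting.rhs, cross_congr (hU 0 le_rfl), hμ 1 le_rfl le_rfl, hC.mu_one]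
    simp only [Complex.ofReal_zero, zero_mul, add_zero, sub_zero]
    rfl
  | 1, hn, hμ, hF, hF2, hU =>
    filter_upwards [rhs_two (μ := μ') hedge hg (by rw [hμ 1 le_rfl (by omega), hC.mu_one]) hC.Z_one (hU 0 (by omega)) (hU 1 le_rfl)
      (hF2 0 (by omega)) (MemSob.mono (by omega) (hF2 1 le_rfl)), calL_congr (S := S) (g := g) (hF 0 le_rfl), (hC.Z_two hn).2.2.1] with z a b c
    rw [a, b, c, hμ 2 (by omega) (by omega), hC.mu_two, hC.F_zero]
    ring
  | n + 2, hn, hμ, hF, hF2, hU =>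
    filter_upwards [rhs_add_three_canonical hreg hedge hhom hσ hN hg hC hn (fun k h1 h2 => hμ k h1 (by omega))
      (fun m hm => hF m (by omega)) hF2 hU, calL_congr (S := S) (g := g) (hF (n + 1) le_rfl), (hC.next n hn).eqZ.2.1] with z a b c
    rw [a, b, c, hμ (n + 3) (by omega) le_rfl]

/-- The expansions with prescribed last envelopes. -/
theorem exists_solution (hN1 : 1 ≤ N) {G G' : Pt d → ℂ} (hG : MemH 2 G) (hG' : MemH 2 G')
    (hGg : MemH 3 G ∨ MemH2H2 (Setting.firstCorr g G)) :
    ∃ F H Z U, S.IsExpansion N μ g F H Z U ∧ S.SolvesHierarchy N μ U ∧ S.Normalized N U ∧ F (N - 1) = G ∧ F N = G' := by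
  -- The equations up to order N constrain the envelopes only up to index N - 2; the last two are
  -- prescribed.
  set F' : ℕ → Pt d → ℂ := fun n => if n + 2 ≤ N then F n else if n + 1 = N then G else G' with hF'
  have f1 : ∀ {n}, n + 2 ≤ N → F' n = F n := fun h => if_pos h
  have f2 : ∀ {n}, n + 1 = N → F' n = G := fun h => by simp only [hF']; rw [if_neg (by omega), if_pos h]
  have f3 : F' N = G' := by simp only [hF']; rw [if_neg (by omega), if_neg (by omega)]
  have hF2 : ∀ n ≤ N, MemH 2 (F' n) := fun n hn => by
    by_cases h1 : n + 2 ≤ N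
    · rw [f1 h1]; exact hC.memF hreg hhom hσ hN h1 (by omega)
    by_cases h2 : n + 1 = N
    · rw [f2 h2]; exact hG
    · obtain rfl : n = N := by omega
      rw [f3]; exact hG'
  -- The corrector of U_{n+1} differentiates F_n. For n ≤ N - 2 the canonical envelopes have at
  -- least three derivatives; for n = N - 1 the envelope is the given G, and this is where the
  -- alternative in the hypothesis enters.
  have hfc : ∀ n, n + 1 ≤ N → MemH2H2 (Setting.firstCorr g (F' n)) := fun n hn => by
    by_cases h1 : n + 2 ≤ N
    · rw [f1 h1]; exact memSob_firstCorr (l := 2) (fun j => (hg j).1) (hC.memF hreg hhom hσ hN h1 (by omega))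
    · rw [f2 (by omega)]
      exact hGg.elim (fun h => memSob_firstCorr (l := 2) (fun j => (hg j).1) h) id
  set U := S.uform g F' Z with hU
  have hUm : ∀ n ≤ N, MemH2H2 (U n) := fun n hn => by
    have hw : MemH2H2 fun z => S.wC z.1 * F' n z.2 := memSob_ex_tensor hedge.memH2per_w (hF2 n hn)
    cases n with
    | zero => exact hw
    | succ n => exact isFunSpace_memH2H2.sub (isFunSpace_memH2H2.add hw (hfc n hn)) (hC.memH2H2_Z hn)
  have hE : ∀ n ≤ N, ∀ᵐ y, S.env (U n) y = F' n y := fun n hn =>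
    env_uform hedge hg (hF2 n hn).base (fun k hk => MemSob.mono (by omega) (hF2 k (by omega))) (hC.memH2H2_Z hn).base.base (hC.env_Z hn)
  have hlead : 2 ≤ N → F' 0 = S.FC := fun h => by rw [f1 h, hC.F_zero]
  have horth : ∀ n, 1 ≤ n → n + 2 ≤ N → ∫ y, S.FC y * F' n y = 0 := fun n h1 h2 => by
    obtain ⟨m, rfl⟩ : ∃ m, n = m + 1 := ⟨n - 1, by omega⟩
    rw [f1 h2]; exact (hC.next m h2).orth
  have hH : ∀ n, n + 3 ≤ N → S.hform μ g F Z (S.uform g F Z) n = S.hform μ g F' Z U n := fun n hn =>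
    hform_eq (fun _ _ => rfl) (fun m hm => (f1 (by omega)).symm) fun _ _ => rfl
  refine ⟨F', fun n => S.hform μ g F' Z U (n - 3), Z, U, ?_, fun n hn => ⟨hUm n hn, ?_⟩, ⟨fun h => ?_, fun n h1 h2 => ?_⟩, f2 (by omega), f3⟩
  · refine ⟨hF2, fun h => Filter.Eventually.of_forall fun y => by rw [hlead h], horth, hE, hC.Z_zero, hC.Z_one, fun h => ?_, fun n _ => ?_,
      fun n hn => ?_, fun n hn => ?_, fun n hn => ?_, Filter.Eventually.of_forall fun _ => rfl,
      fun n _ => Filter.Eventually.of_forall fun _ => rfl⟩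
    · rw [hlead h]; exact (hC.Z_two h).2
    · exact Filter.Eventually.of_forall fun _ => rfl
    · rw [Nat.add_sub_cancel, ← hH n hn]; exact (hC.next n hn).mu
    · rw [Nat.add_sub_cancel, ← hH n hn, f1 hn]; exact (hC.next n hn).eqF
    · simp only [Nat.add_sub_cancel]
      rw [← hH n hn, f1 hn]; exact (hC.next n hn).eqZ
  · cases n with
    | zero => exact Lstar2_w_tensor hedge (MemL2.locallyIntegrable (hF2 0 hn).base)
    | succ n =>
      filter_upwards [rhs_canonical hreg hedge hhom hσ hN hg hC (U := U) hn (fun _ _ _ => rfl)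
        (fun m hm => Filter.Eventually.of_forall fun y => by rw [f1 (show m + 2 ≤ N by omega)])
        (fun m hm => hF2 m (by omega)) (fun k _ => Filter.Eventually.of_forall fun _ => rfl),
        (Lstar2_uform hedge hg (hF2 (n + 1) hn).base (MemSob.mono (by omega) (hF2 n (by omega)))
          (hC.memH2H2_Z hn).memSob_ex).2] with z a b
      rw [a, ← b]
  · filter_upwards [hE 0 (Nat.zero_le N)] with y hy
    rw [hy, hlead h]
  · rw [← horth n h1 h2]
    refine integral_congr_ae ?_
    filter_upwards [hE n (by omega)] with y hy
    rw [hy]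

end Canonical

end MultiScale

/-! ### Every normalized solution has the canonical form -/

namespace MultiScale

variable {d : ℕ} {S : Setting d} {σ : ℝ}

section Representation

variable (hreg : S.Regularity σ) (hedge : S.BandEdge) (hhom : S.HomogenizedEigenpair) (hσ : (d : ℝ) < 2 * σ)
  {N : ℕ} (hN : (N : ℝ) ≤ σ) {g : Fin d → Pt d → ℂ} (hg : ∀ j, S.IsLstarInv (wd (ev j) S.wC) (g j))
  {μ : ℕ → ℝ} {F : ℕ → Pt d → ℂ} {Z : ℕ → Pt d × Pt d → ℂ} (hC : S.IsCanonical N g μ F Z)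

include hreg hedge hσ hg

theorem memL2two_calL {F : Pt d → ℂ} (hF : MemH 2 F) : MemL2two (S.calL g F) := by
  have h := fun j l => memL2two_tensor (MemH2per.wd (hg l).1 j) (MemSob.base (MemSob.wd (MemSob.wd hF l) j))
  have hs : MemL2 (schr ev S.Q S.eAQ F) := isFunSpace_memL2.sub (isFunSpace_memL2.add (isFunSpace_memL2.neg
    (isFunSpace_memL2.sum _ fun j _ => MemSob.base (MemSob.wd (MemSob.wd hF j) j))) (memL2_Q_mul hσ hreg.Q_sobolev hF.base))
    (isFunSpace_memL2.smul _ hF.base)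
  exact isFunSpace_memL2two.add (isFunSpace_memL2two.smul (-4) (isFunSpace_memL2two.sum _ fun j _ =>
    isFunSpace_memL2two.sum _ fun l _ => h j l)) (memL2two_tensor hedge.memH2per_w.memL2per hs)

/-- The solvability condition of the equations of the hierarchy. -/
theorem env_solvability {F1 F2 K : Pt d → ℂ} {H : Pt d × Pt d → ℂ} (c : ℂ) (h1 : MemH 2 F1) (h2 : MemH 1 F2) (hK : MemL2 K)
    (hH : MemL2two H) :
    ∀ᵐ y, S.env (fun z => 2 * Setting.cross (fun z => S.wC z.1 * F2 z.2) z - (S.calL g F1 z + H z - c * (S.wC z.1 * K z.2))) y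
      = -(S.LAQ F1 y + S.env H y - c * K y) := by
  have m1 := memL2two_calL hreg hedge hσ hg h1
  have m2 : MemL2two fun z => S.wC z.1 * K z.2 := memL2two_tensor hedge.memH2per_w.memL2per hK
  have m3 : MemL2two (Setting.cross fun z => S.wC z.1 * F2 z.2) := isFunSpace_memL2two.congr
    (isFunSpace_memL2two.sum Finset.univ fun j _ => memL2two_tensor (hedge.memH2per_w.wd j) (MemSob.wd h2 j))
    ((isCross_w_tensor hedge h2).cross_ae_eq.mono fun _ => Eq.symm)
  have m4 := isFunSpace_memL2two.sub (isFunSpace_memL2two.add m1 hH) (isFunSpace_memL2two.smul c m2)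
  filter_upwards [hedge.env_sub (isFunSpace_memL2two.smul 2 m3) m4, hedge.env_sub (isFunSpace_memL2two.add m1 hH)
    (isFunSpace_memL2two.smul c m2), hedge.env_add m1 hH, env_cross_w_tensor hedge h2, Setting.env_calL hreg hedge hg h1] with y a1 a2 a3 a4 a5
  rw [a1, a2, a3, Setting.env_smul, a4, Setting.env_smul, hedge.env_w_tensor, a5]
  ring

-- The difference of both sides lies in the kernel of L_* and has zero envelope, so it vanishes on
-- almost every slice.
omit hσ hg hreg in
theorem eq_w_env_of_Lstar2_eq_zero {U : Pt d × Pt d → ℂ} (hU : MemH2H2 U) (h : ∀ᵐ z, S.Lstar2 U z = 0) :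
    ∀ᵐ z, U z = S.wC z.1 * S.env U z.2 := by
  have hP := isFunSpace_memSob (isFunSpace_memL2two (d := d)) ex 2
  have hF : MemH 2 (S.env U) := hedge.memSob_env hU.base
  have hw : MemSob MemL2two ex 2 fun z => S.wC z.1 * S.env U z.2 := memSob_ex_tensor (l := 0) hedge.memH2per_w hF.base
  have := hedge.eq_zero2 (hP.sub hU.memSob_ex hw) (by
    filter_upwards [schr_sub (fun z => S.V z.1) S.Es (MemSob.isLap_of hU.memSob_ex) (MemSob.isLap_of hw), h,
      Lstar2_w_tensor hedge (MemL2.locallyIntegrable hF.base)] with z a b c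
    simp only [Setting.Lstar2] at a b c ⊢
    rw [a, b, c, sub_zero]) (by
    filter_upwards [hedge.env_sub hU.memSob_ex.base hw.base] with y a
    rw [a, hedge.env_w_tensor, sub_self])
  filter_upwards [this] with z hz
  exact sub_eq_zero.1 hz

omit hσ hg in
theorem env_rhs {μ' : ℕ → ℝ} {U : ℕ → Pt d × Pt d → ℂ} (hs : S.SolvesHierarchy N μ' U) {n : ℕ} (hn : n ≤ N) :
    ∀ᵐ y, S.env (S.rhs μ' U n) y = 0 := by
  filter_upwards [Setting.env_congr (S := S) (hs n hn).2, hedge.env_Lstar2 hreg (hs n hn).1.memSob_ex] with y a b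
  rw [← a, b]

-- U_{n+1} and the expected form have the same image under L_* and the same envelope; uniqueness for
-- L_* on the complement of w identifies them.
omit hσ hreg in
include hC in
theorem eq_uform_of_rhs_eq {μ' : ℕ → ℝ} {U : ℕ → Pt d × Pt d → ℂ} (hs : S.SolvesHierarchy N μ' U) {n : ℕ} (hn : n + 1 ≤ N)
    (hr : ∀ᵐ z, S.rhs μ' U (n + 1) z = 2 * Setting.cross (fun z => S.wC z.1 * S.env (U n) z.2) z - S.Lstar2 (Z (n + 1)) z) :
    ∀ᵐ z, U (n + 1) z = S.uform g (fun k => S.env (U k)) Z (n + 1) z := by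
  have hP := isFunSpace_memSob (isFunSpace_memL2two (d := d)) ex 2
  have hF2 : ∀ n ≤ N, MemH 2 (S.env (U n)) := fun n hn => hedge.memSob_env (hs n hn).1.base
  have hZ := hC.memH2H2_Z hn
  obtain ⟨u1, u2⟩ := Lstar2_uform (F := fun k => S.env (U k)) hedge hg (hF2 (n + 1) hn).base
    (MemSob.mono (by omega) (hF2 n (by omega))) hZ.memSob_ex
  have hU := (hs (n + 1) hn).1.memSob_ex
  have := hedge.eq_zero2 (hP.sub hU u1) (by
    filter_upwards [schr_sub (fun z => S.V z.1) S.Es (MemSob.isLap_of hU) (MemSob.isLap_of u1), (hs (n + 1) hn).2, u2, hr] with z a b c e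
    simp only [Setting.Lstar2] at a b c e ⊢
    rw [a, b, c, e, sub_self]) (by
    filter_upwards [hedge.env_sub hU.base u1.base, env_uform (F := fun k => S.env (U k)) hedge hg (hF2 (n + 1) hn).base
      (fun k hk => MemSob.mono (by omega) (hF2 k (by omega))) hZ.base.base (hC.env_Z hn)] with y a b
    rw [a, b, sub_self])
  filter_upwards [this] with z hz
  exact sub_eq_zero.1 hz

include hhom hC

/-- As L_{A,Q} F_{A,Q} = 0, the solvability condition of order two reduces to (μ'_2 - e_{A,Q})
F_{A,Q} = 0. -/
theorem mu_two_of_solution {μ' : ℕ → ℝ} {U : ℕ → Pt d × Pt d → ℂ} (hs : S.SolvesHierarchy N μ' U) (hn : S.Normalized N U)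
    (hN2 : 2 ≤ N) (h1 : μ' 1 = 0) (hU0 : ∀ᵐ z, U 0 z = S.uform g (fun k => S.env (U k)) Z 0 z)
    (hU1 : ∀ᵐ z, U 1 z = S.uform g (fun k => S.env (U k)) Z 1 z) : μ' 2 = S.eAQ := by
  have hF2 : ∀ n ≤ N, MemH 2 (S.env (U n)) := fun n hn => hedge.memSob_env (hs n hn).1.base
  have hF0 := hn.1 hN2
  have hF20 := hF2 0 (by omega)
  have hF21 : MemH 1 (S.env (U 1)) := MemSob.mono (by omega) (hF2 1 (by omega))
  have e1 := Setting.env_congr (S := S) (rhs_two (μ := μ') hedge hg h1 hC.Z_one hU0 hU1 hF20 hF21)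
  have e2 := env_solvability (S := S) hreg hedge hσ hg ((μ' 2 : ℂ) - S.eAQ) hF20 hF21 hF20.base isFunSpace_memL2two.zero
  have e3 := LAQ_congr (S := S) hF20 hF0
  have e7 : (fun z => 2 * Setting.cross (fun z => S.wC z.1 * S.env (U 1) z.2) z - S.calL g (S.env (U 0)) z
      + ((μ' 2 : ℂ) - S.eAQ) * (S.wC z.1 * S.env (U 0) z.2)) = (fun z => 2 * Setting.cross (fun z => S.wC z.1 * S.env (U 1) z.2) z
      - (S.calL g (S.env (U 0)) z + 0 - ((μ' 2 : ℂ) - S.eAQ) * (S.wC z.1 * S.env (U 0) z.2))) := funext fun z => by ring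
  rw [e7] at e1
  have e8 : ∀ y, S.env (fun _ => 0) y = 0 := fun y => by simp [Setting.env]
  have e4 : ∀ᵐ y, ((μ' 2 : ℂ) - S.eAQ) * (S.FC y * S.FC y) = 0 := by
    filter_upwards [e1, e2, e3, hF0, env_rhs hreg hedge hs hN2, hhom.eigen] with y a1 a2 a3 a4 a5 a6
    rw [a5, a2, a3, a6, e8, a4] at a1
    linear_combination -S.FC y * a1
  have e5 : ((μ' 2 : ℂ) - S.eAQ) * ∫ y, S.FC y * S.FC y = 0 := by
    rw [← integral_const_mul]
    exact integral_eq_zero_of_ae e4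
  rw [integral_FC_FC hhom hσ hreg.Q_sobolev, mul_one] at e5
  exact_mod_cast sub_eq_zero.1 e5

include hN

/-- The solvability condition of order n + 3 is L_{A,Q} F_{n+1} = -env H + μ' F_{A,Q}. Pairing with
F_{A,Q} eliminates the left side and determines μ'. The difference to the canonical envelope then
lies in the kernel of L_{A,Q} and is orthogonal to F_{A,Q} by normalization. -/
theorem mu_of_solution {μ' : ℕ → ℝ} {U : ℕ → Pt d × Pt d → ℂ} (hs : S.SolvesHierarchy N μ' U) (hn : S.Normalized N U)
    {n : ℕ} (hnN : n + 3 ≤ N) (hμ : ∀ k, 1 ≤ k → k ≤ n + 2 → μ' k = μ k) (hF : ∀ m ≤ n, ∀ᵐ y, S.env (U m) y = F m y)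
    (hU : ∀ k ≤ n + 2, ∀ᵐ z, U k z = S.uform g (fun k => S.env (U k)) Z k z) :
    μ' (n + 3) = μ (n + 3) ∧ ∀ᵐ y, S.env (U (n + 1)) y = F (n + 1) y := by
  have hF2 : ∀ n ≤ N, MemH 2 (S.env (U n)) := fun n hn => hedge.memSob_env (hs n hn).1.base
  have hFL : MemLp S.FC 2 volume := hhom.memH2.base
  have hQ := hreg.Q_sobolev
  have iFC : ∀ {v : Pt d → ℂ}, MemL2 v → Integrable fun y => S.FC y * v y := fun hv => hFL.integrable_mul hv
  obtain ⟨c1, c2, c3, c4, c5, c6, c7⟩ := hC.next n hnN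
  set H := S.hform μ g F Z (S.uform g F Z) n with hH
  have hF1 := hF2 (n + 1) (by omega)
  have e1 := Setting.env_congr (S := S) (rhs_add_three_canonical hreg hedge hhom hσ hN hg hC hnN hμ hF (fun m hm => hF2 m (by omega)) hU)
  have e2 := env_solvability (S := S) hreg hedge hσ hg (μ' (n + 3) : ℂ) hF1 (MemSob.mono (by omega) (hF2 (n + 2) (by omega)))
    hhom.memH2.base c3
  have e3 : ∀ᵐ y, S.LAQ (S.env (U (n + 1))) y = - S.env H y + (μ' (n + 3) : ℂ) * S.FC y := by
    filter_upwards [e1, e2, env_rhs hreg hedge hs hnN] with y a1 a2 a3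
    rw [a1, a2] at a3
    linear_combination -a3
  have hm : μ' (n + 3) = μ (n + 3) := by
    have e4 : ∫ y, S.FC y * S.LAQ (S.env (U (n + 1))) y = ∫ y, ((μ' (n + 3) : ℂ) * (S.FC y * S.FC y) - S.FC y * S.env H y) := by
      refine integral_congr_ae ?_
      filter_upwards [e3] with y hy
      rw [hy]; ring
    rw [integral_FC_LAQ hhom hσ hQ hF1, integral_sub ((iFC hFL).const_mul _) (iFC (hedge.memL2_env c3)), integral_const_mul,
      integral_FC_FC hhom hσ hQ, ← c5, mul_one] at e4
    exact_mod_cast (sub_eq_zero.1 e4.symm)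
  refine ⟨hm, ?_⟩
  have f2 := (c1 2 (by omega)).1
  have := LAQ_eq_zero hhom hσ hQ ((isFunSpace_memH 2).add hF1 ((isFunSpace_memH 2).smul (-1) f2)) (by
    filter_upwards [LAQ_add_smul (S := S) (-1) hF1 f2, e3, c6] with y a b c
    rw [a, b, c, hm]; ring) (by
    have e : ∀ y, S.FC y * (S.env (U (n + 1)) y + -1 * F (n + 1) y) = S.FC y * S.env (U (n + 1)) y - S.FC y * F (n + 1) y :=
      fun y => by ring
    simp only [e]
    rw [integral_sub (iFC hF1.base) (iFC f2.base), hn.2 (n + 1) (by omega) (by omega), c4, sub_zero])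
  filter_upwards [this] with y hy
  linear_combination hy

/-- Strong induction in which order n yields μ_n, F_{n-2} and the form of U_n together, since each
of them needs all three at lower orders. The two highest envelopes are never compared. -/
theorem solution_eq_uform {μ' : ℕ → ℝ} {U : ℕ → Pt d × Pt d → ℂ} (hs : S.SolvesHierarchy N μ' U) (hn : S.Normalized N U)
    (h1 : μ' 1 = 0) : ∀ n ≤ N, (1 ≤ n → μ' n = μ n) ∧ (∀ m, m + 2 = n → ∀ᵐ y, S.env (U m) y = F m y) ∧
      ∀ᵐ z, U n z = S.uform g (fun k => S.env (U k)) Z n z := by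
  have hF2 : ∀ n ≤ N, MemH 2 (S.env (U n)) := fun n hn => hedge.memSob_env (hs n hn).1.base
  intro n
  induction n using Nat.strong_induction_on with
  | _ n ih =>
    intro hnN
    have hμ : ∀ k, 1 ≤ k → k < n → μ' k = μ k := fun k h1 h2 => (ih k h2 (by omega)).1 h1
    have hF : ∀ m, m + 2 < n → ∀ᵐ y, S.env (U m) y = F m y := fun m hm => (ih (m + 2) hm (by omega)).2.1 m rfl
    have hU : ∀ k < n, ∀ᵐ z, U k z = S.uform g (fun k => S.env (U k)) Z k z := fun k hk => (ih k hk (by omega)).2.2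
    cases n with
    | zero =>
      exact ⟨fun h => absurd h (by omega), fun m hm => absurd hm (by omega), eq_w_env_of_Lstar2_eq_zero hedge (hs 0 hnN).1 (hs 0 hnN).2⟩
    | succ n =>
      have key : μ' (n + 1) = μ (n + 1) ∧ ∀ m, m + 2 = n + 1 → ∀ᵐ y, S.env (U m) y = F m y := by
        match n, hnN, hμ, hF, hU with
        | 0, hnN, _, _, hU => exact ⟨by rw [h1, hC.mu_one], fun m hm => absurd hm (by omega)⟩
        | 1, hnN, hμ, _, hU =>
          refine ⟨?_, fun m hm => ?_⟩
          · rw [mu_two_of_solution hreg hedge hhom hσ hg hC hs hn hnN h1 (hU 0 (by omega)) (hU 1 (by omega)), hC.mu_two]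
          · rw [show m = 0 by omega, hC.F_zero]; exact hn.1 hnN
        | n + 2, hnN, hμ, hF, hU =>
          obtain ⟨a, b⟩ := mu_of_solution hreg hedge hhom hσ hN hg hC hs hn hnN (fun k a b => hμ k a (by omega))
            (fun m hm => hF m (by omega)) fun k hk => hU k (by omega)
          exact ⟨a, fun m hm => by rwa [show m = n + 1 by omega]⟩
      obtain ⟨h1, h2⟩ := key
      have hμ' : ∀ k, 1 ≤ k → k ≤ n + 1 → μ' k = μ k := fun k a b => by
        rcases Nat.lt_or_ge k (n + 1) with h' | h'
        · exact hμ k a h'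
        · rw [show k = n + 1 by omega, h1]
      have hF' : ∀ m, m + 1 ≤ n → ∀ᵐ y, S.env (U m) y = F m y := fun m hm => by
        rcases Nat.lt_or_ge (m + 2) (n + 1) with h' | h'
        · exact hF m h'
        · exact h2 m (by omega)
      have hF2' : ∀ m ≤ n, MemH 2 (S.env (U m)) := fun m hm => hF2 m (by omega)
      have hU' : ∀ k ≤ n, ∀ᵐ z, U k z = S.uform g (fun k => S.env (U k)) Z k z := fun k hk => hU k (by omega)
      have hr := rhs_canonical (F' := fun k => S.env (U k)) hreg hedge hhom hσ hN hg hC hnN hμ' hF' hF2' hU'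
      exact ⟨fun _ => h1, h2, eq_uform_of_rhs_eq hedge hg hC hs hnN hr⟩

/-- The corrections of the eigenvalue are determined by the hierarchy. -/
theorem solution_spec {μ' : ℕ → ℝ} {U : ℕ → Pt d × Pt d → ℂ} (hs : S.SolvesHierarchy N μ' U) (hn : S.Normalized N U) :
    ((¬ ∀ᵐ z, U 0 z = 0) → ∀ n, 1 ≤ n → n ≤ N → μ' n = μ n) ∧ (∀ m, m + 2 ≤ N → ∀ᵐ y, S.env (U m) y = F m y) ∧
      ∀ n ≤ N, ∀ᵐ z, U n z = S.uform g (fun k => S.env (U k)) Z n z := by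
  -- If U_0 = 0, the normalization forces N < 2. The number μ'_1 is then undetermined, but it
  -- multiplies U_0 = 0, so the same U solves the hierarchy with the canonical values.
  by_cases h0 : ∀ᵐ z, U 0 z = 0
  · refine ⟨fun h => absurd h0 h, ?_⟩
    have hN2 : N < 2 := by
      by_contra h
      have : ∫ y, S.FC y * S.FC y = 0 := by
        refine integral_eq_zero_of_ae ?_
        filter_upwards [hn.1 (by omega), Setting.env_congr (S := S) h0] with y a b
        have : S.env (fun _ => 0) y = 0 := by simp [Setting.env]
        rw [← a, b, this]; simp
      rw [integral_FC_FC hhom hσ hreg.Q_sobolev] at this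
      exact one_ne_zero this
    have hs' : S.SolvesHierarchy N μ U := fun n hn => by
      refine ⟨(hs n hn).1, ?_⟩
      match n, hn with
      | 0, hn => exact (hs 0 hn).2
      | 1, hn =>
        filter_upwards [(hs 1 hn).2, h0] with z a b
        rw [a, Setting.rhs, Setting.rhs, b, mul_zero, mul_zero]
      | n + 2, hn => exact absurd hn (by omega)
    have := solution_eq_uform hreg hedge hhom hσ hN hg hC hs' hn hC.mu_one
    exact ⟨fun m hm => (this (m + 2) hm).2.1 m rfl, fun n hn => (this n hn).2.2⟩
  -- The cross term of w F_0 has zero envelope, so the envelope of the equation of order one reads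
  -- μ'_1 F_0 = 0. A nonzero μ'_1 would give F_0 = 0 and thus U_0 = 0.
  · have h1 : 1 ≤ N → μ' 1 = 0 := fun hN1 => by
      by_contra hm
      refine h0 ?_
      have hF0 : MemH 2 (S.env (U 0)) := hedge.memSob_env (hs 0 (by omega)).1.base
      have hU := (hs 0 (by omega)).1.memSob_ex
      have e0 := eq_w_env_of_Lstar2_eq_zero hedge (hs 0 (by omega)).1 (hs 0 (by omega)).2
      have hcr := isCross_w_tensor hedge (MemSob.mono (l := 1) (by omega) hF0)
      have m3 : MemL2two (Setting.cross (U 0)) := by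
        rw [cross_congr e0]
        exact isFunSpace_memL2two.congr (isFunSpace_memL2two.sum Finset.univ fun j _ => memL2two_tensor (hedge.memH2per_w.wd j)
          (MemSob.base (MemSob.wd hF0 j))) (hcr.cross_ae_eq.mono fun _ => Eq.symm)
      have e1 : ∀ᵐ y, (μ' 1 : ℂ) * S.env (U 0) y = 0 := by
        filter_upwards [Setting.env_congr (S := S) (hs 1 hN1).2, hedge.env_Lstar2 hreg (hs 1 hN1).1.memSob_ex,
          hedge.env_add (isFunSpace_memL2two.smul 2 m3) (isFunSpace_memL2two.smul (μ' 1 : ℂ) hU.base),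
          env_cross_w_tensor hedge (MemSob.mono (l := 1) (by omega) hF0)] with y a b c e
        rw [b] at a
        rw [Setting.env_smul, Setting.env_smul, cross_congr e0, e, mul_zero, zero_add] at c
        rw [← c, a, ← cross_congr e0]
        rfl
      filter_upwards [e0, Measure.quasiMeasurePreserving_snd.ae e1] with z a b
      rcases mul_eq_zero.1 b with h | h
      · exact absurd (by exact_mod_cast h) hm
      · rw [a, h, mul_zero]
    rcases Nat.eq_zero_or_pos N with hN0 | hN1
    · have := solution_eq_uform (μ' := fun _ => 0) hreg hedge hhom hσ hN hg hC (U := U) (fun n hn => by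
        obtain rfl : n = 0 := by omega
        exact hs 0 hn) hn rfl
      exact ⟨fun _ n h1 h2 => absurd h1 (by omega), fun m hm => absurd hm (by omega), fun n hn => (this n hn).2.2⟩
    · have := solution_eq_uform hreg hedge hhom hσ hN hg hC hs hn (h1 hN1)
      exact ⟨fun _ n h1 h2 => (this n h2).1 h1, fun m hm => (this (m + 2) hm).2.1 m rfl, fun n hn => (this n hn).2.2⟩

/-- The representation of the solutions of the hierarchy. -/
theorem solution_isExpansion {μ' : ℕ → ℝ} {U : ℕ → Pt d × Pt d → ℂ} (hs : S.SolvesHierarchy N μ' U) (hn : S.Normalized N U) :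
    ∃ H Z, S.IsExpansion N μ g (fun n => S.env (U n)) H Z U := by
  obtain ⟨-, hF, hU⟩ := solution_spec hreg hedge hhom hσ hN hg hC hs hn
  have hH : ∀ n, n + 3 ≤ N → ∀ᵐ z, S.hform μ g (fun n => S.env (U n)) Z U n z = S.hform μ g F Z (S.uform g F Z) n z := fun n hn =>
    hform_canonical hreg hedge hhom hσ hN hg hC (fun _ _ _ => rfl) (fun m hm => hF m (by omega)) fun m hm => hU m (by omega)
  refine ⟨fun n => S.hform μ g (fun n => S.env (U n)) Z U (n - 3), Z, fun n hn => hedge.memSob_env (hs n hn).1.base, hn.1, hn.2,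
    fun n _ => Filter.Eventually.of_forall fun _ => rfl, hC.Z_zero, hC.Z_one, fun h => ?_, fun n _ => Filter.Eventually.of_forall fun _ => rfl,
    fun n hn => ?_, fun n hn => ?_, fun n hn => ?_, hU 0 (Nat.zero_le N), fun n hn => hU (n + 1) hn⟩
  · refine isLstarInv2_congr (hC.Z_two h).2 (calL_congr ?_)
    filter_upwards [hn.1 h] with y hy using hy.symm
  · rw [(hC.next n hn).mu]
    refine integral_congr_ae ?_
    filter_upwards [Setting.env_congr (S := S) (hH n hn)] with y hy
    rw [Nat.add_sub_cancel, hy]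
  · filter_upwards [Setting.env_congr (S := S) (hH n hn), LAQ_congr (S := S) (hedge.memSob_env (hs (n + 1) (by omega)).1.base) (hF (n + 1) hn),
      (hC.next n hn).eqF] with y a b c
    rw [Nat.add_sub_cancel, b, c, a]
  · refine isLstarInv2_congr (hC.next n hn).eqZ ?_
    filter_upwards [hH n hn, calL_congr (S := S) (g := g) (hF (n + 1) hn)] with z a b
    rw [Nat.add_sub_cancel, b, a]

theorem solution_unique {μ₁ μ₂ : ℕ → ℝ} {U₁ U₂ : ℕ → Pt d × Pt d → ℂ} (hs₁ : S.SolvesHierarchy N μ₁ U₁) (hn₁ : S.Normalized N U₁)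
    (hs₂ : S.SolvesHierarchy N μ₂ U₂) (hn₂ : S.Normalized N U₂) (h1 : ∀ᵐ y, S.env (U₁ (N - 1)) y = S.env (U₂ (N - 1)) y)
    (h2 : ∀ᵐ y, S.env (U₁ N) y = S.env (U₂ N) y) {n : ℕ} (hn : n ≤ N) : ∀ᵐ z, U₁ n z = U₂ n z := by
  obtain ⟨-, a1, b1⟩ := solution_spec hreg hedge hhom hσ hN hg hC hs₁ hn₁
  obtain ⟨-, a2, b2⟩ := solution_spec hreg hedge hhom hσ hN hg hC hs₂ hn₂
  have : ∀ m ≤ n, ∀ᵐ y, S.env (U₁ m) y = S.env (U₂ m) y := fun m hm => by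
    by_cases h : m + 2 ≤ N
    · filter_upwards [a1 m h, a2 m h] with y a b
      rw [a, b]
    by_cases h' : m = N
    · rwa [h']
    · rwa [show m = N - 1 by omega]
  filter_upwards [b1 n hn, b2 n hn, uform_congr (S := S) (g := g) (Z := Z) this] with z a b c
  rw [a, b, c]

end Representation

end MultiScale

/-! ### The residual as a polynomial in ε -/

namespace MultiScale

section Polynomial

variable {N M T : ℕ} {u a : ℕ → ℂ}

theorem sum_range_eq_of_support (hu : ∀ n, N < n → u n = 0) (hT : N < T) (e : ℂ) (s : ℕ) :
    ∑ n ∈ Finset.range T, e ^ (n + s) * u n = e ^ s * ∑ n ∈ Finset.range (N + 1), e ^ n * u n := by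
  rw [Finset.mul_sum, ← Finset.sum_subset (Finset.range_subset_range.2 (show N + 1 ≤ T by omega))]
  · exact Finset.sum_congr rfl fun n _ => by ring
  · intro n _ h
    rw [hu n (by simpa using h), mul_zero]

/-- Cauchy product of two polynomials. The range exceeds N + M, so every product of nonzero
coefficients is included. -/
theorem sum_range_convolution (hu : ∀ n, N < n → u n = 0) (ha : ∀ j, M < j → a j = 0) (h0 : a 0 = 0) (hT : N + M < T) (e : ℂ) :
    ∑ m ∈ Finset.range T, e ^ m * ∑ j ∈ Finset.Icc 1 m, a j * u (m - j)
      = (∑ j ∈ Finset.Icc 1 M, e ^ j * a j) * ∑ n ∈ Finset.range (N + 1), e ^ n * u n := by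
  have e1 : ∀ m (f : ℕ → ℂ), f 0 = 0 → ∑ j ∈ Finset.Icc 1 m, f j = ∑ j ∈ Finset.range (m + 1), f j := fun m f hf => by
    rw [Finset.sum_range_succ', hf, add_zero, Finset.range_eq_Ico, Finset.sum_Ico_add' f 0 m 1]
    rfl
  have e2 : ∀ m ∈ Finset.range T, e ^ m * ∑ j ∈ Finset.Icc 1 m, a j * u (m - j)
      = ∑ j ∈ Finset.range (m + 1), (e ^ j * a j) * (e ^ (m - j) * u (m - j)) := fun m _ => by
    rw [e1 m _ (by rw [h0, zero_mul]), Finset.mul_sum]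
    refine Finset.sum_congr rfl fun j hj => ?_
    have : e ^ m = e ^ j * e ^ (m - j) := by rw [← pow_add, Nat.add_sub_cancel' (by simpa [Nat.lt_succ_iff] using hj)]
    rw [this]; ring
  rw [Finset.sum_congr rfl e2, Finset.sum_range_diag_flip T (fun j n => (e ^ j * a j) * (e ^ n * u n)),
    e1 M _ (by rw [h0, mul_zero]), Finset.sum_mul]
  symm
  rw [← Finset.sum_subset (Finset.range_subset_range.2 (show M + 1 ≤ T by omega))]
  · refine Finset.sum_congr rfl fun j hj => ?_
    have hj' : j ≤ M := by simpa [Nat.lt_succ_iff] using hj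
    rw [← Finset.mul_sum]
    congr 1
    have := sum_range_eq_of_support hu (show N < T - j by omega) e 0
    simpa using this.symm
  · intro j _ h
    rw [ha j (by simpa using h)]
    simp

/-- The coefficients of the right hand sides of the hierarchy, for numerical sequences. -/
def rhsCoeff (a c q u : ℕ → ℂ) : ℕ → ℂ
  | 0 => 0
  | 1 => 2 * c 0 + a 1 * u 0
  | n + 2 => 2 * c (n + 1) - q n + ∑ j ∈ Finset.Icc 1 (n + 2), a j * u (n + 2 - j)

/-- Generating function form of the hierarchy: the cross terms shift the order by one, the slow
operator by two, and the eigenvalue corrections give a Cauchy product. Sequences are extended by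
zero, so the orders above N are covered by the same formula. -/
theorem sum_rhsCoeff {L c q : ℕ → ℂ} (hL : ∀ n, N < n → L n = 0) (hc : ∀ n, N < n → c n = 0) (hq : ∀ n, N < n → q n = 0)
    (hu : ∀ n, N < n → u n = 0) (ha : ∀ j, M < j → a j = 0) (h0 : a 0 = 0) (hT : N + M < T) (e : ℂ) :
    ∑ m ∈ Finset.range (T + 2), e ^ m * (L m - rhsCoeff a c q u m)
      = ∑ n ∈ Finset.range (N + 1), e ^ n * (L n - 2 * e * c n + e ^ 2 * q n)
        - (∑ j ∈ Finset.Icc 1 M, e ^ j * a j) * ∑ n ∈ Finset.range (N + 1), e ^ n * u n := by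
  have h1 := sum_range_eq_of_support hL (show N < T + 2 by omega) e 0
  have h2 := sum_range_eq_of_support hc (show N < T + 1 by omega) e 1
  have h3 := sum_range_eq_of_support hq (show N < T by omega) e 2
  have h4 := sum_range_convolution hu ha h0 (show N + M < T + 2 by omega) e
  have h5 : ∑ m ∈ Finset.range (T + 2), e ^ m * rhsCoeff a c q u m = 2 * ∑ n ∈ Finset.range (T + 1), e ^ (n + 1) * c n
      - ∑ n ∈ Finset.range T, e ^ (n + 2) * q n + ∑ m ∈ Finset.range (T + 2), e ^ m * ∑ j ∈ Finset.Icc 1 m, a j * u (m - j) := by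
    rw [Finset.sum_range_succ', Finset.sum_range_succ', Finset.sum_range_succ' _ (T + 1), Finset.sum_range_succ' _ T,
      Finset.sum_range_succ' _ T]
    simp only [rhsCoeff, mul_add, mul_sub, Finset.sum_add_distrib, Finset.sum_sub_distrib, Finset.mul_sum]
    simp
    ring_nf
  simp only [mul_sub, Finset.sum_sub_distrib, h5, h4, h3, h2]
  simp only [add_zero, pow_zero, one_mul] at h1
  rw [h1]
  simp only [mul_add, mul_sub, Finset.sum_add_distrib, Finset.sum_sub_distrib, Finset.mul_sum, Finset.sum_mul]
  ring_nf

end Polynomial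

variable {d : ℕ} {S : Setting d} {σ : ℝ}

theorem MemH2H2.memL2two_cross {U : Pt d × Pt d → ℂ} (h : MemH2H2 U) : MemL2two (Setting.cross U) :=
  isFunSpace_memL2two.sum Finset.univ fun j _ => MemSob.base (MemSob.wd (MemSob.base (MemSob.wd h j)) j)

theorem MemH2H2.memL2two_lap {U : Pt d × Pt d → ℂ} (h : MemH2H2 U) : MemL2two (lap ey U) :=
  isFunSpace_memL2two.sum Finset.univ fun j _ => MemSob.base (MemSob.wd (MemSob.wd (MemSob.base h) j) j)

theorem memL2two_bounded_mul {W : Pt d → ℝ} (hW : MemLp W ∞ volume) {U : Pt d × Pt d → ℂ} (h : MemL2two U) :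
    MemL2two fun z => (W z.2 : ℂ) * U z := by
  refine ⟨fun j => ?_, ?_⟩
  · filter_upwards [h.1 j] with z hz
    rw [hz]; simp [ex]
  · have h1 : MemLp (fun z : Pt d × Pt d => W z.2) ∞ ((volume.restrict (cell d)).prod volume) := by
      have : IsProbabilityMeasure ((volume : Measure (Pt d)).restrict (cell d)) := inferInstance
      exact hW.comp_measurePreserving measurePreserving_snd
    rw [volume_restrict_cell_prod]
    exact memLp_bounded_mul h1 h.memLp_prod

/-- The Laplacian in the directions `∂_x + ε ∂_y`. -/
theorem MemH2H2.isLap_multiscale {U : Pt d × Pt d → ℂ} (h : MemH2H2 U) (ε : ℝ) :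
    IsLap (fun j => ex j + ε • ey j) U fun z => lap ex U z + 2 * (ε : ℂ) * Setting.cross U z + (ε : ℂ) ^ 2 * lap ey U z := by
  have hx : ∀ j, HasWeakDeriv (ex j) U (wd (ex j) U) := fun j => MemSob.hasWeakDeriv h j
  have hxx : ∀ j, HasWeakDeriv (ex j) (wd (ex j) U) (wd (ex j) (wd (ex j) U)) := fun j => (MemSob.wd h j).hasWeakDeriv j
  have hxy : ∀ j, HasWeakDeriv (ey j) (wd (ex j) U) (wd (ey j) (wd (ex j) U)) := fun j => (MemSob.wd h j).base.hasWeakDeriv j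
  have hy : ∀ j, HasWeakDeriv (ey j) U (wd (ey j) U) := fun j => h.base.hasWeakDeriv j
  have hyy : ∀ j, HasWeakDeriv (ey j) (wd (ey j) U) (wd (ey j) (wd (ey j) U)) := fun j => (MemSob.wd h.base j).hasWeakDeriv j
  -- The function space provides only ∂_y ∂_x among the mixed derivatives; ∂_x ∂_y then exists and
  -- agrees with it.
  have hyx : ∀ j, HasWeakDeriv (ex j) (wd (ey j) U) (wd (ey j) (wd (ex j) U)) := fun j => (hx j).swap (hxy j) (hy j)
  refine ⟨_, _, fun j => (hx j).add_dir (hy j) ε, fun j => ((hxx j).add_dir (hxy j) ε).add (((hyx j).add_dir (hyy j) ε).smul ε),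
    Filter.Eventually.of_forall fun z => ?_⟩
  simp only [lap, Setting.cross, Finset.mul_sum, ← Finset.sum_add_distrib]
  exact Finset.sum_congr rfl fun j _ => by ring

theorem rhs_eq_rhsCoeff (μ : ℕ → ℝ) (U : ℕ → Pt d × Pt d → ℂ) (n : ℕ) (z : Pt d × Pt d) :
    S.rhs μ U n z = rhsCoeff (fun j => (μ j : ℂ)) (fun n => Setting.cross (U n) z)
      (fun n => - lap ey (U n) z + (S.Q z.2 : ℂ) * U n z) (fun n => U n z) n := by
  match n with
  | 0 => rfl
  | 1 => rfl
  | n + 2 => rfl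

theorem rhs_congr_of_eq {μ ν : ℕ → ℝ} {U V : ℕ → Pt d × Pt d → ℂ} {n : ℕ} (hμ : ∀ j, 1 ≤ j → j ≤ n → μ j = ν j)
    (hU : ∀ k < n, U k = V k) (z : Pt d × Pt d) : S.rhs μ U n z = S.rhs ν V n z := by
  match n, hμ, hU with
  | 0, _, _ => rfl
  | 1, hμ, hU => rw [Setting.rhs, Setting.rhs, hU 0 one_pos, hμ 1 le_rfl le_rfl]
  | n + 2, hμ, hU =>
    rw [Setting.rhs, Setting.rhs, hU n (by omega), hU (n + 1) (by omega)]
    congr 1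
    refine Finset.sum_congr rfl fun j hj => ?_
    obtain ⟨h1, h2⟩ := Finset.mem_Icc.1 hj
    rw [hμ j h1 h2, hU _ (by omega)]

theorem memL2two_rhs (hQ : MemLp S.Q ∞ volume) (μ : ℕ → ℝ) {U : ℕ → Pt d × Pt d → ℂ} (hU : ∀ n, MemH2H2 (U n)) (n : ℕ) :
    MemL2two (S.rhs μ U n) := by
  have hP := isFunSpace_memL2two (d := d)
  have hU0 : ∀ n, MemL2two (U n) := fun n => (hU n).memSob_ex.base
  match n with
  | 0 => exact hP.zero
  | 1 => exact hP.add (hP.smul 2 (hU 0).memL2two_cross) (hP.smul _ (hU0 0))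
  | n + 2 =>
    exact hP.add (hP.sub (hP.smul 2 (hU (n + 1)).memL2two_cross)
      (hP.add (hP.neg (hU n).memL2two_lap) (memL2two_bounded_mul hQ (hU0 n))))
      (hP.sum _ fun j _ => hP.smul _ (hU0 _))

theorem multiscaleOp_approxU {N : ℕ} {U : ℕ → Pt d × Pt d → ℂ} (hU : ∀ n, MemH2H2 (U n)) (ε : ℝ) :
    ∀ᵐ z, S.multiscaleOp ε (Setting.approxU N U ε) z - (S.Es : ℂ) * Setting.approxU N U ε z
      = ∑ n ∈ Finset.range (N + 1), (ε : ℂ) ^ n * (S.Lstar2 (U n) z - 2 * ε * Setting.cross (U n) z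
          + (ε : ℂ) ^ 2 * (- lap ey (U n) z + (S.Q z.2 : ℂ) * U n z)) := by
  have h := (IsLap.sum (Finset.range (N + 1)) fun n _ => ((hU n).isLap_multiscale ε).smul ((ε : ℂ) ^ n)).lap_ae_eq
  filter_upwards [h] with z hz
  have : Setting.approxU N U ε = fun z => ∑ n ∈ Finset.range (N + 1), (ε : ℂ) ^ n * U n z := rfl
  rw [Setting.multiscaleOp, this, hz]
  simp only [Setting.Lstar2, schr, Finset.mul_sum, ← Finset.sum_neg_distrib, ← Finset.sum_add_distrib, ← Finset.sum_sub_distrib]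
  exact Finset.sum_congr rfl fun n _ => by ring

/-- Solutions of the hierarchy are formal approximate eigenpairs. -/
theorem formalError_of_solution {N : ℕ} {μ : ℕ → ℝ} {U : ℕ → Pt d × Pt d → ℂ} (hQ : MemLp S.Q ∞ volume) (h1 : μ 1 = 0)
    (h2 : μ 2 = S.eAQ) (hs : S.SolvesHierarchy N μ U) : S.FormalError N μ U := by
  classical
  have hP : IsFunSpace (MemH2H2 (d := d)) := isFunSpace_memSob (isFunSpace_memSob isFunSpace_memL2two _ _) _ _
  -- The approximate eigenvalue contains ε² e_{A,Q} even for N = 1, so its degree is only bounded by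
  -- max(N, 2).
  set M := max N 2 with hM
  -- Truncation makes the formula for the right hand side meaningful at all orders without changing
  -- it up to N. Above N it collects the terms of the residual that no U_n compensates.
  let V : ℕ → Pt d × Pt d → ℂ := fun n => if n ≤ N then U n else fun _ => 0
  let ν : ℕ → ℝ := fun j => if 1 ≤ j ∧ j ≤ M then μ j else 0
  have hVU : ∀ n ≤ N, V n = U n := fun n hn => if_pos hn
  have hV0 : ∀ n, N < n → V n = fun _ => 0 := fun n hn => if_neg (by omega)
  have hV : ∀ n, MemH2H2 (V n) := fun n => by
    rcases Nat.lt_or_ge N n with h | h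
    · rw [hV0 n h]; exact hP.zero
    · rw [hVU n h]; exact (hs n h).1
  have hres : ∀ n ≤ N, ∀ᵐ z, S.Lstar2 (V n) z = S.rhs ν V n z := fun n hn => by
    filter_upwards [(hs n hn).2] with z hz
    rw [hVU n hn, hz]
    exact rhs_congr_of_eq (fun j a b => (if_pos ⟨a, by omega⟩).symm) (fun k hk => (hVU k (by omega)).symm) z
  have hL0 : ∀ n, N < n → ∀ᵐ z, S.Lstar2 (V n) z = 0 := fun n hn => by rw [hV0 n hn]; exact Lstar2_zero
  have hc0 : ∀ n, N < n → ∀ᵐ z, Setting.cross (V n) z = 0 := fun n hn => by rw [hV0 n hn]; exact IsCross.zero.cross_ae_eq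
  have hl0 : ∀ n, N < n → ∀ᵐ z, lap ey (V n) z = 0 := fun n hn => by
    rw [hV0 n hn]; exact (IsLap.zero (D := ey (d := d))).lap_ae_eq
  have happ : ∀ ε, Setting.approxU N U ε = Setting.approxU N V ε := fun ε => funext fun z =>
    Finset.sum_congr rfl fun n hn => by rw [hVU n (by simpa [Nat.lt_succ_iff] using hn)]
  have hmu : ∀ ε : ℝ, (S.approxMu N μ ε : ℂ) = S.Es + ∑ j ∈ Finset.Icc 1 M, (ε : ℂ) ^ j * (ν j : ℂ) := fun ε => by
    have e1 : Finset.Icc 3 N = Finset.Icc 3 M := by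
      ext j; simp only [Finset.mem_Icc, hM]; omega
    have e2 : ∑ j ∈ Finset.Icc 1 M, ε ^ j * ν j = ε ^ 2 * S.eAQ + ∑ j ∈ Finset.Icc 3 M, ε ^ j * μ j := by
      rw [← Finset.add_sum_Ioc_eq_sum_Icc (show 1 ≤ M by omega), ← Finset.Icc_succ_left_eq_Ioc,
        ← Finset.add_sum_Ioc_eq_sum_Icc (show Order.succ 1 ≤ M by simp [hM]), ← Finset.Icc_succ_left_eq_Ioc]
      have e3 : ∑ j ∈ Finset.Icc (Order.succ (Order.succ 1)) M, ε ^ j * ν j = ∑ j ∈ Finset.Icc 3 M, ε ^ j * μ j := by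
        refine Finset.sum_congr rfl fun j hj => ?_
        have := Finset.mem_Icc.1 hj
        simp only [ν]
        rw [if_pos ⟨by omega, this.2⟩]
      rw [e3]
      have e4 : ν 1 = 0 := by simp only [ν]; rw [h1, ite_self]
      have e5 : ν (Order.succ 1) = S.eAQ := by
        have : ν 2 = S.eAQ := by simp only [ν]; rw [if_pos ⟨by omega, by omega⟩, h2]
        exact this
      rw [e4, e5, mul_zero, zero_add]
      rfl
    rw [Setting.approxMu, e1, add_assoc, ← e2]
    push_cast
    rfl
  -- Above order N the truncated functions vanish, so the coefficient of order N + 1 + m is minus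
  -- the right hand side alone. The residual has degree at most N + M, hence M + 2 coefficients are
  -- enough.
  refine ⟨M + 2, fun m z => - S.rhs ν V (N + 1 + m) z, fun m => isFunSpace_memL2two.neg (memL2two_rhs hQ ν hV _), fun ε => ?_⟩
  have hres' : ∀ᵐ z, ∀ n, n ≤ N → S.Lstar2 (V n) z = S.rhs ν V n z :=
    ae_all_iff.2 fun n => ae_all_iff.2 fun hn => hres n hn
  have hL0' : ∀ᵐ z, ∀ n, N < n → S.Lstar2 (V n) z = 0 := ae_all_iff.2 fun n => ae_all_iff.2 fun hn => hL0 n hn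
  have hc0' : ∀ᵐ z, ∀ n, N < n → Setting.cross (V n) z = 0 := ae_all_iff.2 fun n => ae_all_iff.2 fun hn => hc0 n hn
  have hl0' : ∀ᵐ z, ∀ n, N < n → lap ey (V n) z = 0 := ae_all_iff.2 fun n => ae_all_iff.2 fun hn => hl0 n hn
  filter_upwards [multiscaleOp_approxU (S := S) (N := N) hV ε, hres', hL0', hc0', hl0'] with z a b c e f
  rw [happ ε, hmu ε, add_mul, ← sub_sub, a]
  have hsum := sum_rhsCoeff (N := N) (M := M) (T := N + M + 1) (u := fun n => V n z) (a := fun j => (ν j : ℂ))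
    (L := fun n => S.Lstar2 (V n) z) (c := fun n => Setting.cross (V n) z)
    (q := fun n => - lap ey (V n) z + (S.Q z.2 : ℂ) * V n z) c e (fun n hn => by rw [f n hn, hV0 n hn]; simp)
    (fun n hn => by rw [hV0 n hn]) (fun j hj => by simp [ν, show ¬ j ≤ M by omega]) (by simp [ν]) (by omega) ε
  have : Setting.approxU N V ε z = ∑ n ∈ Finset.range (N + 1), (ε : ℂ) ^ n * V n z := rfl
  rw [this, ← hsum, show N + M + 1 + 2 = (N + 1) + (M + 2) by ring, Finset.sum_range_add, Finset.mul_sum,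
    Finset.sum_eq_zero (s := Finset.range (N + 1)) (fun n hn => by
      rw [b n (by simpa [Nat.lt_succ_iff] using hn), rhs_eq_rhsCoeff, sub_self, mul_zero]), zero_add]
  refine Finset.sum_congr rfl fun m _ => ?_
  rw [c _ (by omega), ← rhs_eq_rhsCoeff, zero_sub, pow_add]
  ring

end MultiScale

end

theorem proposition4p4 {d : ℕ} (hd : 0 < d) (S : MultiScale.Setting d) (N : ℕ) (hN : 1 ≤ N)
    (σ : ℝ) (hσ : (d : ℝ) < σ) (hσN : (N : ℝ) ≤ σ)
    (hreg : S.Regularity σ) (hedge : S.BandEdge) (hhom : S.HomogenizedEigenpair) :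
    ∃ (g : Fin d → MultiScale.Pt d → ℂ) (μ : ℕ → ℝ),
      (∀ j, S.IsLstarInv (MultiScale.wd (MultiScale.ev j) S.wC) (g j)) ∧
      μ 1 = 0 ∧ μ 2 = S.eAQ ∧
      -- solvability, with arbitrary envelopes `F_{N-1} = G`, `F_N = G'` for which the term
      -- `2 ∂_{y_j} G g_j` of `U_N` is in the function space (in particular if `G` is in `H³`)
      (∀ G G' : MultiScale.Pt d → ℂ, MultiScale.MemH 2 G → MultiScale.MemH 2 G' →
        (MultiScale.MemH 3 G ∨ MultiScale.MemH2H2 (MultiScale.Setting.firstCorr g G)) →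
        ∃ F H Z U, S.IsExpansion N μ g F H Z U ∧ S.SolvesHierarchy N μ U ∧
          S.Normalized N U ∧ F (N - 1) = G ∧ F N = G') ∧
      -- every solution has the corrections `μ_n` and the stated representation
      (∀ (μ' : ℕ → ℝ) (U : ℕ → MultiScale.Pt d × MultiScale.Pt d → ℂ),
        S.SolvesHierarchy N μ' U → S.Normalized N U →
          ((¬ ∀ᵐ z, U 0 z = 0) → ∀ n, 1 ≤ n → n ≤ N → μ' n = μ n) ∧
          ∃ H Z, S.IsExpansion N μ g (fun n => S.env (U n)) H Z U) ∧
      -- uniqueness up to the two envelopes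
      (∀ (μ₁ μ₂ : ℕ → ℝ) (U₁ U₂ : ℕ → MultiScale.Pt d × MultiScale.Pt d → ℂ),
        S.SolvesHierarchy N μ₁ U₁ → S.Normalized N U₁ →
        S.SolvesHierarchy N μ₂ U₂ → S.Normalized N U₂ →
        (∀ᵐ y, S.env (U₁ (N - 1)) y = S.env (U₂ (N - 1)) y) →
        (∀ᵐ y, S.env (U₁ N) y = S.env (U₂ N) y) →
          ∀ n ≤ N, ∀ᵐ z, U₁ n z = U₂ n z) ∧
      -- the approximate eigenpair; in particular for the solution with `F_{N-1} = F_N = 0`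
      (∀ U : ℕ → MultiScale.Pt d × MultiScale.Pt d → ℂ,
        S.SolvesHierarchy N μ U → S.FormalError N μ U) := by
  -- The Fourier estimates for Q need the Sobolev condition σ > d/2, which follows from σ > d
  -- because d is positive.
  have hσ' : (d : ℝ) < 2 * σ := by
    have : (0 : ℝ) < d := by exact_mod_cast hd
    linarith
  obtain ⟨g, hg⟩ := MultiScale.exists_real_g hreg hedge
  obtain ⟨μ, F, Z, hC⟩ := MultiScale.exists_isCanonical hreg hedge hhom hσ' hσN hg
  refine ⟨g, μ, hg, hC.mu_one, hC.mu_two, fun G G' hG hG' hGg =>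
      MultiScale.exists_solution hreg hedge hhom hσ' hσN hg hC hN hG hG' hGg, fun μ' U hs hn =>
      ⟨(MultiScale.solution_spec hreg hedge hhom hσ' hσN hg hC hs hn).1,
        MultiScale.solution_isExpansion hreg hedge hhom hσ' hσN hg hC hs hn⟩, ?_, fun U hs =>
      MultiScale.formalError_of_solution (hreg.Q_sobolev.bounded hσ') hC.mu_one hC.mu_two hs⟩
  intro μ₁ μ₂ U₁ U₂ hs₁ hn₁ hs₂ hn₂ h h'
  exact fun n hn => MultiScale.solution_unique hreg hedge hhom hσ' hσN hg hC hs₁ hn₁ hs₂ hn₂ h h' hn
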